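/- Let $\ell>1$ be an odd integer, $\zeta$ a primitive $\ell$-th root of unity, and write $\tfrac12:=\frac{\ell+1}{2}$ for exponents of elements $x$ with $x^\ell=1$. A Hopf algebra $A$ with an invertible $\mathcal R\in A\otimes A$ is quasi-triangular if $(\Delta\otimes \mathrm{id})\mathcal R=\mathcal R_{13}\mathcal R_{23}$, $(\mathrm{id}\otimes\Delta)\mathcal R=\mathcal R_{13}\mathcal R_{12}$ and $\mathcal R\,\Delta(a)=\Delta^{\mathrm{op}}(a)\,\mathcal R$ for all $a\in A$. **The double.** Let $B=B_\zeta(\mathfrak{sl}_2)$ be the Hopf algebra over $\mathbb Z[\zeta]$ generated by $e,k$ with relations $k^\ell=1$, $e^\ell=0$, $ke=\zeta ek$ and with $\Delta(k)=k\otimes k$, $\Delta(e)=e\otimes 1+k^2\otimes e$, $\epsilon(k)=1$, $\epsilon(e)=0$, $S(k)=k^{-1}$, $S(e)=-k^{-2}e$; it is free with basis $e^ik^j$, $0\le i,j<\ell$. Its quantum double $D(B)$ is $B^{*\mathrm{cop}}\otimes B$ as a coalgebra, with product $$(p\otimes x)(q\otimes y)=\sum p\cdot q\big(S^{-1}(x_{(3)})\,\cdot\,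 x_{(1)}\big)\otimes x_{(2)}y,$$ where $B^*$ has the convolution product, with antipode $S(p\otimes x)=(\epsilon\otimes S(x))(p\circ S^{-1}\otimes 1)$, and with canonical R-matrix $\mathcal R_{D}=\sum_i(\epsilon\otimes h_i)\otimes(h^i\otimes 1)$ for dual bases $(h_i)$, $(h^i)$ of $B$, $B^*$. Let $D_e(B)=\mathbb Q(\zeta)\otimes_{\mathbb Z[\zeta]}D(B)$. Let $\alpha,f\in B^*$ be given by $\alpha(e^ik^j)=\delta_{i,0}\zeta^j$ and $f(e^ik^j)=\delta_{i,1}$, and put in $D_e(B)$ $$E=\frac{\alpha^{-1/2}k^{-1}e}{\zeta-\zeta^{-1}},\quad F=-f,\quad K=\alpha^{-1/2}k,\quad Z=\alpha^{1/2}k .$$ **The twist.** Put $P_i=\frac1\ell\sum_{j=0}^{\ell-1}\zeta^{-2ij}Z^j$ and $\mathbf F=\sum_{i=0}^{\ell-1}K^i\otimes P_i$. Let $D_e(B)_{\mathbf F}$ be the algebra $D_e(B)$ with $\Delta_{\mathbf F}(a)=\mathbf F\Delta(a)\mathbf F^{-1}$, $\epsilon_{\mathbf F}=\epsilon$, $S_{\mathbf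 F}(a)=x_{\mathbf F}S(a)x_{\mathbf F}^{-1}$, where $x_{\mathbf F}=m(\mathrm{id}\otimes S)(\mathbf F)$, and $\mathcal R_{\mathbf F}=\mathbf F_{21}\mathcal R_D\mathbf F^{-1}$. **The factors.** Let $U_\zeta$ be the small quantum $\mathfrak{sl}_2$ over $\mathbb Q(\zeta)$: generators $E,F,K$; relations $K^\ell=1$, $E^\ell=F^\ell=0$, $KE=\zeta^2EK$, $KF=\zeta^{-2}FK$, $EF-FE=\frac{K-K^{-1}}{\zeta-\zeta^{-1}}$; $\Delta(E)=E\otimes1+K\otimes E$, $\Delta(F)=F\otimes K^{-1}+1\otimes F$, $\Delta(K)=K\otimes K$, $\epsilon(E)=\epsilon(F)=0$, $\epsilon(K)=1$, $S(E)=-K^{-1}E$, $S(F)=-FK$, $S(K)=K^{-1}$. Put $$\mathcal R_{U_\zeta}=\Big(\sum_{m=0}^{\ell-1}\tau_mE^m\otimes F^m\Big)\frac1\ell\sum_{i,j=0}^{\ell-1}\zeta^{2ij}K^i\otimes K^j,\qquad \tau_m=\frac{(\zeta^{-1}-\zeta)^m}{\zeta^{m(m-1)/2}[m]!},\qquad [n]=\frac{\zeta^n-\zeta^{-n}}{\zeta-\zeta^{-1}}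 .$$ Let $\mathscr A=\mathbb Q(\zeta)[\mathbb Z/\ell]$ be the group algebra with its usual Hopf structure (group-like generator $z$, $z^\ell=1$), and $\mathcal R_{\mathscr A}=\frac1\ell\sum_{i,j=0}^{\ell-1}\zeta^{-2ij}z^i\otimes z^j$. **Claim.** 1. The monomials $F^aE^bK^cZ^d$, $0\le a,b,c,d<\ell$, form a $\mathbb Q(\zeta)$-basis of $D_e(B)$. 2. $\mathbf F$ is a gauge transformation of $D_e(B)$: it is invertible, $(1\otimes\mathbf F)(\mathrm{id}\otimes\Delta)(\mathbf F)=(\mathbf F\otimes1)(\Delta\otimes\mathrm{id})(\mathbf F)$ and $(\epsilon\otimes\mathrm{id})(\mathbf F)=1=(\mathrm{id}\otimes\epsilon)(\mathbf F)$. 3. $(D_e(B)_{\mathbf F},\mathcal R_{\mathbf F})$, $(U_\zeta,\mathcal R_{U_\zeta})$, $(\mathscr A,\mathcal R_{\mathscr A})$ and $(U_\zeta\otimes\mathscr A,(\mathcal R_{U_\zeta})_{13}(\mathcal R_{\mathscr A})_{24})$ are quasi-triangular Hopf algebras. 4. There is an isomorphism of Hopf algebras $\varpi:D_e(B)_{\mathbf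 F}\to U_\zeta\otimes\mathscr A$ over $\mathbb Q(\zeta)$ (bijective, compatible with products, coproducts, counits and antipodes) such that $\varpi(F^aE^bK^cZ^d)=F^aE^bK^c\otimes z^d$ for all $0\le a,b,c,d<\ell$, and $$\varpi^{\otimes2}(\mathcal R_{\mathbf F})=(\mathcal R_{U_\zeta})_{13}(\mathcal R_{\mathscr A})_{24}.$$ -/

import Mathlib

open scoped TensorProduct

set_option linter.unusedSectionVars false


section

open Coalgebra HopfAlgebra WithConv

theorem comul_antipode_eq (R : Type*) {H : Type*} [CommRing R] [Ring H] [HopfAlgebra R H] (x : H) :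
    comul (R := R) (antipode R x)
      = TensorProduct.map (antipode R) (antipode R) (TensorProduct.comm R H H (comul x)) := by
  set i1 : H →ₐ[R] H ⊗[R] H := Algebra.TensorProduct.includeLeft with hi1
  set i2 : H →ₐ[R] H ⊗[R] H := Algebra.TensorProduct.includeRight with hi2
  set j1 : WithConv (H →ₗ[R] H ⊗[R] H) := toConv i1.toLinearMap
  set j2 : WithConv (H →ₗ[R] H ⊗[R] H) := toConv i2.toLinearMap
  set s1 : WithConv (H →ₗ[R] H ⊗[R] H) := toConv (i1.toLinearMap ∘ₗ antipode R)
  set s2 : WithConv (H →ₗ[R] H ⊗[R] H) := toConv (i2.toLinearMap ∘ₗ antipode R)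
  have hd : (toConv comul : WithConv (H →ₗ[R] H ⊗[R] H)) = j1 * j2 := by
    ext y
    rw [(ℛ R y).convMul_apply]
    simp [j1, j2, i1, i2, (ℛ R y).eq]
  have hG : (toConv (TensorProduct.map (antipode R) (antipode R) ∘ₗ
      (TensorProduct.comm R H H).toLinearMap ∘ₗ comul) : WithConv (H →ₗ[R] H ⊗[R] H))
      = s2 * s1 := by
    ext y
    rw [(ℛ R y).convMul_apply]
    simp [s1, s2, i1, i2, ← (ℛ R y).eq]
  have h1 : s1 * j1 = 1 := by
    have := LinearMap.algHom_comp_convMul_distrib i1 (toConv (antipode R)) (toConv LinearMap.id)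
    rw [LinearMap.antipode_mul_id] at this
    apply WithConv.ofConv_injective
    ext y
    have := congr($this y)
    simpa [s1, j1] using this.symm
  have h2 : s2 * j2 = 1 := by
    have := LinearMap.algHom_comp_convMul_distrib i2 (toConv (antipode R)) (toConv LinearMap.id)
    rw [LinearMap.antipode_mul_id] at this
    apply WithConv.ofConv_injective
    ext y
    have := congr($this y)
    simpa [s2, j2] using this.symm
  have hl : (s2 * s1) * (j1 * j2) = 1 := by
    rw [mul_assoc, ← mul_assoc s1, h1, one_mul, h2]
  have hr := LinearMap.comul_right_inv (R := R) (C := H)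
  rw [hd] at hr
  have := left_inv_eq_right_inv hl hr
  rw [← hG] at this
  exact congr($(this.symm) x)

end

/-- A Hopf algebra whose antipode `S` is bijective. -/
class HasBijectiveAntipode (R H : Type*) [CommRing R] [Ring H] [HopfAlgebra R H] : Prop where
  bijective : Function.Bijective (HopfAlgebra.antipode R (A := H))

section AntipodeInv

open Coalgebra HopfAlgebra

variable (R : Type*) {H : Type*} [CommRing R] [Ring H] [HopfAlgebra R H] [HasBijectiveAntipode R H]

/-- The inverse `S⁻¹` of the antipode. -/
noncomputable def antipodeInv : H →ₗ[R] H :=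
  (LinearEquiv.ofBijective (antipode R) HasBijectiveAntipode.bijective).symm.toLinearMap

theorem antipode_antipodeInv (x : H) : antipode R (antipodeInv R x) = x :=
  (LinearEquiv.ofBijective (antipode R (A := H)) HasBijectiveAntipode.bijective).apply_symm_apply x

theorem antipodeInv_antipode (x : H) : antipodeInv R (antipode R x) = x :=
  (LinearEquiv.ofBijective (antipode R (A := H)) HasBijectiveAntipode.bijective).symm_apply_apply x

theorem antipodeInv_mul (x y : H) :
    antipodeInv R (x * y) = antipodeInv R y * antipodeInv R x := by
  apply (HasBijectiveAntipode.bijective (R := R) (H := H)).1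
  rw [antipode_mul_antidistrib]
  simp only [antipode_antipodeInv]

theorem antipodeInv_one : antipodeInv R (1 : H) = 1 := by
  apply (HasBijectiveAntipode.bijective (R := R) (H := H)).1
  rw [antipode_antipodeInv, antipode_one]

theorem counit_antipodeInv (x : H) : counit (R := R) (antipodeInv R x) = counit (R := R) x := by
  rw [← counit_antipode (R := R) (antipodeInv R x), antipode_antipodeInv]

theorem comul_antipodeInv (x : H) :
    comul (R := R) (antipodeInv R x)
      = TensorProduct.map (antipodeInv R) (antipodeInv R)
          (TensorProduct.comm R H H (comul x)) := by
  have h := comul_antipode_eq R (antipodeInv R x)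
  rw [antipode_antipodeInv] at h
  have hc : ∀ t : H ⊗[R] H, TensorProduct.map (antipodeInv R) (antipodeInv R)
      (TensorProduct.comm R H H (TensorProduct.map (antipode R) (antipode R)
        (TensorProduct.comm R H H t))) = t := by
    intro t
    induction t with
    | zero => simp
    | tmul a b => simp [antipodeInv_antipode]
    | add a b ha hb => simp only [map_add, ha, hb]
  rw [h, hc]

/-- `∑ S⁻¹(x₍₂₎) x₍₁₎ = ε(x)`. -/
theorem sum_antipodeInv_right_mul_left {ι : Type*} {x : H} (r : Repr R x ι) :
    ∑ i ∈ r.index, antipodeInv R (r.right i) * r.left i = algebraMap R H (counit x) := by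
  apply (HasBijectiveAntipode.bijective (R := R) (H := H)).1
  have := sum_antipode_mul_eq_algebraMap_counit r
  rw [map_sum, Algebra.algebraMap_eq_smul_one, map_smul, antipode_one,
    ← Algebra.algebraMap_eq_smul_one, ← this]
  exact Finset.sum_congr rfl fun i _ ↦ by
    rw [antipode_mul_antidistrib, antipode_antipodeInv]

/-- `∑ x₍₂₎ S⁻¹(x₍₁₎) = ε(x)`. -/
theorem sum_right_mul_antipodeInv_left {ι : Type*} {x : H} (r : Repr R x ι) :
    ∑ i ∈ r.index, r.right i * antipodeInv R (r.left i) = algebraMap R H (counit x) := by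
  apply (HasBijectiveAntipode.bijective (R := R) (H := H)).1
  have := sum_mul_antipode_eq_algebraMap_counit r
  rw [map_sum, Algebra.algebraMap_eq_smul_one, map_smul, antipode_one,
    ← Algebra.algebraMap_eq_smul_one, ← this]
  exact Finset.sum_congr rfl fun i _ ↦ by
    rw [antipode_mul_antidistrib, antipode_antipodeInv]

end AntipodeInv

/-- The dual `H* = Hom_R(H, R)` with the convolution product `(pq)(x) = ∑ p(x₍₁₎) q(x₍₂₎)`; its
coalgebra structure below is the opposite of the one dual to the product of `H`, so this is
`H^{*cop}`. -/
def DualCop (R H : Type*) [CommRing R] [Ring H] [HopfAlgebra R H] : Type _ :=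
  WithConv (H →ₗ[R] R)

namespace DualCop

open Coalgebra HopfAlgebra

variable {R H : Type*} [CommRing R] [Ring H] [HopfAlgebra R H]

noncomputable instance : Ring (DualCop R H) := inferInstanceAs (Ring (WithConv (H →ₗ[R] R)))

noncomputable instance : Algebra R (DualCop R H) :=
  inferInstanceAs (Algebra R (WithConv (H →ₗ[R] R)))

variable (R H) in
/-- The underlying linear functional. -/
noncomputable def toDual : DualCop R H ≃ₗ[R] (H →ₗ[R] R) where
  toFun p := WithConv.ofConv p
  invFun f := WithConv.toConv f
  map_add' _ _ := rfl
  map_smul' _ _ := rfl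

noncomputable instance : CoeFun (DualCop R H) (fun _ ↦ H → R) := ⟨fun p ↦ toDual R H p⟩

@[ext] theorem ext {p q : DualCop R H} (h : ∀ x : H, p x = q x) : p = q :=
  (toDual R H).injective (LinearMap.ext h)

/-- A linear functional on `H`, as an element of `H^{*cop}`. -/
noncomputable def of (f : H →ₗ[R] R) : DualCop R H := (toDual R H).symm f

@[simp] theorem of_apply (f : H →ₗ[R] R) (x : H) : of f x = f x := rfl
@[simp] theorem zero_apply (x : H) : (0 : DualCop R H) x = 0 := rfl
@[simp] theorem add_apply (p q : DualCop R H) (x : H) : (p + q) x = p x + q x := rfl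
@[simp] theorem smul_apply (c : R) (p : DualCop R H) (x : H) : (c • p) x = c * p x := rfl
@[simp] theorem one_apply (x : H) : (1 : DualCop R H) x = counit x := rfl

@[simp] theorem sum_apply {ι : Type*} (s : Finset ι) (p : ι → DualCop R H) (x : H) :
    (∑ i ∈ s, p i) x = ∑ i ∈ s, p i x := by
  rw [map_sum, LinearMap.sum_apply]

theorem mul_apply (p q : DualCop R H) (x : H) : (p * q) x
    = LinearMap.mul' R R (TensorProduct.map (toDual R H p) (toDual R H q) (comul x)) := rfl

theorem mul_apply' {ι : Type*} {x : H} (r : Repr R x ι) (p q : DualCop R H) :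
    (p * q) x = ∑ i ∈ r.index, p (r.left i) * q (r.right i) := by
  rw [mul_apply, ← r.eq]
  simp

/-- `p ↦ (b ↦ p(b a))`, as a linear map in `a`. -/
noncomputable def rAct : H →ₗ[R] Module.End R (DualCop R H) :=
  LinearMap.mk₂ R (fun a p ↦ of (toDual R H p ∘ₗ LinearMap.mulRight R a))
    (fun a b p ↦ by ext; simp [mul_add]) (fun c a p ↦ by ext; simp)
    (fun a p q ↦ by ext; simp) (fun c a p ↦ by ext; simp)

@[simp] theorem rAct_apply (a b : H) (p : DualCop R H) : (rAct a p) b = p (b * a) := rfl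

/-- `p ↦ (b ↦ p(S⁻¹(a) b))`, as a linear map in `a`. -/
noncomputable def lAct [HasBijectiveAntipode R H] : H →ₗ[R] Module.End R (DualCop R H) :=
  LinearMap.mk₂ R (fun a p ↦ of (toDual R H p ∘ₗ LinearMap.mulLeft R (antipodeInv R a)))
    (fun a b p ↦ by ext; simp [add_mul]) (fun c a p ↦ by ext; simp)
    (fun a p q ↦ by ext; simp) (fun c a p ↦ by ext; simp)

@[simp] theorem lAct_apply [HasBijectiveAntipode R H] (a b : H) (p : DualCop R H) :
    (lAct a p) b = p (antipodeInv R a * b) := rfl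

theorem rAct_mul_eq {ι : Type*} {a : H} (r : Repr R a ι) (p q : DualCop R H) :
    rAct a (p * q) = ∑ i ∈ r.index, rAct (r.left i) p * rAct (r.right i) q := by
  ext b
  simp only [rAct_apply, sum_apply]
  have : ∀ i, (rAct (r.left i) p * rAct (r.right i) q) b
      = ∑ j ∈ (ℛ R b).index, p ((ℛ R b).left j * r.left i) * q ((ℛ R b).right j * r.right i) :=
    fun i ↦ by rw [mul_apply' (ℛ R b)]; rfl
  simp only [this]
  rw [mul_apply, Bialgebra.comul_mul, ← r.eq, ← (ℛ R b).eq]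
  simp only [Finset.sum_mul_sum, map_sum, Algebra.TensorProduct.tmul_mul_tmul,
    TensorProduct.map_tmul, LinearMap.mul'_apply]
  rw [Finset.sum_comm]

theorem lAct_mul_eq [HasBijectiveAntipode R H] {ι : Type*} {a : H} (r : Repr R a ι)
    (p q : DualCop R H) :
    lAct a (p * q) = ∑ i ∈ r.index, lAct (r.right i) p * lAct (r.left i) q := by
  ext b
  simp only [lAct_apply, sum_apply]
  have : ∀ i, (lAct (r.right i) p * lAct (r.left i) q) b
      = ∑ j ∈ (ℛ R b).index, p (antipodeInv R (r.right i) * (ℛ R b).left j)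
          * q (antipodeInv R (r.left i) * (ℛ R b).right j) :=
    fun i ↦ by rw [mul_apply' (ℛ R b)]; rfl
  simp only [this]
  rw [mul_apply, Bialgebra.comul_mul, comul_antipodeInv, ← r.eq, ← (ℛ R b).eq]
  simp only [Finset.sum_mul_sum, map_sum, Algebra.TensorProduct.tmul_mul_tmul,
    TensorProduct.map_tmul, LinearMap.mul'_apply, TensorProduct.comm_tmul]

/-- Contraction of the first tensor factor with `a`. -/
noncomputable def contr {M : Type*} [AddCommGroup M] [Module R M] :
    H →ₗ[R] DualCop R H ⊗[R] M →ₗ[R] M :=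
  LinearMap.flip (TensorProduct.lift (LinearMap.mk₂ R
    (fun (p : DualCop R H) (m : M) ↦ (toDual R H p).smulRight m)
    (fun p q m ↦ by ext; simp [add_smul]) (fun c p m ↦ by ext; simp [mul_smul])
    (fun p m n ↦ by ext; simp) (fun c p m ↦ by ext; simp [smul_smul, mul_comm])))

@[simp] theorem contr_tmul {M : Type*} [AddCommGroup M] [Module R M] (a : H) (p : DualCop R H)
    (m : M) : contr a (p ⊗ₜ[R] m) = p a • m := rfl

theorem contr_mul {ι : Type*} {a : H} (r : Repr R a ι) (s t : DualCop R H ⊗[R] DualCop R H) :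
    contr a (s * t) = ∑ i ∈ r.index, contr (r.left i) s * contr (r.right i) t := by
  induction s with
  | zero => simp
  | add x y hx hy => simp only [add_mul, map_add, hx, hy, Finset.sum_add_distrib]
  | tmul p p' =>
    induction t with
    | zero => simp
    | add x y hx hy => simp only [mul_add, map_add, hx, hy, Finset.sum_add_distrib]
    | tmul q q' =>
      simp only [Algebra.TensorProduct.tmul_mul_tmul, contr_tmul, mul_apply' r, Finset.sum_smul,
        smul_mul_smul_comm]

variable [Module.Finite R H] [Module.Free R H]

variable (R H) in
/-- `H* ⊗ M ≃ Hom(H, M)`, where `p ⊗ m` corresponds to `a ↦ p(a) m`. -/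
noncomputable def tensorEquiv (M : Type*) [AddCommGroup M] [Module R M] :
    DualCop R H ⊗[R] M ≃ₗ[R] (H →ₗ[R] M) :=
  (TensorProduct.congr (toDual R H) (LinearEquiv.refl R M)).trans
    (dualTensorHomEquiv R H M)

theorem tensorEquiv_apply {M : Type*} [AddCommGroup M] [Module R M] (t : DualCop R H ⊗[R] M)
    (a : H) : tensorEquiv R H M t a = contr a t := by
  induction t with
  | zero => simp
  | tmul p m => simp [tensorEquiv]
  | add x y hx hy => simp only [map_add, LinearMap.add_apply, hx, hy]

theorem contr_ext {M : Type*} [AddCommGroup M] [Module R M] {s t : DualCop R H ⊗[R] M}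
    (h : ∀ a : H, contr a s = contr a t) : s = t := by
  apply (tensorEquiv R H M).injective
  ext a
  simp only [tensorEquiv_apply, h]

/-- `Δ(p) = ∑ pᵢ ⊗ qᵢ` is characterised by `∑ pᵢ(a) qᵢ(b) = p(b a)`, the coproduct being opposite
to the dual of the product of `H`; and `ε(p) = p(1)`. -/
noncomputable instance instCoalgebraStruct : CoalgebraStruct R (DualCop R H) where
  comul := (tensorEquiv R H (DualCop R H)).symm.toLinearMap ∘ₗ rAct.flip
  counit := (LinearMap.applyₗ (1 : H)) ∘ₗ (toDual R H).toLinearMap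

theorem contr_comul (a : H) (p : DualCop R H) : contr a (comul (R := R) p) = rAct a p := by
  rw [← tensorEquiv_apply]
  have : comul (R := R) p = (tensorEquiv R H (DualCop R H)).symm (rAct.flip p) := rfl
  rw [this, LinearEquiv.apply_symm_apply]
  rfl

theorem counit_def' (p : DualCop R H) : counit (R := R) p = p 1 := rfl

noncomputable instance instCoalgebra : Coalgebra R (DualCop R H) where
  coassoc := by
    ext p : 1
    refine contr_ext fun a ↦ contr_ext fun b ↦ ?_
    simp only [LinearMap.comp_apply, LinearEquiv.coe_coe]
    have h1 : ∀ t : DualCop R H ⊗[R] DualCop R H,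
        contr a (LinearMap.lTensor (DualCop R H) (comul (R := R)) t) = comul (contr a t) := by
      intro t
      induction t with
      | zero => simp
      | tmul p m => simp
      | add x y hx hy => simp only [map_add, hx, hy]
    have h2' : ∀ (t : DualCop R H ⊗[R] DualCop R H) (q : DualCop R H),
        contr b (contr a (TensorProduct.assoc R _ _ _ (t ⊗ₜ[R] q)))
          = (contr a t) b • q := by
      intro t q
      induction t with
      | zero => simp
      | tmul p m => simp [mul_smul]
      | add x y hx hy => simp only [map_add, TensorProduct.add_tmul, hx, hy, LinearMap.add_apply, add_smul]
    have h2 : ∀ t : DualCop R H ⊗[R] DualCop R H,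
        contr b (contr a (TensorProduct.assoc R _ _ _
          (LinearMap.rTensor (DualCop R H) (comul (R := R)) t))) = contr (b * a) t := by
      intro t
      induction t with
      | zero => simp
      | tmul p m =>
        rw [LinearMap.rTensor_tmul, h2', contr_comul]
        simp
      | add x y hx hy => simp only [map_add, hx, hy]
    rw [h1, h2, contr_comul, contr_comul, contr_comul]
    ext c
    simp [mul_assoc]
  rTensor_counit_comp_comul := by
    ext p : 1
    have h : ∀ t : DualCop R H ⊗[R] DualCop R H,
        LinearMap.rTensor (DualCop R H) (counit (R := R)) t = 1 ⊗ₜ contr 1 t := by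
      intro t
      induction t with
      | zero => simp
      | tmul p m =>
        simp only [LinearMap.rTensor_tmul, contr_tmul, counit_def']
        rw [TensorProduct.tmul_smul, TensorProduct.smul_tmul', smul_eq_mul, mul_one]
      | add x y hx hy => simp only [map_add, hx, hy, TensorProduct.tmul_add]
    simp only [LinearMap.comp_apply, h, contr_comul, TensorProduct.mk_apply]
    congr 1
    ext c
    simp
  lTensor_counit_comp_comul := by
    ext p : 1
    refine contr_ext fun a ↦ ?_
    have h : ∀ t : DualCop R H ⊗[R] DualCop R H,
        contr a (LinearMap.lTensor (DualCop R H) (counit (R := R)) t) = (contr a t) 1 := by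
      intro t
      induction t with
      | zero => simp
      | tmul p m => simp [counit_def']
      | add x y hx hy => simp only [map_add, hx, hy, LinearMap.add_apply]
    simp only [LinearMap.comp_apply, h, contr_comul]
    simp

noncomputable instance instBialgebra : Bialgebra R (DualCop R H) :=
  Bialgebra.mk' R (DualCop R H)
    (by simp [counit_def'])
    (by
      intro p q
      simp only [counit_def']
      rw [mul_apply, Bialgebra.comul_one, Algebra.TensorProduct.one_def]
      simp)
    (by
      refine contr_ext fun a ↦ ?_
      rw [contr_comul, Algebra.TensorProduct.one_def, contr_tmul]
      ext b
      simp [mul_comm])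
    (by
      intro p q
      refine contr_ext fun a ↦ ?_
      rw [contr_comul, contr_mul (ℛ R a), rAct_mul_eq (ℛ R a)]
      simp only [contr_comul])

end DualCop

section Double

open Coalgebra HopfAlgebra WithConv

variable {R H : Type*} [CommRing R] [Ring H] [HopfAlgebra R H]

theorem conv_sum_apply {A ι : Type*} [Ring A] [Algebra R A] {x : H} (r : Repr R x ι)
    (f g : WithConv (H →ₗ[R] A)) :
    (f * g).ofConv x = ∑ i ∈ r.index, f.ofConv (r.left i) * g.ofConv (r.right i) :=
  r.convMul_apply f g

theorem conv_intertwine {V W : Type*} [AddCommGroup V] [Module R V] [AddCommGroup W] [Module R W]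
    (m : V →ₗ[R] W) (f g : WithConv (H →ₗ[R] Module.End R W))
    (f' g' : WithConv (H →ₗ[R] Module.End R V))
    (hf : ∀ x v, f.ofConv x (m v) = m (f'.ofConv x v))
    (hg : ∀ x v, g.ofConv x (m v) = m (g'.ofConv x v)) (x : H) (v : V) :
    (f * g).ofConv x (m v) = m ((f' * g').ofConv x v) := by
  rw [conv_sum_apply (ℛ R x), conv_sum_apply (ℛ R x)]
  simp only [LinearMap.sum_apply, Module.End.mul_apply, hf, hg, map_sum]

theorem conv_cancel {V : Type*} [AddCommGroup V] [Module R V]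
    (v : V) (f g h : WithConv (H →ₗ[R] Module.End R V))
    (hg : ∀ x, g.ofConv x v = counit (R := R) x • v)
    (hc : ∀ x y, Commute (g.ofConv x) (h.ofConv y)) (x : H) :
    (f * g * h).ofConv x v = (f * h).ofConv x v := by
  rw [conv_sum_apply (A := Module.End R V) (ℛ R x), conv_sum_apply (A := Module.End R V) (ℛ R x)]
  simp only [LinearMap.sum_apply]
  refine Finset.sum_congr rfl fun i _ ↦ ?_
  rw [conv_sum_apply (A := Module.End R V) (ℛ R ((ℛ R x).left i))]
  simp only [Finset.sum_mul, LinearMap.sum_apply, mul_assoc, (hc _ _).eq]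
  simp only [Module.End.mul_apply, hg, map_smul]
  have h1 : ∑ j ∈ (ℛ R ((ℛ R x).left i)).index,
      counit (R := R) ((ℛ R ((ℛ R x).left i)).right j) • (ℛ R ((ℛ R x).left i)).left j
        = (ℛ R x).left i := by
    have h := congr(TensorProduct.rid R H $(sum_tmul_counit_eq (ℛ R ((ℛ R x).left i))))
    simp only [map_sum, TensorProduct.rid_tmul, one_smul] at h
    exact h
  conv_rhs => rw [← h1]
  simp only [map_sum, map_smul, LinearMap.sum_apply, LinearMap.smul_apply]

namespace DualCop

/-- The right translation action `(a · p)(b) = p(b a)` of `H` on `H*`. -/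
noncomputable def rActHom : H →ₐ[R] Module.End R (DualCop R H) :=
  AlgHom.ofLinearMap rAct (by ext; simp) (fun a b ↦ by ext; simp [mul_assoc])

/-- The action `(a · p)(b) = p(S⁻¹(a) b)` of `H` on `H*`. -/
noncomputable def lActHom [HasBijectiveAntipode R H] : H →ₐ[R] Module.End R (DualCop R H) :=
  AlgHom.ofLinearMap lAct (by ext; simp [antipodeInv_one])
    (fun a b ↦ by ext; simp [antipodeInv_mul, mul_assoc])

@[simp] theorem rActHom_apply (a : H) : rActHom (R := R) a = rAct a := rfl
@[simp] theorem lActHom_apply [HasBijectiveAntipode R H] (a : H) :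
    lActHom (R := R) a = lAct a := rfl

theorem rAct_one (a : H) : rAct a (1 : DualCop R H) = counit (R := R) a • 1 := by
  ext b
  simp [mul_comm]

theorem lAct_one [HasBijectiveAntipode R H] (a : H) :
    lAct a (1 : DualCop R H) = counit (R := R) a • 1 := by
  ext b
  simp [counit_antipodeInv]

end DualCop

open DualCop

variable (R H) in
/-- The underlying module `H^{*cop} ⊗ H` of the quantum double. -/
def DrinfeldDouble : Type _ := DualCop R H ⊗[R] H

namespace DrinfeldDouble

noncomputable instance : AddCommGroup (DrinfeldDouble R H) :=
  inferInstanceAs (AddCommGroup (DualCop R H ⊗[R] H))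

noncomputable instance : Module R (DrinfeldDouble R H) :=
  inferInstanceAs (Module R (DualCop R H ⊗[R] H))

variable (R H) in
/-- `H → End(H* ⊗ H)`, `x · (q ⊗ y) = q(· x) ⊗ y`. -/
noncomputable def opA : H →ₐ[R] Module.End R (DualCop R H ⊗[R] H) :=
  (Module.End.rTensorAlgHom R (DualCop R H) H).comp rActHom

variable (R H) in
/-- `H → End(H* ⊗ H)`, `x · (q ⊗ y) = q ⊗ x y`. -/
noncomputable def opM : H →ₐ[R] Module.End R (DualCop R H ⊗[R] H) :=
  (Module.End.lTensorAlgHom R H (DualCop R H)).comp (Algebra.lmul R H)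

variable (R H) in
/-- `H → End(H* ⊗ H)`, `x · (q ⊗ y) = q(S⁻¹(x) ·) ⊗ y`. -/
noncomputable def opB [HasBijectiveAntipode R H] :
    H →ₐ[R] Module.End R (DualCop R H ⊗[R] H) :=
  (Module.End.rTensorAlgHom R (DualCop R H) H).comp lActHom

variable (R H) in
/-- `H* → End(H* ⊗ H)`, `p · (q ⊗ y) = p q ⊗ y`. -/
noncomputable def opL : DualCop R H →ₐ[R] Module.End R (DualCop R H ⊗[R] H) :=
  (Module.End.rTensorAlgHom R (DualCop R H) H).comp (Algebra.lmul R (DualCop R H))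

@[simp] theorem opA_tmul (x : H) (q : DualCop R H) (y : H) :
    opA R H x (q ⊗ₜ y) = rAct x q ⊗ₜ y := rfl
@[simp] theorem opM_tmul (x : H) (q : DualCop R H) (y : H) :
    opM R H x (q ⊗ₜ y) = q ⊗ₜ (x * y) := rfl
@[simp] theorem opL_tmul (p : DualCop R H) (q : DualCop R H) (y : H) :
    opL R H p (q ⊗ₜ y) = (p * q) ⊗ₜ y := rfl

theorem commute_opA_opM (x y : H) : Commute (opA R H x) (opM R H y) := by
  refine TensorProduct.ext' fun q z ↦ ?_
  simp

variable [HasBijectiveAntipode R H]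

@[simp] theorem opB_tmul (x : H) (q : DualCop R H) (y : H) :
    opB R H x (q ⊗ₜ y) = lAct x q ⊗ₜ y := rfl

theorem commute_opM_opB (x y : H) : Commute (opM R H x) (opB R H y) := by
  refine TensorProduct.ext' fun q z ↦ ?_
  simp

theorem commute_opA_opB (x y : H) : Commute (opA R H x) (opB R H y) := by
  refine TensorProduct.ext' fun q z ↦ ?_
  simp only [Module.End.mul_apply, opA_tmul, opB_tmul]
  congr 1
  ext b
  simp [mul_assoc]

variable (R H) in
/-- The action `x · (q ⊗ y) = ∑ x₍₂₎ · (x₍₃₎ · (q ⊗ y))`, with `x₍₂₎` acting through `opM` and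
`x₍₃₎` through `opB`. -/
noncomputable def opMB : H →ₐ[R] Module.End R (DualCop R H ⊗[R] H) :=
  (Algebra.TensorProduct.lift (opM R H) (opB R H) commute_opM_opB).comp
    (Bialgebra.comulAlgHom R H)

theorem opMB_eq : toConv (opMB R H).toLinearMap
    = toConv (opM R H).toLinearMap * toConv (opB R H).toLinearMap := by
  ext1
  ext1 x
  rw [conv_sum_apply (ℛ R x)]
  simp [opMB, ← (ℛ R x).eq]

theorem commute_opA_opMB (x y : H) : Commute (opA R H x) (opMB R H y) := by
  have := congr(($(opMB_eq (R := R) (H := H))).ofConv y)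
  rw [conv_sum_apply (ℛ R y)] at this
  simp only [AlgHom.toLinearMap_apply] at this
  rw [this]
  exact Commute.sum_right _ _ _ fun i _ ↦ (commute_opA_opM _ _).mul_right (commute_opA_opB _ _)

variable (R H) in
/-- The action of `H` on `H* ⊗ H` given by left multiplication in the quantum double,
`x · (q ⊗ y) = ∑ q(S⁻¹(x₍₃₎) · x₍₁₎) ⊗ x₍₂₎ y`. -/
noncomputable def opT : H →ₐ[R] Module.End R (DualCop R H ⊗[R] H) :=
  (Algebra.TensorProduct.lift (opA R H) (opMB R H) commute_opA_opMB).comp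
    (Bialgebra.comulAlgHom R H)

theorem opT_eq : toConv (opT R H).toLinearMap = toConv (opA R H).toLinearMap
    * (toConv (opM R H).toLinearMap * toConv (opB R H).toLinearMap) := by
  rw [← opMB_eq]
  ext1
  ext1 x
  rw [conv_sum_apply (ℛ R x)]
  simp [opT, ← (ℛ R x).eq]

/-- The explicit form of the bicrossed product relation. -/
theorem opT_tmul {ι : Type*} {κ : ι → Type*} {x : H} (r : Repr R x ι)
    (s : ∀ i, Repr R (r.right i) (κ i)) (q : DualCop R H) (y : H) :
    opT R H x (q ⊗ₜ y) = ∑ i ∈ r.index, ∑ j ∈ (s i).index,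
      of (toDual R H q ∘ₗ LinearMap.mulLeft R (antipodeInv R ((s i).right j))
        ∘ₗ LinearMap.mulRight R (r.left i)) ⊗ₜ ((s i).left j * y) := by
  have := congr(($(opT_eq (R := R) (H := H))).ofConv x (q ⊗ₜ y))
  rw [conv_sum_apply r] at this
  simp only [conv_sum_apply (s _), AlgHom.toLinearMap_apply, Finset.mul_sum, LinearMap.sum_apply,
    Module.End.mul_apply, opA_tmul, opM_tmul, opB_tmul] at this
  rw [this]
  rfl

variable (R H) in
/-- Left multiplication in the quantum double: `p ⊗ x` acts by
`q ⊗ y ↦ ∑ p q(S⁻¹(x₍₃₎) · x₍₁₎) ⊗ x₍₂₎ y`. -/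
noncomputable def mulLeft :
    DualCop R H ⊗[R] H →ₗ[R] Module.End R (DualCop R H ⊗[R] H) :=
  TensorProduct.lift ((LinearMap.mul R (Module.End R (DualCop R H ⊗[R] H))).compl₁₂
    (opL R H).toLinearMap (opT R H).toLinearMap)

@[simp] theorem mulLeft_tmul (p : DualCop R H) (x : H) :
    mulLeft R H (p ⊗ₜ x) = opL R H p * opT R H x := rfl

theorem mulLeft_opL (p : DualCop R H) (u : DualCop R H ⊗[R] H) :
    mulLeft R H (opL R H p u) = opL R H p * mulLeft R H u := by
  induction u with
  | zero => simp
  | tmul q y => simp [mul_assoc]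
  | add a b ha hb => simp only [map_add, ha, hb, mul_add]

theorem mulLeft_opT (x : H) (u : DualCop R H ⊗[R] H) :
    mulLeft R H (opT R H x u) = opT R H x * mulLeft R H u := by
  let m : DualCop R H ⊗[R] (DualCop R H ⊗[R] H) →ₗ[R] (DualCop R H ⊗[R] H) := TensorProduct.lift (opL R H).toLinearMap
  set lT : Module.End R (DualCop R H ⊗[R] H) →ₐ[R] Module.End R (DualCop R H ⊗[R] (DualCop R H ⊗[R] H)) :=
    Module.End.lTensorAlgHom R (DualCop R H ⊗[R] H) (DualCop R H) with hlT0
  set rT : Module.End R (DualCop R H) →ₐ[R] Module.End R (DualCop R H ⊗[R] (DualCop R H ⊗[R] H)) :=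
    Module.End.rTensorAlgHom R (DualCop R H) (DualCop R H ⊗[R] H) with hrT0
  have hlT : ∀ f p v, lT f (p ⊗ₜ v) = p ⊗ₜ f v := fun _ _ _ ↦ rfl
  have hrT : ∀ f p v, rT f (p ⊗ₜ v) = f p ⊗ₜ v := fun _ _ _ ↦ rfl
  clear_value lT rT
  let A1 : WithConv (H →ₗ[R] Module.End R (DualCop R H ⊗[R] (DualCop R H ⊗[R] H))) :=
    toConv (rT.toLinearMap ∘ₗ rAct)
  let B1 : WithConv (H →ₗ[R] Module.End R (DualCop R H ⊗[R] (DualCop R H ⊗[R] H))) :=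
    toConv (rT.toLinearMap ∘ₗ lAct)
  let A2 : WithConv (H →ₗ[R] Module.End R (DualCop R H ⊗[R] (DualCop R H ⊗[R] H))) :=
    toConv (lT.toLinearMap ∘ₗ (opA R H).toLinearMap)
  let B2 : WithConv (H →ₗ[R] Module.End R (DualCop R H ⊗[R] (DualCop R H ⊗[R] H))) :=
    toConv (lT.toLinearMap ∘ₗ (opB R H).toLinearMap)
  let M2 : WithConv (H →ₗ[R] Module.End R (DualCop R H ⊗[R] (DualCop R H ⊗[R] H))) :=
    toConv (lT.toLinearMap ∘ₗ (opM R H).toLinearMap)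
  let T2 : WithConv (H →ₗ[R] Module.End R (DualCop R H ⊗[R] (DualCop R H ⊗[R] H))) :=
    toConv (lT.toLinearMap ∘ₗ (opT R H).toLinearMap)
  have hT2 : T2 = A2 * (M2 * B2) := by
    have h1 := LinearMap.algHom_comp_convMul_distrib lT (toConv (opM R H).toLinearMap)
      (toConv (opB R H).toLinearMap)
    have h2 := LinearMap.algHom_comp_convMul_distrib lT (toConv (opA R H).toLinearMap)
      (toConv (opM R H).toLinearMap * toConv (opB R H).toLinearMap)
    rw [← opT_eq, h1] at h2
    exact WithConv.ext h2
  have hA : ∀ x v, (toConv (opA R H).toLinearMap).ofConv x (m v)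
      = m ((A1 * A2).ofConv x v) := by
    intro x v
    rw [conv_sum_apply (A := Module.End R (DualCop R H ⊗[R] (DualCop R H ⊗[R] H))) (ℛ R x) A1 A2]
    have : (opA R H).toLinearMap x ∘ₗ m = m ∘ₗ ∑ i ∈ (ℛ R x).index,
        A1.ofConv ((ℛ R x).left i) * A2.ofConv ((ℛ R x).right i) := by
      refine TensorProduct.ext_threefold' fun p q y ↦ ?_
      simp [m, A1, A2, hrT, hlT, rAct_mul_eq (ℛ R x), TensorProduct.sum_tmul]
    exact congr($this v)
  have hB : ∀ x v, (toConv (opB R H).toLinearMap).ofConv x (m v)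
      = m ((B2 * B1).ofConv x v) := by
    intro x v
    rw [conv_sum_apply (A := Module.End R (DualCop R H ⊗[R] (DualCop R H ⊗[R] H))) (ℛ R x) B2 B1]
    have : (opB R H).toLinearMap x ∘ₗ m = m ∘ₗ ∑ i ∈ (ℛ R x).index,
        B2.ofConv ((ℛ R x).left i) * B1.ofConv ((ℛ R x).right i) := by
      refine TensorProduct.ext_threefold' fun p q y ↦ ?_
      simp [m, B1, B2, hrT, hlT, lAct_mul_eq (ℛ R x), TensorProduct.sum_tmul]
    exact congr($this v)
  have hM : ∀ x v, (toConv (opM R H).toLinearMap).ofConv x (m v) = m (M2.ofConv x v) := by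
    intro x v
    have : (opM R H).toLinearMap x ∘ₗ m = m ∘ₗ M2.ofConv x := by
      refine TensorProduct.ext_threefold' fun p q y ↦ ?_
      simp [m, M2, hlT]
    exact congr($this v)
  have key1 : ∀ v, opT R H x (m v) = m ((A1 * (T2 * B1)).ofConv x v) := by
    intro v
    have h := conv_intertwine m _ _ _ _ hA (conv_intertwine m _ _ _ _ hM hB) x v
    rw [← opT_eq] at h
    rw [hT2]
    simp only [mul_assoc] at h ⊢
    exact h
  refine LinearMap.ext fun v ↦ ?_
  let N : (DualCop R H ⊗[R] H) →ₗ[R] DualCop R H ⊗[R] (DualCop R H ⊗[R] H) :=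
    LinearMap.lTensor (DualCop R H) ((opT R H).toLinearMap.flip v)
  have hmN : ∀ u, mulLeft R H u v = m (N u) := by
    intro u
    induction u with
    | zero => simp
    | tmul q y => simp [N, m]
    | add a b ha hb => simp only [map_add, LinearMap.add_apply, ha, hb]
  have kA : ∀ x u, A1.ofConv x (N u) = N ((toConv (opA R H).toLinearMap).ofConv x u) := by
    intro x u
    induction u with
    | zero => simp
    | tmul q y => simp [N, A1, hrT]
    | add a b ha hb => simp only [map_add, ha, hb]
  have kB : ∀ x u, B1.ofConv x (N u) = N ((toConv (opB R H).toLinearMap).ofConv x u) := by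
    intro x u
    induction u with
    | zero => simp
    | tmul q y => simp [N, B1, hrT]
    | add a b ha hb => simp only [map_add, ha, hb]
  have kM : ∀ x u, T2.ofConv x (N u) = N ((toConv (opM R H).toLinearMap).ofConv x u) := by
    intro x u
    induction u with
    | zero => simp
    | tmul q y => simp [N, T2, hlT]
    | add a b ha hb => simp only [map_add, ha, hb]
  have key2 : (A1 * (T2 * B1)).ofConv x (N u) = N (opT R H x u) := by
    have h := conv_intertwine N _ _ _ _ kA (conv_intertwine N _ _ _ _ kM kB) x u
    rw [← opT_eq] at h
    exact h
  rw [hmN, ← key2, ← key1, ← hmN]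
  rfl

theorem opT_one (x : H) : opT R H x (1 ⊗ₜ 1) = 1 ⊗ₜ x := by
  have h1 : ∀ x, opMB R H x (1 ⊗ₜ 1) = 1 ⊗ₜ x := by
    intro x
    have := congr(($(opMB_eq (R := R) (H := H))).ofConv x (1 ⊗ₜ 1))
    rw [conv_sum_apply (ℛ R x)] at this
    simp only [AlgHom.toLinearMap_apply, LinearMap.sum_apply, Module.End.mul_apply, opB_tmul,
      lAct_one, TensorProduct.smul_tmul, opM_tmul, mul_smul_comm, mul_one,
      ← TensorProduct.tmul_sum] at this
    rw [this]
    congr 1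
    have h := congr(TensorProduct.rid R H $(sum_tmul_counit_eq (ℛ R x)))
    simp only [map_sum, TensorProduct.rid_tmul, one_smul] at h
    exact h
  have := congr(($(opT_eq (R := R) (H := H))).ofConv x (1 ⊗ₜ 1))
  rw [← opMB_eq, conv_sum_apply (ℛ R x)] at this
  simp only [AlgHom.toLinearMap_apply, LinearMap.sum_apply, Module.End.mul_apply, opA_tmul, h1,
    rAct_one, TensorProduct.smul_tmul, ← TensorProduct.tmul_sum] at this
  rw [this, sum_counit_smul]

theorem mulLeft_mulLeft (u v : DualCop R H ⊗[R] H) :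
    mulLeft R H (mulLeft R H u v) = mulLeft R H u * mulLeft R H v := by
  induction u with
  | zero => simp
  | tmul p x => simp only [mulLeft_tmul, Module.End.mul_apply, mulLeft_opL, mulLeft_opT, mul_assoc]
  | add a b ha hb => simp only [map_add, LinearMap.add_apply, ha, hb, add_mul]

theorem mulLeft_one : mulLeft R H (1 ⊗ₜ 1) = 1 := by
  simp

theorem mulLeft_apply_one (u : DualCop R H ⊗[R] H) : mulLeft R H u (1 ⊗ₜ 1) = u := by
  induction u with
  | zero => simp
  | tmul p x => simp [opT_one]
  | add a b ha hb => simp only [map_add, LinearMap.add_apply, ha, hb]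

/-- The quantum double as a ring, with the bicrossed product
`(p ⊗ x)(q ⊗ y) = ∑ p q(S⁻¹(x₍₃₎) · x₍₁₎) ⊗ x₍₂₎ y`. -/
noncomputable instance : Ring (DrinfeldDouble R H) where
  __ := (inferInstance : AddCommGroup (DrinfeldDouble R H))
  one := (1 : DualCop R H) ⊗ₜ[R] (1 : H)
  mul u v := mulLeft R H u v
  mul_assoc u v w := congr($(mulLeft_mulLeft (R := R) (H := H) u v) w)
  one_mul u := congr($(mulLeft_one (R := R) (H := H)) u)
  mul_one u := mulLeft_apply_one u
  left_distrib u v w := (mulLeft R H u).map_add v w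
  right_distrib u v w := congr($((mulLeft R H).map_add u v) w)
  zero_mul u := congr($((mulLeft R H).map_zero) u)
  mul_zero u := (mulLeft R H u).map_zero

theorem mul_def (u v : DrinfeldDouble R H) : u * v = mulLeft R H u v := rfl

noncomputable instance : Algebra R (DrinfeldDouble R H) :=
  Algebra.ofModule (fun c u v ↦ congr($((mulLeft R H).map_smul c u) v))
    (fun c u v ↦ (mulLeft R H u).map_smul c v)

variable (R H) in
/-- The embedding `x ↦ ε ⊗ x` of `H` in its double. -/
noncomputable def ofAlg : H →ₐ[R] DrinfeldDouble R H :=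
  AlgHom.ofLinearMap
    (show H →ₗ[R] DrinfeldDouble R H from TensorProduct.mk R (DualCop R H) H 1) rfl (by
      intro x y
      change (1 : DualCop R H) ⊗ₜ[R] (x * y) = mulLeft R H (1 ⊗ₜ x) (1 ⊗ₜ y)
      rw [mulLeft_tmul, map_one, one_mul, ← opT_one, ← opT_one (x := y), map_mul]
      rfl)

variable (R H) in
/-- The embedding `p ↦ p ⊗ 1` of `H^{*cop}` in the double of `H`. -/
noncomputable def ofDual : DualCop R H →ₐ[R] DrinfeldDouble R H :=
  AlgHom.ofLinearMap
    (show DualCop R H →ₗ[R] DrinfeldDouble R H from (TensorProduct.mk R (DualCop R H) H).flip 1)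
    rfl (by
      intro p q
      change (p * q) ⊗ₜ[R] (1 : H) = mulLeft R H (p ⊗ₜ 1) (q ⊗ₜ 1)
      rw [mulLeft_tmul, map_one, mul_one, opL_tmul])

theorem ofAlg_mul (x : H) (v : DrinfeldDouble R H) : ofAlg R H x * v = opT R H x v := by
  change mulLeft R H (1 ⊗ₜ x) v = _
  rw [mulLeft_tmul, map_one, one_mul]

theorem ofDual_mul (p : DualCop R H) (v : DrinfeldDouble R H) :
    ofDual R H p * v = opL R H p v := by
  change mulLeft R H (p ⊗ₜ 1) v = _
  rw [mulLeft_tmul, map_one, mul_one]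

variable (R H) in
/-- The element `p ⊗ x` of the double. -/
noncomputable def tmul (p : DualCop R H) (x : H) : DrinfeldDouble R H := p ⊗ₜ[R] x

theorem ofDual_mul_ofAlg (p : DualCop R H) (x : H) :
    ofDual R H p * ofAlg R H x = tmul R H p x := by
  rw [ofDual_mul]
  change opL R H p (1 ⊗ₜ x) = p ⊗ₜ x
  rw [opL_tmul, mul_one]

theorem induction_on {motive : DrinfeldDouble R H → Prop} (u : DrinfeldDouble R H)
    (zero : motive 0) (tmul : ∀ p x, motive (tmul R H p x))
    (add : ∀ a b, motive a → motive b → motive (a + b)) : motive u :=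
  TensorProduct.induction_on u zero tmul add

section Coalg

variable [Module.Finite R H] [Module.Free R H]

/-- As a coalgebra, the quantum double is the tensor product `H^{*cop} ⊗ H`. -/
noncomputable instance : Coalgebra R (DrinfeldDouble R H) :=
  inferInstanceAs (Coalgebra R (DualCop R H ⊗[R] H))

variable (R H) in
/-- The rearrangement `(p ⊗ q) ⊗ (x ⊗ y) ↦ (p ⊗ x) ⊗ (q ⊗ y)`. -/
noncomputable def shuffle : (DualCop R H ⊗[R] DualCop R H) ⊗[R] (H ⊗[R] H) →ₗ[R]
    DrinfeldDouble R H ⊗[R] DrinfeldDouble R H :=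
  (TensorProduct.tensorTensorTensorComm R (DualCop R H) (DualCop R H) H H).toLinearMap

theorem shuffle_tmul (p q : DualCop R H) (x y : H) :
    shuffle R H ((p ⊗ₜ q) ⊗ₜ (x ⊗ₜ y)) = tmul R H p x ⊗ₜ tmul R H q y := rfl

theorem comul_tmul (p : DualCop R H) (x : H) :
    comul (R := R) (tmul R H p x) = shuffle R H (comul p ⊗ₜ comul x) := rfl

theorem counit_tmul (p : DualCop R H) (x : H) :
    counit (R := R) (tmul R H p x) = counit x * p 1 := rfl

theorem shuffle_eq (t : DualCop R H ⊗[R] DualCop R H) (s : H ⊗[R] H) :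
    shuffle R H (t ⊗ₜ s) = Algebra.TensorProduct.map (ofDual R H) (ofDual R H) t
      * Algebra.TensorProduct.map (ofAlg R H) (ofAlg R H) s := by
  induction t with
  | zero => simp
  | add a b ha hb => simp only [TensorProduct.add_tmul, map_add, ha, hb, add_mul]
  | tmul p q =>
    induction s with
    | zero => simp
    | add a b ha hb => simp only [TensorProduct.tmul_add, map_add, ha, hb, mul_add]
    | tmul x y =>
      rw [shuffle_tmul, Algebra.TensorProduct.map_tmul, Algebra.TensorProduct.map_tmul,
        Algebra.TensorProduct.tmul_mul_tmul, ofDual_mul_ofAlg, ofDual_mul_ofAlg]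

theorem comul_ofDual_mul (p : DualCop R H) (v : DrinfeldDouble R H) :
    comul (R := R) (ofDual R H p * v)
      = Algebra.TensorProduct.map (ofDual R H) (ofDual R H) (comul p) * comul v := by
  induction v using induction_on with
  | zero => simp
  | add a b ha hb => simp only [mul_add, map_add, ha, hb]
  | tmul q y =>
    have : ofDual R H p * tmul R H q y = tmul R H (p * q) y := by
      rw [ofDual_mul]
      exact opL_tmul p q y
    rw [this, comul_tmul, comul_tmul, shuffle_eq, shuffle_eq, Bialgebra.comul_mul, map_mul,
      mul_assoc]

theorem comul_rAct (x : H) (q : DualCop R H) :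
    comul (R := R) (rAct x q) = LinearMap.rTensor (DualCop R H) (rAct x) (comul q) := by
  refine contr_ext fun a ↦ ?_
  have h : ∀ t : DualCop R H ⊗[R] DualCop R H,
      contr a (LinearMap.rTensor (DualCop R H) (rAct x) t) = contr (a * x) t := by
    intro t
    induction t with
    | zero => simp
    | tmul p m => simp
    | add x y hx hy => simp only [map_add, hx, hy]
  rw [h, contr_comul, contr_comul]
  ext b
  simp [mul_assoc]

theorem comul_lAct (x : H) (q : DualCop R H) :
    comul (R := R) (lAct x q) = LinearMap.lTensor (DualCop R H) (lAct x) (comul q) := by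
  refine contr_ext fun a ↦ ?_
  have h : ∀ t : DualCop R H ⊗[R] DualCop R H,
      contr a (LinearMap.lTensor (DualCop R H) (lAct x) t) = lAct x (contr a t) := by
    intro t
    induction t with
    | zero => simp
    | tmul p m => simp
    | add x y hx hy => simp only [map_add, hx, hy]
  rw [h, contr_comul, contr_comul]
  ext b
  simp [mul_assoc]

theorem sum_lAct_rAct_comul (x : H) (q : DualCop R H) :
    ∑ i ∈ (ℛ R x).index, LinearMap.rTensor (DualCop R H) (lAct ((ℛ R x).left i))
      (LinearMap.lTensor (DualCop R H) (rAct ((ℛ R x).right i)) (comul (R := R) q))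
      = counit (R := R) x • comul q := by
  refine contr_ext fun a ↦ ?_
  have h : ∀ (y z : H) (t : DualCop R H ⊗[R] DualCop R H),
      contr a (LinearMap.rTensor (DualCop R H) (lAct y)
        (LinearMap.lTensor (DualCop R H) (rAct z) t)) = rAct z (contr (antipodeInv R y * a) t) := by
    intro y z t
    induction t with
    | zero => simp
    | tmul p m => simp
    | add x y hx hy => simp only [map_add, hx, hy]
  simp only [map_sum, h, contr_comul, map_smul]
  ext b
  have := congr(q (b * $(sum_right_mul_antipodeInv_left R (ℛ R x)) * a))
  simpa [Finset.mul_sum, Finset.sum_mul, mul_assoc, Algebra.algebraMap_eq_smul_one] using this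

variable (R H) in
/-- The operator `opA`, on the double. -/
noncomputable def dA : H →ₐ[R] Module.End R (DrinfeldDouble R H) := opA R H
variable (R H) in
/-- The operator `opM`, on the double. -/
noncomputable def dM : H →ₐ[R] Module.End R (DrinfeldDouble R H) := opM R H
variable (R H) in
/-- The operator `opB`, on the double. -/
noncomputable def dB : H →ₐ[R] Module.End R (DrinfeldDouble R H) := opB R H
variable (R H) in
/-- The operator `opT`, on the double. -/
noncomputable def dT : H →ₐ[R] Module.End R (DrinfeldDouble R H) := opT R H

theorem dA_tmul (x : H) (q : DualCop R H) (y : H) :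
    dA R H x (tmul R H q y) = tmul R H (rAct x q) y := rfl
theorem dB_tmul (x : H) (q : DualCop R H) (y : H) :
    dB R H x (tmul R H q y) = tmul R H (lAct x q) y := rfl
theorem dM_tmul (x : H) (q : DualCop R H) (y : H) :
    dM R H x (tmul R H q y) = tmul R H q (x * y) := rfl
theorem ofAlg_mul_eq (x : H) (v : DrinfeldDouble R H) : ofAlg R H x * v = dT R H x v :=
  ofAlg_mul x v
theorem dT_eq : toConv (dT R H).toLinearMap = toConv (dA R H).toLinearMap
    * (toConv (dM R H).toLinearMap * toConv (dB R H).toLinearMap) := opT_eq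
theorem commute_dA_dM (x y : H) : Commute (dA R H x) (dM R H y) :=
  commute_opA_opM (R := R) (H := H) x y
theorem commute_dA_dB (x y : H) : Commute (dA R H x) (dB R H y) :=
  commute_opA_opB (R := R) (H := H) x y

theorem opB_opA_comul (x : H) (v : DrinfeldDouble R H) :
    ∑ i ∈ (ℛ R x).index, LinearMap.rTensor (DrinfeldDouble R H) (dB R H ((ℛ R x).left i))
      (LinearMap.lTensor (DrinfeldDouble R H) (dA R H ((ℛ R x).right i)) (comul (R := R) v))
      = counit (R := R) x • comul (R := R) v := by
  have h : ∀ (y z : H) (t : DualCop R H ⊗[R] DualCop R H) (s : H ⊗[R] H),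
      LinearMap.rTensor (DrinfeldDouble R H) (dB R H y)
        (LinearMap.lTensor (DrinfeldDouble R H) (dA R H z) (shuffle R H (t ⊗ₜ s)))
      = shuffle R H (LinearMap.rTensor (DualCop R H) (lAct y)
          (LinearMap.lTensor (DualCop R H) (rAct z) t) ⊗ₜ s) := by
    intro y z t s
    induction t with
    | zero => simp
    | add a b ha hb => simp only [TensorProduct.add_tmul, map_add, ha, hb]
    | tmul p q =>
      induction s with
      | zero => simp
      | add a b ha hb => simp only [TensorProduct.tmul_add, map_add, ha, hb]
      | tmul x y => rfl
  induction v using induction_on with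
  | zero => simp
  | add a b ha hb => simp only [map_add, Finset.sum_add_distrib, ha, hb, smul_add]
  | tmul q y =>
    rw [comul_tmul]
    simp only [h]
    rw [← map_sum, ← TensorProduct.sum_tmul, sum_lAct_rAct_comul, ← TensorProduct.smul_tmul',
      map_smul]

theorem comul_opA (x : H) (v : DrinfeldDouble R H) :
    comul (R := R) (dA R H x v)
      = LinearMap.rTensor (DrinfeldDouble R H) (dA R H x) (comul v) := by
  have h : ∀ (t : DualCop R H ⊗[R] DualCop R H) (s : H ⊗[R] H),
      LinearMap.rTensor (DrinfeldDouble R H) (dA R H x) (shuffle R H (t ⊗ₜ s))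
      = shuffle R H (LinearMap.rTensor (DualCop R H) (rAct x) t ⊗ₜ s) := by
    intro t s
    induction t with
    | zero => simp
    | add a b ha hb => simp only [TensorProduct.add_tmul, map_add, ha, hb]
    | tmul p q =>
      induction s with
      | zero => simp
      | add a b ha hb => simp only [TensorProduct.tmul_add, map_add, ha, hb]
      | tmul x y => rfl
  induction v using induction_on with
  | zero => simp
  | add a b ha hb => simp only [map_add, ha, hb]
  | tmul q y =>
    rw [comul_tmul, h, ← comul_rAct]
    rfl

theorem comul_opB (x : H) (v : DrinfeldDouble R H) :
    comul (R := R) (dB R H x v)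
      = LinearMap.lTensor (DrinfeldDouble R H) (dB R H x) (comul v) := by
  have h : ∀ (t : DualCop R H ⊗[R] DualCop R H) (s : H ⊗[R] H),
      LinearMap.lTensor (DrinfeldDouble R H) (dB R H x) (shuffle R H (t ⊗ₜ s))
      = shuffle R H (LinearMap.lTensor (DualCop R H) (lAct x) t ⊗ₜ s) := by
    intro t s
    induction t with
    | zero => simp
    | add a b ha hb => simp only [TensorProduct.add_tmul, map_add, ha, hb]
    | tmul p q =>
      induction s with
      | zero => simp
      | add a b ha hb => simp only [TensorProduct.tmul_add, map_add, ha, hb]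
      | tmul x y => rfl
  induction v using induction_on with
  | zero => simp
  | add a b ha hb => simp only [map_add, ha, hb]
  | tmul q y =>
    rw [comul_tmul, h, ← comul_lAct]
    rfl

theorem comul_opM (x : H) (v : DrinfeldDouble R H) :
    comul (R := R) (dM R H x v)
      = ∑ i ∈ (ℛ R x).index, LinearMap.rTensor (DrinfeldDouble R H) (dM R H ((ℛ R x).left i))
        (LinearMap.lTensor (DrinfeldDouble R H) (dM R H ((ℛ R x).right i)) (comul v)) := by
  have h : ∀ (y z : H) (t : DualCop R H ⊗[R] DualCop R H) (s : H ⊗[R] H),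
      LinearMap.rTensor (DrinfeldDouble R H) (dM R H y)
        (LinearMap.lTensor (DrinfeldDouble R H) (dM R H z) (shuffle R H (t ⊗ₜ s)))
      = shuffle R H (t ⊗ₜ ((y ⊗ₜ z) * s)) := by
    intro y z t s
    induction t with
    | zero => simp
    | add a b ha hb => simp only [TensorProduct.add_tmul, map_add, ha, hb]
    | tmul p q =>
      induction s with
      | zero => simp
      | add a b ha hb => simp only [TensorProduct.tmul_add, map_add, mul_add, ha, hb]
      | tmul x y =>
        rw [Algebra.TensorProduct.tmul_mul_tmul]
        rfl
  induction v using induction_on with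
  | zero => simp
  | add a b ha hb => simp only [map_add, Finset.sum_add_distrib, ha, hb]
  | tmul q y =>
    rw [comul_tmul]
    simp only [h]
    rw [← map_sum, ← TensorProduct.tmul_sum, ← Finset.sum_mul, (ℛ R x).eq, ← Bialgebra.comul_mul]
    rfl

theorem comul_ofAlg_mul (x : H) (v : DrinfeldDouble R H) :
    comul (R := R) (ofAlg R H x * v)
      = Algebra.TensorProduct.map (ofAlg R H) (ofAlg R H) (comul x) * comul v := by
  let f1 : Module.End R (DrinfeldDouble R H) →ₐ[R]
      Module.End R (DrinfeldDouble R H ⊗[R] DrinfeldDouble R H) :=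
    Module.End.rTensorAlgHom R (DrinfeldDouble R H) (DrinfeldDouble R H)
  let f2 : Module.End R (DrinfeldDouble R H) →ₐ[R]
      Module.End R (DrinfeldDouble R H ⊗[R] DrinfeldDouble R H) :=
    Module.End.lTensorAlgHom R (DrinfeldDouble R H) (DrinfeldDouble R H)
  let oA : H →ₗ[R] Module.End R (DrinfeldDouble R H) := (dA R H).toLinearMap
  let oM : H →ₗ[R] Module.End R (DrinfeldDouble R H) := (dM R H).toLinearMap
  let oB : H →ₗ[R] Module.End R (DrinfeldDouble R H) := (dB R H).toLinearMap
  let oT : H →ₗ[R] Module.End R (DrinfeldDouble R H) := (dT R H).toLinearMap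
  have hoT : toConv oT = toConv oA * (toConv oM * toConv oB) := dT_eq
  let E := WithConv (H →ₗ[R] Module.End R (DrinfeldDouble R H ⊗[R] DrinfeldDouble R H))
  let A1 : E := toConv (f1.toLinearMap ∘ₗ oA)
  let M1 : E := toConv (f1.toLinearMap ∘ₗ oM)
  let B1 : E := toConv (f1.toLinearMap ∘ₗ oB)
  let T1 : E := toConv (f1.toLinearMap ∘ₗ oT)
  let A2 : E := toConv (f2.toLinearMap ∘ₗ oA)
  let M2 : E := toConv (f2.toLinearMap ∘ₗ oM)
  let B2 : E := toConv (f2.toLinearMap ∘ₗ oB)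
  let T2 : E := toConv (f2.toLinearMap ∘ₗ oT)
  have hT1 : T1 = A1 * (M1 * B1) := by
    have h1 := LinearMap.algHom_comp_convMul_distrib f1 (toConv oM) (toConv oB)
    have h2 := LinearMap.algHom_comp_convMul_distrib f1 (toConv oA) (toConv oM * toConv oB)
    rw [← hoT, h1] at h2
    exact WithConv.ext h2
  have hT2 : T2 = A2 * (M2 * B2) := by
    have h1 := LinearMap.algHom_comp_convMul_distrib f2 (toConv oM) (toConv oB)
    have h2 := LinearMap.algHom_comp_convMul_distrib f2 (toConv oA) (toConv oM * toConv oB)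
    rw [← hoT, h1] at h2
    exact WithConv.ext h2
  have hA : ∀ x v, A1.ofConv x (comul (R := R) v) = comul ((toConv oA).ofConv x v) :=
    fun x v ↦ (comul_opA x v).symm
  have hB : ∀ x v, B2.ofConv x (comul (R := R) v) = comul ((toConv oB).ofConv x v) :=
    fun x v ↦ (comul_opB x v).symm
  have hM : ∀ x v, (M1 * M2).ofConv x (comul (R := R) v) = comul ((toConv oM).ofConv x v) := by
    intro x v
    rw [conv_sum_apply
      (A := Module.End R (DrinfeldDouble R H ⊗[R] DrinfeldDouble R H)) (ℛ R x) M1 M2]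
    simp only [LinearMap.sum_apply, Module.End.mul_apply]
    exact (comul_opM x v).symm
  have key := conv_intertwine (comul (R := R)) _ _ _ _ hA (conv_intertwine _ _ _ _ _ hM hB) x v
  rw [← hoT] at key
  have hl : comul (R := R) (ofAlg R H x * v) = comul (R := R) ((toConv oT).ofConv x v) := by
    rw [ofAlg_mul_eq]
    rfl
  have hr : Algebra.TensorProduct.map (ofAlg R H) (ofAlg R H) (comul x) * comul (R := R) v
      = (T1 * T2).ofConv x (comul v) := by
    rw [conv_sum_apply
      (A := Module.End R (DrinfeldDouble R H ⊗[R] DrinfeldDouble R H)) (ℛ R x) T1 T2,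
      ← (ℛ R x).eq, map_sum, Finset.sum_mul, LinearMap.sum_apply]
    refine Finset.sum_congr rfl fun i _ ↦ ?_
    generalize comul (R := R) v = w
    induction w with
    | zero => simp
    | add a b ha hb => simp only [mul_add, map_add, ha, hb]
    | tmul c d =>
      rw [Algebra.TensorProduct.map_tmul, Algebra.TensorProduct.tmul_mul_tmul, ofAlg_mul_eq,
        ofAlg_mul_eq]
      rfl
  have hBA : ∀ y, (B1 * A2).ofConv y (comul (R := R) v) = counit (R := R) y • comul v := by
    intro y
    rw [conv_sum_apply
      (A := Module.End R (DrinfeldDouble R H ⊗[R] DrinfeldDouble R H)) (ℛ R y) B1 A2]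
    simp only [LinearMap.sum_apply, Module.End.mul_apply]
    exact opB_opA_comul y v
  have hc12 : ∀ f g : Module.End R (DrinfeldDouble R H), Commute (f1 f) (f2 g) := by
    intro f g
    exact TensorProduct.ext' fun a b ↦ rfl
  have hcom : ∀ y z, Commute ((B1 * A2).ofConv y) ((M2 * B2).ofConv z) := by
    intro y z
    rw [conv_sum_apply
      (A := Module.End R (DrinfeldDouble R H ⊗[R] DrinfeldDouble R H)) (ℛ R y) B1 A2,
      conv_sum_apply
      (A := Module.End R (DrinfeldDouble R H ⊗[R] DrinfeldDouble R H)) (ℛ R z) M2 B2]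
    refine Commute.sum_left _ _ _ fun i _ ↦ Commute.sum_right _ _ _ fun j _ ↦ ?_
    refine Commute.mul_left (Commute.mul_right (hc12 _ _) (hc12 _ _)) (Commute.mul_right ?_ ?_)
    · exact (commute_dA_dM (R := R) (H := H) _ _).map f2
    · exact (commute_dA_dB (R := R) (H := H) _ _).map f2
  have hfin := conv_cancel (comul (R := R) v) (A1 * M1) (B1 * A2) (M2 * B2) hBA hcom x
  rw [hl, hr, ← key, hT1, hT2]
  simp only [mul_assoc] at hfin ⊢
  exact hfin.symm

theorem comul_mul' (u v : DrinfeldDouble R H) :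
    comul (R := R) (u * v) = comul u * comul v := by
  induction u using induction_on with
  | zero => simp
  | add a b ha hb => simp only [add_mul, map_add, ha, hb]
  | tmul p x =>
    rw [← ofDual_mul_ofAlg, mul_assoc, comul_ofDual_mul, comul_ofAlg_mul, ofDual_mul_ofAlg,
      comul_tmul, shuffle_eq, mul_assoc]

theorem counit_mul' (u v : DrinfeldDouble R H) :
    counit (R := R) (u * v) = counit u * counit v := by
  have hL : ∀ (p : DualCop R H) (v : DrinfeldDouble R H),
      counit (R := R) (ofDual R H p * v) = p 1 * counit (R := R) v := by
    intro p v
    induction v using induction_on with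
    | zero => simp
    | add a b ha hb => simp only [mul_add, map_add, ha, hb]
    | tmul q y =>
      have : ofDual R H p * tmul R H q y = tmul R H (p * q) y := by
        rw [ofDual_mul]
        exact opL_tmul p q y
      rw [this, counit_tmul, counit_tmul, ← counit_def', ← counit_def', ← counit_def',
        Bialgebra.counit_mul]
      ring
  have hT : ∀ (x : H) (v : DrinfeldDouble R H),
      counit (R := R) (ofAlg R H x * v) = counit (R := R) x * counit (R := R) v := by
    intro x v
    induction v using induction_on with
    | zero => simp
    | add a b ha hb => simp only [mul_add, map_add, ha, hb]
    | tmul q y =>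
      rw [ofAlg_mul]
      have e : opT R H x (tmul R H q y) = _ := opT_tmul (ℛ R x) (fun i ↦ ℛ R _) q y
      rw [e]
      have e2 : ∀ (p : DualCop R H) (z : H),
        counit (R := R) (show DrinfeldDouble R H from p ⊗ₜ[R] z) = counit z * p 1 := counit_tmul
      have e3 := map_sum (counit (R := R) (A := DrinfeldDouble R H))
        (fun i ↦ ∑ j ∈ (ℛ R ((ℛ R x).right i)).index,
          tmul R H (of (toDual R H q ∘ₗ LinearMap.mulLeft R
            (antipodeInv R ((ℛ R ((ℛ R x).right i)).right j))
            ∘ₗ LinearMap.mulRight R ((ℛ R x).left i)))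
            ((ℛ R ((ℛ R x).right i)).left j * y)) (ℛ R x).index
      refine e3.trans ?_
      simp only [map_sum, counit_tmul, of_apply, LinearMap.comp_apply, LinearMap.mulLeft_apply,
        LinearMap.mulRight_apply, one_mul, Bialgebra.counit_mul]
      have e4 : ∀ i, ∑ j ∈ (ℛ R ((ℛ R x).right i)).index,
          counit (R := R) ((ℛ R ((ℛ R x).right i)).left j) * counit (R := R) y
            * q (antipodeInv R ((ℛ R ((ℛ R x).right i)).right j) * (ℛ R x).left i)
          = counit (R := R) y * q (antipodeInv R ((ℛ R x).right i) * (ℛ R x).left i) := by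
        intro i
        conv_rhs => rw [← sum_counit_smul (ℛ R ((ℛ R x).right i))]
        simp only [map_sum, map_smul, Finset.sum_mul, smul_mul_assoc, smul_eq_mul, Finset.mul_sum]
        exact Finset.sum_congr rfl fun j _ ↦ by ring
      simp only [e4]
      rw [← Finset.mul_sum, ← map_sum, sum_antipodeInv_right_mul_left,
        Algebra.algebraMap_eq_smul_one, map_smul, smul_eq_mul]
      ring
  induction u using induction_on with
  | zero => simp
  | add a b ha hb => simp only [add_mul, map_add, ha, hb]
  | tmul p x =>
    rw [← ofDual_mul_ofAlg, mul_assoc, hL, hT, ofDual_mul_ofAlg, counit_tmul]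
    ring

noncomputable instance : Bialgebra R (DrinfeldDouble R H) :=
  Bialgebra.mk' R (DrinfeldDouble R H)
    (by
      change counit (R := R) (tmul R H 1 1) = 1
      rw [counit_tmul]
      simp)
    (counit_mul' _ _)
    (by
      change comul (R := R) (tmul R H 1 1) = 1
      rw [comul_tmul, Bialgebra.comul_one, Bialgebra.comul_one, Algebra.TensorProduct.one_def,
        Algebra.TensorProduct.one_def, shuffle_tmul]
      rfl)
    (comul_mul' _ _)

variable (R H) in
/-- Precomposition `p ↦ p ∘ S⁻¹`, the antipode of `H^{*cop}`. -/
noncomputable def dualAntipode : DualCop R H →ₗ[R] DualCop R H where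
  toFun p := of (toDual R H p ∘ₗ antipodeInv R)
  map_add' p q := by ext; simp
  map_smul' c p := by ext; simp

@[simp] theorem dualAntipode_apply (p : DualCop R H) (x : H) :
    dualAntipode R H p x = p (antipodeInv R x) := rfl

variable (R H) in
/-- The antipode of the double, `p ⊗ x ↦ (ε ⊗ S(x)) (p ∘ S⁻¹ ⊗ 1)`. -/
noncomputable def doubleAntipode : DrinfeldDouble R H →ₗ[R] DrinfeldDouble R H :=
  TensorProduct.lift ((LinearMap.mul R (DrinfeldDouble R H)).compl₁₂
    ((ofAlg R H).toLinearMap ∘ₗ antipode R)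
    ((ofDual R H).toLinearMap ∘ₗ dualAntipode R H)).flip

theorem doubleAntipode_tmul (p : DualCop R H) (x : H) :
    doubleAntipode R H (tmul R H p x)
      = ofAlg R H (antipode R x) * ofDual R H (dualAntipode R H p) := rfl

theorem mul_dualAntipode_left (p : DualCop R H) :
    LinearMap.mul' R (DualCop R H)
      (LinearMap.rTensor (DualCop R H) (dualAntipode R H) (comul (R := R) p)) = p 1 • 1 := by
  ext c
  have h : ∀ t : DualCop R H ⊗[R] DualCop R H,
      (LinearMap.mul' R (DualCop R H)
        (LinearMap.rTensor (DualCop R H) (dualAntipode R H) t)) c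
      = ∑ i ∈ (ℛ R c).index, (contr (antipodeInv R ((ℛ R c).left i)) t) ((ℛ R c).right i) := by
    intro t
    induction t with
    | zero => simp
    | tmul q r => simp [mul_apply' (ℛ R c)]
    | add x y hx hy => simp only [map_add, LinearMap.add_apply, hx, hy, Finset.sum_add_distrib]
  rw [h]
  simp only [contr_comul, rAct_apply]
  rw [← map_sum, sum_right_mul_antipodeInv_left, Algebra.algebraMap_eq_smul_one, map_smul]
  simp [mul_comm]

theorem mul_dualAntipode_right (p : DualCop R H) :
    LinearMap.mul' R (DualCop R H)
      (LinearMap.lTensor (DualCop R H) (dualAntipode R H) (comul (R := R) p)) = p 1 • 1 := by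
  ext c
  have h : ∀ t : DualCop R H ⊗[R] DualCop R H,
      (LinearMap.mul' R (DualCop R H)
        (LinearMap.lTensor (DualCop R H) (dualAntipode R H) t)) c
      = ∑ i ∈ (ℛ R c).index, (contr ((ℛ R c).left i) t) (antipodeInv R ((ℛ R c).right i)) := by
    intro t
    induction t with
    | zero => simp
    | tmul q r => simp [mul_apply' (ℛ R c)]
    | add x y hx hy => simp only [map_add, LinearMap.add_apply, hx, hy, Finset.sum_add_distrib]
  rw [h]
  simp only [contr_comul, rAct_apply]
  rw [← map_sum, sum_antipodeInv_right_mul_left, Algebra.algebraMap_eq_smul_one, map_smul]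
  simp [mul_comm]

noncomputable instance : HopfAlgebra R (DrinfeldDouble R H) where
  antipode := doubleAntipode R H
  mul_antipode_rTensor_comul := by
    ext u : 1
    simp only [LinearMap.comp_apply]
    induction u using induction_on with
    | zero => simp
    | add a b ha hb => simp only [map_add, ha, hb]
    | tmul p x =>
      have h : ∀ (t : DualCop R H ⊗[R] DualCop R H) (y z : H),
          LinearMap.mul' R (DrinfeldDouble R H) (LinearMap.rTensor (DrinfeldDouble R H)
            (doubleAntipode R H) (shuffle R H (t ⊗ₜ (y ⊗ₜ z))))
          = ofAlg R H (antipode R y) * ofDual R H (LinearMap.mul' R (DualCop R H)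
            (LinearMap.rTensor (DualCop R H) (dualAntipode R H) t)) * ofAlg R H z := by
        intro t y z
        induction t with
        | zero => simp
        | add a b ha hb => simp only [TensorProduct.add_tmul, map_add, ha, hb, mul_add, add_mul]
        | tmul q r =>
          rw [shuffle_tmul, LinearMap.rTensor_tmul, LinearMap.mul'_apply, doubleAntipode_tmul,
            ← ofDual_mul_ofAlg, LinearMap.rTensor_tmul, LinearMap.mul'_apply, map_mul]
          simp only [mul_assoc]
      rw [comul_tmul, ← (ℛ R x).eq]
      simp only [TensorProduct.tmul_sum, map_sum, h, mul_dualAntipode_left, map_smul, map_one,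
        mul_smul_comm, mul_one, smul_mul_assoc, ← map_mul]
      rw [← Finset.smul_sum, ← map_sum, sum_antipode_mul_eq_algebraMap_counit, counit_tmul,
        AlgHom.commutes, Algebra.linearMap_apply, map_mul, Algebra.smul_def]
      exact Algebra.commutes _ _
  mul_antipode_lTensor_comul := by
    ext u : 1
    simp only [LinearMap.comp_apply]
    induction u using induction_on with
    | zero => simp
    | add a b ha hb => simp only [map_add, ha, hb]
    | tmul p x =>
      have h : ∀ (q r : DualCop R H) (s : H ⊗[R] H),
          LinearMap.mul' R (DrinfeldDouble R H) (LinearMap.lTensor (DrinfeldDouble R H)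
            (doubleAntipode R H) (shuffle R H ((q ⊗ₜ r) ⊗ₜ s)))
          = ofDual R H q * ofAlg R H (LinearMap.mul' R H (LinearMap.lTensor H (antipode R) s))
            * ofDual R H (dualAntipode R H r) := by
        intro q r s
        induction s with
        | zero => simp
        | add a b ha hb => simp only [TensorProduct.tmul_add, map_add, ha, hb, mul_add, add_mul]
        | tmul y z =>
          rw [shuffle_tmul, LinearMap.lTensor_tmul, LinearMap.mul'_apply, doubleAntipode_tmul,
            ← ofDual_mul_ofAlg, LinearMap.lTensor_tmul, LinearMap.mul'_apply, map_mul]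
          simp only [mul_assoc]
      have h2 : ∀ t : DualCop R H ⊗[R] DualCop R H,
          LinearMap.mul' R (DrinfeldDouble R H) (LinearMap.lTensor (DrinfeldDouble R H)
            (doubleAntipode R H) (shuffle R H (t ⊗ₜ comul x)))
          = counit (R := R) x • ofDual R H (LinearMap.mul' R (DualCop R H)
            (LinearMap.lTensor (DualCop R H) (dualAntipode R H) t)) := by
        intro t
        induction t with
        | zero => simp
        | add a b ha hb => simp only [TensorProduct.add_tmul, map_add, ha, hb, smul_add]
        | tmul q r =>
          rw [h, mul_antipode_lTensor_comul_apply, AlgHom.commutes,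
            LinearMap.lTensor_tmul, LinearMap.mul'_apply, map_mul, ← Algebra.commutes, mul_assoc,
            ← Algebra.smul_def]
      rw [comul_tmul, h2, mul_dualAntipode_right, map_smul, map_one (ofDual R H), counit_tmul, smul_smul,
        Algebra.linearMap_apply, Algebra.algebraMap_eq_smul_one]

end Coalg
end DrinfeldDouble
end Double

/-- Gaussian binomial coefficients `[i + j choose i]_q`. -/
def qBinom {R : Type*} [CommRing R] (q : R) : ℕ → ℕ → R
  | 0, _ => 1
  | _ + 1, 0 => 1
  | i + 1, j + 1 => qBinom q i (j + 1) + q ^ (i + 1) * qBinom q (i + 1) j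

theorem qBinom_mul {R : Type*} [CommRing R] (q : R) (i j : ℕ) :
    qBinom q i j * (∏ s ∈ Finset.range i, (1 - q ^ (s + 1)))
        * (∏ s ∈ Finset.range j, (1 - q ^ (s + 1)))
      = ∏ s ∈ Finset.range (i + j), (1 - q ^ (s + 1)) := by
  induction i generalizing j with
  | zero => simp [qBinom]
  | succ i ih =>
    induction j with
    | zero => simp [qBinom]
    | succ j ihj =>
      have h1 := ih (j + 1)
      have e : i + 1 + j = i + (j + 1) := by omega
      rw [e] at ihj
      have e2 : i + 1 + (j + 1) = (i + (j + 1)) + 1 := by omega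
      rw [qBinom, e2, Finset.prod_range_succ _ (i + (j + 1))]
      have e3 : q ^ (i + (j + 1) + 1) = q ^ (i + 1) * q ^ (j + 1) := by
        rw [← pow_add]; congr 1; omega
      calc _ = (qBinom q i (j + 1) * (∏ s ∈ Finset.range i, (1 - q ^ (s + 1)))
              * (∏ s ∈ Finset.range (j + 1), (1 - q ^ (s + 1)))) * (1 - q ^ (i + 1))
            + q ^ (i + 1) * (qBinom q (i + 1) j * (∏ s ∈ Finset.range (i + 1), (1 - q ^ (s + 1)))
              * (∏ s ∈ Finset.range j, (1 - q ^ (s + 1)))) * (1 - q ^ (j + 1)) := by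
            simp only [Finset.prod_range_succ]; ring
        _ = _ := by rw [h1, ihj, e3]; ring

theorem add_pow_of_mul_eq_smul {R A : Type*} [CommRing R] [Ring A] [Algebra R A] (q : R) (a b : A)
    (hab : b * a = q • (a * b)) (n : ℕ) :
    (a + b) ^ n = ∑ p ∈ Finset.HasAntidiagonal.antidiagonal n, qBinom q p.1 p.2 • (a ^ p.1 * b ^ p.2) := by
  have hb : ∀ i : ℕ, b * a ^ i = q ^ i • (a ^ i * b) := by
    intro i
    induction i with
    | zero => simp
    | succ i ih =>
      rw [pow_succ, ← mul_assoc, ih, smul_mul_assoc, mul_assoc, hab, mul_smul_comm, smul_smul,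
        mul_assoc, pow_succ]
  induction n with
  | zero => simp [qBinom]
  | succ n ih =>
    let g : ℕ → ℕ → R := fun i j ↦ match i with
      | 0 => 0
      | i + 1 => qBinom q i j
    let h : ℕ → ℕ → R := fun i j ↦ match j with
      | 0 => 0
      | j + 1 => q ^ i * qBinom q i j
    have hgh : ∀ p ∈ Finset.HasAntidiagonal.antidiagonal (n + 1), qBinom q p.1 p.2 = g p.1 p.2 + h p.1 p.2 := by
      rintro ⟨i, j⟩ hp
      rw [Finset.HasAntidiagonal.mem_antidiagonal] at hp
      match i, j with
      | 0, 0 => simp at hp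
      | 0, j + 1 => simp [qBinom, g, h]
      | i + 1, 0 => cases i <;> simp [qBinom, g, h]
      | i + 1, j + 1 => simp [qBinom, g, h]
    rw [Finset.sum_congr rfl fun p hp ↦ by rw [hgh p hp, add_smul], Finset.sum_add_distrib,
      Finset.Nat.sum_antidiagonal_succ (f := fun p ↦ g p.1 p.2 • (a ^ p.1 * b ^ p.2)),
      Finset.Nat.sum_antidiagonal_succ' (f := fun p ↦ h p.1 p.2 • (a ^ p.1 * b ^ p.2)),
      pow_succ', ih, add_mul, Finset.mul_sum, Finset.mul_sum]
    simp only [g, h, zero_smul, zero_add]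
    congr 1
    · exact Finset.sum_congr rfl fun p _ ↦ by rw [mul_smul_comm, pow_succ', mul_assoc]
    · exact Finset.sum_congr rfl fun p _ ↦ by
        rw [mul_smul_comm, ← mul_assoc, hb, smul_mul_assoc, mul_assoc, ← pow_succ', smul_smul,
          mul_comm]

theorem add_pow_of_isPrimitiveRoot {R A : Type*} [CommRing R] [IsDomain R] [Ring A] [Algebra R A]
    {q : R} {n : ℕ} (hn : 0 < n) (hq : IsPrimitiveRoot q n) (a b : A)
    (hab : b * a = q • (a * b)) : (a + b) ^ n = a ^ n + b ^ n := by
  have h0 : ∀ i j, i + j = n → 0 < i → 0 < j → qBinom q i j = 0 := by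
    intro i j hij hi hj
    have h := qBinom_mul q i j
    have hne : ∀ m, m < n → ∏ s ∈ Finset.range m, (1 - q ^ (s + 1)) ≠ 0 := by
      intro m hm
      rw [Finset.prod_ne_zero_iff]
      intro s hs
      rw [Finset.mem_range] at hs
      exact sub_ne_zero.2 (hq.pow_ne_one_of_pos_of_lt (by omega) (by omega)).symm
    have hz : ∏ s ∈ Finset.range (i + j), (1 - q ^ (s + 1)) = 0 := by
      refine Finset.prod_eq_zero (i := n - 1) (Finset.mem_range.2 (by omega)) ?_
      rw [Nat.sub_add_cancel hn, hq.pow_eq_one, sub_self]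
    rw [hz] at h
    simpa [hne i (by omega), hne j (by omega)] using h
  rw [add_pow_of_mul_eq_smul q a b hab]
  obtain ⟨m, rfl⟩ : ∃ m, n = m + 1 := ⟨n - 1, by omega⟩
  rw [Finset.Nat.sum_antidiagonal_succ]
  simp only [qBinom, pow_zero, one_mul, one_smul]
  rw [add_comm]
  congr 1
  cases m with
  | zero => simp [qBinom]
  | succ m =>
    rw [Finset.Nat.sum_antidiagonal_succ' (f := fun p : ℕ × ℕ ↦
      qBinom q (p.1 + 1) p.2 • (a ^ (p.1 + 1) * b ^ p.2)), Finset.sum_eq_zero, add_zero]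
    · simp [qBinom]
    · rintro ⟨i, j⟩ hp
      rw [Finset.HasAntidiagonal.mem_antidiagonal] at hp
      simp only at hp ⊢
      rw [h0 _ _ (by omega) (by omega) (by omega), zero_smul]

section Presented

open Coalgebra

theorem adjoin_range_mkAlgHom {R X : Type*} [CommRing R]
    (r : FreeAlgebra R X → FreeAlgebra R X → Prop) :
    Algebra.adjoin R (Set.range fun x ↦ RingQuot.mkAlgHom R r (FreeAlgebra.ι R x)) = ⊤ := by
  have h : Set.range (fun x ↦ RingQuot.mkAlgHom R r (FreeAlgebra.ι R x))
      = RingQuot.mkAlgHom R r '' Set.range (FreeAlgebra.ι R) := by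
    rw [← Set.range_comp]; rfl
  rw [h, ← AlgHom.map_adjoin, FreeAlgebra.adjoin_range_ι, Algebra.map_top]
  exact AlgHom.range_eq_top _ |>.2 (RingQuot.mkAlgHom_surjective R r)

theorem submodule_eq_top_of_mul_mem {R A : Type*} [CommRing R] [Ring A] [Algebra R A] {s : Set A}
    (hs : Algebra.adjoin R s = ⊤) (M : Submodule R A) (h1 : (1 : A) ∈ M)
    (h : ∀ x ∈ s, ∀ m ∈ M, x * m ∈ M) : M = ⊤ := by
  rw [eq_top_iff]
  rintro x -
  have hx : x ∈ Algebra.adjoin R s := by rw [hs]; trivial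
  have : ∀ m ∈ M, x * m ∈ M := by
    induction hx using Algebra.adjoin_induction with
    | mem x hx => exact h x hx
    | algebraMap r =>
      intro m hm
      rw [← Algebra.smul_def]
      exact M.smul_mem r hm
    | add x y _ _ hx hy =>
      intro m hm
      rw [add_mul]
      exact M.add_mem (hx m hm) (hy m hm)
    | mul x y _ _ hx hy =>
      intro m hm
      rw [mul_assoc]
      exact hx _ (hy m hm)
  simpa using this 1 h1

/-- An anti-homomorphism which satisfies the antipode axioms on generators is an antipode. -/
noncomputable abbrev HopfAlgebra.ofGenerators {R A : Type*} [CommRing R] [Ring A] [Bialgebra R A]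
    (S : A →ₐ[R] Aᵐᵒᵖ) {s : Set A} (hs : Algebra.adjoin R s = ⊤)
    (hl : ∀ x ∈ s, LinearMap.mul' R A (((MulOpposite.opLinearEquiv R).symm.toLinearMap
      ∘ₗ S.toLinearMap).rTensor A (comul x)) = algebraMap R A (counit x))
    (hr : ∀ x ∈ s, LinearMap.mul' R A (((MulOpposite.opLinearEquiv R).symm.toLinearMap
      ∘ₗ S.toLinearMap).lTensor A (comul x)) = algebraMap R A (counit x)) :
    HopfAlgebra R A where
  antipode := (MulOpposite.opLinearEquiv R).symm.toLinearMap ∘ₗ S.toLinearMap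
  mul_antipode_rTensor_comul := by
    ext x
    have hx : x ∈ Algebra.adjoin R s := by rw [hs]; trivial
    change LinearMap.mul' R A (LinearMap.rTensor A _ (comul x)) = algebraMap R A (counit x)
    induction hx using Algebra.adjoin_induction with
    | mem x hx => exact hl x hx
    | algebraMap r => simp [Algebra.TensorProduct.algebraMap_apply]
    | add x y _ _ hx hy => simp only [map_add, hx, hy]
    | mul x y _ _ hx hy =>
      rw [Bialgebra.comul_mul, Bialgebra.counit_mul, map_mul (algebraMap R A)]
      rw [← (ℛ R x).eq] at hx ⊢
      rw [← (ℛ R y).eq] at hy ⊢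
      simp only [map_sum, LinearMap.rTensor_tmul, LinearMap.mul'_apply, Finset.sum_mul_sum,
        Algebra.TensorProduct.tmul_mul_tmul, LinearMap.comp_apply, LinearEquiv.coe_coe,
        AlgHom.toLinearMap_apply, map_mul S, MulOpposite.coe_opLinearEquiv_symm,
        MulOpposite.unop_mul] at hx hy ⊢
      rw [Finset.sum_comm]
      have : ∀ j, ∑ i ∈ (ℛ R x).index, MulOpposite.unop (S ((ℛ R y).left j))
          * MulOpposite.unop (S ((ℛ R x).left i)) * ((ℛ R x).right i * (ℛ R y).right j)
          = algebraMap R A (counit x)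
            * (MulOpposite.unop (S ((ℛ R y).left j)) * (ℛ R y).right j) := by
        intro j
        rw [← mul_assoc, Algebra.commutes, mul_assoc, ← hx, Finset.sum_mul, Finset.mul_sum]
        exact Finset.sum_congr rfl fun i _ ↦ by simp only [mul_assoc]
      simp only [this]
      rw [← Finset.mul_sum, hy]
  mul_antipode_lTensor_comul := by
    ext x
    have hx : x ∈ Algebra.adjoin R s := by rw [hs]; trivial
    change LinearMap.mul' R A (LinearMap.lTensor A _ (comul x)) = algebraMap R A (counit x)
    induction hx using Algebra.adjoin_induction with
    | mem x hx => exact hr x hx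
    | algebraMap r => simp [Algebra.TensorProduct.algebraMap_apply]
    | add x y _ _ hx hy => simp only [map_add, hx, hy]
    | mul x y _ _ hx hy =>
      rw [Bialgebra.comul_mul, Bialgebra.counit_mul, map_mul (algebraMap R A)]
      rw [← (ℛ R x).eq] at hx ⊢
      rw [← (ℛ R y).eq] at hy ⊢
      simp only [map_sum, LinearMap.lTensor_tmul, LinearMap.mul'_apply, Finset.sum_mul_sum,
        Algebra.TensorProduct.tmul_mul_tmul, LinearMap.comp_apply, LinearEquiv.coe_coe,
        AlgHom.toLinearMap_apply, map_mul S, MulOpposite.coe_opLinearEquiv_symm,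
        MulOpposite.unop_mul] at hx hy ⊢
      have : ∀ i, ∑ j ∈ (ℛ R y).index, (ℛ R x).left i * (ℛ R y).left j
          * (MulOpposite.unop (S ((ℛ R y).right j)) * MulOpposite.unop (S ((ℛ R x).right i)))
          = ((ℛ R x).left i * MulOpposite.unop (S ((ℛ R x).right i)))
            * algebraMap R A (counit y) := by
        intro i
        rw [mul_assoc, ← Algebra.commutes, ← hy, Finset.sum_mul, Finset.mul_sum]
        exact Finset.sum_congr rfl fun i _ ↦ by simp only [mul_assoc]
      simp only [this]
      rw [← Finset.sum_mul, hx]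

end Presented

/-- Generators of the SmallBorel subalgebra. -/
inductive SmallBorelGen : Type
  | e : SmallBorelGen
  | k : SmallBorelGen

/-- The relations `k ^ ℓ = 1`, `e ^ ℓ = 0` and `k e = ζ e k`. -/
inductive SmallBorelRel (R : Type*) [CommRing R] (ζ : R) (ℓ : ℕ) :
    FreeAlgebra R SmallBorelGen → FreeAlgebra R SmallBorelGen → Prop
  | k_pow : SmallBorelRel R ζ ℓ (FreeAlgebra.ι R SmallBorelGen.k ^ ℓ) 1
  | e_pow : SmallBorelRel R ζ ℓ (FreeAlgebra.ι R SmallBorelGen.e ^ ℓ) 0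
  | k_mul_e : SmallBorelRel R ζ ℓ (FreeAlgebra.ι R SmallBorelGen.k * FreeAlgebra.ι R SmallBorelGen.e)
      (ζ • (FreeAlgebra.ι R SmallBorelGen.e * FreeAlgebra.ι R SmallBorelGen.k))

/-- The algebra `B_ζ(sl₂)` over `R`. -/
def SmallBorel (R : Type*) [CommRing R] (ζ : R) (ℓ : ℕ) : Type _ := RingQuot (SmallBorelRel R ζ ℓ)

theorem exists_mul_pow_eq_smul {R A : Type*} [CommRing R] [Ring A] [Algebra R A] {q : R} {x y : A}
    (h : y * x = q • (x * y)) (n : ℕ) : ∃ c : R, (x * y) ^ n = c • (x ^ n * y ^ n) := by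
  have hx : ∀ i : ℕ, y * x ^ i = q ^ i • (x ^ i * y) := by
    intro i
    induction i with
    | zero => simp
    | succ i ih =>
      rw [pow_succ, ← mul_assoc, ih, smul_mul_assoc, mul_assoc, h, mul_smul_comm, smul_smul,
        mul_assoc, pow_succ]
  induction n with
  | zero => exact ⟨1, by simp⟩
  | succ n ih =>
    obtain ⟨c, hc⟩ := ih
    refine ⟨q ^ n * c, ?_⟩
    rw [pow_succ', hc, mul_smul_comm, mul_assoc, ← mul_assoc y, hx, smul_mul_assoc, mul_smul_comm,
      smul_smul, pow_succ', pow_succ', mul_comm c]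
    simp only [mul_assoc]

namespace SmallBorel

open Coalgebra HopfAlgebra

section Alg

variable {R : Type*} [CommRing R] {ζ : R} {ℓ : ℕ}

instance : Ring (SmallBorel R ζ ℓ) := inferInstanceAs (Ring (RingQuot (SmallBorelRel R ζ ℓ)))

instance : Algebra R (SmallBorel R ζ ℓ) := inferInstanceAs (Algebra R (RingQuot (SmallBorelRel R ζ ℓ)))

variable (R ζ ℓ) in
/-- The generator `e`. -/
def e : SmallBorel R ζ ℓ := RingQuot.mkAlgHom R (SmallBorelRel R ζ ℓ) (FreeAlgebra.ι R SmallBorelGen.e)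

variable (R ζ ℓ) in
/-- The generator `k`. -/
def k : SmallBorel R ζ ℓ := RingQuot.mkAlgHom R (SmallBorelRel R ζ ℓ) (FreeAlgebra.ι R SmallBorelGen.k)

theorem k_pow : k R ζ ℓ ^ ℓ = 1 := by
  have := RingQuot.mkAlgHom_rel R (SmallBorelRel.k_pow (R := R) (ζ := ζ) (ℓ := ℓ))
  rwa [map_pow, map_one] at this

theorem e_pow : e R ζ ℓ ^ ℓ = 0 := by
  have := RingQuot.mkAlgHom_rel R (SmallBorelRel.e_pow (R := R) (ζ := ζ) (ℓ := ℓ))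
  rwa [map_pow, map_zero] at this

theorem k_mul_e : k R ζ ℓ * e R ζ ℓ = ζ • (e R ζ ℓ * k R ζ ℓ) := by
  have := RingQuot.mkAlgHom_rel R (SmallBorelRel.k_mul_e (R := R) (ζ := ζ) (ℓ := ℓ))
  rwa [map_mul, map_smul, map_mul] at this

theorem adjoin_eq_top : Algebra.adjoin R {e R ζ ℓ, k R ζ ℓ} = ⊤ := by
  refine Eq.trans (congrArg _ ?_) (adjoin_range_mkAlgHom (SmallBorelRel R ζ ℓ))
  ext x
  constructor
  · rintro (rfl | rfl)
    · exact ⟨SmallBorelGen.e, rfl⟩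
    · exact ⟨SmallBorelGen.k, rfl⟩
  · rintro ⟨_ | _, rfl⟩
    · exact Or.inl rfl
    · exact Or.inr rfl

variable (R ζ ℓ) in
/-- The universal property of the presentation. -/
def lift {A : Type*} [Ring A] [Algebra R A] (x y : A) (hy : y ^ ℓ = 1) (hx : x ^ ℓ = 0)
    (hyx : y * x = ζ • (x * y)) : SmallBorel R ζ ℓ →ₐ[R] A :=
  RingQuot.liftAlgHom R ⟨FreeAlgebra.lift R fun
    | SmallBorelGen.e => x
    | SmallBorelGen.k => y, by rintro _ _ (_ | _ | _) <;> simp [hy, hx, hyx]⟩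

@[simp] theorem lift_e {A : Type*} [Ring A] [Algebra R A] (x y : A) (hy : y ^ ℓ = 1)
    (hx : x ^ ℓ = 0) (hyx : y * x = ζ • (x * y)) : lift R ζ ℓ x y hy hx hyx (e R ζ ℓ) = x := by
  exact (RingQuot.liftAlgHom_mkAlgHom_apply ..).trans (FreeAlgebra.lift_ι_apply ..)

@[simp] theorem lift_k {A : Type*} [Ring A] [Algebra R A] (x y : A) (hy : y ^ ℓ = 1)
    (hx : x ^ ℓ = 0) (hyx : y * x = ζ • (x * y)) : lift R ζ ℓ x y hy hx hyx (k R ζ ℓ) = y := by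
  exact (RingQuot.liftAlgHom_mkAlgHom_apply ..).trans (FreeAlgebra.lift_ι_apply ..)

theorem algHom_ext {A : Type*} [Ring A] [Algebra R A] {f g : SmallBorel R ζ ℓ →ₐ[R] A}
    (he : f (e R ζ ℓ) = g (e R ζ ℓ)) (hk : f (k R ζ ℓ) = g (k R ζ ℓ)) : f = g := by
  refine AlgHom.ext_of_adjoin_eq_top adjoin_eq_top ?_
  rintro x (rfl | rfl)
  · exact he
  · exact hk

variable [NeZero ℓ]

theorem k_mul_k_pow_sub_one : k R ζ ℓ * k R ζ ℓ ^ (ℓ - 1) = 1 := by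
  rw [← pow_succ', Nat.sub_add_cancel (Nat.pos_of_ne_zero (NeZero.ne ℓ)), k_pow]

theorem k_pow_sub_one_mul_k : k R ζ ℓ ^ (ℓ - 1) * k R ζ ℓ = 1 := by
  rw [← pow_succ, Nat.sub_add_cancel (Nat.pos_of_ne_zero (NeZero.ne ℓ)), k_pow]

theorem e_mul_k_inv :
    e R ζ ℓ * k R ζ ℓ ^ (ℓ - 1) = ζ • (k R ζ ℓ ^ (ℓ - 1) * e R ζ ℓ) := by
  have h : k R ζ ℓ ^ (ℓ - 1) * (k R ζ ℓ * e R ζ ℓ) * k R ζ ℓ ^ (ℓ - 1)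
      = k R ζ ℓ ^ (ℓ - 1) * (ζ • (e R ζ ℓ * k R ζ ℓ)) * k R ζ ℓ ^ (ℓ - 1) := by rw [k_mul_e]
  rw [← mul_assoc, k_pow_sub_one_mul_k, one_mul] at h
  rw [h, mul_smul_comm, smul_mul_assoc, mul_assoc, mul_assoc, k_mul_k_pow_sub_one, mul_one]

end Alg

section Hopf

variable {R : Type*} [CommRing R] [IsDomain R] {ζ : R} {ℓ : ℕ}
  [Fact (Odd ℓ)] [Fact (IsPrimitiveRoot ζ ℓ)]

theorem neZero (ℓ : ℕ) [h : Fact (Odd ℓ)] : NeZero ℓ := ⟨h.out.pos.ne'⟩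

theorem isPrimitiveRoot_sq : IsPrimitiveRoot (ζ ^ 2) ℓ :=
  (Fact.out : IsPrimitiveRoot ζ ℓ).pow_of_coprime 2
    (Nat.coprime_two_left.2 (Fact.out : Odd ℓ))

variable (R ζ ℓ) in
/-- The coproduct, `Δ(e) = e ⊗ 1 + k² ⊗ e` and `Δ(k) = k ⊗ k`. -/
noncomputable def comulHom : SmallBorel R ζ ℓ →ₐ[R] SmallBorel R ζ ℓ ⊗[R] SmallBorel R ζ ℓ :=
  lift R ζ ℓ (e R ζ ℓ ⊗ₜ 1 + (k R ζ ℓ ^ 2) ⊗ₜ e R ζ ℓ) (k R ζ ℓ ⊗ₜ k R ζ ℓ)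
    (by rw [Algebra.TensorProduct.tmul_pow, k_pow, Algebra.TensorProduct.one_def])
    (by
      rw [add_pow_of_isPrimitiveRoot (q := ζ ^ 2) (Fact.out : Odd ℓ).pos isPrimitiveRoot_sq,
        Algebra.TensorProduct.tmul_pow, Algebra.TensorProduct.tmul_pow, e_pow,
        TensorProduct.zero_tmul, TensorProduct.tmul_zero, add_zero]
      simp only [Algebra.TensorProduct.tmul_mul_tmul, mul_one, one_mul, pow_two,
        TensorProduct.smul_tmul']
      congr 1
      rw [mul_assoc, k_mul_e, mul_smul_comm, ← mul_assoc, k_mul_e, smul_mul_assoc, smul_smul,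
        mul_assoc])
    (by
      rw [mul_add, add_mul, smul_add]
      simp only [Algebra.TensorProduct.tmul_mul_tmul, mul_one, one_mul, k_mul_e,
        TensorProduct.smul_tmul', TensorProduct.tmul_smul, pow_two, mul_assoc])

variable (R ζ ℓ) in
/-- The counit, `ε(e) = 0` and `ε(k) = 1`. -/
noncomputable def counitHom : SmallBorel R ζ ℓ →ₐ[R] R :=
  lift R ζ ℓ 0 1 (one_pow _) (zero_pow (Fact.out : Odd ℓ).pos.ne') (by simp)

noncomputable instance : Bialgebra R (SmallBorel R ζ ℓ) :=
  Bialgebra.ofAlgHom (comulHom R ζ ℓ) (counitHom R ζ ℓ)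
    (by
      apply algHom_ext
      · simp [comulHom, TensorProduct.add_tmul, TensorProduct.tmul_add, add_assoc,
          Algebra.TensorProduct.one_def, Algebra.TensorProduct.tmul_pow]
      · simp [comulHom])
    (by
      apply algHom_ext
      · simp [comulHom, counitHom]
      · simp [comulHom, counitHom])
    (by
      apply algHom_ext
      · simp [comulHom, counitHom]
      · simp [comulHom, counitHom])

@[simp] theorem comul_e :
    comul (R := R) (e R ζ ℓ) = e R ζ ℓ ⊗ₜ 1 + (k R ζ ℓ ^ 2) ⊗ₜ e R ζ ℓ := lift_e ..

@[simp] theorem comul_k : comul (R := R) (k R ζ ℓ) = k R ζ ℓ ⊗ₜ k R ζ ℓ := lift_k ..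

@[simp] theorem counit_e : counit (R := R) (e R ζ ℓ) = 0 := lift_e ..

@[simp] theorem counit_k : counit (R := R) (k R ζ ℓ) = 1 := lift_k ..

theorem neg_inv_sq_mul_e_pow : (-((k R ζ ℓ ^ (ℓ - 1)) ^ 2 * e R ζ ℓ)) ^ ℓ = 0 := by
  have := neZero ℓ
  have h : e R ζ ℓ * (k R ζ ℓ ^ (ℓ - 1)) ^ 2
      = (ζ * ζ) • ((k R ζ ℓ ^ (ℓ - 1)) ^ 2 * e R ζ ℓ) := by
    rw [pow_two, ← mul_assoc, e_mul_k_inv, smul_mul_assoc, mul_assoc, e_mul_k_inv, mul_smul_comm,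
      smul_smul, mul_assoc]
  obtain ⟨c, hc⟩ := exists_mul_pow_eq_smul h ℓ
  rw [neg_pow, hc, e_pow, mul_zero, smul_zero, mul_zero]

variable (R ζ ℓ) in
/-- The antipode as an anti-homomorphism, `S(e) = - k⁻² e` and `S(k) = k⁻¹`. -/
noncomputable def antipodeHom : SmallBorel R ζ ℓ →ₐ[R] (SmallBorel R ζ ℓ)ᵐᵒᵖ :=
  lift R ζ ℓ (MulOpposite.op (-((k R ζ ℓ ^ (ℓ - 1)) ^ 2 * e R ζ ℓ)))
    (MulOpposite.op (k R ζ ℓ ^ (ℓ - 1)))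
    (by rw [← MulOpposite.op_pow, pow_right_comm, k_pow, one_pow, MulOpposite.op_one])
    (by rw [← MulOpposite.op_pow, neg_inv_sq_mul_e_pow, MulOpposite.op_zero])
    (by
      have := neZero ℓ
      rw [← MulOpposite.op_mul, ← MulOpposite.op_mul, ← MulOpposite.op_smul]
      congr 1
      rw [neg_mul, mul_neg, smul_neg, mul_assoc, e_mul_k_inv, mul_smul_comm, ← mul_assoc,
        ← mul_assoc, ← pow_succ, ← pow_succ'])

theorem k_sq_mul_inv_sq : k R ζ ℓ ^ 2 * (k R ζ ℓ ^ (ℓ - 1)) ^ 2 = 1 := by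
  have := neZero ℓ
  rw [← (Commute.pow_self _ _).symm.mul_pow, k_mul_k_pow_sub_one, one_pow]

theorem k_inv_sq_mul_sq : (k R ζ ℓ ^ (ℓ - 1)) ^ 2 * k R ζ ℓ ^ 2 = 1 := by
  have := neZero ℓ
  rw [← (Commute.pow_self _ _).mul_pow, k_pow_sub_one_mul_k, one_pow]

noncomputable instance : HopfAlgebra R (SmallBorel R ζ ℓ) :=
  HopfAlgebra.ofGenerators (antipodeHom R ζ ℓ) adjoin_eq_top
    (by
      have := neZero ℓ
      rintro x (rfl | rfl)
      · simp [antipodeHom]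
      · simp [antipodeHom, k_pow_sub_one_mul_k])
    (by
      have := neZero ℓ
      rintro x (rfl | rfl)
      · simp [antipodeHom, ← mul_assoc, k_sq_mul_inv_sq]
      · simp [antipodeHom, k_mul_k_pow_sub_one])

theorem antipode_e :
    antipode R (e R ζ ℓ) = -((k R ζ ℓ ^ (ℓ - 1)) ^ 2 * e R ζ ℓ) :=
  congrArg MulOpposite.unop (lift_e ..)

theorem antipode_k : antipode R (k R ζ ℓ) = k R ζ ℓ ^ (ℓ - 1) :=
  congrArg MulOpposite.unop (lift_k ..)

theorem antipode_k_pow (n : ℕ) : antipode R (k R ζ ℓ ^ n) = (k R ζ ℓ ^ (ℓ - 1)) ^ n := by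
  induction n with
  | zero => simp
  | succ n ih => rw [pow_succ, antipode_mul_antidistrib, ih, antipode_k, pow_succ']

theorem antipode_antipode (x : SmallBorel R ζ ℓ) :
    antipode R (antipode R x) = (k R ζ ℓ ^ (ℓ - 1)) ^ 2 * x * k R ζ ℓ ^ 2 := by
  have hkk : antipode R (k R ζ ℓ ^ (ℓ - 1)) = k R ζ ℓ := by
    have := neZero ℓ
    have h := congrArg (antipode R) (k_mul_k_pow_sub_one (R := R) (ζ := ζ) (ℓ := ℓ))
    rw [antipode_mul_antidistrib, antipode_k, antipode_one] at h
    calc _ = antipode R (k R ζ ℓ ^ (ℓ - 1)) * (k R ζ ℓ ^ (ℓ - 1) * k R ζ ℓ) := by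
          rw [k_pow_sub_one_mul_k, mul_one]
      _ = _ := by rw [← mul_assoc, h, one_mul]
  have hx : x ∈ Algebra.adjoin R {e R ζ ℓ, k R ζ ℓ} := by rw [adjoin_eq_top]; trivial
  induction hx using Algebra.adjoin_induction with
  | mem x hx =>
    rcases hx with rfl | rfl
    · rw [antipode_e, map_neg, antipode_mul_antidistrib, antipode_e, pow_two,
        antipode_mul_antidistrib, hkk, neg_mul, neg_neg, pow_two]
    · have := neZero ℓ
      rw [antipode_k, hkk, mul_assoc, ← pow_succ', pow_succ (k R ζ ℓ) 2, ← mul_assoc, k_inv_sq_mul_sq,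
        one_mul]
  | algebraMap r =>
    rw [Algebra.algebraMap_eq_smul_one, map_smul, map_smul, antipode_one, antipode_one,
      mul_smul_comm, smul_mul_assoc, mul_one, k_inv_sq_mul_sq]
  | add x y _ _ hx hy => simp only [map_add, hx, hy, mul_add, add_mul]
  | mul x y _ _ hx hy =>
    rw [antipode_mul_antidistrib, antipode_mul_antidistrib, hx, hy]
    have : ∀ a b c d f g : SmallBorel R ζ ℓ, a * b * c * (d * f * g) = a * b * (c * d) * f * g := by
      intros; simp only [mul_assoc]
    rw [this, k_sq_mul_inv_sq, mul_one, mul_assoc _ x y]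

instance : HasBijectiveAntipode R (SmallBorel R ζ ℓ) where
  bijective := by
    have hb : Function.Bijective (antipode R ∘ antipode R : SmallBorel R ζ ℓ → _) := by
      refine Function.bijective_iff_has_inverse.2
        ⟨fun x ↦ k R ζ ℓ ^ 2 * x * (k R ζ ℓ ^ (ℓ - 1)) ^ 2, fun x ↦ ?_, fun x ↦ ?_⟩
      · simp only [Function.comp_apply, antipode_antipode]
        rw [mul_assoc, mul_assoc, k_sq_mul_inv_sq, mul_one, ← mul_assoc, k_sq_mul_inv_sq, one_mul]
      · simp only [Function.comp_apply, antipode_antipode]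
        rw [mul_assoc, mul_assoc, mul_assoc, k_inv_sq_mul_sq, mul_one, ← mul_assoc,
          k_inv_sq_mul_sq, one_mul]
    exact ⟨hb.1.of_comp, hb.2.of_comp⟩

end Hopf

section Basis

variable {R : Type*} [CommRing R] {ζ : R} {ℓ : ℕ}

theorem k_mul_e_pow (i : ℕ) : k R ζ ℓ * e R ζ ℓ ^ i = ζ ^ i • (e R ζ ℓ ^ i * k R ζ ℓ) := by
  induction i with
  | zero => simp
  | succ i ih =>
    rw [pow_succ, ← mul_assoc, ih, smul_mul_assoc, mul_assoc, k_mul_e, mul_smul_comm, smul_smul,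
      mul_assoc, pow_succ]

variable (R ζ ℓ) in
/-- The monomials `e ^ i k ^ j`, `0 ≤ i, j < ℓ`. -/
def monomial (p : Fin ℓ × Fin ℓ) : SmallBorel R ζ ℓ := e R ζ ℓ ^ (p.1 : ℕ) * k R ζ ℓ ^ (p.2 : ℕ)

theorem span_monomial [NeZero ℓ] : Submodule.span R (Set.range (monomial R ζ ℓ)) = ⊤ := by
  have hl : 0 < ℓ := Nat.pos_of_ne_zero (NeZero.ne ℓ)
  have h : ∀ i j : ℕ, e R ζ ℓ ^ i * k R ζ ℓ ^ j ∈ Submodule.span R (Set.range (monomial R ζ ℓ)) := by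
    intro i j
    by_cases hi : i < ℓ
    · have hk : k R ζ ℓ ^ j = k R ζ ℓ ^ (j % ℓ) := by
        conv_lhs => rw [← Nat.div_add_mod j ℓ, pow_add, pow_mul, k_pow, one_pow, one_mul]
      rw [hk]
      exact Submodule.subset_span ⟨(⟨i, hi⟩, ⟨j % ℓ, Nat.mod_lt _ hl⟩), rfl⟩
    · have : e R ζ ℓ ^ i = 0 := by
        rw [← Nat.sub_add_cancel (not_lt.1 hi), pow_add, e_pow, mul_zero]
      rw [this, zero_mul]
      exact Submodule.zero_mem _
  refine submodule_eq_top_of_mul_mem adjoin_eq_top _ ?_ ?_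
  · simpa using h 0 0
  · intro x hx m hm
    induction hm using Submodule.span_induction with
    | mem m hm =>
      obtain ⟨p, rfl⟩ := hm
      rcases hx with rfl | rfl
      · rw [monomial, ← mul_assoc, ← pow_succ']
        exact h _ _
      · rw [monomial, ← mul_assoc, k_mul_e_pow, smul_mul_assoc, mul_assoc, ← pow_succ']
        exact Submodule.smul_mem _ _ (h _ _)
    | zero => simp
    | add a b _ _ ha hb =>
      rw [mul_add]
      exact Submodule.add_mem _ ha hb
    | smul c a _ ha =>
      rw [mul_smul_comm]
      exact Submodule.smul_mem _ _ ha

variable (R ℓ) in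
/-- The operator of `e` on the space with basis `e ^ i k ^ j`. -/
def repE : Module.End R (Fin ℓ × ZMod ℓ → R) where
  toFun f p := if h : 0 < (p.1 : ℕ) then f (⟨p.1 - 1, by omega⟩, p.2) else 0
  map_add' f g := by ext p; by_cases h : 0 < (p.1 : ℕ) <;> simp [h]
  map_smul' c f := by ext p; by_cases h : 0 < (p.1 : ℕ) <;> simp [h]

variable (R ζ ℓ) in
/-- The operator of `k` on the space with basis `e ^ i k ^ j`. -/
def repK : Module.End R (Fin ℓ × ZMod ℓ → R) where
  toFun f p := ζ ^ (p.1 : ℕ) * f (p.1, p.2 - 1)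
  map_add' f g := by ext p; simp [mul_add]
  map_smul' c f := by ext p; simp [mul_left_comm]

theorem repE_pow_apply (n : ℕ) (f : Fin ℓ × ZMod ℓ → R) (p : Fin ℓ × ZMod ℓ) :
    (repE R ℓ ^ n) f p = if h : n ≤ (p.1 : ℕ) then f (⟨p.1 - n, by omega⟩, p.2) else 0 := by
  induction n generalizing p with
  | zero => simp
  | succ n ih =>
    rw [pow_succ', Module.End.mul_apply]
    by_cases h : 0 < (p.1 : ℕ)
    · have h1 : repE R ℓ ((repE R ℓ ^ n) f) p = ((repE R ℓ ^ n) f) (⟨p.1 - 1, by omega⟩, p.2) :=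
        dif_pos h
      rw [h1, ih]
      by_cases h2 : n + 1 ≤ (p.1 : ℕ)
      · rw [dif_pos h2, dif_pos (by simp only; omega)]
        simp only [Nat.sub_sub, add_comm 1 n]
      · rw [dif_neg h2, dif_neg (by simp only; omega)]
    · have h1 : repE R ℓ ((repE R ℓ ^ n) f) p = 0 := dif_neg h
      rw [h1, dif_neg (by omega)]

theorem repK_pow_apply (n : ℕ) (f : Fin ℓ × ZMod ℓ → R) (p : Fin ℓ × ZMod ℓ) :
    (repK R ζ ℓ ^ n) f p = ζ ^ (p.1 * n : ℕ) * f (p.1, p.2 - n) := by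
  induction n generalizing p with
  | zero => simp
  | succ n ih =>
    rw [pow_succ', Module.End.mul_apply]
    change ζ ^ (p.1 : ℕ) * ((repK R ζ ℓ ^ n) f) (p.1, p.2 - 1) = _
    rw [ih, mul_add, mul_one, pow_add]
    push_cast
    rw [sub_sub, add_comm (1 : ZMod ℓ)]
    ring

section

variable [Fact (IsPrimitiveRoot ζ ℓ)]

variable (R ζ ℓ) in
/-- The regular representation in the monomial basis. -/
def rep : SmallBorel R ζ ℓ →ₐ[R] Module.End R (Fin ℓ × ZMod ℓ → R) :=
  lift R ζ ℓ (repE R ℓ) (repK R ζ ℓ)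
    (by
      refine LinearMap.ext fun f ↦ funext fun p ↦ ?_
      rw [repK_pow_apply, mul_comm (p.1 : ℕ), pow_mul, (Fact.out : IsPrimitiveRoot ζ ℓ).pow_eq_one]
      simp)
    (by
      refine LinearMap.ext fun f ↦ funext fun p ↦ ?_
      rw [repE_pow_apply, dif_neg (by omega)]
      rfl)
    (by
      refine LinearMap.ext fun f ↦ funext fun p ↦ ?_
      simp only [Module.End.mul_apply, LinearMap.smul_apply, Pi.smul_apply, repE, repK,
        LinearMap.coe_mk, AddHom.coe_mk, smul_eq_mul]
      by_cases h : 0 < (p.1 : ℕ)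
      · rw [dif_pos h, dif_pos h, ← mul_assoc, ← pow_succ', Nat.sub_add_cancel h]
      · rw [dif_neg h, dif_neg h, mul_zero, mul_zero])

theorem linearIndependent_monomial [NeZero ℓ] : LinearIndependent R (monomial R ζ ℓ) := by
  have h0 : ∀ p : Fin ℓ × Fin ℓ, rep R ζ ℓ (monomial R ζ ℓ p) (Pi.single (0, 0) 1)
      = Pi.single (p.1, ((p.2 : ℕ) : ZMod ℓ)) 1 := by
    intro p
    have hr : rep R ζ ℓ (monomial R ζ ℓ p) = repE R ℓ ^ (p.1 : ℕ) * repK R ζ ℓ ^ (p.2 : ℕ) := by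
      rw [monomial, map_mul, map_pow, map_pow, rep, lift_e, lift_k]
    rw [hr, Module.End.mul_apply]
    funext q
    rw [repE_pow_apply]
    by_cases h : (p.1 : ℕ) ≤ q.1
    · rw [dif_pos h, repK_pow_apply]
      simp only [Pi.single_apply, Prod.ext_iff, Fin.ext_iff, Fin.val_zero, sub_eq_zero]
      by_cases h2 : (q.1 : ℕ) = p.1
      · simp [h2]
      · have : ¬ ((q.1 : ℕ) - p.1 = 0) := by omega
        simp [h2, this]
    · rw [dif_neg h, Pi.single_eq_of_ne]
      rintro rfl
      exact h le_rfl
  refine LinearIndependent.of_comp ((rep R ζ ℓ).toLinearMap.flip (Pi.single (0, 0) 1)) ?_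
  have h1 : ((rep R ζ ℓ).toLinearMap.flip (Pi.single (0, 0) 1)) ∘ monomial R ζ ℓ
      = (Pi.basisFun R (Fin ℓ × ZMod ℓ))
        ∘ fun p : Fin ℓ × Fin ℓ ↦ (p.1, ((p.2 : ℕ) : ZMod ℓ)) := by
    funext p
    simp only [Function.comp_apply, Pi.basisFun_apply]
    exact h0 p
  rw [h1]
  refine (Pi.basisFun R (Fin ℓ × ZMod ℓ)).linearIndependent.comp _ ?_
  rintro ⟨a, b⟩ ⟨c, d⟩ h
  simp only [Prod.mk.injEq] at h
  refine Prod.ext h.1 (Fin.ext ?_)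
  have := (ZMod.natCast_eq_natCast_iff' _ _ _).1 h.2
  rwa [Nat.mod_eq_of_lt b.2, Nat.mod_eq_of_lt d.2] at this

variable (R ζ ℓ) in
/-- The basis `e ^ i k ^ j`, `0 ≤ i, j < ℓ`. -/
noncomputable def basis [NeZero ℓ] : Module.Basis (Fin ℓ × Fin ℓ) R (SmallBorel R ζ ℓ) :=
  Module.Basis.mk (linearIndependent_monomial (R := R) (ζ := ζ) (ℓ := ℓ)) span_monomial.ge

end

variable [Fact (Odd ℓ)] [Fact (IsPrimitiveRoot ζ ℓ)]

instance : Module.Free R (SmallBorel R ζ ℓ) :=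
  have := neZero ℓ
  Module.Free.of_basis (basis R ζ ℓ)

instance : Module.Finite R (SmallBorel R ζ ℓ) :=
  have := neZero ℓ
  Module.Finite.of_basis (basis R ζ ℓ)

end Basis

end SmallBorel

/-- Generators of the small quantum group of `sl₂`. -/
inductive SmallQuantumGen : Type
  | E : SmallQuantumGen
  | F : SmallQuantumGen
  | K : SmallQuantumGen

/-- The relations `K ^ ℓ = 1`, `E ^ ℓ = F ^ ℓ = 0`, `K E = ζ² E K`, `K F = ζ⁻² F K` and
`E F - F E = (K - K⁻¹) / (ζ - ζ⁻¹)`, where `K⁻¹ = K ^ (ℓ - 1)`. -/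
inductive SmallQuantumRel (𝕜 : Type*) [Field 𝕜] (ζ : 𝕜) (ℓ : ℕ) :
    FreeAlgebra 𝕜 SmallQuantumGen → FreeAlgebra 𝕜 SmallQuantumGen → Prop
  | K_pow : SmallQuantumRel 𝕜 ζ ℓ (FreeAlgebra.ι 𝕜 SmallQuantumGen.K ^ ℓ) 1
  | E_pow : SmallQuantumRel 𝕜 ζ ℓ (FreeAlgebra.ι 𝕜 SmallQuantumGen.E ^ ℓ) 0
  | F_pow : SmallQuantumRel 𝕜 ζ ℓ (FreeAlgebra.ι 𝕜 SmallQuantumGen.F ^ ℓ) 0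
  | K_mul_E : SmallQuantumRel 𝕜 ζ ℓ
      (FreeAlgebra.ι 𝕜 SmallQuantumGen.K * FreeAlgebra.ι 𝕜 SmallQuantumGen.E)
      (ζ ^ 2 • (FreeAlgebra.ι 𝕜 SmallQuantumGen.E * FreeAlgebra.ι 𝕜 SmallQuantumGen.K))
  | K_mul_F : SmallQuantumRel 𝕜 ζ ℓ
      (FreeAlgebra.ι 𝕜 SmallQuantumGen.K * FreeAlgebra.ι 𝕜 SmallQuantumGen.F)
      (ζ⁻¹ ^ 2 • (FreeAlgebra.ι 𝕜 SmallQuantumGen.F * FreeAlgebra.ι 𝕜 SmallQuantumGen.K))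
  | E_F : SmallQuantumRel 𝕜 ζ ℓ
      (FreeAlgebra.ι 𝕜 SmallQuantumGen.E * FreeAlgebra.ι 𝕜 SmallQuantumGen.F
        - FreeAlgebra.ι 𝕜 SmallQuantumGen.F * FreeAlgebra.ι 𝕜 SmallQuantumGen.E)
      ((ζ - ζ⁻¹)⁻¹ • (FreeAlgebra.ι 𝕜 SmallQuantumGen.K
        - FreeAlgebra.ι 𝕜 SmallQuantumGen.K ^ (ℓ - 1)))

/-- The small quantum group `U_ζ` of `sl₂` over `𝕜`. -/
def SmallQuantumSL2 (𝕜 : Type*) [Field 𝕜] (ζ : 𝕜) (ℓ : ℕ) : Type _ :=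
  RingQuot (SmallQuantumRel 𝕜 ζ ℓ)

namespace SmallQuantumSL2

open Coalgebra HopfAlgebra

section Alg

variable {𝕜 : Type*} [Field 𝕜] {ζ : 𝕜} {ℓ : ℕ}

instance : Ring (SmallQuantumSL2 𝕜 ζ ℓ) :=
  inferInstanceAs (Ring (RingQuot (SmallQuantumRel 𝕜 ζ ℓ)))

instance : Algebra 𝕜 (SmallQuantumSL2 𝕜 ζ ℓ) :=
  inferInstanceAs (Algebra 𝕜 (RingQuot (SmallQuantumRel 𝕜 ζ ℓ)))

variable (𝕜 ζ ℓ) in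
/-- The generator `E`. -/
def E : SmallQuantumSL2 𝕜 ζ ℓ :=
  RingQuot.mkAlgHom 𝕜 (SmallQuantumRel 𝕜 ζ ℓ) (FreeAlgebra.ι 𝕜 SmallQuantumGen.E)

variable (𝕜 ζ ℓ) in
/-- The generator `F`. -/
def F : SmallQuantumSL2 𝕜 ζ ℓ :=
  RingQuot.mkAlgHom 𝕜 (SmallQuantumRel 𝕜 ζ ℓ) (FreeAlgebra.ι 𝕜 SmallQuantumGen.F)

variable (𝕜 ζ ℓ) in
/-- The generator `K`. -/
def K : SmallQuantumSL2 𝕜 ζ ℓ :=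
  RingQuot.mkAlgHom 𝕜 (SmallQuantumRel 𝕜 ζ ℓ) (FreeAlgebra.ι 𝕜 SmallQuantumGen.K)

theorem K_pow : K 𝕜 ζ ℓ ^ ℓ = 1 := by
  have := RingQuot.mkAlgHom_rel 𝕜 (SmallQuantumRel.K_pow (𝕜 := 𝕜) (ζ := ζ) (ℓ := ℓ))
  rwa [map_pow, map_one] at this

theorem E_pow : E 𝕜 ζ ℓ ^ ℓ = 0 := by
  have := RingQuot.mkAlgHom_rel 𝕜 (SmallQuantumRel.E_pow (𝕜 := 𝕜) (ζ := ζ) (ℓ := ℓ))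
  rwa [map_pow, map_zero] at this

theorem F_pow : F 𝕜 ζ ℓ ^ ℓ = 0 := by
  have := RingQuot.mkAlgHom_rel 𝕜 (SmallQuantumRel.F_pow (𝕜 := 𝕜) (ζ := ζ) (ℓ := ℓ))
  rwa [map_pow, map_zero] at this

theorem K_mul_E : K 𝕜 ζ ℓ * E 𝕜 ζ ℓ = ζ ^ 2 • (E 𝕜 ζ ℓ * K 𝕜 ζ ℓ) := by
  have := RingQuot.mkAlgHom_rel 𝕜 (SmallQuantumRel.K_mul_E (𝕜 := 𝕜) (ζ := ζ) (ℓ := ℓ))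
  rwa [map_mul, map_smul, map_mul] at this

theorem K_mul_F : K 𝕜 ζ ℓ * F 𝕜 ζ ℓ = ζ⁻¹ ^ 2 • (F 𝕜 ζ ℓ * K 𝕜 ζ ℓ) := by
  have := RingQuot.mkAlgHom_rel 𝕜 (SmallQuantumRel.K_mul_F (𝕜 := 𝕜) (ζ := ζ) (ℓ := ℓ))
  rwa [map_mul, map_smul, map_mul] at this

theorem E_F : E 𝕜 ζ ℓ * F 𝕜 ζ ℓ - F 𝕜 ζ ℓ * E 𝕜 ζ ℓ
    = (ζ - ζ⁻¹)⁻¹ • (K 𝕜 ζ ℓ - K 𝕜 ζ ℓ ^ (ℓ - 1)) := by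
  have := RingQuot.mkAlgHom_rel 𝕜 (SmallQuantumRel.E_F (𝕜 := 𝕜) (ζ := ζ) (ℓ := ℓ))
  rwa [map_sub, map_mul, map_smul, map_mul, map_sub, map_pow] at this

theorem adjoin_eq_top : Algebra.adjoin 𝕜 {E 𝕜 ζ ℓ, F 𝕜 ζ ℓ, K 𝕜 ζ ℓ} = ⊤ := by
  refine Eq.trans (congrArg _ ?_) (adjoin_range_mkAlgHom (SmallQuantumRel 𝕜 ζ ℓ))
  ext x
  constructor
  · rintro (rfl | rfl | rfl)
    · exact ⟨SmallQuantumGen.E, rfl⟩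
    · exact ⟨SmallQuantumGen.F, rfl⟩
    · exact ⟨SmallQuantumGen.K, rfl⟩
  · rintro ⟨_ | _ | _, rfl⟩
    · exact Or.inl rfl
    · exact Or.inr (Or.inl rfl)
    · exact Or.inr (Or.inr rfl)

variable (𝕜 ζ ℓ) in
/-- The universal property of the presentation. -/
def lift {A : Type*} [Ring A] [Algebra 𝕜 A] (x y z : A) (hz : z ^ ℓ = 1) (hx : x ^ ℓ = 0)
    (hy : y ^ ℓ = 0) (hzx : z * x = ζ ^ 2 • (x * z)) (hzy : z * y = ζ⁻¹ ^ 2 • (y * z))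
    (hxy : x * y - y * x = (ζ - ζ⁻¹)⁻¹ • (z - z ^ (ℓ - 1))) : SmallQuantumSL2 𝕜 ζ ℓ →ₐ[𝕜] A :=
  RingQuot.liftAlgHom 𝕜 ⟨FreeAlgebra.lift 𝕜 fun
    | SmallQuantumGen.E => x
    | SmallQuantumGen.F => y
    | SmallQuantumGen.K => z, by
      rintro _ _ (_ | _ | _ | _ | _ | _)
      · simp [hz]
      · simp [hx]
      · simp [hy]
      · simp only [map_mul, map_smul, FreeAlgebra.lift_ι_apply, hzx]
      · simp only [map_mul, map_smul, FreeAlgebra.lift_ι_apply, hzy]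
      · simp only [map_mul, map_sub, map_smul, map_pow, FreeAlgebra.lift_ι_apply, hxy]⟩

section lift

variable {A : Type*} [Ring A] [Algebra 𝕜 A] (x y z : A) (hz : z ^ ℓ = 1) (hx : x ^ ℓ = 0)
    (hy : y ^ ℓ = 0) (hzx : z * x = ζ ^ 2 • (x * z)) (hzy : z * y = ζ⁻¹ ^ 2 • (y * z))
    (hxy : x * y - y * x = (ζ - ζ⁻¹)⁻¹ • (z - z ^ (ℓ - 1)))

@[simp] theorem lift_E : lift 𝕜 ζ ℓ x y z hz hx hy hzx hzy hxy (E 𝕜 ζ ℓ) = x :=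
  (RingQuot.liftAlgHom_mkAlgHom_apply ..).trans (FreeAlgebra.lift_ι_apply ..)

@[simp] theorem lift_F : lift 𝕜 ζ ℓ x y z hz hx hy hzx hzy hxy (F 𝕜 ζ ℓ) = y :=
  (RingQuot.liftAlgHom_mkAlgHom_apply ..).trans (FreeAlgebra.lift_ι_apply ..)

@[simp] theorem lift_K : lift 𝕜 ζ ℓ x y z hz hx hy hzx hzy hxy (K 𝕜 ζ ℓ) = z :=
  (RingQuot.liftAlgHom_mkAlgHom_apply ..).trans (FreeAlgebra.lift_ι_apply ..)

end lift

theorem algHom_ext {A : Type*} [Ring A] [Algebra 𝕜 A] {f g : SmallQuantumSL2 𝕜 ζ ℓ →ₐ[𝕜] A}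
    (hE : f (E 𝕜 ζ ℓ) = g (E 𝕜 ζ ℓ)) (hF : f (F 𝕜 ζ ℓ) = g (F 𝕜 ζ ℓ))
    (hK : f (K 𝕜 ζ ℓ) = g (K 𝕜 ζ ℓ)) : f = g := by
  refine AlgHom.ext_of_adjoin_eq_top adjoin_eq_top ?_
  rintro x (rfl | rfl | rfl)
  · exact hE
  · exact hF
  · exact hK

end Alg

section Hopf

variable {𝕜 : Type*} [Field 𝕜] {ζ : 𝕜} {ℓ : ℕ} [Fact (Odd ℓ)]

theorem K_mul_K_inv : K 𝕜 ζ ℓ * K 𝕜 ζ ℓ ^ (ℓ - 1) = 1 := by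
  rw [← pow_succ', Nat.sub_add_cancel (Fact.out : Odd ℓ).pos, K_pow]

theorem K_inv_mul_K : K 𝕜 ζ ℓ ^ (ℓ - 1) * K 𝕜 ζ ℓ = 1 := by
  rw [← pow_succ, Nat.sub_add_cancel (Fact.out : Odd ℓ).pos, K_pow]

theorem mul_K_inv {c : 𝕜} {x : SmallQuantumSL2 𝕜 ζ ℓ} (h : K 𝕜 ζ ℓ * x = c • (x * K 𝕜 ζ ℓ)) :
    x * K 𝕜 ζ ℓ ^ (ℓ - 1) = c • (K 𝕜 ζ ℓ ^ (ℓ - 1) * x) := by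
  have h : K 𝕜 ζ ℓ ^ (ℓ - 1) * (K 𝕜 ζ ℓ * x) * K 𝕜 ζ ℓ ^ (ℓ - 1)
      = K 𝕜 ζ ℓ ^ (ℓ - 1) * (c • (x * K 𝕜 ζ ℓ)) * K 𝕜 ζ ℓ ^ (ℓ - 1) := by rw [h]
  rw [← mul_assoc, K_inv_mul_K, one_mul] at h
  rw [h, mul_smul_comm, smul_mul_assoc, mul_assoc, mul_assoc, K_mul_K_inv, mul_one]

theorem E_mul_K_inv : E 𝕜 ζ ℓ * K 𝕜 ζ ℓ ^ (ℓ - 1) = ζ ^ 2 • (K 𝕜 ζ ℓ ^ (ℓ - 1) * E 𝕜 ζ ℓ) :=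
  mul_K_inv K_mul_E

theorem F_mul_K_inv : F 𝕜 ζ ℓ * K 𝕜 ζ ℓ ^ (ℓ - 1) = ζ⁻¹ ^ 2 • (K 𝕜 ζ ℓ ^ (ℓ - 1) * F 𝕜 ζ ℓ) :=
  mul_K_inv K_mul_F

theorem K_inv_pow : (K 𝕜 ζ ℓ ^ (ℓ - 1)) ^ ℓ = 1 := by
  rw [pow_right_comm, K_pow, one_pow]

theorem K_inv_pow_sub_one : (K 𝕜 ζ ℓ ^ (ℓ - 1)) ^ (ℓ - 1) = K 𝕜 ζ ℓ := by
  have h : (K 𝕜 ζ ℓ ^ (ℓ - 1)) ^ (ℓ - 1) * K 𝕜 ζ ℓ ^ (ℓ - 1) = 1 := by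
    rw [← pow_succ, Nat.sub_add_cancel (Fact.out : Odd ℓ).pos, K_inv_pow]
  calc _ = (K 𝕜 ζ ℓ ^ (ℓ - 1)) ^ (ℓ - 1) * (K 𝕜 ζ ℓ ^ (ℓ - 1) * K 𝕜 ζ ℓ) := by
        rw [K_inv_mul_K, mul_one]
    _ = _ := by rw [← mul_assoc, h, one_mul]

variable [Fact (IsPrimitiveRoot ζ ℓ)]

variable (ℓ) in
theorem zeta_ne_zero {𝕜 : Type*} [Field 𝕜] {ζ : 𝕜} [Fact (IsPrimitiveRoot ζ ℓ)] : ζ ≠ 0 :=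
  (Fact.out : IsPrimitiveRoot ζ ℓ).ne_zero (Fact.out : Odd ℓ).pos.ne'

theorem K_inv_mul_E :
    K 𝕜 ζ ℓ ^ (ℓ - 1) * E 𝕜 ζ ℓ = ζ⁻¹ ^ 2 • (E 𝕜 ζ ℓ * K 𝕜 ζ ℓ ^ (ℓ - 1)) := by
  rw [E_mul_K_inv, smul_smul, ← mul_pow, inv_mul_cancel₀ (zeta_ne_zero ℓ), one_pow, one_smul]

theorem K_inv_mul_F :
    K 𝕜 ζ ℓ ^ (ℓ - 1) * F 𝕜 ζ ℓ = ζ ^ 2 • (F 𝕜 ζ ℓ * K 𝕜 ζ ℓ ^ (ℓ - 1)) := by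
  rw [F_mul_K_inv, smul_smul, ← mul_pow, mul_inv_cancel₀ (zeta_ne_zero ℓ), one_pow, one_smul]

variable (𝕜 ζ ℓ) in
/-- The coproduct, `Δ(E) = E ⊗ 1 + K ⊗ E`, `Δ(F) = F ⊗ K⁻¹ + 1 ⊗ F`, `Δ(K) = K ⊗ K`. -/
noncomputable def comulHom :
    SmallQuantumSL2 𝕜 ζ ℓ →ₐ[𝕜] SmallQuantumSL2 𝕜 ζ ℓ ⊗[𝕜] SmallQuantumSL2 𝕜 ζ ℓ :=
  lift 𝕜 ζ ℓ (E 𝕜 ζ ℓ ⊗ₜ 1 + K 𝕜 ζ ℓ ⊗ₜ E 𝕜 ζ ℓ)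
    (F 𝕜 ζ ℓ ⊗ₜ (K 𝕜 ζ ℓ ^ (ℓ - 1)) + 1 ⊗ₜ F 𝕜 ζ ℓ) (K 𝕜 ζ ℓ ⊗ₜ K 𝕜 ζ ℓ)
    (by rw [Algebra.TensorProduct.tmul_pow, K_pow, Algebra.TensorProduct.one_def])
    (by
      rw [add_pow_of_isPrimitiveRoot (q := ζ ^ 2) (Fact.out : Odd ℓ).pos
        SmallBorel.isPrimitiveRoot_sq,
        Algebra.TensorProduct.tmul_pow, Algebra.TensorProduct.tmul_pow, E_pow,
        TensorProduct.zero_tmul, TensorProduct.tmul_zero, add_zero]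
      simp only [Algebra.TensorProduct.tmul_mul_tmul, mul_one, one_mul, K_mul_E,
        TensorProduct.smul_tmul'])
    (by
      rw [add_comm, add_pow_of_isPrimitiveRoot (q := ζ ^ 2) (Fact.out : Odd ℓ).pos
        SmallBorel.isPrimitiveRoot_sq,
        Algebra.TensorProduct.tmul_pow, Algebra.TensorProduct.tmul_pow, F_pow,
        TensorProduct.zero_tmul, TensorProduct.tmul_zero, add_zero]
      simp only [Algebra.TensorProduct.tmul_mul_tmul, mul_one, one_mul, K_inv_mul_F,
        TensorProduct.tmul_smul])
    (by
      simp only [mul_add, add_mul, smul_add, Algebra.TensorProduct.tmul_mul_tmul, mul_one, one_mul,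
        K_mul_E, TensorProduct.smul_tmul', TensorProduct.tmul_smul])
    (by
      simp only [mul_add, add_mul, smul_add, Algebra.TensorProduct.tmul_mul_tmul, mul_one, one_mul,
        K_mul_F, TensorProduct.smul_tmul', TensorProduct.tmul_smul, ← pow_succ, ← pow_succ'])
    (by
      have h1 : E 𝕜 ζ ℓ * F 𝕜 ζ ℓ = F 𝕜 ζ ℓ * E 𝕜 ζ ℓ
          + (ζ - ζ⁻¹)⁻¹ • (K 𝕜 ζ ℓ - K 𝕜 ζ ℓ ^ (ℓ - 1)) := by rw [← E_F]; abel
      have h2 : (ζ ^ 2 : 𝕜) * ζ⁻¹ ^ 2 = 1 := by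
        rw [← mul_pow, mul_inv_cancel₀ (zeta_ne_zero ℓ), one_pow]
      simp only [mul_add, add_mul, Algebra.TensorProduct.tmul_mul_tmul, mul_one, one_mul,
        K_mul_F, E_mul_K_inv, TensorProduct.smul_tmul', TensorProduct.tmul_smul, smul_smul, h1,
        h2, one_smul, TensorProduct.add_tmul, TensorProduct.tmul_add, TensorProduct.sub_tmul,
        TensorProduct.tmul_sub, smul_sub, Algebra.TensorProduct.tmul_pow]
      abel)

variable (𝕜 ζ ℓ) in
/-- The counit, `ε(E) = ε(F) = 0` and `ε(K) = 1`. -/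
noncomputable def counitHom : SmallQuantumSL2 𝕜 ζ ℓ →ₐ[𝕜] 𝕜 :=
  lift 𝕜 ζ ℓ 0 0 1 (one_pow _) (zero_pow (Fact.out : Odd ℓ).pos.ne')
    (zero_pow (Fact.out : Odd ℓ).pos.ne') (by simp) (by simp) (by simp)

noncomputable instance : Bialgebra 𝕜 (SmallQuantumSL2 𝕜 ζ ℓ) :=
  Bialgebra.ofAlgHom (comulHom 𝕜 ζ ℓ) (counitHom 𝕜 ζ ℓ)
    (by
      apply algHom_ext
      · simp [comulHom, TensorProduct.add_tmul, TensorProduct.tmul_add, add_assoc,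
          Algebra.TensorProduct.one_def]
      · simp [comulHom, TensorProduct.add_tmul, TensorProduct.tmul_add, add_assoc,
          Algebra.TensorProduct.one_def, Algebra.TensorProduct.tmul_pow]
      · simp [comulHom])
    (by
      apply algHom_ext
      · simp [comulHom, counitHom]
      · simp [comulHom, counitHom]
      · simp [comulHom, counitHom])
    (by
      apply algHom_ext
      · simp [comulHom, counitHom]
      · simp [comulHom, counitHom]
      · simp [comulHom, counitHom])

@[simp] theorem comul_E : comul (R := 𝕜) (E 𝕜 ζ ℓ) = E 𝕜 ζ ℓ ⊗ₜ 1 + K 𝕜 ζ ℓ ⊗ₜ E 𝕜 ζ ℓ :=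
  lift_E ..

@[simp] theorem comul_F :
    comul (R := 𝕜) (F 𝕜 ζ ℓ) = F 𝕜 ζ ℓ ⊗ₜ (K 𝕜 ζ ℓ ^ (ℓ - 1)) + 1 ⊗ₜ F 𝕜 ζ ℓ := lift_F ..

@[simp] theorem comul_K : comul (R := 𝕜) (K 𝕜 ζ ℓ) = K 𝕜 ζ ℓ ⊗ₜ K 𝕜 ζ ℓ := lift_K ..

@[simp] theorem counit_E : counit (R := 𝕜) (E 𝕜 ζ ℓ) = 0 := lift_E ..

@[simp] theorem counit_F : counit (R := 𝕜) (F 𝕜 ζ ℓ) = 0 := lift_F ..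

@[simp] theorem counit_K : counit (R := 𝕜) (K 𝕜 ζ ℓ) = 1 := lift_K ..

variable (𝕜 ζ ℓ) in
/-- The antipode as an anti-homomorphism, `S(E) = - K⁻¹ E`, `S(F) = - F K` and `S(K) = K⁻¹`. -/
noncomputable def antipodeHom : SmallQuantumSL2 𝕜 ζ ℓ →ₐ[𝕜] (SmallQuantumSL2 𝕜 ζ ℓ)ᵐᵒᵖ :=
  lift 𝕜 ζ ℓ (MulOpposite.op (-(K 𝕜 ζ ℓ ^ (ℓ - 1) * E 𝕜 ζ ℓ)))
    (MulOpposite.op (-(F 𝕜 ζ ℓ * K 𝕜 ζ ℓ))) (MulOpposite.op (K 𝕜 ζ ℓ ^ (ℓ - 1)))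
    (by rw [← MulOpposite.op_pow, K_inv_pow, MulOpposite.op_one])
    (by
      obtain ⟨c, hc⟩ := exists_mul_pow_eq_smul (E_mul_K_inv (𝕜 := 𝕜) (ζ := ζ) (ℓ := ℓ)) ℓ
      rw [← MulOpposite.op_pow, neg_pow, hc, E_pow, mul_zero, smul_zero, mul_zero,
        MulOpposite.op_zero])
    (by
      obtain ⟨c, hc⟩ := exists_mul_pow_eq_smul (K_mul_F (𝕜 := 𝕜) (ζ := ζ) (ℓ := ℓ)) ℓ
      rw [← MulOpposite.op_pow, neg_pow, hc, F_pow, zero_mul, smul_zero, mul_zero,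
        MulOpposite.op_zero])
    (by
      rw [← MulOpposite.op_mul, ← MulOpposite.op_mul, ← MulOpposite.op_smul]
      congr 1
      rw [neg_mul, mul_neg, smul_neg, mul_assoc, E_mul_K_inv, mul_smul_comm])
    (by
      rw [← MulOpposite.op_mul, ← MulOpposite.op_mul, ← MulOpposite.op_smul]
      congr 1
      rw [neg_mul, mul_neg, smul_neg, mul_assoc, K_mul_K_inv, mul_one, ← mul_assoc, K_inv_mul_F,
        smul_mul_assoc, mul_assoc, K_inv_mul_K, mul_one, smul_smul, ← mul_pow,
        inv_mul_cancel₀ (zeta_ne_zero ℓ), one_pow, one_smul])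
    (by
      rw [← MulOpposite.op_mul, ← MulOpposite.op_mul, ← MulOpposite.op_sub,
        ← MulOpposite.op_pow, ← MulOpposite.op_sub, ← MulOpposite.op_smul]
      congr 1
      have h1 : E 𝕜 ζ ℓ * F 𝕜 ζ ℓ = F 𝕜 ζ ℓ * E 𝕜 ζ ℓ
          + (ζ - ζ⁻¹)⁻¹ • (K 𝕜 ζ ℓ - K 𝕜 ζ ℓ ^ (ℓ - 1)) := by rw [← E_F]; abel
      have h2 : K 𝕜 ζ ℓ ^ (ℓ - 1) * E 𝕜 ζ ℓ * (F 𝕜 ζ ℓ * K 𝕜 ζ ℓ) = E 𝕜 ζ ℓ * F 𝕜 ζ ℓ := by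
        rw [K_inv_mul_E, smul_mul_assoc, mul_assoc, ← mul_assoc (K 𝕜 ζ ℓ ^ (ℓ - 1)), K_inv_mul_F,
          smul_mul_assoc, mul_smul_comm, smul_smul, mul_assoc (F 𝕜 ζ ℓ), K_inv_mul_K, mul_one,
          ← mul_pow, inv_mul_cancel₀ (zeta_ne_zero ℓ), one_pow, one_smul]
      have h3 : F 𝕜 ζ ℓ * K 𝕜 ζ ℓ * (K 𝕜 ζ ℓ ^ (ℓ - 1) * E 𝕜 ζ ℓ) = F 𝕜 ζ ℓ * E 𝕜 ζ ℓ := by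
        rw [mul_assoc, ← mul_assoc (K 𝕜 ζ ℓ), K_mul_K_inv, one_mul]
      rw [neg_mul_neg, neg_mul_neg, h2, h3, K_inv_pow_sub_one, h1, smul_sub, smul_sub]
      abel)

noncomputable instance : HopfAlgebra 𝕜 (SmallQuantumSL2 𝕜 ζ ℓ) :=
  HopfAlgebra.ofGenerators (antipodeHom 𝕜 ζ ℓ) adjoin_eq_top
    (by
      rintro x (rfl | rfl | rfl)
      · simp [antipodeHom]
      · simp [antipodeHom, mul_assoc, K_mul_K_inv]
      · simp [antipodeHom, K_inv_mul_K])
    (by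
      rintro x (rfl | rfl | rfl)
      · simp [antipodeHom, ← mul_assoc, K_mul_K_inv]
      · simp [antipodeHom, ← MulOpposite.op_pow, K_inv_pow_sub_one]
      · simp [antipodeHom, K_mul_K_inv])

theorem antipode_E : antipode 𝕜 (E 𝕜 ζ ℓ) = -(K 𝕜 ζ ℓ ^ (ℓ - 1) * E 𝕜 ζ ℓ) :=
  congrArg MulOpposite.unop (lift_E ..)

theorem antipode_F : antipode 𝕜 (F 𝕜 ζ ℓ) = -(F 𝕜 ζ ℓ * K 𝕜 ζ ℓ) :=
  congrArg MulOpposite.unop (lift_F ..)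

theorem antipode_K : antipode 𝕜 (K 𝕜 ζ ℓ) = K 𝕜 ζ ℓ ^ (ℓ - 1) :=
  congrArg MulOpposite.unop (lift_K ..)

end Hopf

end SmallQuantumSL2

section Quasitriangular

open Coalgebra

variable (R A : Type*) [CommRing R] [Ring A] [Algebra R A]

/-- `a ⊗ b ↦ a ⊗ b ⊗ 1`. -/
noncomputable def leg12 : A ⊗[R] A →ₐ[R] A ⊗[R] (A ⊗[R] A) :=
  Algebra.TensorProduct.map (AlgHom.id R A) Algebra.TensorProduct.includeLeft

/-- `a ⊗ b ↦ a ⊗ 1 ⊗ b`. -/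
noncomputable def leg13 : A ⊗[R] A →ₐ[R] A ⊗[R] (A ⊗[R] A) :=
  Algebra.TensorProduct.map (AlgHom.id R A) Algebra.TensorProduct.includeRight

/-- `a ⊗ b ↦ 1 ⊗ a ⊗ b`. -/
noncomputable def leg23 : A ⊗[R] A →ₐ[R] A ⊗[R] (A ⊗[R] A) :=
  Algebra.TensorProduct.includeRight

variable {R A}

/-- `(A, Δ, ε, S, 𝓡)` is a quasi-triangular Hopf algebra with universal R-matrix `𝓡`. -/
structure IsQuasitriangularHopf (Δ : A →ₗ[R] A ⊗[R] A) (ε : A →ₗ[R] R) (S : A →ₗ[R] A)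
    (𝓡 : A ⊗[R] A) : Prop where
  coassoc (a : A) : TensorProduct.assoc R A A A (Δ.rTensor A (Δ a)) = Δ.lTensor A (Δ a)
  counit_left (a : A) : TensorProduct.lid R A (ε.rTensor A (Δ a)) = a
  counit_right (a : A) : TensorProduct.rid R A (ε.lTensor A (Δ a)) = a
  comul_one : Δ 1 = 1
  comul_mul (a b : A) : Δ (a * b) = Δ a * Δ b
  counit_one : ε 1 = 1
  counit_mul (a b : A) : ε (a * b) = ε a * ε b
  antipode_left (a : A) : LinearMap.mul' R A (S.rTensor A (Δ a)) = algebraMap R A (ε a)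
  antipode_right (a : A) : LinearMap.mul' R A (S.lTensor A (Δ a)) = algebraMap R A (ε a)
  isUnit : IsUnit 𝓡
  comul_rTensor : TensorProduct.assoc R A A A (Δ.rTensor A 𝓡) = leg13 R A 𝓡 * leg23 R A 𝓡
  comul_lTensor : Δ.lTensor A 𝓡 = leg13 R A 𝓡 * leg12 R A 𝓡
  mul_comul (a : A) : 𝓡 * Δ a = TensorProduct.comm R A A (Δ a) * 𝓡

/-- `𝓕 ∈ A ⊗ A` is a gauge transformation: it is invertible,
`(1 ⊗ 𝓕) (id ⊗ Δ)(𝓕) = (𝓕 ⊗ 1) (Δ ⊗ id)(𝓕)` and `(ε ⊗ id)(𝓕) = 1 = (id ⊗ ε)(𝓕)`. -/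
structure IsGaugeTransformation (Δ : A →ₗ[R] A ⊗[R] A) (ε : A →ₗ[R] R) (𝓕 : A ⊗[R] A) :
    Prop where
  isUnit : IsUnit 𝓕
  cocycle : leg23 R A 𝓕 * Δ.lTensor A 𝓕
    = leg12 R A 𝓕 * TensorProduct.assoc R A A A (Δ.rTensor A 𝓕)
  counit_left : TensorProduct.lid R A (ε.rTensor A 𝓕) = 1
  counit_right : TensorProduct.rid R A (ε.lTensor A 𝓕) = 1

/-- The twisted coproduct `Δ_𝓕(a) = 𝓕 Δ(a) 𝓕⁻¹`. -/
noncomputable def twistComul (Δ : A →ₗ[R] A ⊗[R] A) (𝓕 : A ⊗[R] A) : A →ₗ[R] A ⊗[R] A :=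
  LinearMap.mulLeft R 𝓕 ∘ₗ LinearMap.mulRight R (Ring.inverse 𝓕) ∘ₗ Δ

/-- The element `x_𝓕 = m (id ⊗ S)(𝓕)`. -/
noncomputable def twistElement (S : A →ₗ[R] A) (𝓕 : A ⊗[R] A) : A :=
  LinearMap.mul' R A (S.lTensor A 𝓕)

/-- The twisted antipode `S_𝓕(a) = x_𝓕 S(a) x_𝓕⁻¹`. -/
noncomputable def twistAntipode (S : A →ₗ[R] A) (𝓕 : A ⊗[R] A) : A →ₗ[R] A :=
  LinearMap.mulLeft R (twistElement S 𝓕) ∘ₗ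
    LinearMap.mulRight R (Ring.inverse (twistElement S 𝓕)) ∘ₗ S

/-- The twisted R-matrix `𝓕₂₁ 𝓡 𝓕⁻¹`. -/
noncomputable def twistR (𝓡 𝓕 : A ⊗[R] A) : A ⊗[R] A :=
  TensorProduct.comm R A A 𝓕 * 𝓡 * Ring.inverse 𝓕

end Quasitriangular

/-- `𝓡` makes the Hopf algebra `A` quasi-triangular. -/
def IsUniversalR {R A : Type*} [CommRing R] [Ring A] [HopfAlgebra R A] (𝓡 : A ⊗[R] A) : Prop :=
  IsQuasitriangularHopf (Coalgebra.comul (R := R)) (Coalgebra.counit (R := R))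
    (HopfAlgebra.antipode R) 𝓡

section UniversalR

open DrinfeldDouble DualCop

variable (R H : Type*) [CommRing R] [Ring H] [HopfAlgebra R H] [HasBijectiveAntipode R H]
  [Module.Finite R H] [Module.Free R H]

/-- The canonical R-matrix `∑ᵢ (ε ⊗ hᵢ) ⊗ (hⁱ ⊗ 1)` of the double, where `hᵢ` is a basis of `H` and
`hⁱ` is the dual basis. -/
noncomputable def DrinfeldDouble.universalR : DrinfeldDouble R H ⊗[R] DrinfeldDouble R H :=
  ∑ i, ofAlg R H (Module.Free.chooseBasis R H i)
    ⊗ₜ ofDual R H (of ((Module.Free.chooseBasis R H).coord i))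

/-- The canonical R-matrix does not depend on the basis. -/
theorem DrinfeldDouble.universalR_eq {ι : Type*} [Fintype ι] (b : Module.Basis ι R H) :
    universalR R H = ∑ i, ofAlg R H (b i) ⊗ₜ ofDual R H (of (b.coord i)) := by
  classical
  let c := Module.Free.chooseBasis R H
  have h1 : ∀ j, ofAlg R H (c j) = ∑ i, b.coord i (c j) • ofAlg R H (b i) := by
    intro j
    conv_lhs => rw [← b.sum_repr (c j)]
    simp only [map_sum, map_smul, Module.Basis.coord_apply]
  have h2 : ∀ i, ofDual R H (of (b.coord i))
      = ∑ j, b.coord i (c j) • ofDual R H (of (c.coord j)) := by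
    intro i
    simp only [← map_smul, ← map_sum]
    congr 1
    ext x
    conv_lhs => rw [← c.sum_repr x]
    simp only [of_apply, map_sum, map_smul, smul_eq_mul, Module.Basis.coord_apply,
      LinearMap.sum_apply, LinearMap.smul_apply]
    exact Finset.sum_congr rfl fun _ _ ↦ mul_comm _ _
  simp only [universalR, h2, TensorProduct.tmul_sum]
  change ∑ j, ofAlg R H (c j) ⊗ₜ ofDual R H (of (c.coord j)) = _
  simp only [h1, TensorProduct.sum_tmul]
  rw [Finset.sum_comm]
  simp only [TensorProduct.smul_tmul]

end UniversalR

section BaseChange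

variable (R 𝕜 A : Type*) [CommRing R] [CommRing 𝕜] [Algebra R 𝕜] [Ring A] [Algebra R A]

/-- The map `A ⊗_R A → (𝕜 ⊗_R A) ⊗_𝕜 (𝕜 ⊗_R A)`, `a ⊗ b ↦ (1 ⊗ a) ⊗ (1 ⊗ b)`. -/
noncomputable def baseChangeSq : A ⊗[R] A →ₗ[R] (𝕜 ⊗[R] A) ⊗[𝕜] (𝕜 ⊗[R] A) :=
  TensorProduct.lift (LinearMap.mk₂ R
    (fun a b ↦ ((1 : 𝕜) ⊗ₜ[R] a) ⊗ₜ[𝕜] ((1 : 𝕜) ⊗ₜ[R] b))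
    (fun a b c ↦ by rw [TensorProduct.tmul_add, TensorProduct.add_tmul])
    (fun r a b ↦ by rw [TensorProduct.tmul_smul]; exact (TensorProduct.smul_tmul' ..).symm)
    (fun a b c ↦ by rw [TensorProduct.tmul_add, TensorProduct.tmul_add])
    (fun r a b ↦ by rw [TensorProduct.tmul_smul, TensorProduct.tmul_smul]))

end BaseChange

section QuantumInt

variable {𝕜 : Type*} [Field 𝕜] (ζ : 𝕜)

/-- The quantum integer `[n] = (ζⁿ - ζ⁻ⁿ) / (ζ - ζ⁻¹)`. -/
def qInt (n : ℕ) : 𝕜 := (ζ ^ n - ζ⁻¹ ^ n) / (ζ - ζ⁻¹)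

/-- The quantum factorial `[m]! = [1] [2] ⋯ [m]`. -/
def qFactorial (m : ℕ) : 𝕜 := ∏ s ∈ Finset.range m, qInt ζ (s + 1)

/-- `τ_m = (ζ⁻¹ - ζ) ^ m / (ζ ^ (m (m - 1) / 2) [m]!)`. -/
def tauCoeff (m : ℕ) : 𝕜 := (ζ⁻¹ - ζ) ^ m / (ζ ^ (m * (m - 1) / 2) * qFactorial ζ m)

/-- `(1 / ℓ) ∑ᵢⱼ q ^ (2 i j) xⁱ ⊗ yʲ`, the sum being over `0 ≤ i, j < ℓ`. -/
noncomputable def bicharacter {𝕜 : Type*} [Field 𝕜] (ℓ : ℕ) (q : 𝕜) {A : Type*} [Ring A]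
    [Algebra 𝕜 A] (x y : A) : A ⊗[𝕜] A :=
  (ℓ : 𝕜)⁻¹ • ∑ i ∈ Finset.range ℓ, ∑ j ∈ Finset.range ℓ, q ^ (2 * i * j) • ((x ^ i) ⊗ₜ (y ^ j))

end QuantumInt

/-- The R-matrix `(∑ τ_m E ^ m ⊗ F ^ m) · (1 / ℓ) ∑ ζ ^ (2 i j) Kⁱ ⊗ Kʲ` of `U_ζ`. -/
noncomputable def SmallQuantumSL2.rMatrix (𝕜 : Type*) [Field 𝕜] (ζ : 𝕜) (ℓ : ℕ) :
    SmallQuantumSL2 𝕜 ζ ℓ ⊗[𝕜] SmallQuantumSL2 𝕜 ζ ℓ :=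
  (∑ m ∈ Finset.range ℓ, tauCoeff ζ m • ((E 𝕜 ζ ℓ ^ m) ⊗ₜ (F 𝕜 ζ ℓ ^ m)))
    * bicharacter ℓ ζ (K 𝕜 ζ ℓ) (K 𝕜 ζ ℓ)

/-- The group algebra `𝒜 = 𝕜[ℤ/ℓ]`. -/
abbrev CyclicAlgebra (𝕜 : Type*) [Field 𝕜] (ℓ : ℕ) : Type _ :=
  MonoidAlgebra 𝕜 (Multiplicative (ZMod ℓ))

namespace CyclicAlgebra

/-- The group-like generator `z` of `𝒜`. -/
noncomputable def z (𝕜 : Type*) [Field 𝕜] (ℓ : ℕ) : CyclicAlgebra 𝕜 ℓ :=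
  MonoidAlgebra.of 𝕜 (Multiplicative (ZMod ℓ)) (Multiplicative.ofAdd 1)

/-- The R-matrix `(1 / ℓ) ∑ ζ ^ (-2 i j) zⁱ ⊗ zʲ` of `𝒜`. -/
noncomputable def rMatrix (𝕜 : Type*) [Field 𝕜] (ζ : 𝕜) (ℓ : ℕ) :
    CyclicAlgebra 𝕜 ℓ ⊗[𝕜] CyclicAlgebra 𝕜 ℓ :=
  bicharacter ℓ ζ⁻¹ (z 𝕜 ℓ) (z 𝕜 ℓ)

end CyclicAlgebra

/-- For `𝓡 ∈ A ⊗ A` and `𝓢 ∈ B ⊗ B`, the element `𝓡₁₃ 𝓢₂₄` of `(A ⊗ B) ⊗ (A ⊗ B)`. -/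
noncomputable def productR {𝕜 A B : Type*} [CommRing 𝕜] [Ring A] [Algebra 𝕜 A] [Ring B]
    [Algebra 𝕜 B] (𝓡 : A ⊗[𝕜] A) (𝓢 : B ⊗[𝕜] B) : (A ⊗[𝕜] B) ⊗[𝕜] (A ⊗[𝕜] B) :=
  Algebra.TensorProduct.map (Algebra.TensorProduct.includeLeft : A →ₐ[𝕜] A ⊗[𝕜] B)
      (Algebra.TensorProduct.includeLeft : A →ₐ[𝕜] A ⊗[𝕜] B) 𝓡
    * Algebra.TensorProduct.map (Algebra.TensorProduct.includeRight : B →ₐ[𝕜] A ⊗[𝕜] B)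
      (Algebra.TensorProduct.includeRight : B →ₐ[𝕜] A ⊗[𝕜] B) 𝓢

/-- The ring `ℤ[ζ]`, as a subring of `𝕜`. -/
abbrev IntAdjoin {𝕜 : Type*} [Field 𝕜] (ζ : 𝕜) : Type _ := Algebra.adjoin ℤ {ζ}

/-- `ζ`, as an element of `ℤ[ζ]`. -/
def zetaInt {𝕜 : Type*} [Field 𝕜] (ζ : 𝕜) : IntAdjoin ζ :=
  ⟨ζ, Algebra.self_mem_adjoin_singleton ℤ ζ⟩

instance {𝕜 : Type*} [Field 𝕜] (ζ : 𝕜) (ℓ : ℕ) [h : Fact (IsPrimitiveRoot ζ ℓ)] :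
    Fact (IsPrimitiveRoot (zetaInt ζ) ℓ) :=
  ⟨IsPrimitiveRoot.of_map_of_injective (f := (Algebra.adjoin ℤ {ζ}).val) h.out
    Subtype.val_injective⟩

/-- `B_ζ(sl₂)` over `ℤ[ζ]`. -/
abbrev BorelInt {𝕜 : Type*} [Field 𝕜] (ζ : 𝕜) (ℓ : ℕ) : Type _ :=
  SmallBorel (IntAdjoin ζ) (zetaInt ζ) ℓ

/-- The quantum double `D(B)` of `B = B_ζ(sl₂)` over `ℤ[ζ]`. -/
abbrev DoubleInt {𝕜 : Type*} [Field 𝕜] (ζ : 𝕜) (ℓ : ℕ) [Fact (Odd ℓ)]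
    [Fact (IsPrimitiveRoot ζ ℓ)] : Type _ :=
  DrinfeldDouble (IntAdjoin ζ) (BorelInt ζ ℓ)

/-- The extension of scalars `D_e(B) = 𝕜 ⊗ D(B)`. -/
abbrev DoubleExt (𝕜 : Type*) [Field 𝕜] (ζ : 𝕜) (ℓ : ℕ) [Fact (Odd ℓ)]
    [Fact (IsPrimitiveRoot ζ ℓ)] : Type _ :=
  𝕜 ⊗[IntAdjoin ζ] DoubleInt ζ ℓ

namespace DoubleExt

open DrinfeldDouble

variable (𝕜 : Type*) [Field 𝕜] (ζ : 𝕜) (ℓ : ℕ) [Fact (Odd ℓ)] [Fact (IsPrimitiveRoot ζ ℓ)]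

/-- The functional on `B` with values `c p` on the basis elements `e ^ p.1 k ^ p.2`. -/
noncomputable def functional (c : Fin ℓ × Fin ℓ → IntAdjoin ζ) :
    BorelInt ζ ℓ →ₗ[IntAdjoin ζ] IntAdjoin ζ :=
  have := SmallBorel.neZero ℓ
  (SmallBorel.basis (IntAdjoin ζ) (zetaInt ζ) ℓ).constr ℕ c

/-- The element `e` of `D_e(B)`. -/
noncomputable def e : DoubleExt 𝕜 ζ ℓ := 1 ⊗ₜ ofAlg (IntAdjoin ζ) (BorelInt ζ ℓ) (SmallBorel.e _ _ _)

/-- The element `k` of `D_e(B)`. -/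
noncomputable def k : DoubleExt 𝕜 ζ ℓ := 1 ⊗ₜ ofAlg (IntAdjoin ζ) (BorelInt ζ ℓ) (SmallBorel.k _ _ _)

/-- The element `α` of `D_e(B)`: the functional with `α(eⁱ kʲ) = δ_{i,0} ζʲ`. -/
noncomputable def α : DoubleExt 𝕜 ζ ℓ :=
  1 ⊗ₜ ofDual (IntAdjoin ζ) (BorelInt ζ ℓ) (DualCop.of (functional 𝕜 ζ ℓ
    fun p ↦ if (p.1 : ℕ) = 0 then zetaInt ζ ^ (p.2 : ℕ) else 0))

/-- The element `f` of `D_e(B)`: the functional with `f(eⁱ kʲ) = δ_{i,1}`. -/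
noncomputable def f : DoubleExt 𝕜 ζ ℓ :=
  1 ⊗ₜ ofDual (IntAdjoin ζ) (BorelInt ζ ℓ) (DualCop.of (functional 𝕜 ζ ℓ
    fun p ↦ if (p.1 : ℕ) = 1 then 1 else 0))

/-- `E = α^{-1/2} k⁻¹ e / (ζ - ζ⁻¹)`. The elements `α` and `k` have order `ℓ`, so `x⁻¹ = x ^ (ℓ - 1)`,
and `1/2` stands for the inverse `(ℓ + 1) / 2` of `2` modulo `ℓ`. -/
noncomputable def E : DoubleExt 𝕜 ζ ℓ :=
  (ζ - ζ⁻¹)⁻¹ • ((α 𝕜 ζ ℓ ^ (ℓ - 1)) ^ ((ℓ + 1) / 2) * k 𝕜 ζ ℓ ^ (ℓ - 1) * e 𝕜 ζ ℓ)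

/-- `F = -f`. -/
noncomputable def F : DoubleExt 𝕜 ζ ℓ := -f 𝕜 ζ ℓ

/-- `K = α^{-1/2} k`. -/
noncomputable def K : DoubleExt 𝕜 ζ ℓ := (α 𝕜 ζ ℓ ^ (ℓ - 1)) ^ ((ℓ + 1) / 2) * k 𝕜 ζ ℓ

/-- `Z = α^{1/2} k`. -/
noncomputable def Z : DoubleExt 𝕜 ζ ℓ := α 𝕜 ζ ℓ ^ ((ℓ + 1) / 2) * k 𝕜 ζ ℓ

/-- The idempotents `P_i = (1 / ℓ) ∑ⱼ ζ ^ (-2 i j) Zʲ`. -/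
noncomputable def P (i : ℕ) : DoubleExt 𝕜 ζ ℓ :=
  (ℓ : 𝕜)⁻¹ • ∑ j ∈ Finset.range ℓ, ζ⁻¹ ^ (2 * i * j) • Z 𝕜 ζ ℓ ^ j

/-- The gauge element `∑ᵢ Kⁱ ⊗ P_i`, the sum being over `0 ≤ i < ℓ`. -/
noncomputable def gauge : DoubleExt 𝕜 ζ ℓ ⊗[𝕜] DoubleExt 𝕜 ζ ℓ :=
  ∑ i ∈ Finset.range ℓ, (K 𝕜 ζ ℓ ^ i) ⊗ₜ P 𝕜 ζ ℓ i

/-- The canonical R-matrix of the double, in `D_e(B) ⊗ D_e(B)`. -/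
noncomputable def rMatrix : DoubleExt 𝕜 ζ ℓ ⊗[𝕜] DoubleExt 𝕜 ζ ℓ :=
  baseChangeSq (IntAdjoin ζ) 𝕜 (DoubleInt ζ ℓ) (universalR (IntAdjoin ζ) (BorelInt ζ ℓ))

/-- The coproduct of `D_e(B)_𝓕`, where `𝓕` is the gauge element. -/
noncomputable def gaugeComul : DoubleExt 𝕜 ζ ℓ →ₗ[𝕜] DoubleExt 𝕜 ζ ℓ ⊗[𝕜] DoubleExt 𝕜 ζ ℓ :=
  twistComul (Coalgebra.comul (R := 𝕜)) (gauge 𝕜 ζ ℓ)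

/-- The antipode of `D_e(B)_𝓕`. -/
noncomputable def gaugeAntipode : DoubleExt 𝕜 ζ ℓ →ₗ[𝕜] DoubleExt 𝕜 ζ ℓ :=
  twistAntipode (HopfAlgebra.antipode 𝕜) (gauge 𝕜 ζ ℓ)

/-- The R-matrix of `D_e(B)_𝓕`. -/
noncomputable def gaugeRMatrix : DoubleExt 𝕜 ζ ℓ ⊗[𝕜] DoubleExt 𝕜 ζ ℓ :=
  twistR (rMatrix 𝕜 ζ ℓ) (gauge 𝕜 ζ ℓ)

/-- The PBW monomials `F ^ a E ^ b K ^ c Z ^ d`. -/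
noncomputable def pbw (p : Fin ℓ × Fin ℓ × Fin ℓ × Fin ℓ) : DoubleExt 𝕜 ζ ℓ :=
  F 𝕜 ζ ℓ ^ (p.1 : ℕ) * E 𝕜 ζ ℓ ^ (p.2.1 : ℕ) * K 𝕜 ζ ℓ ^ (p.2.2.1 : ℕ) * Z 𝕜 ζ ℓ ^ (p.2.2.2 : ℕ)

end DoubleExt

/-! Inside $D_e(B)$ everything follows from a short list of relations. Put $b=\alpha^{1/2}$. Then
$k$ and $b$ commute, $ke=\zeta ek$, $kf=\zeta^{-1}fk$, $be=\zeta^{-1}eb$, $bf=\zeta fb$ and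
$ef-fe=b^2-k^2$. In $Z=bk$ the weights cancel, so $Z$ is central; in $K=b^{-1}k$ they add up to
$\zeta^{\pm2}$. Since $KZ=k^2$ and $K^{-1}Z=b^2=\alpha$, the commutator is $ef-fe=Z(K^{-1}-K)$, and
dividing $e$ by $Z$ gives the relations of $U_\zeta$ for $E,F,K$. The presentations of $U_\zeta$ and
$\mathscr A$ therefore yield a homomorphism $U_\zeta\otimes\mathscr A\to D_e(B)$; its inverse will
be $\varpi$.

It is onto because $ZE$, $KZ$, $K^{-1}Z$ and $F$ recover $e,k,\alpha,f$ ($\ell$ is odd, so $k$ is a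
power of $k^2$), and these generate $D_e(B)$. The $\ell^4$ monomials $F^aE^bK^c\otimes z^d$ span the
source by reordering, and $D_e(B)$ has dimension $\ell^4$; hence their images form a basis and the
map is injective. No separate PBW theorem for $U_\zeta$ is needed.

The coproduct of the double differs from that of $U_\zeta\otimes\mathscr A$ only by powers of $Z$:
$\Delta(E)=E\otimes Z^{-1}+K\otimes E$ and $\Delta(F)=1\otimes F+F\otimes ZK^{-1}$. All torus
computations rest on $T_q(x,y)=\frac1\ell\sum_{i,j}q^{ij}x^iy^j=\sum_i x^ip_i$, where $p_i$ projects
to the eigenspace of $y$ for $q^{-i}$. It is multiplicative in $x$ and in $y$ (`torusPairing_mul`,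
`torusPairing_mul'`), and passing an element of weight $q^{\pm1}$ under $x$ across it creates a
factor $y^{\mp1}$ (`torusPairing_mul_of_mul_eq` and its inverse form). The gauge element is
$T_{\zeta^{-2}}(K\otimes1,1\otimes Z)$: multiplicativity gives the cocycle identity, and conjugation
by it removes exactly the unwanted powers of $Z$. The element $T_{\zeta^{-2}}(K,Z^{-1})$ does the
same for the antipode.

For the R-matrix, Fourier inversion on the functionals $e^ik^j\mapsto\delta_{i,n}\zeta^{sj}$, which
are multiples of $f^n\alpha^s$, turns the canonical element into
$\exp_\zeta\big(\tfrac{e}{\zeta^{-1}-\zeta}\otimes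
f\big)\,T_{\zeta^{-1}}(k\otimes1,1\otimes\alpha)=\exp_\zeta(ZE\otimes
F)\,T_{\zeta^{-2}}(KZ\otimes1,1\otimes ZK^{-1})$. Write the last pairing as a product of four. The
factor on $(Z,K^{-1})$ cancels against $\mathbf F_{21}$, the one on $(K,Z)$ against $\mathbf
F^{-1}$, and $\mathbf F_{21}$ carries $ZE\otimes F$ to $E\otimes F$. What is left is $\mathcal
R_{U_\zeta}$ times $\mathcal R_{\mathscr A}$ (`IsHopfExtension.twistR_eq`).

Quasi-triangularity is proved for $U_\zeta$ (the addition law `qExp_add` for the hexagons,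
commutators of $E$ with $F^m$ and of $E^m$ with $F$ for the intertwining) and for $\mathscr A$, then
passed to the product and transported to the twisted double along the isomorphism. That of the
untwisted double is never needed. -/

section RootSums

/-! ### Sums over roots of unity -/

open Classical in
theorem sum_pow_eq_ite {𝕜 : Type*} [Field 𝕜] {ℓ : ℕ} (c : 𝕜) (hc : c ^ ℓ = 1) :
    ∑ j ∈ Finset.range ℓ, c ^ j = if c = 1 then (ℓ : 𝕜) else 0 := by
  split_ifs with h
  · simp [h]
  · have := mul_geom_sum c ℓ
    rw [hc, sub_self] at this
    exact (mul_eq_zero.1 this).resolve_left (sub_ne_zero.2 h)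

/-- Multiplication by a unit permutes the residues modulo $\ell$. With $c=2$ and $c=\ell-1$ this is
what changes the root of unity in a torus pairing. -/
theorem sum_range_mul_mod {M : Type*} [AddCommMonoid M] {ℓ c : ℕ} (hc : Nat.Coprime c ℓ)
    (hl : 0 < ℓ) (g : ℕ → M) (hg : ∀ i, g (i % ℓ) = g i) :
    ∑ i ∈ Finset.range ℓ, g (c * i) = ∑ i ∈ Finset.range ℓ, g i := by
  have hinj : Set.InjOn (fun i ↦ c * i % ℓ) (Finset.range ℓ : Set ℕ) := by
    intro a ha b hb hab
    have ha := Finset.mem_range.1 ha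
    have hb := Finset.mem_range.1 hb
    have : a ≡ b [MOD ℓ] := Nat.ModEq.cancel_left_of_coprime hc.symm hab
    exact this.eq_of_lt_of_lt ha hb
  have himg : (Finset.range ℓ).image (fun i ↦ c * i % ℓ) = Finset.range ℓ := by
    refine Finset.eq_of_subset_of_card_le ?_ ?_
    · intro x hx
      obtain ⟨i, -, rfl⟩ := Finset.mem_image.1 hx
      exact Finset.mem_range.2 (Nat.mod_lt _ hl)
    · rw [Finset.card_image_of_injOn hinj]
  conv_rhs => rw [← himg, Finset.sum_image hinj]
  exact Finset.sum_congr rfl fun i _ ↦ (hg _).symm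

end RootSums

/-! ### Torus pairings -/

section Pairing

variable {𝕜 : Type*} [Field 𝕜] {C : Type*} [Ring C] [Algebra 𝕜 C]

/-- The projection `(1 / ℓ) ∑ⱼ q ^ (i j) yʲ` to the eigenspace of `y` with eigenvalue `q ^ (- i)`. -/
noncomputable def eigenProj (ℓ : ℕ) (q : 𝕜) (y : C) (i : ℕ) : C :=
  (ℓ : 𝕜)⁻¹ • ∑ j ∈ Finset.range ℓ, q ^ (i * j) • y ^ j

/-- The element `(1 / ℓ) ∑ᵢⱼ q ^ (i j) xⁱ yʲ`. -/
noncomputable def torusPairing (ℓ : ℕ) (q : 𝕜) (x y : C) : C :=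
  (ℓ : 𝕜)⁻¹ • ∑ i ∈ Finset.range ℓ, ∑ j ∈ Finset.range ℓ, q ^ (i * j) • (x ^ i * y ^ j)

/-- On the part of $C$ where $y$ acts as $q^{-i}$ the pairing acts as $x^i$, so it is a substitute
for $x^{-\log_q y}$. The later arguments use this form. -/
theorem torusPairing_eq (ℓ : ℕ) (q : 𝕜) (x y : C) :
    torusPairing ℓ q x y = ∑ i ∈ Finset.range ℓ, x ^ i * eigenProj ℓ q y i := by
  simp only [torusPairing, eigenProj, Finset.smul_sum, Finset.mul_sum, mul_smul_comm]

theorem torusPairing_symm (ℓ : ℕ) (q : 𝕜) {x y : C} (h : Commute x y) :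
    torusPairing ℓ q x y = torusPairing ℓ q y x := by
  rw [torusPairing, torusPairing, Finset.sum_comm]
  simp only [mul_comm, (h.pow_pow _ _).eq]

theorem map_torusPairing {C' : Type*} [Ring C'] [Algebra 𝕜 C'] (g : C →ₐ[𝕜] C') (ℓ : ℕ) (q : 𝕜)
    (x y : C) : g (torusPairing ℓ q x y) = torusPairing ℓ q (g x) (g y) := by
  simp only [torusPairing, map_smul, map_sum, map_mul, map_pow]

theorem commute_torusPairing (ℓ : ℕ) (q : 𝕜) {u x y : C} (hx : Commute u x) (hy : Commute u y) :
    Commute u (torusPairing ℓ q x y) := by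
  refine Commute.smul_right (Commute.sum_right _ _ _ fun i _ ↦ Commute.sum_right _ _ _ fun j _ ↦ ?_) _
  exact Commute.smul_right ((hx.pow_right _).mul_right (hy.pow_right _)) _

theorem bicharacter_eq_torusPairing {A : Type*} [Ring A] [Algebra 𝕜 A] (ℓ : ℕ) (q : 𝕜) (x y : A) :
    bicharacter ℓ q x y = torusPairing ℓ (q ^ 2) (x ⊗ₜ[𝕜] (1 : A)) ((1 : A) ⊗ₜ[𝕜] y) := by
  simp only [bicharacter, torusPairing, Algebra.TensorProduct.tmul_pow, one_pow,
    Algebra.TensorProduct.tmul_mul_tmul, one_mul, mul_one, ← pow_mul, mul_assoc]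

variable {ℓ : ℕ} {q : 𝕜} {x x' y u : C}

theorem pow_mod_of_pow_eq_one {M : Type*} [Monoid M] {x : M} (hx : x ^ ℓ = 1) (i : ℕ) :
    x ^ (i % ℓ) = x ^ i := by
  conv_rhs => rw [← Nat.div_add_mod i ℓ, pow_add, pow_mul, hx, one_pow, one_mul]

/-- Passing from $(q,x)$ to $(q^c,x^c)$ only replaces the summation index $i$ by $ci$ modulo $\ell$.
-/
theorem torusPairing_pow {c : ℕ} (hc : Nat.Coprime c ℓ) (hl : 0 < ℓ) (hq : q ^ ℓ = 1)
    (hx : x ^ ℓ = 1) : torusPairing ℓ (q ^ c) (x ^ c) y = torusPairing ℓ q x y := by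
  simp only [torusPairing_eq]
  have := sum_range_mul_mod hc hl (fun i ↦ x ^ i * eigenProj ℓ q y i) (fun i ↦ by
    simp only [pow_mod_of_pow_eq_one hx, eigenProj, pow_mul, pow_mod_of_pow_eq_one hq])
  rw [← this]
  refine Finset.sum_congr rfl fun i _ ↦ ?_
  simp only [eigenProj, ← pow_mul, mul_assoc]

/-- The eigenvalue equation $y\,p_i=q^{-i}p_i$, obtained by shifting the index $j$; the factor $q^i$
stands on the left to avoid inverses. -/
theorem mul_eigenProj (hl : 0 < ℓ) (hq : q ^ ℓ = 1) (hy : y ^ ℓ = 1) (i : ℕ) :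
    q ^ i • (y * eigenProj ℓ q y i) = eigenProj ℓ q y i := by
  rw [eigenProj, mul_smul_comm, smul_comm]
  congr 1
  rw [Finset.mul_sum, Finset.smul_sum]
  obtain ⟨m, rfl⟩ : ∃ m, ℓ = m + 1 := ⟨ℓ - 1, by omega⟩
  have h : ∀ j, q ^ i • (y * q ^ (i * j) • y ^ j) = q ^ (i * (j + 1)) • y ^ (j + 1) := by
    intro j
    rw [mul_smul_comm, smul_smul, ← pow_succ', ← pow_add]
    congr 2
    ring
  simp only [h]
  -- The last term of the shifted sum has exponent $\ell$; as $q^\ell=1$ and $y^\ell=1$, it is the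
  -- missing term $j=0$ of the original sum.
  rw [Finset.sum_range_succ, Finset.sum_range_succ' (fun j ↦ q ^ (i * j) • y ^ j), hy, mul_comm i,
    pow_mul, hq]
  simp

theorem commute_eigenProj (h : Commute u y) (i : ℕ) : Commute u (eigenProj ℓ q y i) :=
  Commute.smul_right (Commute.sum_right _ _ _ fun _ _ ↦ (h.pow_right _).smul_right _) _

/-- Moving $u$ across $x^ip_i$ costs $q^i$, and $q^iy$ acts as the identity on $p_i$. Hence the
pairing conjugates $uy$ to $u$. -/
theorem torusPairing_mul_of_mul_eq (hl : 0 < ℓ) (hq : q ^ ℓ = 1) (hy : y ^ ℓ = 1)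
    (hxu : x * u = q • (u * x)) (hyu : Commute y u) :
    torusPairing ℓ q x y * (u * y) = u * torusPairing ℓ q x y := by
  have hp : ∀ i : ℕ, x ^ i * u = q ^ i • (u * x ^ i) := by
    intro i
    induction i with
    | zero => simp
    | succ i ih =>
      rw [pow_succ, mul_assoc, hxu, mul_smul_comm, ← mul_assoc, ih, smul_mul_assoc, smul_smul,
        mul_assoc, pow_succ']
  simp only [torusPairing_eq, Finset.sum_mul, Finset.mul_sum]
  refine Finset.sum_congr rfl fun i _ ↦ ?_
  rw [mul_assoc, ← mul_assoc _ u, ← (commute_eigenProj hyu.symm i).eq, mul_assoc u,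
    ← (commute_eigenProj (Commute.refl y) i).eq, ← mul_assoc, hp, smul_mul_assoc, mul_assoc,
    ← mul_smul_comm, ← mul_smul_comm, mul_eigenProj hl hq hy]

/-- The same for the opposite weight: now the factor $q^{-i}$ is itself the action of $y$ on $p_i$,
so $u$ gains a factor $y$. -/
theorem torusPairing_mul_of_mul_eq_inv (hl : 0 < ℓ) (hq : q ^ ℓ = 1) (hy : y ^ ℓ = 1)
    (hxu : x * u = q⁻¹ • (u * x)) (hyu : Commute y u) (hxy : Commute x y) :
    torusPairing ℓ q x y * u = u * y * torusPairing ℓ q x y := by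
  have hq0 : q ≠ 0 := by
    rintro rfl
    rw [zero_pow hl.ne'] at hq
    exact zero_ne_one hq
  have hp : ∀ i : ℕ, q ^ i • (x ^ i * u) = u * x ^ i := by
    intro i
    induction i with
    | zero => simp
    | succ i ih =>
      rw [pow_succ x, mul_assoc, hxu, mul_smul_comm, smul_smul, pow_succ, mul_assoc,
        mul_inv_cancel₀ hq0, mul_one, ← mul_assoc, ← smul_mul_assoc, ih, mul_assoc]
  simp only [torusPairing_eq, Finset.sum_mul, Finset.mul_sum]
  refine Finset.sum_congr rfl fun i _ ↦ ?_
  rw [mul_assoc (x ^ i), ← (commute_eigenProj hyu.symm i).eq, ← mul_assoc]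
  conv_lhs => rw [← mul_eigenProj hl hq hy]
  rw [mul_smul_comm, ← smul_mul_assoc, hp, mul_assoc u y, ← mul_assoc y, (hxy.symm.pow_right i).eq]
  simp only [mul_assoc]

variable [CharZero 𝕜]

/-- Since $y^j$ acts on $p_{i'}$ as $q^{-i'j}$, the product is $p_{i'}$ times $\frac1\ell\sum_j
q^{(i-i')j}$, and primitivity makes this sum vanish unless $i=i'$. -/
theorem eigenProj_mul (hq : IsPrimitiveRoot q ℓ) (hy : y ^ ℓ = 1) {i i' : ℕ}
    (hi : i < ℓ) (hi' : i' < ℓ) :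
    eigenProj ℓ q y i * eigenProj ℓ q y i' = if i = i' then eigenProj ℓ q y i' else 0 := by
  have hl : 0 < ℓ := by omega
  have hq0 : q ≠ 0 := hq.ne_zero hl.ne'
  have h : ∀ j, y ^ j * eigenProj ℓ q y i' = q⁻¹ ^ (i' * j) • eigenProj ℓ q y i' := by
    intro j
    induction j with
    | zero => simp
    | succ j ih =>
      have : y * eigenProj ℓ q y i' = q⁻¹ ^ i' • eigenProj ℓ q y i' := by
        conv_rhs => rw [← mul_eigenProj hl hq.pow_eq_one hy, smul_smul, inv_pow,
          inv_mul_cancel₀ (pow_ne_zero _ hq0), one_smul]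
      rw [pow_succ, mul_assoc, this, mul_smul_comm, ih, smul_smul, ← pow_add]
      congr 2
      ring
  conv_lhs => enter [1]; rw [eigenProj]
  rw [smul_mul_assoc, Finset.sum_mul]
  simp only [smul_mul_assoc, h, smul_smul, ← Finset.sum_smul]
  have h2 : ∀ j, q ^ (i * j) * q⁻¹ ^ (i' * j) = (q ^ i * q⁻¹ ^ i') ^ j := by
    intro j; rw [mul_pow, pow_mul, pow_mul]
  have h3 : q ^ i * q⁻¹ ^ i' = 1 ↔ i = i' := by
    rw [inv_pow, mul_inv_eq_one₀ (pow_ne_zero _ hq0)]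
    exact ⟨fun h ↦ hq.pow_inj hi hi' h, fun h ↦ by rw [h]⟩
  simp only [h2]
  rw [sum_pow_eq_ite _ (by
    rw [mul_pow, ← pow_mul, ← pow_mul, mul_comm i, mul_comm i', pow_mul, pow_mul, inv_pow,
      hq.pow_eq_one]; simp)]
  simp only [h3]
  split_ifs with h4
  · rw [inv_mul_cancel₀ (Nat.cast_ne_zero.2 hl.ne'), one_smul]
  · simp

/-- Orthogonality of the projections of $y$ leaves only diagonal terms $x^ix'^ip_i=(xx')^ip_i$. This
multiplicativity is behind the cocycle identity, the hexagons and the final cancellation. -/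
theorem torusPairing_mul (hq : IsPrimitiveRoot q ℓ) (hy : y ^ ℓ = 1) (hx'y : Commute x' y)
    (hxx' : Commute x x') :
    torusPairing ℓ q x y * torusPairing ℓ q x' y = torusPairing ℓ q (x * x') y := by
  simp only [torusPairing_eq, Finset.sum_mul_sum]
  refine Finset.sum_congr rfl fun i hi ↦ ?_
  have hi := Finset.mem_range.1 hi
  rw [Finset.sum_eq_single i]
  · rw [mul_assoc, ← mul_assoc _ (x' ^ i), ← (commute_eigenProj (hx'y.pow_left i) i).eq, mul_assoc,
      eigenProj_mul hq hy hi hi, if_pos rfl, ← mul_assoc, hxx'.mul_pow]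
  · intro i' hi' hne
    rw [mul_assoc, ← mul_assoc _ (x' ^ i'), ← (commute_eigenProj (hx'y.pow_left i') i).eq,
      mul_assoc, eigenProj_mul hq hy hi (Finset.mem_range.1 hi'), if_neg hne.symm]
    simp
  · intro h
    exact absurd (Finset.mem_range.2 hi) h

theorem torusPairing_mul' (hq : IsPrimitiveRoot q ℓ) {y y' : C} (hx : x ^ ℓ = 1)
    (hxy : Commute x y) (hxy' : Commute x y') (hyy' : Commute y y') :
    torusPairing ℓ q x y * torusPairing ℓ q x y' = torusPairing ℓ q x (y * y') := by
  rw [torusPairing_symm ℓ q hxy, torusPairing_symm ℓ q hxy',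
    torusPairing_mul hq hx hxy'.symm hyy', torusPairing_symm ℓ q (hxy.mul_right hxy')]

/-- Summing over $i$ first gives $\sum_i q^{ij}$, which is zero except at $j=0$. -/
theorem torusPairing_one_left (hl : 0 < ℓ) (hq : IsPrimitiveRoot q ℓ) :
    torusPairing ℓ q 1 y = 1 := by
  rw [torusPairing, Finset.sum_comm]
  simp only [one_pow, one_mul, ← Finset.sum_smul]
  have h : ∀ j ∈ Finset.range ℓ, (∑ i ∈ Finset.range ℓ, (q ^ j) ^ i) • y ^ j
      = if j = 0 then (ℓ : 𝕜) • 1 else 0 := by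
    intro j hj
    rw [sum_pow_eq_ite _ (by rw [← pow_mul, mul_comm, pow_mul, hq.pow_eq_one, one_pow])]
    by_cases h : j = 0
    · simp [h]
    · rw [if_neg (hq.pow_ne_one_of_pos_of_lt h (Finset.mem_range.1 hj)), if_neg h, zero_smul]
  have h' := Finset.sum_congr rfl h
  simp only [← pow_mul, mul_comm] at h' ⊢
  rw [h', Finset.sum_ite_eq' , if_pos (Finset.mem_range.2 hl), smul_smul,
    inv_mul_cancel₀ (Nat.cast_ne_zero.2 hl.ne'), one_smul]

theorem torusPairing_one_right (hl : 0 < ℓ) (hq : IsPrimitiveRoot q ℓ) :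
    torusPairing ℓ q x 1 = 1 := by
  rw [torusPairing_symm ℓ q (Commute.one_right x), torusPairing_one_left hl hq]

theorem torusPairing_mul_cancel (hl : 0 < ℓ) (hq : IsPrimitiveRoot q ℓ) (hy : y ^ ℓ = 1)
    (hx'y : Commute x' y) (hxx' : Commute x x') (h : x * x' = 1) :
    torusPairing ℓ q x y * torusPairing ℓ q x' y = 1 := by
  rw [torusPairing_mul hq hy hx'y hxx', h, torusPairing_one_left hl hq]

theorem pow_mul_pow_sub_one {M : Type*} [Monoid M] {x : M} (hl : 0 < ℓ) (hx : x ^ ℓ = 1) :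
    x * x ^ (ℓ - 1) = 1 := by
  rw [← pow_succ', Nat.sub_add_cancel hl, hx]

theorem pow_sub_one_pow_eq_one {M : Type*} [Monoid M] {x : M} (hx : x ^ ℓ = 1) (n : ℕ) :
    (x ^ n) ^ ℓ = 1 := by
  rw [← pow_mul, mul_comm, pow_mul, hx, one_pow]

theorem torusPairing_inv (hl : 0 < ℓ) (hq : q ^ ℓ = 1) (hx : x ^ ℓ = 1) :
    torusPairing ℓ q⁻¹ (x ^ (ℓ - 1)) y = torusPairing ℓ q x y := by
  have hq' : q⁻¹ = q ^ (ℓ - 1) := by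
    refine inv_eq_of_mul_eq_one_right ?_
    rw [← pow_succ', Nat.sub_add_cancel hl, hq]
  rw [hq', torusPairing_pow ?_ hl hq hx]
  refine Nat.Coprime.symm ?_
  rw [Nat.coprime_self_sub_right (by omega)]
  simp

/-- By multiplicativity in the first argument the pairing of $x^{\ell-1}=x^{-1}$ with $y$ is the
inverse. -/
theorem isUnit_torusPairing (hl : 0 < ℓ) (hq : IsPrimitiveRoot q ℓ) (hx : x ^ ℓ = 1)
    (hy : y ^ ℓ = 1) (hxy : Commute x y) : IsUnit (torusPairing ℓ q x y) := by
  have h1 := pow_mul_pow_sub_one hl hx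
  have hc : Commute x (x ^ (ℓ - 1)) := Commute.self_pow x _
  exact ⟨⟨_, _, torusPairing_mul_cancel hl hq hy (hxy.pow_left _) hc h1,
    torusPairing_mul_cancel hl hq hy hxy hc.symm (hc.eq ▸ h1)⟩, rfl⟩

end Pairing

/-! ### The truncated q-exponential and its addition law -/

section QExp

variable {𝕜 : Type*} [Field 𝕜] {ζ : 𝕜} {ℓ : ℕ}

/-- The truncated `q`-exponential `∑_{m < ℓ} τ_m X ^ m`. -/
noncomputable def qExp {C : Type*} [Ring C] [Algebra 𝕜 C] (ℓ : ℕ) (ζ : 𝕜) (X : C) : C :=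
  ∑ m ∈ Finset.range ℓ, tauCoeff ζ m • X ^ m

theorem map_qExp {C C' : Type*} [Ring C] [Algebra 𝕜 C] [Ring C'] [Algebra 𝕜 C'] (g : C →ₐ[𝕜] C')
    (X : C) : g (qExp ℓ ζ X) = qExp ℓ ζ (g X) := by
  simp only [qExp, map_sum, map_smul, map_pow]

theorem semiconjBy_qExp {C : Type*} [Ring C] [Algebra 𝕜 C] {a X Y : C} (h : SemiconjBy a X Y) :
    SemiconjBy a (qExp ℓ ζ X) (qExp ℓ ζ Y) := by
  simp only [SemiconjBy, qExp, Finset.mul_sum, Finset.sum_mul, mul_smul_comm, smul_mul_assoc,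
    (h.pow_right _).eq]

/-- $[n]=0$ would force $\zeta^{2n}=1$; for $\ell$ odd $\zeta^2$ is again a primitive $\ell$-th root
of unity, so this fails for $0<n<\ell$. -/
theorem qFactorial_ne_zero (hζ : IsPrimitiveRoot ζ ℓ) (ho : Odd ℓ) (hl : 1 < ℓ) {m : ℕ}
    (hm : m < ℓ) : qFactorial ζ m ≠ 0 := by
  have h0 : ζ ≠ 0 := hζ.ne_zero (by omega)
  have h : ∀ n, 0 < n → n < ℓ → ζ ^ n - ζ⁻¹ ^ n ≠ 0 := by
    intro n hn hnl h
    rw [sub_eq_zero, inv_pow, ← mul_eq_one_iff_eq_inv₀ (pow_ne_zero _ h0), ← pow_two, ← pow_mul,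
      mul_comm, pow_mul] at h
    have hζ2 : IsPrimitiveRoot (ζ ^ 2) ℓ := hζ.pow_of_coprime 2 (Nat.coprime_two_left.2 ho)
    exact hζ2.pow_ne_one_of_pos_of_lt hn.ne' hnl h
  rw [qFactorial, Finset.prod_ne_zero_iff]
  intro s hs
  rw [Finset.mem_range] at hs
  refine div_ne_zero (h _ (by omega) (by omega)) ?_
  simpa using h 1 one_pos hl

theorem sub_inv_ne_zero (hζ : IsPrimitiveRoot ζ ℓ) (ho : Odd ℓ) (hl : 1 < ℓ) : ζ - ζ⁻¹ ≠ 0 := by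
  intro h
  have h1 := qFactorial_ne_zero hζ ho hl hl
  simp [qFactorial, qInt, h] at h1

theorem tauCoeff_zero : tauCoeff ζ 0 = 1 := by simp [tauCoeff, qFactorial]

/-- The factor $\zeta^m[m+1]$ is the one occurring in the commutators of $E$ with $F^{m+1}$ and of
$E^{m+1}$ with $F$; this recursion makes the sums in the intertwining relations telescope. -/
theorem tauCoeff_succ (hζ : IsPrimitiveRoot ζ ℓ) (ho : Odd ℓ) (hl : 1 < ℓ) {m : ℕ}
    (hm : m + 1 < ℓ) :
    tauCoeff ζ (m + 1) * (ζ ^ m * qInt ζ (m + 1)) = (ζ⁻¹ - ζ) * tauCoeff ζ m := by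
  have h0 : ζ ≠ 0 := hζ.ne_zero (by omega)
  have h1 := qFactorial_ne_zero hζ ho hl hm
  rw [qFactorial, Finset.prod_range_succ, ← qFactorial] at h1
  -- The exponents $m(m-1)/2$ are natural-number quotients; both are rewritten as sums $0+1+\dots$
  -- so that the difference $m$ becomes visible.
  have h2 : (m + 1) * (m + 1 - 1) / 2 = m * (m - 1) / 2 + m := by
    rw [← Finset.sum_range_id_mul_two, ← Finset.sum_range_id_mul_two, Nat.mul_div_cancel _ two_pos,
      Nat.mul_div_cancel _ two_pos, Finset.sum_range_succ]
  have h3 := (mul_ne_zero_iff.1 h1).1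
  have h4 := (mul_ne_zero_iff.1 h1).2
  rw [tauCoeff, tauCoeff, h2, qFactorial, Finset.prod_range_succ, ← qFactorial, pow_add, pow_succ]
  field_simp
  ring

theorem tauCoeff_succ' (hζ : IsPrimitiveRoot ζ ℓ) (ho : Odd ℓ) (hl : 1 < ℓ) {m : ℕ}
    (hm : m + 1 < ℓ) :
    tauCoeff ζ (m + 1) * ((ζ - ζ⁻¹)⁻¹ * (ζ ^ m * qInt ζ (m + 1))) = -tauCoeff ζ m := by
  rw [mul_left_comm, tauCoeff_succ hζ ho hl hm, ← neg_sub ζ, neg_mul, mul_neg,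
    inv_mul_cancel_left₀ (sub_inv_ne_zero hζ ho hl)]

/-- Because $1-\zeta^{2(m+1)}=(1-\zeta^2)\,\zeta^m[m+1]$, the $\tau_m$ are, up to the $m$-th power
of a constant, inverses of the products $\prod_{s\le m}(1-\zeta^{2s})$: the series is Euler's
$q$-exponential in base $\zeta^2$. -/
theorem tauCoeff_mul_prod (hζ : IsPrimitiveRoot ζ ℓ) (ho : Odd ℓ) (hl : 1 < ℓ) {m : ℕ}
    (hm : m < ℓ) :
    tauCoeff ζ m * ∏ s ∈ Finset.range m, (1 - (ζ ^ 2) ^ (s + 1))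
      = ((ζ⁻¹ - ζ) * (1 - ζ ^ 2)) ^ m := by
  have h0 : ζ ≠ 0 := hζ.ne_zero (by omega)
  induction m with
  | zero => simp [tauCoeff_zero]
  | succ m ih =>
    have h := tauCoeff_succ hζ ho hl hm
    have h2 : 1 - (ζ ^ 2) ^ (m + 1) = (1 - ζ ^ 2) * (ζ ^ m * qInt ζ (m + 1)) := by
      have := sub_inv_ne_zero hζ ho hl
      rw [qInt, ← mul_assoc, mul_div_assoc', eq_div_iff this, inv_pow]
      field_simp
      ring
    rw [Finset.prod_range_succ, h2, pow_succ _ m, ← ih (by omega)]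
    calc _ = (tauCoeff ζ (m + 1) * (ζ ^ m * qInt ζ (m + 1)))
          * ((∏ s ∈ Finset.range m, (1 - (ζ ^ 2) ^ (s + 1))) * (1 - ζ ^ 2)) := by ring
      _ = _ := by rw [h]; ring

/-- In the form $\tau_m=c^m/\prod_{s\le m}(1-\zeta^{2s})$ the powers of $c$ match, and the quotient
of the products is the Gaussian binomial coefficient. -/
theorem tauCoeff_add (hζ : IsPrimitiveRoot ζ ℓ) (ho : Odd ℓ) (hl : 1 < ℓ) {i j : ℕ}
    (hij : i + j < ℓ) :
    tauCoeff ζ (i + j) * qBinom (ζ ^ 2) i j = tauCoeff ζ i * tauCoeff ζ j := by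
  have hζ2 : IsPrimitiveRoot (ζ ^ 2) ℓ := hζ.pow_of_coprime 2 (Nat.coprime_two_left.2 ho)
  have hne : ∀ m, m < ℓ → ∏ s ∈ Finset.range m, (1 - (ζ ^ 2) ^ (s + 1)) ≠ 0 := by
    intro m hm
    rw [Finset.prod_ne_zero_iff]
    intro s hs
    rw [Finset.mem_range] at hs
    exact sub_ne_zero.2 (hζ2.pow_ne_one_of_pos_of_lt (by omega) (by omega)).symm
  have h1 := tauCoeff_mul_prod hζ ho hl hij
  have h2 := tauCoeff_mul_prod hζ ho hl (show i < ℓ by omega)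
  have h3 := tauCoeff_mul_prod hζ ho hl (show j < ℓ by omega)
  refine mul_right_cancel₀ (mul_ne_zero (hne i (by omega)) (hne j (by omega))) ?_
  calc _ = tauCoeff ζ (i + j) * (qBinom (ζ ^ 2) i j
        * (∏ s ∈ Finset.range i, (1 - (ζ ^ 2) ^ (s + 1)))
        * (∏ s ∈ Finset.range j, (1 - (ζ ^ 2) ^ (s + 1)))) := by ring
    _ = (tauCoeff ζ i * ∏ s ∈ Finset.range i, (1 - (ζ ^ 2) ^ (s + 1)))
        * (tauCoeff ζ j * ∏ s ∈ Finset.range j, (1 - (ζ ^ 2) ^ (s + 1))) := by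
      rw [qBinom_mul, h1, h2, h3, pow_add]
    _ = _ := by ring

/-- The $q$-binomial theorem expands the left side over pairs $i+j<\ell$, while the product of the
truncated series runs over all $i,j<\ell$. The vanishing hypothesis removes the surplus pairs, which
the truncation on the left does not contain. -/
theorem qExp_add (hζ : IsPrimitiveRoot ζ ℓ) (ho : Odd ℓ) (hl : 1 < ℓ) {C : Type*} [Ring C]
    [Algebra 𝕜 C] {a b : C} (hab : b * a = ζ ^ 2 • (a * b))
    (h0 : ∀ i j, ℓ ≤ i + j → a ^ i * b ^ j = 0) :
    qExp ℓ ζ (a + b) = qExp ℓ ζ a * qExp ℓ ζ b := by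
  let g : ℕ × ℕ → C := fun p ↦ (tauCoeff ζ p.1 * tauCoeff ζ p.2) • (a ^ p.1 * b ^ p.2)
  have h1 : qExp ℓ ζ (a + b) = ∑ m ∈ Finset.range ℓ, ∑ p ∈ Finset.HasAntidiagonal.antidiagonal m, g p := by
    refine Finset.sum_congr rfl fun m hm ↦ ?_
    rw [add_pow_of_mul_eq_smul _ _ _ hab, Finset.smul_sum]
    refine Finset.sum_congr rfl fun p hp ↦ ?_
    rw [Finset.mem_range] at hm
    rw [Finset.HasAntidiagonal.mem_antidiagonal] at hp
    subst hp
    rw [smul_smul, tauCoeff_add hζ ho hl hm]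
  have h2 : qExp ℓ ζ a * qExp ℓ ζ b = ∑ p ∈ Finset.range ℓ ×ˢ Finset.range ℓ, g p := by
    rw [qExp, qExp, Finset.sum_mul_sum, Finset.sum_product]
    simp only [g, smul_mul_smul_comm]
  rw [h1, h2, Finset.sum_sigma']
  have h3 : ∑ p ∈ Finset.range ℓ ×ˢ Finset.range ℓ, g p
      = ∑ p ∈ (Finset.range ℓ ×ˢ Finset.range ℓ).filter (fun p ↦ p.1 + p.2 < ℓ), g p := by
    refine (Finset.sum_filter_of_ne fun p _ hp ↦ ?_).symm
    by_contra h
    exact hp (by simp only [g, h0 _ _ (not_lt.1 h), smul_zero])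
  rw [h3]
  -- Pairs with total degree below $\ell$ are sorted by their total degree.
  refine Finset.sum_bij' (fun p _ ↦ p.2) (fun p _ ↦ ⟨p.1 + p.2, p⟩) ?_ ?_ ?_ ?_ ?_
  · rintro ⟨m, p⟩ hp
    simp only [Finset.mem_sigma, Finset.mem_range, Finset.HasAntidiagonal.mem_antidiagonal,
      Finset.mem_filter, Finset.mem_product] at hp ⊢
    omega
  · rintro p hp
    simp only [Finset.mem_sigma, Finset.mem_range, Finset.HasAntidiagonal.mem_antidiagonal,
      Finset.mem_filter, Finset.mem_product] at hp ⊢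
    exact ⟨hp.2, trivial⟩
  · rintro ⟨m, p⟩ hp
    simp only [Finset.mem_sigma, Finset.HasAntidiagonal.mem_antidiagonal] at hp
    obtain ⟨_, rfl⟩ := hp
    rfl
  · intros; rfl
  · intros; rfl

/-- The constant term is $\tau_0=1$ and the rest is divisible by the nilpotent $X$, with a cofactor
that commutes with $X$. -/
theorem isUnit_qExp (hl : 0 < ℓ) {C : Type*} [Ring C] [Algebra 𝕜 C] {X : C} (hX : X ^ ℓ = 0) :
    IsUnit (qExp ℓ ζ X) := by
  obtain ⟨n, rfl⟩ : ∃ n, ℓ = n + 1 := ⟨ℓ - 1, by omega⟩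
  rw [qExp, Finset.sum_range_succ', pow_zero, tauCoeff_zero, one_smul, add_comm]
  refine IsNilpotent.isUnit_one_add ?_
  have h : ∑ m ∈ Finset.range n, tauCoeff ζ (m + 1) • X ^ (m + 1)
      = X * ∑ m ∈ Finset.range n, tauCoeff ζ (m + 1) • X ^ m := by
    simp only [Finset.mul_sum, mul_smul_comm, pow_succ']
  rw [h]
  refine Commute.isNilpotent_mul_right ?_ ⟨_, hX⟩
  exact Commute.sum_right _ _ _ fun m _ ↦ (Commute.self_pow X m).smul_right _

end QExp

/-! ### Reduction of the R-matrix axioms to algebra generators -/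

section Legs

open Coalgebra

variable (R A : Type*) [CommRing R] [Ring A]

/-- `Δ ⊗ id` as an algebra homomorphism. -/
noncomputable def comulLeft [Bialgebra R A] : A ⊗[R] A →ₐ[R] A ⊗[R] (A ⊗[R] A) :=
  (Algebra.TensorProduct.assoc R R R A A A).toAlgHom.comp
    (Algebra.TensorProduct.map (Bialgebra.comulAlgHom R A) (AlgHom.id R A))

/-- `id ⊗ Δ` as an algebra homomorphism. -/
noncomputable def comulRight [Bialgebra R A] : A ⊗[R] A →ₐ[R] A ⊗[R] (A ⊗[R] A) :=
  Algebra.TensorProduct.map (AlgHom.id R A) (Bialgebra.comulAlgHom R A)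

variable {R A}

theorem assoc_rTensor_comul [Bialgebra R A] (t : A ⊗[R] A) :
    TensorProduct.assoc R A A A ((comul (R := R)).rTensor A t) = comulLeft R A t := by
  rfl

theorem lTensor_comul [Bialgebra R A] (t : A ⊗[R] A) :
    (comul (R := R)).lTensor A t = comulRight R A t := by
  rfl

variable [HopfAlgebra R A]

/-- The Hopf axioms are already known and the hexagons concern $\mathcal R$ alone; only the
intertwining relation quantifies over $a$, and the $a$ that satisfy it form a subalgebra because
$\Delta$ and the flip are multiplicative. -/
theorem IsUniversalR.of_generators {𝓡 : A ⊗[R] A} {s : Set A} (hs : Algebra.adjoin R s = ⊤)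
    (hu : IsUnit 𝓡) (h1 : comulLeft R A 𝓡 = leg13 R A 𝓡 * leg23 R A 𝓡)
    (h2 : comulRight R A 𝓡 = leg13 R A 𝓡 * leg12 R A 𝓡)
    (h3 : ∀ a ∈ s, 𝓡 * comul (R := R) a = TensorProduct.comm R A A (comul a) * 𝓡) :
    IsUniversalR 𝓡 where
  coassoc a := Coalgebra.coassoc_apply a
  counit_left a := by simp
  counit_right a := by simp
  comul_one := Bialgebra.comul_one
  comul_mul := Bialgebra.comul_mul
  counit_one := Bialgebra.counit_one
  counit_mul := Bialgebra.counit_mul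
  antipode_left a := HopfAlgebra.mul_antipode_rTensor_comul_apply a
  antipode_right a := HopfAlgebra.mul_antipode_lTensor_comul_apply a
  isUnit := hu
  comul_rTensor := h1
  comul_lTensor := h2
  mul_comul a := by
    have ha : a ∈ Algebra.adjoin R s := by rw [hs]; trivial
    have hm : ∀ x y : A ⊗[R] A, TensorProduct.comm R A A (x * y)
        = TensorProduct.comm R A A x * TensorProduct.comm R A A y :=
      map_mul (Algebra.TensorProduct.comm R A A)
    induction ha using Algebra.adjoin_induction with
    | mem x hx => exact h3 x hx
    | algebraMap r =>
      have : TensorProduct.comm R A A (1 : A ⊗[R] A) = 1 := map_one (Algebra.TensorProduct.comm R A A)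
      rw [Algebra.algebraMap_eq_smul_one, map_smul, Bialgebra.comul_one, map_smul, this,
        mul_smul_comm, smul_mul_assoc, mul_one, one_mul]
    | add x y _ _ hx hy => simp only [map_add, mul_add, add_mul, hx, hy]
    | mul x y _ _ hx hy =>
      rw [Bialgebra.comul_mul, ← mul_assoc, hx, mul_assoc, hy, hm, mul_assoc]

theorem IsUniversalR.comulLeft_eq {𝓡 : A ⊗[R] A} (h : IsUniversalR 𝓡) :
    comulLeft R A 𝓡 = leg13 R A 𝓡 * leg23 R A 𝓡 := h.comul_rTensor

theorem IsUniversalR.comulRight_eq {𝓡 : A ⊗[R] A} (h : IsUniversalR 𝓡) :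
    comulRight R A 𝓡 = leg13 R A 𝓡 * leg12 R A 𝓡 := h.comul_lTensor

end Legs

/-! ### The group algebra and its R-matrix -/

namespace CyclicAlgebra

open Coalgebra

variable {𝕜 : Type*} [Field 𝕜] {ℓ : ℕ}

theorem z_pow (n : ℕ) : z 𝕜 ℓ ^ n = MonoidAlgebra.of 𝕜 (Multiplicative (ZMod ℓ))
    (Multiplicative.ofAdd (n : ZMod ℓ)) := by
  rw [z, ← map_pow, ← ofAdd_nsmul, nsmul_one]

theorem z_pow_card : z 𝕜 ℓ ^ ℓ = 1 := by
  rw [z_pow, ZMod.natCast_self, ofAdd_zero, map_one]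

@[simp] theorem comul_z : comul (R := 𝕜) (z 𝕜 ℓ) = z 𝕜 ℓ ⊗ₜ z 𝕜 ℓ := by
  simp [z, MonoidAlgebra.of]

@[simp] theorem counit_z : counit (R := 𝕜) (z 𝕜 ℓ) = 1 := by
  simp [z, MonoidAlgebra.of]

theorem antipode_z [NeZero ℓ] : HopfAlgebra.antipode 𝕜 (z 𝕜 ℓ) = z 𝕜 ℓ ^ (ℓ - 1) := by
  rw [z_pow, Nat.cast_sub (Nat.pos_of_ne_zero (NeZero.ne ℓ)), ZMod.natCast_self]
  simp [z, MonoidAlgebra.of]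

theorem span_z_pow [NeZero ℓ] :
    Submodule.span 𝕜 (Set.range fun d : Fin ℓ ↦ z 𝕜 ℓ ^ (d : ℕ)) = ⊤ := by
  rw [eq_top_iff]
  rintro x -
  induction x using MonoidAlgebra.induction_on with
  | of m =>
    refine Submodule.subset_span ⟨⟨ZMod.val (Multiplicative.toAdd m), ZMod.val_lt _⟩, ?_⟩
    simp [z_pow]
  | add x y hx hy => exact Submodule.add_mem _ hx hy
  | smul c x hx => exact Submodule.smul_mem _ _ hx

theorem adjoin_z [NeZero ℓ] : Algebra.adjoin 𝕜 {z 𝕜 ℓ} = ⊤ := by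
  rw [← Algebra.toSubmodule_eq_top, eq_top_iff, ← span_z_pow, Submodule.span_le]
  rintro _ ⟨d, rfl⟩
  exact Subalgebra.pow_mem (Algebra.adjoin 𝕜 {z 𝕜 ℓ}) (Algebra.subset_adjoin rfl) _

/-- The homomorphism `z ↦ x`, where `x ^ ℓ = 1`. -/
noncomputable def lift [NeZero ℓ] {A : Type*} [Ring A] [Algebra 𝕜 A] (x : A) (hx : x ^ ℓ = 1) :
    CyclicAlgebra 𝕜 ℓ →ₐ[𝕜] A :=
  MonoidAlgebra.lift 𝕜 A (Multiplicative (ZMod ℓ))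
    { toFun := fun m ↦ x ^ (Multiplicative.toAdd m).val
      map_one' := by simp
      map_mul' := fun a b ↦ by
        rw [toAdd_mul, ZMod.val_add, pow_mod_of_pow_eq_one hx, pow_add] }

@[simp] theorem lift_z [NeZero ℓ] [Fact (1 < ℓ)] {A : Type*} [Ring A] [Algebra 𝕜 A] (x : A)
    (hx : x ^ ℓ = 1) : lift (𝕜 := 𝕜) x hx (z 𝕜 ℓ) = x := by
  simp [lift, z, ZMod.val_one]

/-- The R-matrix is the torus pairing of $z\otimes1$ and $1\otimes z$ at $q=\zeta^{-2}$. As $z$ is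
group-like, the hexagons are multiplicativity in each argument; the intertwining relation is trivial
since $\mathscr A$ is commutative and $\Delta(z)$ is symmetric. -/
theorem isUniversalR [CharZero 𝕜] {ζ : 𝕜} (ho : Odd ℓ) (hζ : IsPrimitiveRoot ζ ℓ) :
    IsUniversalR (rMatrix 𝕜 ζ ℓ) := by
  have hl := ho.pos
  have : NeZero ℓ := ⟨hl.ne'⟩
  have hq : IsPrimitiveRoot (ζ⁻¹ ^ 2) ℓ :=
    hζ.inv.pow_of_coprime 2 (Nat.coprime_two_left.2 ho)
  have hz := z_pow_card (𝕜 := 𝕜) (ℓ := ℓ)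
  have hp : ∀ {A B : Type _} [Ring A] [Algebra 𝕜 A] [Ring B] [Algebra 𝕜 B] (a : A) (b : B),
    a ^ ℓ = 1 → b ^ ℓ = 1 → (a ⊗ₜ[𝕜] b) ^ ℓ = 1 := by
    intro A B _ _ _ _ a b ha hb
    rw [Algebra.TensorProduct.tmul_pow, ha, hb, Algebra.TensorProduct.one_def]
  have hc : ∀ x y : CyclicAlgebra 𝕜 ℓ ⊗[𝕜] (CyclicAlgebra 𝕜 ℓ ⊗[𝕜] CyclicAlgebra 𝕜 ℓ), Commute x y :=
    fun x y ↦ mul_comm x y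
  refine IsUniversalR.of_generators adjoin_z ?_ ?_ ?_ ?_
  · rw [rMatrix, bicharacter_eq_torusPairing]
    exact isUnit_torusPairing hl hq (hp _ _ hz (one_pow _)) (hp _ _ (one_pow _) hz)
      (Commute.all _ _)
  · rw [rMatrix, bicharacter_eq_torusPairing]
    simp only [map_torusPairing]
    have h1 : comulLeft 𝕜 (CyclicAlgebra 𝕜 ℓ) (z 𝕜 ℓ ⊗ₜ 1)
        = leg13 𝕜 _ (z 𝕜 ℓ ⊗ₜ 1) * leg23 𝕜 _ (z 𝕜 ℓ ⊗ₜ 1) := by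
      simp [comulLeft, leg13, leg23]
    have h2 : comulLeft 𝕜 (CyclicAlgebra 𝕜 ℓ) (1 ⊗ₜ z 𝕜 ℓ) = leg13 𝕜 _ (1 ⊗ₜ z 𝕜 ℓ) := by
      simp [comulLeft, leg13, Algebra.TensorProduct.one_def]
    have h3 : leg23 𝕜 (CyclicAlgebra 𝕜 ℓ) (1 ⊗ₜ z 𝕜 ℓ) = leg13 𝕜 _ (1 ⊗ₜ z 𝕜 ℓ) := by
      simp [leg13, leg23]
    rw [h1, h2, h3, torusPairing_mul hq _ (hc _ _) (hc _ _)]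
    rw [← map_pow, hp _ _ (one_pow _) hz, map_one]
  · rw [rMatrix, bicharacter_eq_torusPairing]
    simp only [map_torusPairing]
    have h1 : comulRight 𝕜 (CyclicAlgebra 𝕜 ℓ) (1 ⊗ₜ z 𝕜 ℓ)
        = leg13 𝕜 _ (1 ⊗ₜ z 𝕜 ℓ) * leg12 𝕜 _ (1 ⊗ₜ z 𝕜 ℓ) := by
      simp [comulRight, leg13, leg12]
    have h2 : comulRight 𝕜 (CyclicAlgebra 𝕜 ℓ) (z 𝕜 ℓ ⊗ₜ 1) = leg13 𝕜 _ (z 𝕜 ℓ ⊗ₜ 1) := by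
      simp [comulRight, leg13, Algebra.TensorProduct.one_def]
    have h3 : leg12 𝕜 (CyclicAlgebra 𝕜 ℓ) (z 𝕜 ℓ ⊗ₜ 1) = leg13 𝕜 _ (z 𝕜 ℓ ⊗ₜ 1) := by
      simp [leg13, leg12]
    rw [h1, h2, h3, torusPairing_mul' hq _ (hc _ _) (hc _ _) (hc _ _)]
    rw [← map_pow, hp _ _ hz (one_pow _), map_one]
  · rintro _ rfl
    rw [comul_z, TensorProduct.comm_tmul, mul_comm]

end CyclicAlgebra

/-! ### Commutators of powers in the small quantum group -/

namespace SmallQuantumSL2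

open Coalgebra

variable {𝕜 : Type*} [Field 𝕜] {ζ : 𝕜} {ℓ : ℕ}

theorem rMatrix_eq : rMatrix 𝕜 ζ ℓ = qExp ℓ ζ (E 𝕜 ζ ℓ ⊗ₜ[𝕜] F 𝕜 ζ ℓ)
    * torusPairing ℓ (ζ ^ 2) (K 𝕜 ζ ℓ ⊗ₜ[𝕜] 1) (1 ⊗ₜ[𝕜] K 𝕜 ζ ℓ) := by
  simp only [rMatrix, bicharacter_eq_torusPairing, qExp, Algebra.TensorProduct.tmul_pow]

variable [Fact (Odd ℓ)] [Fact (IsPrimitiveRoot ζ ℓ)]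

theorem K_mul_E_pow (m : ℕ) :
    K 𝕜 ζ ℓ * E 𝕜 ζ ℓ ^ m = (ζ ^ 2) ^ m • (E 𝕜 ζ ℓ ^ m * K 𝕜 ζ ℓ) := by
  induction m with
  | zero => simp
  | succ m ih =>
    rw [pow_succ, ← mul_assoc, ih, smul_mul_assoc, mul_assoc, K_mul_E, mul_smul_comm, smul_smul,
      ← mul_assoc, pow_succ (ζ ^ 2)]

theorem K_inv_mul_E_pow (m : ℕ) : K 𝕜 ζ ℓ ^ (ℓ - 1) * E 𝕜 ζ ℓ ^ m
    = (ζ⁻¹ ^ 2) ^ m • (E 𝕜 ζ ℓ ^ m * K 𝕜 ζ ℓ ^ (ℓ - 1)) := by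
  induction m with
  | zero => simp
  | succ m ih =>
    rw [pow_succ, ← mul_assoc, ih, smul_mul_assoc, mul_assoc, K_inv_mul_E, mul_smul_comm, smul_smul,
      ← mul_assoc, pow_succ (ζ⁻¹ ^ 2)]

theorem K_mul_F_pow (m : ℕ) :
    K 𝕜 ζ ℓ * F 𝕜 ζ ℓ ^ m = (ζ⁻¹ ^ 2) ^ m • (F 𝕜 ζ ℓ ^ m * K 𝕜 ζ ℓ) := by
  induction m with
  | zero => simp
  | succ m ih =>
    rw [pow_succ, ← mul_assoc, ih, smul_mul_assoc, mul_assoc, K_mul_F, mul_smul_comm, smul_smul,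
      ← mul_assoc, pow_succ (ζ⁻¹ ^ 2)]

/-- Commutation with $F$ is a derivation, so the commutator grows by one term at a time. The torus
part is kept on the right and $\zeta^m[m+1]$ is pulled out, in order to match the recursion of the
$\tau_m$. -/
theorem E_pow_mul_F (m : ℕ) (hl : 1 < ℓ) :
    E 𝕜 ζ ℓ ^ (m + 1) * F 𝕜 ζ ℓ - F 𝕜 ζ ℓ * E 𝕜 ζ ℓ ^ (m + 1)
      = (ζ - ζ⁻¹)⁻¹ • (ζ ^ m * qInt ζ (m + 1)) •
        (E 𝕜 ζ ℓ ^ m * (K 𝕜 ζ ℓ - (ζ⁻¹ ^ 2) ^ m • K 𝕜 ζ ℓ ^ (ℓ - 1))) := by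
  have h0 : ζ ≠ 0 := zeta_ne_zero ℓ
  have h1 : ζ - ζ⁻¹ ≠ 0 := sub_inv_ne_zero Fact.out Fact.out hl
  have h2 : ζ - ζ⁻¹ = (ζ ^ 2 - 1) / ζ := by field_simp
  have h4 : ζ ^ 2 - 1 ≠ 0 := fun h ↦ h1 (by rw [h2, h, zero_div])
  induction m with
  | zero => simp [E_F, qInt, div_self h1]
  | succ m ih =>
    have : E 𝕜 ζ ℓ ^ (m + 1 + 1) * F 𝕜 ζ ℓ - F 𝕜 ζ ℓ * E 𝕜 ζ ℓ ^ (m + 1 + 1)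
        = E 𝕜 ζ ℓ ^ (m + 1) * (E 𝕜 ζ ℓ * F 𝕜 ζ ℓ - F 𝕜 ζ ℓ * E 𝕜 ζ ℓ)
          + (E 𝕜 ζ ℓ ^ (m + 1) * F 𝕜 ζ ℓ - F 𝕜 ζ ℓ * E 𝕜 ζ ℓ ^ (m + 1)) * E 𝕜 ζ ℓ := by
      rw [pow_succ _ (m + 1)]
      noncomm_ring
    rw [this, E_F, ih]
    simp only [smul_mul_assoc, mul_assoc, sub_mul, K_mul_E, K_inv_mul_E, mul_sub, mul_smul_comm,
      smul_sub, smul_smul]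
    simp only [← mul_assoc, ← pow_succ]
    have h3 : ∀ (a b c d e f : 𝕜) (x y : SmallQuantumSL2 𝕜 ζ ℓ), a + c = e → b + d = f →
        a • x - b • y + (c • x - d • y) = e • x - f • y := by
      rintro a b c d e f x y rfl rfl
      rw [add_smul, add_smul]; abel
    -- The coefficients of $E^{m+1}K$ and of $E^{m+1}K^{-1}$ are compared separately; each is an
    -- identity of rational functions in $\zeta$.
    refine h3 _ _ _ _ _ _ _ _ ?_ ?_ <;>
    · simp only [qInt, inv_pow, h2]
      field_simp
      ring

/-- Mirror image of the preceding formula. It is used twice: for the R-matrix, and to move $E$ past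
powers of $F$ when monomials are reordered. -/
theorem E_mul_F_pow (m : ℕ) (hl : 1 < ℓ) :
    E 𝕜 ζ ℓ * F 𝕜 ζ ℓ ^ (m + 1) - F 𝕜 ζ ℓ ^ (m + 1) * E 𝕜 ζ ℓ
      = (ζ - ζ⁻¹)⁻¹ • (ζ ^ m * qInt ζ (m + 1)) •
        (F 𝕜 ζ ℓ ^ m * ((ζ⁻¹ ^ 2) ^ m • K 𝕜 ζ ℓ - K 𝕜 ζ ℓ ^ (ℓ - 1))) := by
  have h0 : ζ ≠ 0 := zeta_ne_zero ℓ
  have h1 : ζ - ζ⁻¹ ≠ 0 := sub_inv_ne_zero Fact.out Fact.out hl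
  have h2 : ζ - ζ⁻¹ = (ζ ^ 2 - 1) / ζ := by field_simp
  have h4 : ζ ^ 2 - 1 ≠ 0 := fun h ↦ h1 (by rw [h2, h, zero_div])
  induction m with
  | zero => simp [E_F, qInt, div_self h1]
  | succ m ih =>
    have : E 𝕜 ζ ℓ * F 𝕜 ζ ℓ ^ (m + 1 + 1) - F 𝕜 ζ ℓ ^ (m + 1 + 1) * E 𝕜 ζ ℓ
        = F 𝕜 ζ ℓ ^ (m + 1) * (E 𝕜 ζ ℓ * F 𝕜 ζ ℓ - F 𝕜 ζ ℓ * E 𝕜 ζ ℓ)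
          + (E 𝕜 ζ ℓ * F 𝕜 ζ ℓ ^ (m + 1) - F 𝕜 ζ ℓ ^ (m + 1) * E 𝕜 ζ ℓ) * F 𝕜 ζ ℓ := by
      rw [pow_succ _ (m + 1)]
      noncomm_ring
    rw [this, E_F, ih]
    simp only [smul_mul_assoc, mul_assoc, sub_mul, K_mul_F, K_inv_mul_F, mul_sub, mul_smul_comm,
      smul_sub, smul_smul]
    simp only [← mul_assoc, ← pow_succ]
    have h3 : ∀ (a b c d e f : 𝕜) (x y : SmallQuantumSL2 𝕜 ζ ℓ), a + c = e → b + d = f →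
        a • x - b • y + (c • x - d • y) = e • x - f • y := by
      rintro a b c d e f x y rfl rfl
      rw [add_smul, add_smul]; abel
    refine h3 _ _ _ _ _ _ _ _ ?_ ?_ <;>
    · simp only [qInt, inv_pow, h2]
      field_simp
      ring

end SmallQuantumSL2

/-! ### Quasi-triangularity of the small quantum group -/

namespace SmallQuantumSL2

open Coalgebra

variable {𝕜 : Type*} [Field 𝕜] {ζ : 𝕜} {ℓ : ℕ} [Fact (Odd ℓ)] [Fact (IsPrimitiveRoot ζ ℓ)]

/-- The elements on both sides are what remains of $\Delta(E)$ and $\Delta^{\mathrm{op}}(E)$ after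
the torus factor has been passed. In the difference, the commutator of $1\otimes E$ with the term of
degree $m+1$ cancels the contribution of $E\otimes K^{\mp1}$ in degree $m$. -/
theorem qExp_mul_E (hl : 1 < ℓ) :
    qExp ℓ ζ (E 𝕜 ζ ℓ ⊗ₜ[𝕜] F 𝕜 ζ ℓ) * (E 𝕜 ζ ℓ ⊗ₜ (K 𝕜 ζ ℓ ^ (ℓ - 1)) + 1 ⊗ₜ E 𝕜 ζ ℓ)
      = (E 𝕜 ζ ℓ ⊗ₜ K 𝕜 ζ ℓ + 1 ⊗ₜ E 𝕜 ζ ℓ) * qExp ℓ ζ (E 𝕜 ζ ℓ ⊗ₜ[𝕜] F 𝕜 ζ ℓ) := by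
  obtain ⟨n, hn⟩ : ∃ n, ℓ = n + 1 := ⟨ℓ - 1, by omega⟩
  have hE := E_pow (𝕜 := 𝕜) (ζ := ζ) (ℓ := ℓ)
  have key : ∀ m ∈ Finset.range n, tauCoeff ζ (m + 1) • ((E 𝕜 ζ ℓ ^ (m + 1)) ⊗ₜ[𝕜]
      (E 𝕜 ζ ℓ * F 𝕜 ζ ℓ ^ (m + 1) - F 𝕜 ζ ℓ ^ (m + 1) * E 𝕜 ζ ℓ))
      = tauCoeff ζ m • ((E 𝕜 ζ ℓ ^ (m + 1)) ⊗ₜ[𝕜]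
        (F 𝕜 ζ ℓ ^ m * K 𝕜 ζ ℓ ^ (ℓ - 1) - K 𝕜 ζ ℓ * F 𝕜 ζ ℓ ^ m)) := by
    intro m hm
    rw [Finset.mem_range] at hm
    have h2 := tauCoeff_succ' (ζ := ζ) Fact.out Fact.out hl (m := m) (by omega)
    rw [E_mul_F_pow m hl, smul_smul, TensorProduct.tmul_smul, smul_smul, h2, neg_smul, ← smul_neg,
      ← TensorProduct.tmul_neg, ← mul_neg, neg_sub, K_mul_F_pow, ← mul_smul_comm, ← mul_sub]
  rw [← sub_eq_zero]
  have h1 : ∀ m, tauCoeff ζ m • (E 𝕜 ζ ℓ ⊗ₜ[𝕜] F 𝕜 ζ ℓ) ^ m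
        * (E 𝕜 ζ ℓ ⊗ₜ (K 𝕜 ζ ℓ ^ (ℓ - 1)) + 1 ⊗ₜ E 𝕜 ζ ℓ)
      - (E 𝕜 ζ ℓ ⊗ₜ K 𝕜 ζ ℓ + 1 ⊗ₜ E 𝕜 ζ ℓ) * (tauCoeff ζ m • (E 𝕜 ζ ℓ ⊗ₜ[𝕜] F 𝕜 ζ ℓ) ^ m)
      = tauCoeff ζ m • ((E 𝕜 ζ ℓ ^ (m + 1)) ⊗ₜ[𝕜]
        (F 𝕜 ζ ℓ ^ m * K 𝕜 ζ ℓ ^ (ℓ - 1) - K 𝕜 ζ ℓ * F 𝕜 ζ ℓ ^ m))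
      - tauCoeff ζ m • ((E 𝕜 ζ ℓ ^ m) ⊗ₜ[𝕜]
      (E 𝕜 ζ ℓ * F 𝕜 ζ ℓ ^ m - F 𝕜 ζ ℓ ^ m * E 𝕜 ζ ℓ)) := by
    intro m
    simp only [Algebra.TensorProduct.tmul_pow, mul_add, add_mul, smul_mul_assoc, mul_smul_comm,
      Algebra.TensorProduct.tmul_mul_tmul, mul_one, one_mul, TensorProduct.tmul_sub, smul_sub,
      ← pow_succ, ← pow_succ']
    abel
  rw [qExp, Finset.sum_mul, Finset.mul_sum, ← Finset.sum_sub_distrib]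
  simp only [h1]
  -- After the shift by one degree two terms are left: the top one contains $E^\ell=0$, and the
  -- bottom one is the commutator of $E$ with $F^0=1$.
  rw [Finset.sum_sub_distrib, sub_eq_zero, hn, Finset.sum_range_succ, Finset.sum_range_succ', ← hn,
    ← Finset.sum_congr rfl key]
  simp [hE]

/-- The same telescoping with the commutators in the first leg; the surviving top term now contains
$F^\ell=0$. -/
theorem qExp_mul_F (hl : 1 < ℓ) :
    qExp ℓ ζ (E 𝕜 ζ ℓ ⊗ₜ[𝕜] F 𝕜 ζ ℓ) * (F 𝕜 ζ ℓ ⊗ₜ 1 + K 𝕜 ζ ℓ ⊗ₜ F 𝕜 ζ ℓ)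
      = ((K 𝕜 ζ ℓ ^ (ℓ - 1)) ⊗ₜ F 𝕜 ζ ℓ + F 𝕜 ζ ℓ ⊗ₜ 1) * qExp ℓ ζ (E 𝕜 ζ ℓ ⊗ₜ[𝕜] F 𝕜 ζ ℓ) := by
  obtain ⟨n, hn⟩ : ∃ n, ℓ = n + 1 := ⟨ℓ - 1, by omega⟩
  have hF := F_pow (𝕜 := 𝕜) (ζ := ζ) (ℓ := ℓ)
  have key : ∀ m ∈ Finset.range n, tauCoeff ζ (m + 1) •
      ((E 𝕜 ζ ℓ ^ (m + 1) * F 𝕜 ζ ℓ - F 𝕜 ζ ℓ * E 𝕜 ζ ℓ ^ (m + 1)) ⊗ₜ[𝕜] (F 𝕜 ζ ℓ ^ (m + 1)))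
      = tauCoeff ζ m • ((K 𝕜 ζ ℓ ^ (ℓ - 1) * E 𝕜 ζ ℓ ^ m - E 𝕜 ζ ℓ ^ m * K 𝕜 ζ ℓ) ⊗ₜ[𝕜]
        (F 𝕜 ζ ℓ ^ (m + 1))) := by
    intro m hm
    rw [Finset.mem_range] at hm
    have h2 := tauCoeff_succ' (ζ := ζ) Fact.out Fact.out hl (m := m) (by omega)
    rw [E_pow_mul_F m hl, smul_smul, ← TensorProduct.smul_tmul', smul_smul, h2, neg_smul, ← smul_neg,
      ← TensorProduct.neg_tmul, ← mul_neg, neg_sub, K_inv_mul_E_pow, ← mul_smul_comm, ← mul_sub]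
  rw [← sub_eq_zero]
  have h1 : ∀ m, tauCoeff ζ m • (E 𝕜 ζ ℓ ⊗ₜ[𝕜] F 𝕜 ζ ℓ) ^ m
        * (F 𝕜 ζ ℓ ⊗ₜ 1 + K 𝕜 ζ ℓ ⊗ₜ F 𝕜 ζ ℓ)
      - ((K 𝕜 ζ ℓ ^ (ℓ - 1)) ⊗ₜ F 𝕜 ζ ℓ + F 𝕜 ζ ℓ ⊗ₜ 1) * (tauCoeff ζ m • (E 𝕜 ζ ℓ ⊗ₜ[𝕜] F 𝕜 ζ ℓ) ^ m)
      = tauCoeff ζ m • ((E 𝕜 ζ ℓ ^ m * F 𝕜 ζ ℓ - F 𝕜 ζ ℓ * E 𝕜 ζ ℓ ^ m) ⊗ₜ[𝕜] (F 𝕜 ζ ℓ ^ m))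
        - tauCoeff ζ m • ((K 𝕜 ζ ℓ ^ (ℓ - 1) * E 𝕜 ζ ℓ ^ m - E 𝕜 ζ ℓ ^ m * K 𝕜 ζ ℓ) ⊗ₜ[𝕜]
        (F 𝕜 ζ ℓ ^ (m + 1))) := by
    intro m
    simp only [Algebra.TensorProduct.tmul_pow, mul_add, add_mul, smul_mul_assoc, mul_smul_comm,
      Algebra.TensorProduct.tmul_mul_tmul, mul_one, one_mul, TensorProduct.sub_tmul, smul_sub,
      smul_add,
      ← pow_succ, ← pow_succ']
    abel
  rw [qExp, Finset.sum_mul, Finset.mul_sum, ← Finset.sum_sub_distrib]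
  simp only [h1]
  rw [Finset.sum_sub_distrib, sub_eq_zero, hn, Finset.sum_range_succ', Finset.sum_range_succ, ← hn,
    ← Finset.sum_congr rfl key]
  simp [hF]

theorem tmul_pow_eq_one {A B : Type*} [Ring A] [Algebra 𝕜 A] [Ring B] [Algebra 𝕜 B] {a : A} {b : B}
    (ha : a ^ ℓ = 1) (hb : b ^ ℓ = 1) : (a ⊗ₜ[𝕜] b) ^ ℓ = 1 := by
  rw [Algebra.TensorProduct.tmul_pow, ha, hb, Algebra.TensorProduct.one_def]

/-- The torus factor is crossed first; it turns $E\otimes1$ into $E\otimes K^{-1}$ and $K\otimes E$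
into $1\otimes E$, and acts similarly on $\Delta(F)$. The exponential factor then yields the
opposite coproduct. For $K$ both factors commute with $K\otimes K$, because $E\otimes F$ has weight
zero. -/
theorem rMatrix_mul_comul [CharZero 𝕜] (hl : 1 < ℓ) :
    ∀ a ∈ ({E 𝕜 ζ ℓ, F 𝕜 ζ ℓ, K 𝕜 ζ ℓ} : Set _), rMatrix 𝕜 ζ ℓ * comul (R := 𝕜) a
      = TensorProduct.comm 𝕜 _ _ (comul a) * rMatrix 𝕜 ζ ℓ := by
  have hl0 : 0 < ℓ := by omega
  have hq : IsPrimitiveRoot (ζ ^ 2) ℓ := SmallBorel.isPrimitiveRoot_sq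
  have hK := K_pow (𝕜 := 𝕜) (ζ := ζ) (ℓ := ℓ)
  have hK1 : (K 𝕜 ζ ℓ ⊗ₜ[𝕜] (1 : SmallQuantumSL2 𝕜 ζ ℓ)) ^ ℓ = 1 := tmul_pow_eq_one hK (one_pow _)
  have hK2 : ((1 : SmallQuantumSL2 𝕜 ζ ℓ) ⊗ₜ[𝕜] K 𝕜 ζ ℓ) ^ ℓ = 1 := tmul_pow_eq_one (one_pow _) hK
  have hc : Commute (K 𝕜 ζ ℓ ⊗ₜ[𝕜] (1 : SmallQuantumSL2 𝕜 ζ ℓ)) (1 ⊗ₜ K 𝕜 ζ ℓ) := by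
    simp [Commute, SemiconjBy]
  rw [rMatrix_eq]
  set P := torusPairing ℓ (ζ ^ 2) (K 𝕜 ζ ℓ ⊗ₜ[𝕜] 1) (1 ⊗ₜ[𝕜] K 𝕜 ζ ℓ) with hP
  -- The symmetric form allows elements of the second leg to be crossed with the roles of $x$ and
  -- $y$ exchanged.
  have hP' : P = torusPairing ℓ (ζ ^ 2) (1 ⊗ₜ[𝕜] K 𝕜 ζ ℓ) (K 𝕜 ζ ℓ ⊗ₜ[𝕜] 1) :=
    torusPairing_symm _ _ hc
  have hE1 : P * (E 𝕜 ζ ℓ ⊗ₜ 1) = (E 𝕜 ζ ℓ ⊗ₜ (K 𝕜 ζ ℓ ^ (ℓ - 1))) * P := by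
    -- The choice $u=E\otimes K^{-1}$ makes $uy$ equal to $E\otimes1$.
    have := torusPairing_mul_of_mul_eq (u := E 𝕜 ζ ℓ ⊗ₜ[𝕜] (K 𝕜 ζ ℓ ^ (ℓ - 1))) hl0
      hq.pow_eq_one hK2 (x := K 𝕜 ζ ℓ ⊗ₜ 1)
      (by simp [K_mul_E, TensorProduct.smul_tmul'])
      (by simp [Commute, SemiconjBy, ← pow_succ, ← pow_succ'])
    simpa [K_inv_mul_K] using this
  have hE2 : P * (K 𝕜 ζ ℓ ⊗ₜ E 𝕜 ζ ℓ) = (1 ⊗ₜ E 𝕜 ζ ℓ) * P := by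
    have := torusPairing_mul_of_mul_eq (u := 1 ⊗ₜ[𝕜] E 𝕜 ζ ℓ) hl0
      hq.pow_eq_one hK1 (x := 1 ⊗ₜ K 𝕜 ζ ℓ)
      (by simp [K_mul_E]) (by simp [Commute, SemiconjBy])
    simpa [← hP'] using this
  have hF1 : P * (F 𝕜 ζ ℓ ⊗ₜ (K 𝕜 ζ ℓ ^ (ℓ - 1))) = (F 𝕜 ζ ℓ ⊗ₜ 1) * P := by
    have := torusPairing_mul_of_mul_eq_inv (u := F 𝕜 ζ ℓ ⊗ₜ[𝕜] (K 𝕜 ζ ℓ ^ (ℓ - 1))) hl0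
      hq.pow_eq_one hK2 (x := K 𝕜 ζ ℓ ⊗ₜ 1)
      (by simp [K_mul_F, TensorProduct.smul_tmul'])
      (by simp [Commute, SemiconjBy, ← pow_succ, ← pow_succ']) hc
    simpa [K_inv_mul_K] using this
  have hF2 : P * (1 ⊗ₜ F 𝕜 ζ ℓ) = (K 𝕜 ζ ℓ ⊗ₜ F 𝕜 ζ ℓ) * P := by
    have := torusPairing_mul_of_mul_eq_inv (u := 1 ⊗ₜ[𝕜] F 𝕜 ζ ℓ) hl0
      hq.pow_eq_one hK1 (x := 1 ⊗ₜ K 𝕜 ζ ℓ)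
      (by simp [K_mul_F]) (by simp [Commute, SemiconjBy]) hc.symm
    simpa [← hP'] using this
  rintro _ (rfl | rfl | rfl)
  · rw [comul_E, mul_assoc, mul_add, hE1, hE2, ← add_mul, ← mul_assoc, qExp_mul_E hl, map_add,
      TensorProduct.comm_tmul, TensorProduct.comm_tmul, mul_assoc,
      add_comm (1 ⊗ₜ[𝕜] E 𝕜 ζ ℓ)]
  · rw [comul_F, mul_assoc, mul_add, hF1, hF2, ← add_mul, ← mul_assoc, qExp_mul_F hl, map_add,
      TensorProduct.comm_tmul, TensorProduct.comm_tmul, mul_assoc]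
  · have h1 : Commute (K 𝕜 ζ ℓ ⊗ₜ[𝕜] K 𝕜 ζ ℓ) P :=
      commute_torusPairing _ _ (by simp [Commute, SemiconjBy]) (by simp [Commute, SemiconjBy])
    have h2 : Commute (K 𝕜 ζ ℓ ⊗ₜ[𝕜] K 𝕜 ζ ℓ) (E 𝕜 ζ ℓ ⊗ₜ[𝕜] F 𝕜 ζ ℓ) := by
      have h0 : ζ ≠ 0 := zeta_ne_zero ℓ
      simp [Commute, SemiconjBy, K_mul_E, K_mul_F, ← TensorProduct.smul_tmul', h0]
    have h3 : Commute (K 𝕜 ζ ℓ ⊗ₜ[𝕜] K 𝕜 ζ ℓ) (qExp ℓ ζ (E 𝕜 ζ ℓ ⊗ₜ[𝕜] F 𝕜 ζ ℓ)) :=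
      Commute.sum_right _ _ _ fun m _ ↦ (h2.pow_right m).smul_right _
    rw [comul_K, TensorProduct.comm_tmul]
    exact (h3.mul_right h1).symm.eq

/-- $(\Delta\otimes\mathrm{id})(E\otimes F)$ is a sum of two elements that commute up to $\zeta^2$,
so the exponential factors; the torus part factors by multiplicativity. The factors are brought into
the right order by moving the pairing of legs 1 and 3 across $1\otimes E\otimes F$, which supplies
the $K$ in the first leg. -/
theorem comulLeft_rMatrix [CharZero 𝕜] (hl : 1 < ℓ) :
    comulLeft 𝕜 _ (rMatrix 𝕜 ζ ℓ) = leg13 𝕜 _ (rMatrix 𝕜 ζ ℓ) * leg23 𝕜 _ (rMatrix 𝕜 ζ ℓ) := by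
  have hl0 : 0 < ℓ := by omega
  have hq : IsPrimitiveRoot (ζ ^ 2) ℓ := SmallBorel.isPrimitiveRoot_sq
  have hK := K_pow (𝕜 := 𝕜) (ζ := ζ) (ℓ := ℓ)
  have hE := E_pow (𝕜 := 𝕜) (ζ := ζ) (ℓ := ℓ)
  have hF := F_pow (𝕜 := 𝕜) (ζ := ζ) (ℓ := ℓ)
  rw [rMatrix_eq]
  simp only [map_mul, map_qExp, map_torusPairing]
  have e1 : comulLeft 𝕜 _ (E 𝕜 ζ ℓ ⊗ₜ F 𝕜 ζ ℓ)
      = E 𝕜 ζ ℓ ⊗ₜ (1 ⊗ₜ F 𝕜 ζ ℓ) + K 𝕜 ζ ℓ ⊗ₜ (E 𝕜 ζ ℓ ⊗ₜ F 𝕜 ζ ℓ) := by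
    simp [comulLeft, TensorProduct.add_tmul]
  have e2 : comulLeft 𝕜 _ (K 𝕜 ζ ℓ ⊗ₜ 1)
      = (K 𝕜 ζ ℓ ⊗ₜ (1 ⊗ₜ 1)) * (1 ⊗ₜ (K 𝕜 ζ ℓ ⊗ₜ 1)) := by simp [comulLeft]
  have e3 : comulLeft 𝕜 (SmallQuantumSL2 𝕜 ζ ℓ) (1 ⊗ₜ K 𝕜 ζ ℓ) = 1 ⊗ₜ (1 ⊗ₜ K 𝕜 ζ ℓ) := by
    simp [comulLeft, Algebra.TensorProduct.one_def]
  have e4 : leg13 𝕜 _ (E 𝕜 ζ ℓ ⊗ₜ F 𝕜 ζ ℓ) = E 𝕜 ζ ℓ ⊗ₜ (1 ⊗ₜ F 𝕜 ζ ℓ) := by simp [leg13]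
  have e5 : leg13 𝕜 _ (K 𝕜 ζ ℓ ⊗ₜ 1) = K 𝕜 ζ ℓ ⊗ₜ (1 ⊗ₜ 1) := by simp [leg13]
  have e6 : leg13 𝕜 _ (1 ⊗ₜ K 𝕜 ζ ℓ) = 1 ⊗ₜ (1 ⊗ₜ K 𝕜 ζ ℓ) := by simp [leg13]
  have e7 : ∀ t, leg23 𝕜 (SmallQuantumSL2 𝕜 ζ ℓ) t = 1 ⊗ₜ t := fun t ↦ rfl
  rw [e1, e2, e3, e4, e5, e6, e7, e7, e7]
  set K1 : SmallQuantumSL2 𝕜 ζ ℓ ⊗[𝕜] (SmallQuantumSL2 𝕜 ζ ℓ ⊗[𝕜] SmallQuantumSL2 𝕜 ζ ℓ) :=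
    K 𝕜 ζ ℓ ⊗ₜ (1 ⊗ₜ 1)
  set K2 : SmallQuantumSL2 𝕜 ζ ℓ ⊗[𝕜] (SmallQuantumSL2 𝕜 ζ ℓ ⊗[𝕜] SmallQuantumSL2 𝕜 ζ ℓ) :=
    1 ⊗ₜ (K 𝕜 ζ ℓ ⊗ₜ 1)
  set K3 : SmallQuantumSL2 𝕜 ζ ℓ ⊗[𝕜] (SmallQuantumSL2 𝕜 ζ ℓ ⊗[𝕜] SmallQuantumSL2 𝕜 ζ ℓ) :=
    1 ⊗ₜ (1 ⊗ₜ K 𝕜 ζ ℓ)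
  have hK1 : K1 ^ ℓ = 1 := tmul_pow_eq_one hK (tmul_pow_eq_one (one_pow _) (one_pow _))
  have hK3 : K3 ^ ℓ = 1 := tmul_pow_eq_one (one_pow _) (tmul_pow_eq_one (one_pow _) hK)
  have c12 : Commute K1 K2 := by simp [Commute, SemiconjBy, K1, K2]
  have c13 : Commute K1 K3 := by simp [Commute, SemiconjBy, K1, K3]
  have c23 : Commute K2 K3 := by simp [Commute, SemiconjBy, K2, K3]
  rw [← torusPairing_mul hq hK3 c23 c12, qExp_add Fact.out Fact.out hl]
  · have h1 : torusPairing ℓ (ζ ^ 2) K1 K3 * (1 ⊗ₜ (E 𝕜 ζ ℓ ⊗ₜ F 𝕜 ζ ℓ))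
        = (K 𝕜 ζ ℓ ⊗ₜ (E 𝕜 ζ ℓ ⊗ₜ F 𝕜 ζ ℓ)) * torusPairing ℓ (ζ ^ 2) K1 K3 := by
      rw [torusPairing_symm _ _ c13, torusPairing_mul_of_mul_eq_inv hl0 hq.pow_eq_one hK1]
      · simp [K1]
      · simp [K3, K_mul_F, TensorProduct.tmul_smul]
      · simp [Commute, SemiconjBy, K1]
      · exact c13.symm
    have h2 : torusPairing ℓ (ζ ^ 2) K1 K3 * qExp ℓ ζ (1 ⊗ₜ[𝕜] (E 𝕜 ζ ℓ ⊗ₜ[𝕜] F 𝕜 ζ ℓ))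
        = qExp ℓ ζ (K 𝕜 ζ ℓ ⊗ₜ[𝕜] (E 𝕜 ζ ℓ ⊗ₜ[𝕜] F 𝕜 ζ ℓ)) * torusPairing ℓ (ζ ^ 2) K1 K3 := by
      exact semiconjBy_qExp h1
    rw [mul_assoc, ← mul_assoc (qExp _ _ (K 𝕜 ζ ℓ ⊗ₜ[𝕜] _)), ← h2]
    simp only [mul_assoc]
  · simp [K_mul_E, TensorProduct.smul_tmul']
  -- Both summands carry one $F$ in the third leg, so high total degree contains $F^\ell=0$.
  · intro i j hij
    have : F 𝕜 ζ ℓ ^ (i + j) = 0 := pow_eq_zero_of_le hij hF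
    simp [Algebra.TensorProduct.tmul_pow, ← pow_add, this]

/-- Here the pairing of legs 1 and 3 meets $E\otimes F\otimes1$ and supplies the $K^{-1}$ in the
third leg; the surplus products vanish through $E^\ell=0$ in the first leg. -/
theorem comulRight_rMatrix [CharZero 𝕜] (hl : 1 < ℓ) :
    comulRight 𝕜 _ (rMatrix 𝕜 ζ ℓ) = leg13 𝕜 _ (rMatrix 𝕜 ζ ℓ) * leg12 𝕜 _ (rMatrix 𝕜 ζ ℓ) := by
  have hl0 : 0 < ℓ := by omega
  have hq : IsPrimitiveRoot (ζ ^ 2) ℓ := SmallBorel.isPrimitiveRoot_sq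
  have hK := K_pow (𝕜 := 𝕜) (ζ := ζ) (ℓ := ℓ)
  have hE := E_pow (𝕜 := 𝕜) (ζ := ζ) (ℓ := ℓ)
  rw [rMatrix_eq]
  simp only [map_mul, map_qExp, map_torusPairing]
  -- The summands are listed in the order in which they $\zeta^2$-commute as the addition law
  -- requires.
  have e1 : comulRight 𝕜 _ (E 𝕜 ζ ℓ ⊗ₜ F 𝕜 ζ ℓ)
      = E 𝕜 ζ ℓ ⊗ₜ (1 ⊗ₜ F 𝕜 ζ ℓ) + E 𝕜 ζ ℓ ⊗ₜ (F 𝕜 ζ ℓ ⊗ₜ (K 𝕜 ζ ℓ ^ (ℓ - 1))) := by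
    simp [comulRight, TensorProduct.tmul_add, add_comm]
  have e2 : comulRight 𝕜 _ (1 ⊗ₜ K 𝕜 ζ ℓ)
      = (1 ⊗ₜ (1 ⊗ₜ K 𝕜 ζ ℓ)) * (1 ⊗ₜ (K 𝕜 ζ ℓ ⊗ₜ 1)) := by simp [comulRight]
  have e3 : comulRight 𝕜 (SmallQuantumSL2 𝕜 ζ ℓ) (K 𝕜 ζ ℓ ⊗ₜ 1) = K 𝕜 ζ ℓ ⊗ₜ (1 ⊗ₜ 1) := by
    simp [comulRight, Algebra.TensorProduct.one_def]
  have e4 : leg13 𝕜 _ (E 𝕜 ζ ℓ ⊗ₜ F 𝕜 ζ ℓ) = E 𝕜 ζ ℓ ⊗ₜ (1 ⊗ₜ F 𝕜 ζ ℓ) := by simp [leg13]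
  have e5 : leg13 𝕜 _ (K 𝕜 ζ ℓ ⊗ₜ 1) = K 𝕜 ζ ℓ ⊗ₜ (1 ⊗ₜ 1) := by simp [leg13]
  have e6 : leg13 𝕜 _ (1 ⊗ₜ K 𝕜 ζ ℓ) = 1 ⊗ₜ (1 ⊗ₜ K 𝕜 ζ ℓ) := by simp [leg13]
  have e7 : leg12 𝕜 _ (E 𝕜 ζ ℓ ⊗ₜ F 𝕜 ζ ℓ) = E 𝕜 ζ ℓ ⊗ₜ (F 𝕜 ζ ℓ ⊗ₜ 1) := by simp [leg12]
  have e8 : leg12 𝕜 _ (K 𝕜 ζ ℓ ⊗ₜ 1) = K 𝕜 ζ ℓ ⊗ₜ (1 ⊗ₜ 1) := by simp [leg12]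
  have e9 : leg12 𝕜 _ (1 ⊗ₜ K 𝕜 ζ ℓ) = 1 ⊗ₜ (K 𝕜 ζ ℓ ⊗ₜ 1) := by simp [leg12]
  rw [e1, e2, e3, e4, e5, e6, e7, e8, e9]
  set K1 : SmallQuantumSL2 𝕜 ζ ℓ ⊗[𝕜] (SmallQuantumSL2 𝕜 ζ ℓ ⊗[𝕜] SmallQuantumSL2 𝕜 ζ ℓ) :=
    K 𝕜 ζ ℓ ⊗ₜ (1 ⊗ₜ 1)
  set K2 : SmallQuantumSL2 𝕜 ζ ℓ ⊗[𝕜] (SmallQuantumSL2 𝕜 ζ ℓ ⊗[𝕜] SmallQuantumSL2 𝕜 ζ ℓ) :=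
    1 ⊗ₜ (K 𝕜 ζ ℓ ⊗ₜ 1)
  set K3 : SmallQuantumSL2 𝕜 ζ ℓ ⊗[𝕜] (SmallQuantumSL2 𝕜 ζ ℓ ⊗[𝕜] SmallQuantumSL2 𝕜 ζ ℓ) :=
    1 ⊗ₜ (1 ⊗ₜ K 𝕜 ζ ℓ)
  have hK1 : K1 ^ ℓ = 1 := tmul_pow_eq_one hK (tmul_pow_eq_one (one_pow _) (one_pow _))
  have hK3 : K3 ^ ℓ = 1 := tmul_pow_eq_one (one_pow _) (tmul_pow_eq_one (one_pow _) hK)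
  have c12 : Commute K1 K2 := by simp [Commute, SemiconjBy, K1, K2]
  have c13 : Commute K1 K3 := by simp [Commute, SemiconjBy, K1, K3]
  have c23 : Commute K2 K3 := by simp [Commute, SemiconjBy, K2, K3]
  rw [← torusPairing_mul' hq hK1 c13 c12 c23.symm, qExp_add Fact.out Fact.out hl]
  · have h1 : torusPairing ℓ (ζ ^ 2) K1 K3 * (E 𝕜 ζ ℓ ⊗ₜ (F 𝕜 ζ ℓ ⊗ₜ 1))
        = (E 𝕜 ζ ℓ ⊗ₜ (F 𝕜 ζ ℓ ⊗ₜ (K 𝕜 ζ ℓ ^ (ℓ - 1)))) * torusPairing ℓ (ζ ^ 2) K1 K3 := by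
      rw [← torusPairing_mul_of_mul_eq hl0 hq.pow_eq_one hK3]
      · simp [K3, K_inv_mul_K]
      · simp [K1, K_mul_E, TensorProduct.smul_tmul']
      · simp [Commute, SemiconjBy, K3, ← pow_succ, ← pow_succ']
    have h2 : torusPairing ℓ (ζ ^ 2) K1 K3 * qExp ℓ ζ (E 𝕜 ζ ℓ ⊗ₜ[𝕜] (F 𝕜 ζ ℓ ⊗ₜ[𝕜] (1 : SmallQuantumSL2 𝕜 ζ ℓ)))
        = qExp ℓ ζ (E 𝕜 ζ ℓ ⊗ₜ[𝕜] (F 𝕜 ζ ℓ ⊗ₜ[𝕜] (K 𝕜 ζ ℓ ^ (ℓ - 1)))) * torusPairing ℓ (ζ ^ 2) K1 K3 := by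
      exact semiconjBy_qExp h1
    rw [mul_assoc, ← mul_assoc (qExp _ _ (E 𝕜 ζ ℓ ⊗ₜ[𝕜] (F 𝕜 ζ ℓ ⊗ₜ[𝕜] (K 𝕜 ζ ℓ ^ _)))), ← h2]
    simp only [mul_assoc]
  · simp [K_inv_mul_F, TensorProduct.tmul_smul]
  · intro i j hij
    have : E 𝕜 ζ ℓ ^ (i + j) = 0 := pow_eq_zero_of_le hij hE
    simp [Algebra.TensorProduct.tmul_pow, ← pow_add, this]

theorem isUniversalR [CharZero 𝕜] (hl : 1 < ℓ) : IsUniversalR (rMatrix 𝕜 ζ ℓ) := by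
  refine IsUniversalR.of_generators adjoin_eq_top ?_ (comulLeft_rMatrix hl) (comulRight_rMatrix hl)
    (rMatrix_mul_comul hl)
  have hl0 : 0 < ℓ := by omega
  have hK := K_pow (𝕜 := 𝕜) (ζ := ζ) (ℓ := ℓ)
  rw [rMatrix_eq]
  refine (isUnit_qExp hl0 ?_).mul (isUnit_torusPairing hl0 SmallBorel.isPrimitiveRoot_sq
    (tmul_pow_eq_one hK (one_pow _)) (tmul_pow_eq_one (one_pow _) hK)
    (by simp [Commute, SemiconjBy]))
  rw [Algebra.TensorProduct.tmul_pow, E_pow, TensorProduct.zero_tmul]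

end SmallQuantumSL2

/-! ### Transport along algebra homomorphisms -/

section Functoriality

open Coalgebra

variable {R A C : Type*} [CommRing R] [Ring A] [Ring C]

section legs

variable [Algebra R A] [Algebra R C]

theorem leg12_map (g : A →ₐ[R] C) (t : A ⊗[R] A) :
    leg12 R C (Algebra.TensorProduct.map g g t)
      = Algebra.TensorProduct.map g (Algebra.TensorProduct.map g g) (leg12 R A t) := by
  induction t with
  | zero => simp
  | tmul a b => simp [leg12]
  | add x y hx hy => simp only [map_add, hx, hy]

theorem leg13_map (g : A →ₐ[R] C) (t : A ⊗[R] A) :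
    leg13 R C (Algebra.TensorProduct.map g g t)
      = Algebra.TensorProduct.map g (Algebra.TensorProduct.map g g) (leg13 R A t) := by
  induction t with
  | zero => simp
  | tmul a b => simp [leg13]
  | add x y hx hy => simp only [map_add, hx, hy]

theorem leg23_map (g : A →ₐ[R] C) (t : A ⊗[R] A) :
    leg23 R C (Algebra.TensorProduct.map g g t)
      = Algebra.TensorProduct.map g (Algebra.TensorProduct.map g g) (leg23 R A t) := by
  induction t with
  | zero => simp
  | tmul a b => simp [leg23]
  | add x y hx hy => simp only [map_add, hx, hy]

theorem comm_map (g : A →ₐ[R] C) (t : A ⊗[R] A) :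
    TensorProduct.comm R C C (Algebra.TensorProduct.map g g t)
      = Algebra.TensorProduct.map g g (TensorProduct.comm R A A t) := by
  induction t with
  | zero => simp
  | tmul a b => simp
  | add x y hx hy => simp only [map_add, hx, hy]

/-- Coproducts are arbitrary linear maps here, since the twisted coproduct is not that of an
instance of a coalgebra. -/
theorem assoc_rTensor_map (g : A →ₐ[R] C) {Δ : A →ₗ[R] A ⊗[R] A} {Δ' : C →ₗ[R] C ⊗[R] C}
    (h : ∀ a, Δ' (g a) = Algebra.TensorProduct.map g g (Δ a)) (t : A ⊗[R] A) :
    TensorProduct.assoc R C C C (Δ'.rTensor C (Algebra.TensorProduct.map g g t))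
      = Algebra.TensorProduct.map g (Algebra.TensorProduct.map g g)
        (TensorProduct.assoc R A A A (Δ.rTensor A t)) := by
  induction t with
  | zero => simp
  | tmul a b =>
    simp only [Algebra.TensorProduct.map_tmul, LinearMap.rTensor_tmul, h]
    generalize Δ a = s
    induction s with
    | zero => simp
    | tmul a b => simp
    | add x y hx hy => simp only [map_add, TensorProduct.add_tmul, hx, hy]
  | add x y hx hy => simp only [map_add, hx, hy]

theorem lTensor_map (g : A →ₐ[R] C) {Δ : A →ₗ[R] A ⊗[R] A} {Δ' : C →ₗ[R] C ⊗[R] C}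
    (h : ∀ a, Δ' (g a) = Algebra.TensorProduct.map g g (Δ a)) (t : A ⊗[R] A) :
    Δ'.lTensor C (Algebra.TensorProduct.map g g t)
      = Algebra.TensorProduct.map g (Algebra.TensorProduct.map g g) (Δ.lTensor A t) := by
  induction t with
  | zero => simp
  | tmul a b => simp [h]
  | add x y hx hy => simp only [map_add, hx, hy]

end legs

/-- The axioms of a quasi-triangular Hopf algebra are transported along an isomorphism. -/
theorem IsQuasitriangularHopf.of_algEquiv [Algebra R A] [Algebra R C]
    {Δ : A →ₗ[R] A ⊗[R] A} {ε : A →ₗ[R] R} {S : A →ₗ[R] A} {𝓡 : A ⊗[R] A}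
    {Δ' : C →ₗ[R] C ⊗[R] C} {ε' : C →ₗ[R] R} {S' : C →ₗ[R] C} {𝓡' : C ⊗[R] C}
    (hA : IsQuasitriangularHopf Δ ε S 𝓡) (g : A ≃ₐ[R] C)
    (hΔ : ∀ a, Δ' (g a) = Algebra.TensorProduct.map (g : A →ₐ[R] C) (g : A →ₐ[R] C) (Δ a))
    (hε : ∀ a, ε' (g a) = ε a) (hS : ∀ a, S' (g a) = g (S a))
    (h𝓡 : Algebra.TensorProduct.map (g : A →ₐ[R] C) (g : A →ₐ[R] C) 𝓡 = 𝓡') :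
    IsQuasitriangularHopf Δ' ε' S' 𝓡' := by
  have hΔ' : ∀ a, Δ' ((g : A →ₐ[R] C) a) = Algebra.TensorProduct.map (g : A →ₐ[R] C)
    (g : A →ₐ[R] C) (Δ a) := hΔ
  have h1 : ∀ t : A ⊗[R] A, TensorProduct.lid R C (ε'.rTensor C
      (Algebra.TensorProduct.map (g : A →ₐ[R] C) (g : A →ₐ[R] C) t))
        = g (TensorProduct.lid R A (ε.rTensor A t)) := by
    intro t
    induction t with
    | zero => simp
    | tmul a b => simp [hε]
    | add x y hx hy => simp only [map_add, hx, hy]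
  have h2 : ∀ t : A ⊗[R] A, TensorProduct.rid R C (ε'.lTensor C
      (Algebra.TensorProduct.map (g : A →ₐ[R] C) (g : A →ₐ[R] C) t))
        = g (TensorProduct.rid R A (ε.lTensor A t)) := by
    intro t
    induction t with
    | zero => simp
    | tmul a b => simp [hε]
    | add x y hx hy => simp only [map_add, hx, hy]
  have h3 : ∀ t : A ⊗[R] A, LinearMap.mul' R C (S'.rTensor C
      (Algebra.TensorProduct.map (g : A →ₐ[R] C) (g : A →ₐ[R] C) t))
        = g (LinearMap.mul' R A (S.rTensor A t)) := by
    intro t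
    induction t with
    | zero => simp
    | tmul a b => simp [hS]
    | add x y hx hy => simp only [map_add, hx, hy]
  have h4 : ∀ t : A ⊗[R] A, LinearMap.mul' R C (S'.lTensor C
      (Algebra.TensorProduct.map (g : A →ₐ[R] C) (g : A →ₐ[R] C) t))
        = g (LinearMap.mul' R A (S.lTensor A t)) := by
    intro t
    induction t with
    | zero => simp
    | tmul a b => simp [hS]
    | add x y hx hy => simp only [map_add, hx, hy]
  constructor
  · refine g.surjective.forall.2 fun a ↦ ?_
    rw [hΔ, assoc_rTensor_map _ hΔ', lTensor_map _ hΔ', hA.coassoc]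
  · refine g.surjective.forall.2 fun a ↦ ?_
    rw [hΔ, h1, hA.counit_left]
  · refine g.surjective.forall.2 fun a ↦ ?_
    rw [hΔ, h2, hA.counit_right]
  · rw [← map_one g, hΔ, hA.comul_one, map_one]
  · refine g.surjective.forall.2 fun a ↦ g.surjective.forall.2 fun b ↦ ?_
    rw [← map_mul, hΔ, hA.comul_mul, map_mul, hΔ, hΔ]
  · rw [← map_one g, hε, hA.counit_one]
  · refine g.surjective.forall.2 fun a ↦ g.surjective.forall.2 fun b ↦ ?_
    rw [← map_mul, hε, hA.counit_mul, hε, hε]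
  · refine g.surjective.forall.2 fun a ↦ ?_
    rw [hΔ, h3, hA.antipode_left, hε, AlgEquiv.commutes]
  · refine g.surjective.forall.2 fun a ↦ ?_
    rw [hΔ, h4, hA.antipode_right, hε, AlgEquiv.commutes]
  · rw [← h𝓡]
    exact hA.isUnit.map _
  · rw [← h𝓡, assoc_rTensor_map _ hΔ', hA.comul_rTensor, leg13_map, leg23_map, map_mul]
  · rw [← h𝓡, lTensor_map _ hΔ', hA.comul_lTensor, leg13_map, leg12_map, map_mul]
  · refine g.surjective.forall.2 fun a ↦ ?_
    rw [← h𝓡, hΔ, ← map_mul, hA.mul_comul, comm_map, map_mul]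

end Functoriality

/-! ### R-matrices on tensor products of Hopf algebras -/

section Product

open Coalgebra Algebra.TensorProduct

variable {R A B : Type*} [CommRing R] [Ring A] [Ring B]

theorem adjoin_union_image_include [Algebra R A] [Algebra R B] {s : Set A} {t : Set B}
    (hs : Algebra.adjoin R s = ⊤) (ht : Algebra.adjoin R t = ⊤) :
    Algebra.adjoin R ((includeLeft : A →ₐ[R] A ⊗[R] B) '' s
      ∪ (includeRight : B →ₐ[R] A ⊗[R] B) '' t) = ⊤ := by
  rw [eq_top_iff]
  rintro x -
  have h1 : ∀ a : A, (includeLeft : A →ₐ[R] A ⊗[R] B) a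
      ∈ Algebra.adjoin R ((includeLeft : A →ₐ[R] A ⊗[R] B) '' s
      ∪ (includeRight : B →ₐ[R] A ⊗[R] B) '' t) := by
    intro a
    have : a ∈ Algebra.adjoin R s := by rw [hs]; trivial
    have h := (Subalgebra.mem_map (f := (includeLeft : A →ₐ[R] A ⊗[R] B))).2 ⟨a, this, rfl⟩
    rw [AlgHom.map_adjoin] at h
    exact Algebra.adjoin_mono Set.subset_union_left h
  have h2 : ∀ b : B, (includeRight : B →ₐ[R] A ⊗[R] B) b
      ∈ Algebra.adjoin R ((includeLeft : A →ₐ[R] A ⊗[R] B) '' s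
      ∪ (includeRight : B →ₐ[R] A ⊗[R] B) '' t) := by
    intro b
    have : b ∈ Algebra.adjoin R t := by rw [ht]; trivial
    have h := (Subalgebra.mem_map (f := (includeRight : B →ₐ[R] A ⊗[R] B))).2 ⟨b, this, rfl⟩
    rw [AlgHom.map_adjoin] at h
    exact Algebra.adjoin_mono Set.subset_union_right h
  induction x with
  | zero => exact Subalgebra.zero_mem _
  | tmul a b =>
    have : a ⊗ₜ[R] b = (includeLeft : A →ₐ[R] A ⊗[R] B) a
      * (includeRight : B →ₐ[R] A ⊗[R] B) b := by simp
    rw [this]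
    exact Subalgebra.mul_mem _ (h1 a) (h2 b)
  | add x y hx hy => exact Subalgebra.add_mem _ hx hy

theorem commute_map_map {A₁ A₂ B₁ B₂ C₁ C₂ : Type*} [Ring A₁] [Ring A₂] [Ring B₁] [Ring B₂]
    [Ring C₁] [Ring C₂] [Algebra R A₁] [Algebra R A₂] [Algebra R B₁] [Algebra R B₂] [Algebra R C₁]
    [Algebra R C₂] {f₁ : A₁ →ₐ[R] C₁} {g₁ : B₁ →ₐ[R] C₁} {f₂ : A₂ →ₐ[R] C₂} {g₂ : B₂ →ₐ[R] C₂}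
    (h₁ : ∀ a b, Commute (f₁ a) (g₁ b)) (h₂ : ∀ a b, Commute (f₂ a) (g₂ b)) (x : A₁ ⊗[R] A₂)
    (y : B₁ ⊗[R] B₂) :
    Commute (Algebra.TensorProduct.map f₁ f₂ x) (Algebra.TensorProduct.map g₁ g₂ y) := by
  induction x with
  | zero => simp
  | add x x' hx hx' => rw [map_add]; exact hx.add_left hx'
  | tmul a a' =>
    induction y with
    | zero => simp
    | add y y' hy hy' => rw [map_add]; exact hy.add_right hy'
    | tmul b b' =>
      simp only [Algebra.TensorProduct.map_tmul, Commute, SemiconjBy,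
        Algebra.TensorProduct.tmul_mul_tmul, (h₁ a b).eq, (h₂ a' b').eq]

theorem commute_includeLeft_includeRight [Algebra R A] [Algebra R B] (a : A) (b : B) :
    Commute ((includeLeft : A →ₐ[R] A ⊗[R] B) a) ((includeRight : B →ₐ[R] A ⊗[R] B) b) := by
  simp [Commute, SemiconjBy]

variable [HopfAlgebra R A] [HopfAlgebra R B]

theorem comul_includeLeft (a : A) :
    comul (R := R) ((includeLeft : A →ₐ[R] A ⊗[R] B) a)
      = Algebra.TensorProduct.map (includeLeft : A →ₐ[R] A ⊗[R] B) (includeLeft : A →ₐ[R] A ⊗[R] B)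
          (comul (R := R) a) := by
  rw [includeLeft_apply, TensorProduct.comul_tmul, Bialgebra.comul_one,
    Algebra.TensorProduct.one_def]
  generalize comul (R := R) a = t
  induction t with
  | zero => simp
  | tmul a b => simp
  | add x y hx hy => simp only [map_add, TensorProduct.add_tmul, hx, hy]

theorem comul_includeRight (b : B) :
    comul (R := R) ((includeRight : B →ₐ[R] A ⊗[R] B) b)
      = Algebra.TensorProduct.map (includeRight : B →ₐ[R] A ⊗[R] B) (includeRight : B →ₐ[R] A ⊗[R] B)
          (comul (R := R) b) := by
  rw [includeRight_apply, TensorProduct.comul_tmul, Bialgebra.comul_one,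
    Algebra.TensorProduct.one_def]
  generalize comul (R := R) b = t
  induction t with
  | zero => simp
  | tmul a b => simp
  | add x y hx hy => simp only [map_add, TensorProduct.tmul_add, hx, hy]

theorem comulLeft_map {C : Type*} [Ring C] [HopfAlgebra R C] (g : A →ₐ[R] C)
    (h : ∀ a, comul (R := R) (g a) = Algebra.TensorProduct.map g g (comul (R := R) a))
    (t : A ⊗[R] A) : comulLeft R C (Algebra.TensorProduct.map g g t)
      = Algebra.TensorProduct.map g (Algebra.TensorProduct.map g g) (comulLeft R A t) :=
  assoc_rTensor_map g h t

theorem comulRight_map {C : Type*} [Ring C] [HopfAlgebra R C] (g : A →ₐ[R] C)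
    (h : ∀ a, comul (R := R) (g a) = Algebra.TensorProduct.map g g (comul (R := R) a))
    (t : A ⊗[R] A) : comulRight R C (Algebra.TensorProduct.map g g t)
      = Algebra.TensorProduct.map g (Algebra.TensorProduct.map g g) (comulRight R A t) :=
  lTensor_map g h t

/-- The inclusions of $A$ and $B$ respect coproducts, so each R-matrix satisfies its own hexagon
inside $(A\otimes B)^{\otimes3}$. Images of $A$ and of $B$ commute leg by leg, which allows the two
middle factors to be exchanged. -/
theorem IsUniversalR.comulLeft_productR {𝓡 : A ⊗[R] A} {𝓢 : B ⊗[R] B} (h𝓡 : IsUniversalR 𝓡)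
    (h𝓢 : IsUniversalR 𝓢) : comulLeft R (A ⊗[R] B) (productR 𝓡 𝓢)
      = leg13 R _ (productR 𝓡 𝓢) * leg23 R _ (productR 𝓡 𝓢) := by
  have hcc := commute_includeLeft_includeRight (R := R) (A := A) (B := B)
  have hc3 := commute_map_map hcc (commute_map_map hcc hcc)
  rw [productR, map_mul, map_mul, map_mul, leg13_map, leg13_map, leg23_map, leg23_map,
    comulLeft_map _ comul_includeLeft, comulLeft_map _ comul_includeRight, h𝓡.comulLeft_eq,
    h𝓢.comulLeft_eq, map_mul, map_mul]
  exact (hc3 _ _).mul_mul_mul_comm _ _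

theorem IsUniversalR.comulRight_productR {𝓡 : A ⊗[R] A} {𝓢 : B ⊗[R] B} (h𝓡 : IsUniversalR 𝓡)
    (h𝓢 : IsUniversalR 𝓢) : comulRight R (A ⊗[R] B) (productR 𝓡 𝓢)
      = leg13 R _ (productR 𝓡 𝓢) * leg12 R _ (productR 𝓡 𝓢) := by
  have hcc := commute_includeLeft_includeRight (R := R) (A := A) (B := B)
  have hc3 := commute_map_map hcc (commute_map_map hcc hcc)
  rw [productR, map_mul, map_mul, map_mul, leg13_map, leg13_map, leg12_map, leg12_map,
    comulRight_map _ comul_includeLeft, comulRight_map _ comul_includeRight, h𝓡.comulRight_eq,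
    h𝓢.comulRight_eq, map_mul, map_mul]
  exact (hc3 _ _).mul_mul_mul_comm _ _

/-- The intertwining relation is checked on $A\otimes1$ and $1\otimes B$, which generate; there one
of the two R-matrices commutes with everything in sight. -/
theorem IsUniversalR.productR {𝓡 : A ⊗[R] A} {𝓢 : B ⊗[R] B} (h𝓡 : IsUniversalR 𝓡)
    (h𝓢 : IsUniversalR 𝓢) : IsUniversalR (R := R) (A := A ⊗[R] B) (productR 𝓡 𝓢) := by
  have hcc := commute_includeLeft_includeRight (R := R) (A := A) (B := B)
  have hc2 := commute_map_map hcc hcc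
  refine IsUniversalR.of_generators
    (adjoin_union_image_include (s := Set.univ) (t := Set.univ) (by simp) (by simp))
    ((h𝓡.isUnit.map _).mul (h𝓢.isUnit.map _)) (h𝓡.comulLeft_productR h𝓢)
    (h𝓡.comulRight_productR h𝓢) ?_
  rintro _ (⟨a, -, rfl⟩ | ⟨b, -, rfl⟩)
  · rw [_root_.productR, comul_includeLeft, comm_map, mul_assoc, ← (hc2 _ _).eq, ← mul_assoc,
      ← map_mul, h𝓡.mul_comul, map_mul, mul_assoc]
  · rw [_root_.productR, comul_includeRight, comm_map, mul_assoc, ← map_mul, h𝓢.mul_comul,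
      map_mul, ← mul_assoc, ← mul_assoc, (hc2 _ _).eq]

end Product

/-! ### The dual of the Borel part and its graded characters -/

namespace SmallBorel

open Coalgebra DualCop HopfAlgebra

variable {R : Type*} [CommRing R] [IsDomain R] {ζ : R} {ℓ : ℕ} [Fact (Odd ℓ)]
  [Fact (IsPrimitiveRoot ζ ℓ)]

/-- The $q$-binomial theorem applies since $k^2\otimes e$ and $e\otimes1$ commute up to $\zeta^2$.
This is the input for convolution products in the dual. -/
theorem comul_e_pow_mul_k_pow (i j : ℕ) : comul (R := R) (e R ζ ℓ ^ i * k R ζ ℓ ^ j)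
    = ∑ p ∈ Finset.HasAntidiagonal.antidiagonal i, qBinom (ζ ^ 2) p.1 p.2 •
      ((e R ζ ℓ ^ p.1 * k R ζ ℓ ^ (2 * p.2 + j)) ⊗ₜ[R] (e R ζ ℓ ^ p.2 * k R ζ ℓ ^ j)) := by
  rw [Bialgebra.comul_mul, Bialgebra.comul_pow, Bialgebra.comul_pow, comul_e, comul_k,
    add_pow_of_mul_eq_smul (ζ ^ 2), Finset.sum_mul]
  · refine Finset.sum_congr rfl fun p _ ↦ ?_
    simp only [Algebra.TensorProduct.tmul_pow, one_pow, Algebra.TensorProduct.tmul_mul_tmul,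
      one_mul, smul_mul_assoc, mul_assoc, ← pow_mul, ← pow_add]
  · simp only [Algebra.TensorProduct.tmul_mul_tmul, mul_one, one_mul, pow_two,
      TensorProduct.smul_tmul']
    congr 1
    rw [mul_assoc, k_mul_e, mul_smul_comm, ← mul_assoc, k_mul_e, smul_mul_assoc, smul_smul,
      mul_assoc]

variable (R ζ ℓ) in
/-- The functional `eⁱ kʲ ↦ δ_{i,n} ζ ^ (s j)`. -/
noncomputable def gradedChar (n s : ℕ) : DualCop R (SmallBorel R ζ ℓ) :=
  have := neZero ℓ
  of ((basis R ζ ℓ).constr ℕ fun p ↦ if (p.1 : ℕ) = n then ζ ^ (s * (p.2 : ℕ)) else 0)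

theorem k_pow_mod (j : ℕ) : k R ζ ℓ ^ (j % ℓ) = k R ζ ℓ ^ j := pow_mod_of_pow_eq_one k_pow j

theorem basis_apply [NeZero ℓ] (p : Fin ℓ × Fin ℓ) :
    basis R ζ ℓ p = e R ζ ℓ ^ (p.1 : ℕ) * k R ζ ℓ ^ (p.2 : ℕ) := by
  simp [basis, monomial]

theorem gradedChar_apply (n s : ℕ) {i : ℕ} (hi : i < ℓ) (j : ℕ) :
    gradedChar R ζ ℓ n s (e R ζ ℓ ^ i * k R ζ ℓ ^ j) = if i = n then ζ ^ (s * j) else 0 := by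
  have := neZero ℓ
  rw [← k_pow_mod, ← basis_apply (⟨i, hi⟩, ⟨j % ℓ, Nat.mod_lt _ (by omega)⟩), gradedChar, of_apply,
    Module.Basis.constr_basis]
  simp only [mul_comm s, pow_mul]
  rw [← pow_mod_of_pow_eq_one (Fact.out : IsPrimitiveRoot ζ ℓ).pow_eq_one j]

theorem dual_ext {p q : DualCop R (SmallBorel R ζ ℓ)}
    (h : ∀ i j, i < ℓ → p (e R ζ ℓ ^ i * k R ζ ℓ ^ j) = q (e R ζ ℓ ^ i * k R ζ ℓ ^ j)) : p = q := by
  have := neZero ℓ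
  refine (toDual R _).injective ((basis R ζ ℓ).ext fun x ↦ ?_)
  rw [basis_apply]
  exact h _ _ x.1.2

theorem gradedChar_eq_zero {n : ℕ} (hn : ℓ ≤ n) (s : ℕ) : gradedChar R ζ ℓ n s = 0 := by
  refine dual_ext fun i j hi ↦ ?_
  rw [gradedChar_apply _ _ hi, if_neg (by omega), DualCop.zero_apply]

theorem gradedChar_zero_zero : gradedChar R ζ ℓ 0 0 = 1 := by
  refine dual_ext fun i j hi ↦ ?_
  rw [gradedChar_apply _ _ hi, one_apply]
  cases i <;> simp

/-- Of the coproduct of $e^ik^j$ only the term of bidegree $(n,n')$ is seen. Its left leg contains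
the extra $k^{2n'}$, whence the factor $\zeta^{2sn'}$. -/
theorem gradedChar_mul (n s n' s' : ℕ) : gradedChar R ζ ℓ n s * gradedChar R ζ ℓ n' s'
    = (qBinom (ζ ^ 2) n n' * ζ ^ (2 * s * n')) • gradedChar R ζ ℓ (n + n') (s + s') := by
  refine dual_ext fun i j hi ↦ ?_
  rw [mul_apply, comul_e_pow_mul_k_pow, map_sum, map_sum, DualCop.smul_apply, gradedChar_apply _ _ hi]
  have h : ∀ p ∈ Finset.HasAntidiagonal.antidiagonal i, LinearMap.mul' R R (TensorProduct.map
      (toDual R _ (gradedChar R ζ ℓ n s)) (toDual R _ (gradedChar R ζ ℓ n' s'))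
      (qBinom (ζ ^ 2) p.1 p.2 • ((e R ζ ℓ ^ p.1 * k R ζ ℓ ^ (2 * p.2 + j)) ⊗ₜ[R]
        (e R ζ ℓ ^ p.2 * k R ζ ℓ ^ j))))
      = if p = (n, n') then qBinom (ζ ^ 2) n n' * ζ ^ (2 * s * n') * ζ ^ ((s + s') * j) else 0 := by
    rintro ⟨a, b⟩ hp
    rw [Finset.HasAntidiagonal.mem_antidiagonal] at hp
    simp only at hp
    rw [map_smul, map_smul, TensorProduct.map_tmul, LinearMap.mul'_apply, gradedChar_apply _ _ (by omega),
      gradedChar_apply _ _ (by omega)]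
    by_cases ha : a = n <;> by_cases hb : b = n' <;> simp [ha, hb]
    ring
  rw [Finset.sum_congr rfl h, Finset.sum_ite_eq']
  by_cases hi' : i = n + n'
  · rw [if_pos (by simp [hi']), if_pos hi']
  · rw [if_neg (by simpa [eq_comm] using hi'), if_neg hi', mul_zero]

theorem gradedChar_zero_mul (s n' s' : ℕ) : gradedChar R ζ ℓ 0 s * gradedChar R ζ ℓ n' s'
    = ζ ^ (2 * s * n') • gradedChar R ζ ℓ n' (s + s') := by
  rw [gradedChar_mul, qBinom, one_mul, zero_add]

theorem gradedChar_mul_zero (n s s' : ℕ) : gradedChar R ζ ℓ n s * gradedChar R ζ ℓ 0 s'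
    = gradedChar R ζ ℓ n (s + s') := by
  have : qBinom (ζ ^ 2) n 0 = 1 := by cases n <;> simp [qBinom]
  rw [gradedChar_mul, this, mul_zero, pow_zero, one_mul, one_smul, add_zero]

theorem gradedChar_zero_pow (s n : ℕ) : gradedChar R ζ ℓ 0 s ^ n = gradedChar R ζ ℓ 0 (s * n) := by
  induction n with
  | zero => simp [gradedChar_zero_zero]
  | succ n ih => rw [pow_succ, ih, gradedChar_mul_zero, mul_add, mul_one]

/-- The factors are the $q$-integers in base $\zeta^2$, so $f^n$ is a $q$-factorial multiple of the
degree $n$ functional. In particular $f^\ell=0$, as $B$ has no degree $\ell$. -/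
theorem gradedChar_one_pow (n : ℕ) : gradedChar R ζ ℓ 1 0 ^ n
    = (∏ m ∈ Finset.range n, qBinom (ζ ^ 2) m 1) • gradedChar R ζ ℓ n 0 := by
  induction n with
  | zero => simp [gradedChar_zero_zero]
  | succ n ih =>
    rw [pow_succ, ih, smul_mul_assoc, gradedChar_mul, smul_smul, Finset.prod_range_succ]
    simp

theorem gradedChar_mod (n s : ℕ) : gradedChar R ζ ℓ n (s % ℓ) = gradedChar R ζ ℓ n s := by
  refine dual_ext fun i j hi ↦ ?_
  rw [gradedChar_apply _ _ hi, gradedChar_apply _ _ hi]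
  simp only [pow_mul, pow_mod_of_pow_eq_one (Fact.out : IsPrimitiveRoot ζ ℓ).pow_eq_one]

theorem gradedChar_pow_card : gradedChar R ζ ℓ 0 1 ^ ℓ = 1 := by
  rw [gradedChar_zero_pow, one_mul, ← gradedChar_mod, Nat.mod_self, gradedChar_zero_zero]

theorem gradedChar_one_pow_card : gradedChar R ζ ℓ 1 0 ^ ℓ = 0 := by
  rw [gradedChar_one_pow, gradedChar_eq_zero le_rfl, smul_zero]

theorem k_pow_mul_e_pow (j i : ℕ) :
    k R ζ ℓ ^ j * e R ζ ℓ ^ i = ζ ^ (i * j) • (e R ζ ℓ ^ i * k R ζ ℓ ^ j) := by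
  induction j with
  | zero => simp
  | succ j ih =>
    rw [pow_succ, mul_assoc, k_mul_e_pow, mul_smul_comm, ← mul_assoc, ih, smul_mul_assoc, smul_smul,
      mul_assoc, ← pow_add, mul_add, mul_one, add_comm]

theorem monomial_mul_monomial (i j i' j' : ℕ) :
    e R ζ ℓ ^ i * k R ζ ℓ ^ j * (e R ζ ℓ ^ i' * k R ζ ℓ ^ j')
      = ζ ^ (i' * j) • (e R ζ ℓ ^ (i + i') * k R ζ ℓ ^ (j + j')) := by
  rw [mul_assoc, ← mul_assoc (k R ζ ℓ ^ j), k_pow_mul_e_pow, smul_mul_assoc, mul_smul_comm, pow_add,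
    pow_add]
  simp only [mul_assoc]

theorem gradedChar_apply' {n : ℕ} (hn : n < ℓ) (s i j : ℕ) :
    gradedChar R ζ ℓ n s (e R ζ ℓ ^ i * k R ζ ℓ ^ j) = if i = n then ζ ^ (s * j) else 0 := by
  by_cases hi : i < ℓ
  · exact gradedChar_apply n s hi j
  · rw [pow_eq_zero_of_le (not_lt.1 hi) e_pow, zero_mul, map_zero, if_neg (by omega)]

theorem gradedChar_zero_apply_mul (x y : SmallBorel R ζ ℓ) :
    gradedChar R ζ ℓ 0 1 (x * y) = gradedChar R ζ ℓ 0 1 x * gradedChar R ζ ℓ 0 1 y := by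
  have := neZero ℓ
  have h : (LinearMap.mul R _).compr₂ (toDual R _ (gradedChar R ζ ℓ 0 1))
      = (LinearMap.mul R R).compl₁₂ (toDual R _ (gradedChar R ζ ℓ 0 1))
        (toDual R _ (gradedChar R ζ ℓ 0 1)) := by
    refine LinearMap.ext_basis (basis R ζ ℓ) (basis R ζ ℓ) fun p p' ↦ ?_
    have hl : 0 < ℓ := (Fact.out : Odd ℓ).pos
    simp only [basis_apply, LinearMap.compr₂_apply, LinearMap.mul_apply', LinearMap.compl₁₂_apply,
      monomial_mul_monomial, map_smul, gradedChar_apply' hl]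
    by_cases h1 : (p.1 : ℕ) = 0 <;> by_cases h2 : (p'.1 : ℕ) = 0 <;> simp [h1, h2, pow_add]
  exact congr($h x y)

/-- $f$ is a skew derivation because degree one can be reached from only one of the two factors;
commuting $k^j$ past $e$ produces the value of $\alpha$. -/
theorem gradedChar_one_apply_mul [Fact (1 < ℓ)] (x y : SmallBorel R ζ ℓ) :
    gradedChar R ζ ℓ 1 0 (x * y) = gradedChar R ζ ℓ 1 0 x * counit (R := R) y
      + gradedChar R ζ ℓ 0 1 x * gradedChar R ζ ℓ 1 0 y := by
  have := neZero ℓ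
  have h : (LinearMap.mul R _).compr₂ (toDual R _ (gradedChar R ζ ℓ 1 0))
      = (LinearMap.mul R R).compl₁₂ (toDual R _ (gradedChar R ζ ℓ 1 0))
        (toDual R _ (gradedChar R ζ ℓ 0 0))
        + (LinearMap.mul R R).compl₁₂ (toDual R _ (gradedChar R ζ ℓ 0 1))
        (toDual R _ (gradedChar R ζ ℓ 1 0)) := by
    refine LinearMap.ext_basis (basis R ζ ℓ) (basis R ζ ℓ) fun p p' ↦ ?_
    have hl : 0 < ℓ := (Fact.out : Odd ℓ).pos
    simp only [basis_apply, LinearMap.compr₂_apply, LinearMap.mul_apply', LinearMap.compl₁₂_apply,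
      monomial_mul_monomial, map_smul, gradedChar_apply' hl, LinearMap.add_apply,
      gradedChar_apply' (Fact.out : 1 < ℓ)]
    by_cases h1 : (p.1 : ℕ) = 0
    · by_cases h2 : (p'.1 : ℕ) = 1 <;> simp [h1, h2]
    · by_cases h2 : (p'.1 : ℕ) = 0
      · simp [h1, h2]
      · have h3 : ¬ (p.1 : ℕ) + p'.1 = 1 := by omega
        simp [h1, h2, h3]
  rw [gradedChar_zero_zero] at h
  exact congr($h x y)

@[simp] theorem gradedChar_k (n s : ℕ) :
    gradedChar R ζ ℓ n s (k R ζ ℓ) = if n = 0 then ζ ^ s else 0 := by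
  have := gradedChar_apply (R := R) (ζ := ζ) n s (Fact.out : Odd ℓ).pos 1
  simpa [eq_comm] using this

theorem gradedChar_k_pow (n s j : ℕ) :
    gradedChar R ζ ℓ n s (k R ζ ℓ ^ j) = if n = 0 then ζ ^ (s * j) else 0 := by
  have := gradedChar_apply (R := R) (ζ := ζ) n s (Fact.out : Odd ℓ).pos j
  simpa [eq_comm] using this

@[simp] theorem gradedChar_e [Fact (1 < ℓ)] (n s : ℕ) :
    gradedChar R ζ ℓ n s (e R ζ ℓ) = if n = 1 then 1 else 0 := by
  have := gradedChar_apply (R := R) (ζ := ζ) n s (Fact.out : 1 < ℓ) 0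
  simpa [eq_comm] using this

theorem comul_gradedChar_zero_one : comul (R := R) (gradedChar R ζ ℓ 0 1)
    = gradedChar R ζ ℓ 0 1 ⊗ₜ gradedChar R ζ ℓ 0 1 := by
  refine contr_ext fun a ↦ ?_
  rw [contr_comul, contr_tmul]
  ext b
  rw [rAct_apply, gradedChar_zero_apply_mul, DualCop.smul_apply, mul_comm]

/-- Dual to the skew derivation rule. The legs appear in reversed order because the coproduct of the
dual is $B^{*\mathrm{cop}}$. -/
theorem comul_gradedChar_one_zero [Fact (1 < ℓ)] : comul (R := R) (gradedChar R ζ ℓ 1 0)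
    = 1 ⊗ₜ gradedChar R ζ ℓ 1 0 + gradedChar R ζ ℓ 1 0 ⊗ₜ gradedChar R ζ ℓ 0 1 := by
  refine contr_ext fun a ↦ ?_
  rw [contr_comul, map_add, contr_tmul, contr_tmul]
  ext b
  rw [rAct_apply, gradedChar_one_apply_mul, DualCop.add_apply, DualCop.smul_apply,
    DualCop.smul_apply, one_apply, mul_comm, mul_comm (gradedChar R ζ ℓ 0 1 b)]

theorem antipodeInv_k : antipodeInv R (k R ζ ℓ) = k R ζ ℓ ^ (ℓ - 1) := by
  have := neZero ℓ
  apply (HasBijectiveAntipode.bijective (R := R) (H := SmallBorel R ζ ℓ)).1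
  rw [antipode_antipodeInv, antipode_k_pow, ← pow_mul, ← sq]
  -- $(\ell-1)^2\equiv1$ modulo $\ell$. With truncated subtraction the formula fails at $\ell=1$,
  -- where $k=1$ anyway.
  have h : (ℓ - 1) ^ 2 = ℓ * (ℓ - 2) + 1 ∨ ℓ = 1 := by
    obtain ⟨n, hn⟩ : ∃ n, ℓ = n + 1 := ⟨ℓ - 1, by have := (Fact.out : Odd ℓ).pos; omega⟩
    rcases n with _ | n
    · right; omega
    · left; rw [hn]; simp; ring
  rcases h with h | h
  · rw [h, pow_succ, pow_mul, k_pow, one_pow, one_mul]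
  · subst h
    have := k_pow (R := R) (ζ := ζ) (ℓ := 1)
    rw [pow_one] at this
    simp [this]

theorem antipodeInv_e : antipodeInv R (e R ζ ℓ) = -(e R ζ ℓ * (k R ζ ℓ ^ (ℓ - 1)) ^ 2) := by
  have := neZero ℓ
  apply (HasBijectiveAntipode.bijective (R := R) (H := SmallBorel R ζ ℓ)).1
  have h : antipode R (k R ζ ℓ ^ (ℓ - 1)) = k R ζ ℓ := by
    rw [← antipodeInv_k, antipode_antipodeInv]
  rw [antipode_antipodeInv, map_neg, antipode_mul_antidistrib, antipode_e, mul_neg, neg_neg, sq,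
    antipode_mul_antidistrib, h, ← sq, ← mul_assoc, ← sq (k R ζ ℓ ^ (ℓ - 1)), k_sq_mul_inv_sq,
    one_mul]

end SmallBorel

/-! ### Cross relations in the quantum double -/

namespace SmallBorel

section Double

open Coalgebra DualCop DrinfeldDouble

variable {R : Type*} [CommRing R] [IsDomain R] {ζ : R} {ℓ : ℕ} [Fact (Odd ℓ)]
  [Fact (IsPrimitiveRoot ζ ℓ)]

/-- As $k$ is group-like, the bicrossed product is conjugation: $p$ becomes $p(k^{-1}\,\cdot\,k)$.
-/
theorem ofAlg_k_mul_ofDual (p : DualCop R (SmallBorel R ζ ℓ)) :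
    ofAlg R _ (k R ζ ℓ) * ofDual R _ p
      = ofDual R _ (rAct (k R ζ ℓ) (lAct (k R ζ ℓ) p)) * ofAlg R _ (k R ζ ℓ) := by
  rw [ofAlg_mul, ofDual_mul_ofAlg]
  change opT R _ (k R ζ ℓ) (p ⊗ₜ 1) = _ ⊗ₜ _
  simp [opT, opMB]

/-- The three terms come from the iterated coproduct $e\otimes1\otimes1+k^2\otimes
e\otimes1+k^2\otimes k^2\otimes e$. -/
theorem ofAlg_e_mul_ofDual (p : DualCop R (SmallBorel R ζ ℓ)) :
    ofAlg R _ (e R ζ ℓ) * ofDual R _ p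
      = ofDual R _ (rAct (e R ζ ℓ) p)
        + ofDual R _ (rAct (k R ζ ℓ ^ 2) p) * ofAlg R _ (e R ζ ℓ)
        + ofDual R _ (rAct (k R ζ ℓ ^ 2) (lAct (e R ζ ℓ) p)) * ofAlg R _ (k R ζ ℓ ^ 2) := by
  rw [ofAlg_mul, ofDual_mul_ofAlg, ofDual_mul_ofAlg, ← mul_one (ofDual R _ (rAct (e R ζ ℓ) p)),
    ← map_one (ofAlg R _), ofDual_mul_ofAlg]
  have h : opT R _ (e R ζ ℓ) (p ⊗ₜ 1) = rAct (e R ζ ℓ) p ⊗ₜ[R] (1 : SmallBorel R ζ ℓ)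
      + rAct (k R ζ ℓ ^ 2) p ⊗ₜ[R] e R ζ ℓ
      + rAct (k R ζ ℓ ^ 2) (lAct (e R ζ ℓ) p) ⊗ₜ[R] (k R ζ ℓ ^ 2) := by
    simp [opT, opMB, add_assoc, -map_pow]
  exact h

theorem ofAlg_k_mul_ofDual_zero : ofAlg R _ (k R ζ ℓ) * ofDual R _ (gradedChar R ζ ℓ 0 1)
    = ofDual R _ (gradedChar R ζ ℓ 0 1) * ofAlg R _ (k R ζ ℓ) := by
  rw [ofAlg_k_mul_ofDual]
  congr 2
  ext b
  have h : gradedChar R ζ ℓ 0 1 (k R ζ ℓ ^ (ℓ - 1)) * gradedChar R ζ ℓ 0 1 (k R ζ ℓ) = 1 := by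
    have := neZero ℓ
    rw [← gradedChar_zero_apply_mul, k_pow_sub_one_mul_k, ← pow_zero (k R ζ ℓ), gradedChar_k_pow]
    simp
  rw [rAct_apply, lAct_apply, antipodeInv_k, gradedChar_zero_apply_mul, gradedChar_zero_apply_mul,
    mul_left_comm, h, mul_one]

theorem ofAlg_k_mul_ofDual_one [Fact (1 < ℓ)] :
    ofDual R _ (gradedChar R ζ ℓ 1 0) * ofAlg R _ (k R ζ ℓ)
    = ζ • (ofAlg R _ (k R ζ ℓ) * ofDual R _ (gradedChar R ζ ℓ 1 0)) := by
  rw [ofAlg_k_mul_ofDual, ← smul_mul_assoc, ← map_smul]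
  congr 2
  ext b
  have h : ζ * gradedChar R ζ ℓ 0 1 (k R ζ ℓ ^ (ℓ - 1)) = 1 := by
    rw [gradedChar_k_pow, if_pos rfl, one_mul, ← pow_succ',
      Nat.sub_add_cancel (Fact.out : Odd ℓ).pos, (Fact.out : IsPrimitiveRoot ζ ℓ).pow_eq_one]
  rw [DualCop.smul_apply, rAct_apply, lAct_apply, antipodeInv_k, gradedChar_one_apply_mul,
    gradedChar_one_apply_mul, gradedChar_k_pow, gradedChar_k]
  simp [← mul_assoc, h]

/-- $\alpha$ is multiplicative and kills $e$, so only the middle term of the cross relation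
survives, and translation by $k^2$ multiplies $\alpha$ by $\zeta^2$. -/
theorem ofAlg_e_mul_ofDual_zero [Fact (1 < ℓ)] :
    ofAlg R _ (e R ζ ℓ) * ofDual R _ (gradedChar R ζ ℓ 0 1)
    = ζ ^ 2 • (ofDual R _ (gradedChar R ζ ℓ 0 1) * ofAlg R _ (e R ζ ℓ)) := by
  have h1 : rAct (e R ζ ℓ) (gradedChar R ζ ℓ 0 1) = 0 := by
    ext b
    rw [rAct_apply, gradedChar_zero_apply_mul, gradedChar_e]
    simp
  have h2 : lAct (e R ζ ℓ) (gradedChar R ζ ℓ 0 1) = 0 := by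
    ext b
    rw [lAct_apply, antipodeInv_e, ← neg_one_smul R, smul_mul_assoc, map_smul,
      gradedChar_zero_apply_mul, gradedChar_zero_apply_mul, gradedChar_e]
    simp
  have h3 : rAct (k R ζ ℓ ^ 2) (gradedChar R ζ ℓ 0 1) = ζ ^ 2 • gradedChar R ζ ℓ 0 1 := by
    ext b
    rw [rAct_apply, gradedChar_zero_apply_mul, gradedChar_k_pow, if_pos rfl, one_mul,
      DualCop.smul_apply, mul_comm]
  rw [ofAlg_e_mul_ofDual, h1, h2, h3]
  simp

/-- The outer terms of the cross relation evaluate $f$ on an explicit $e$: on the right this leaves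
$\alpha$, on the left, through $S^{-1}(e)=-ek^{-2}$, it leaves $-\epsilon$. -/
theorem ofAlg_e_mul_ofDual_one [Fact (1 < ℓ)] :
    ofAlg R _ (e R ζ ℓ) * ofDual R _ (gradedChar R ζ ℓ 1 0)
    = ofDual R _ (gradedChar R ζ ℓ 0 1) + ofDual R _ (gradedChar R ζ ℓ 1 0) * ofAlg R _ (e R ζ ℓ)
      - ofAlg R _ (k R ζ ℓ ^ 2) := by
  have h1 : rAct (e R ζ ℓ) (gradedChar R ζ ℓ 1 0) = gradedChar R ζ ℓ 0 1 := by
    ext b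
    rw [rAct_apply, gradedChar_one_apply_mul, gradedChar_e]
    simp
  have h3 : rAct (k R ζ ℓ ^ 2) (gradedChar R ζ ℓ 1 0) = gradedChar R ζ ℓ 1 0 := by
    ext b
    rw [rAct_apply, gradedChar_one_apply_mul, gradedChar_k_pow]
    simp
  have h2 : rAct (k R ζ ℓ ^ 2) (lAct (e R ζ ℓ) (gradedChar R ζ ℓ 1 0)) = -1 := by
    ext b
    rw [rAct_apply, lAct_apply, antipodeInv_e, ← neg_one_smul R, smul_mul_assoc, map_smul,
      mul_assoc (e R ζ ℓ), gradedChar_one_apply_mul, gradedChar_e, gradedChar_e]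
    simp
  rw [ofAlg_e_mul_ofDual, h1, h2, h3, map_neg, map_one, neg_one_mul, sub_eq_add_neg]

end Double

end SmallBorel

/-! ### From e, k, f and the square root of α to E, F, K, Z -/

theorem pow_mul_eq_smul {R A : Type*} [CommRing R] [Ring A] [Algebra R A] {c : R} {x u : A}
    (h : x * u = c • (u * x)) (n : ℕ) : x ^ n * u = c ^ n • (u * x ^ n) := by
  induction n with
  | zero => simp
  | succ n ih =>
    rw [pow_succ, mul_assoc, h, mul_smul_comm, ← mul_assoc, ih, smul_mul_assoc, smul_smul, mul_assoc,
      pow_succ' c]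

theorem mul_mul_eq_smul {R A : Type*} [CommRing R] [Ring A] [Algebra R A] {c d : R} {x y u : A}
    (hx : x * u = c • (u * x)) (hy : y * u = d • (u * y)) :
    x * y * u = (c * d) • (u * (x * y)) := by
  rw [mul_assoc, hy, mul_smul_comm, ← mul_assoc, hx, smul_mul_assoc, smul_smul, mul_assoc,
    mul_comm c]

/-- $(\ell+1)/2$ is the inverse of $2$ modulo $\ell$, so this power undoes squaring. -/
theorem pow_half_of_odd {M : Type*} [Monoid M] {ℓ : ℕ} (ho : Odd ℓ) {x : M} (hx : x ^ ℓ = 1) :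
    (x ^ 2) ^ ((ℓ + 1) / 2) = x := by
  obtain ⟨n, rfl⟩ := ho
  rw [← pow_mul, show 2 * ((2 * n + 1 + 1) / 2) = 2 * n + 1 + 1 by omega, pow_succ, hx, one_mul]

theorem pow_sub_one_eq_inv {𝕜 : Type*} [Field 𝕜] {ℓ : ℕ} (hl : 0 < ℓ) {q : 𝕜} (hq : q ^ ℓ = 1) :
    q ^ (ℓ - 1) = q⁻¹ :=
  (inv_eq_of_mul_eq_one_right (pow_mul_pow_sub_one hl hq)).symm

/-- The relations of the quantum double of `B_ζ(sl₂)`, in terms of `e`, `k`, `f` and a square root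
`b` of `α`. -/
structure IsBorelDouble {𝕜 D : Type*} [Field 𝕜] [Ring D] [Algebra 𝕜 D] (ℓ : ℕ) (ζ : 𝕜)
    (e k b f : D) : Prop where
  odd : Odd ℓ
  isPrimitiveRoot : IsPrimitiveRoot ζ ℓ
  k_pow : k ^ ℓ = 1
  b_pow : b ^ ℓ = 1
  e_pow : e ^ ℓ = 0
  f_pow : f ^ ℓ = 0
  comm : Commute k b
  k_e : k * e = ζ • (e * k)
  k_f : k * f = ζ⁻¹ • (f * k)
  b_e : b * e = ζ⁻¹ • (e * b)
  b_f : b * f = ζ • (f * b)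
  e_f : e * f = b ^ 2 + f * e - k ^ 2

namespace IsBorelDouble

variable {𝕜 D : Type*} [Field 𝕜] [Ring D] [Algebra 𝕜 D] {ℓ : ℕ} {ζ : 𝕜} {e k b f : D}
  (h : IsBorelDouble ℓ ζ e k b f)

include h

theorem pos : 0 < ℓ := h.odd.pos

theorem zeta_ne_zero : ζ ≠ 0 := h.isPrimitiveRoot.ne_zero h.pos.ne'

theorem zeta_pow : ζ ^ (ℓ - 1) = ζ⁻¹ := pow_sub_one_eq_inv h.pos h.isPrimitiveRoot.pow_eq_one

theorem zeta_inv_pow : ζ⁻¹ ^ (ℓ - 1) = ζ := by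
  rw [pow_sub_one_eq_inv h.pos h.isPrimitiveRoot.inv.pow_eq_one, inv_inv]

theorem b_inv_mul_b : b ^ (ℓ - 1) * b = 1 := pow_sub_one_mul h.pos.ne' b ▸ h.b_pow

theorem k_inv_mul_k : k ^ (ℓ - 1) * k = 1 := pow_sub_one_mul h.pos.ne' k ▸ h.k_pow

/-- The weights $\zeta^{-1}$ of $b$ and $\zeta$ of $k$ on $e$ cancel. -/
theorem commute_Z_e : Commute (b * k) e := by
  rw [Commute, SemiconjBy, mul_mul_eq_smul h.b_e h.k_e, inv_mul_cancel₀ h.zeta_ne_zero, one_smul]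

theorem commute_Z_f : Commute (b * k) f := by
  rw [Commute, SemiconjBy, mul_mul_eq_smul h.b_f h.k_f, mul_inv_cancel₀ h.zeta_ne_zero, one_smul]

theorem commute_Z_k : Commute (b * k) k := h.comm.symm.mul_left (Commute.refl k)

theorem commute_Z_b : Commute (b * k) b := (Commute.refl b).mul_left h.comm

theorem commute_Z_K : Commute (b * k) (b ^ (ℓ - 1) * k) :=
  (h.commute_Z_b.pow_right _).mul_right h.commute_Z_k

theorem Z_pow : (b * k) ^ ℓ = 1 := by rw [h.comm.symm.mul_pow, h.b_pow, h.k_pow, one_mul]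

theorem Z_inv : (b * k) ^ (ℓ - 1) = b ^ (ℓ - 1) * k ^ (ℓ - 1) := h.comm.symm.mul_pow _

theorem K_pow : (b ^ (ℓ - 1) * k) ^ ℓ = 1 := by
  rw [(h.comm.symm.pow_left _).mul_pow, h.k_pow, mul_one, pow_sub_one_pow_eq_one h.b_pow]

theorem K_e : b ^ (ℓ - 1) * k * e = ζ ^ 2 • (e * (b ^ (ℓ - 1) * k)) := by
  rw [mul_mul_eq_smul (pow_mul_eq_smul h.b_e _) h.k_e, h.zeta_inv_pow, sq]

theorem K_f : b ^ (ℓ - 1) * k * f = ζ⁻¹ ^ 2 • (f * (b ^ (ℓ - 1) * k)) := by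
  rw [mul_mul_eq_smul (pow_mul_eq_smul h.b_f _) h.k_f, h.zeta_pow, sq]

/-- Together with $K^{-1}Z=b^2$ this factors $b^2-k^2$ as $Z(K^{-1}-K)$. -/
theorem K_mul_Z : b ^ (ℓ - 1) * k * (b * k) = k ^ 2 := by
  rw [mul_assoc, ← mul_assoc k, h.comm.eq, mul_assoc b, ← mul_assoc, h.b_inv_mul_b, one_mul, sq]

theorem K_inv : (b ^ (ℓ - 1) * k) ^ (ℓ - 1) = b * k ^ (ℓ - 1) := by
  have h1 : (b ^ (ℓ - 1)) ^ (ℓ - 1) = b := by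
    have h2 : (b ^ (ℓ - 1)) ^ (ℓ - 1) * b ^ (ℓ - 1) = 1 :=
      (pow_sub_one_mul h.pos.ne' _).trans (pow_sub_one_pow_eq_one h.b_pow _)
    calc _ = (b ^ (ℓ - 1)) ^ (ℓ - 1) * (b ^ (ℓ - 1) * b) := by rw [h.b_inv_mul_b, mul_one]
      _ = b := by rw [← mul_assoc, h2, one_mul]
  rw [(h.comm.symm.pow_left _).mul_pow, h1]

theorem K_inv_mul_Z : (b ^ (ℓ - 1) * k) ^ (ℓ - 1) * (b * k) = b ^ 2 := by
  rw [h.K_inv, mul_assoc, ← mul_assoc (k ^ (ℓ - 1)), (h.comm.pow_left _).eq, mul_assoc b,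
    h.k_inv_mul_k, mul_one, sq]

theorem Z_mul_Z_inv_mul (u : D) : b * k * (b ^ (ℓ - 1) * k ^ (ℓ - 1) * u) = u := by
  rw [← h.Z_inv, ← mul_assoc, pow_mul_pow_sub_one h.pos h.Z_pow, one_mul]

theorem E_pow : (b ^ (ℓ - 1) * k ^ (ℓ - 1) * e) ^ ℓ = 0 := by
  rw [← h.Z_inv, (h.commute_Z_e.pow_left _).mul_pow, h.e_pow, mul_zero]

theorem K_E : b ^ (ℓ - 1) * k * (b ^ (ℓ - 1) * k ^ (ℓ - 1) * e)
    = ζ ^ 2 • (b ^ (ℓ - 1) * k ^ (ℓ - 1) * e * (b ^ (ℓ - 1) * k)) := by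
  rw [← h.Z_inv, ← mul_assoc, ← (h.commute_Z_K.pow_left _).eq, mul_assoc, h.K_e, mul_smul_comm,
    mul_assoc]

/-- The central $Z^{-1}$ is pulled out of the commutator, and $ef-fe=b^2-k^2=Z(K^{-1}-K)$ cancels
it. The sign is absorbed later by $F=-f$. -/
theorem E_f : b ^ (ℓ - 1) * k ^ (ℓ - 1) * e * f - f * (b ^ (ℓ - 1) * k ^ (ℓ - 1) * e)
    = (b ^ (ℓ - 1) * k) ^ (ℓ - 1) - b ^ (ℓ - 1) * k := by
  have h1 : (b * k) ^ (ℓ - 1) * (b * k) = 1 := pow_sub_one_mul h.pos.ne' (b * k) ▸ h.Z_pow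
  rw [← h.Z_inv, ← mul_assoc, ← (h.commute_Z_f.pow_left _).eq, mul_assoc, mul_assoc, ← mul_sub, h.e_f,
    add_sub_right_comm, add_sub_cancel_right, mul_sub, ← h.K_mul_Z, ← h.K_inv_mul_Z,
    ← (h.commute_Z_K.pow_right _).eq, ← h.commute_Z_K.eq, ← mul_assoc _ (b * k), ← mul_assoc _ (b * k), h1,
    one_mul, one_mul]

end IsBorelDouble

/-! ### The extended double satisfies these relations -/

namespace DoubleExt

open DrinfeldDouble SmallBorel

variable (𝕜 : Type*) [Field 𝕜] (ζ : 𝕜) (ℓ : ℕ) [Fact (Odd ℓ)] [Fact (IsPrimitiveRoot ζ ℓ)]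

/-- The inclusion of `D(B)` in `D_e(B)`. -/
noncomputable def incl : DoubleInt ζ ℓ →ₐ[IntAdjoin ζ] DoubleExt 𝕜 ζ ℓ :=
  Algebra.TensorProduct.includeRight

theorem incl_apply (u : DoubleInt ζ ℓ) : incl 𝕜 ζ ℓ u = 1 ⊗ₜ u := rfl

theorem incl_smul (c : IntAdjoin ζ) (u : DoubleInt ζ ℓ) :
    incl 𝕜 ζ ℓ (c • u) = (c : 𝕜) • incl 𝕜 ζ ℓ u := by
  rw [map_smul]
  exact (algebraMap_smul 𝕜 c _).symm

theorem functional_zero : DualCop.of (functional 𝕜 ζ ℓ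
    fun p ↦ if (p.1 : ℕ) = 0 then zetaInt ζ ^ (p.2 : ℕ) else 0)
    = gradedChar (IntAdjoin ζ) (zetaInt ζ) ℓ 0 1 := by
  simp only [gradedChar, functional, one_mul]

theorem functional_one : DualCop.of (functional 𝕜 ζ ℓ fun p ↦ if (p.1 : ℕ) = 1 then 1 else 0)
    = gradedChar (IntAdjoin ζ) (zetaInt ζ) ℓ 1 0 := by
  simp only [gradedChar, functional, zero_mul, pow_zero]

theorem α_eq : α 𝕜 ζ ℓ = incl 𝕜 ζ ℓ (ofDual _ _ (gradedChar (IntAdjoin ζ) (zetaInt ζ) ℓ 0 1)) := by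
  rw [← functional_zero]; rfl

theorem f_eq : f 𝕜 ζ ℓ = incl 𝕜 ζ ℓ (ofDual _ _ (gradedChar (IntAdjoin ζ) (zetaInt ζ) ℓ 1 0)) := by
  rw [← functional_one]; rfl

theorem e_eq : e 𝕜 ζ ℓ = incl 𝕜 ζ ℓ (ofAlg _ _ (SmallBorel.e (IntAdjoin ζ) (zetaInt ζ) ℓ)) := rfl

theorem k_eq : k 𝕜 ζ ℓ = incl 𝕜 ζ ℓ (ofAlg _ _ (SmallBorel.k (IntAdjoin ζ) (zetaInt ζ) ℓ)) := rfl

theorem coe_zetaInt : ((zetaInt ζ : IntAdjoin ζ) : 𝕜) = ζ := rfl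

theorem k_pow : k 𝕜 ζ ℓ ^ ℓ = 1 := by
  rw [k_eq, ← map_pow, ← map_pow, SmallBorel.k_pow, map_one, map_one]

theorem e_pow : e 𝕜 ζ ℓ ^ ℓ = 0 := by
  rw [e_eq, ← map_pow, ← map_pow, SmallBorel.e_pow, map_zero, map_zero]

theorem α_pow : α 𝕜 ζ ℓ ^ ℓ = 1 := by
  rw [α_eq, ← map_pow, ← map_pow, gradedChar_pow_card, map_one, map_one]

theorem f_pow : f 𝕜 ζ ℓ ^ ℓ = 0 := by
  rw [f_eq, ← map_pow, ← map_pow, gradedChar_one_pow_card, map_zero, map_zero]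

theorem k_mul_e : k 𝕜 ζ ℓ * e 𝕜 ζ ℓ = ζ • (e 𝕜 ζ ℓ * k 𝕜 ζ ℓ) := by
  rw [k_eq, e_eq, ← map_mul, ← map_mul, SmallBorel.k_mul_e, map_smul, incl_smul, coe_zetaInt,
    map_mul, map_mul]

theorem k_mul_α : k 𝕜 ζ ℓ * α 𝕜 ζ ℓ = α 𝕜 ζ ℓ * k 𝕜 ζ ℓ := by
  rw [k_eq, α_eq, ← map_mul, ofAlg_k_mul_ofDual_zero, map_mul]

theorem e_mul_α [Fact (1 < ℓ)] : e 𝕜 ζ ℓ * α 𝕜 ζ ℓ = ζ ^ 2 • (α 𝕜 ζ ℓ * e 𝕜 ζ ℓ) := by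
  rw [e_eq, α_eq, ← map_mul, ofAlg_e_mul_ofDual_zero, incl_smul, map_mul]
  rfl

theorem α_mul_f : α 𝕜 ζ ℓ * f 𝕜 ζ ℓ = ζ ^ 2 • (f 𝕜 ζ ℓ * α 𝕜 ζ ℓ) := by
  rw [f_eq, α_eq, ← map_mul, ← map_mul, ← map_mul, ← map_mul, gradedChar_zero_mul,
    gradedChar_mul_zero, map_smul, incl_smul]
  rfl

theorem f_mul_k [Fact (1 < ℓ)] : f 𝕜 ζ ℓ * k 𝕜 ζ ℓ = ζ • (k 𝕜 ζ ℓ * f 𝕜 ζ ℓ) := by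
  rw [k_eq, f_eq, ← map_mul, ofAlg_k_mul_ofDual_one, incl_smul, map_mul]
  rfl

theorem e_mul_f [Fact (1 < ℓ)] :
    e 𝕜 ζ ℓ * f 𝕜 ζ ℓ = α 𝕜 ζ ℓ + f 𝕜 ζ ℓ * e 𝕜 ζ ℓ - k 𝕜 ζ ℓ ^ 2 := by
  rw [e_eq, f_eq, α_eq, k_eq, ← map_mul, ofAlg_e_mul_ofDual_one, map_sub, map_add, map_mul, map_pow,
    map_pow]

/-- The relations for $\alpha$ have weights $\zeta^{\pm2}$; raising $\alpha$ to the power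
$(\ell+1)/2$ turns them into $\zeta^{\pm1}$, and $b^2=\alpha$ by the same congruence. -/
theorem isBorelDouble [Fact (1 < ℓ)] :
    IsBorelDouble ℓ ζ (e 𝕜 ζ ℓ) (k 𝕜 ζ ℓ) (α 𝕜 ζ ℓ ^ ((ℓ + 1) / 2)) (f 𝕜 ζ ℓ) where
  odd := Fact.out
  isPrimitiveRoot := Fact.out
  k_pow := k_pow 𝕜 ζ ℓ
  b_pow := by rw [pow_right_comm, α_pow, one_pow]
  e_pow := e_pow 𝕜 ζ ℓ
  f_pow := f_pow 𝕜 ζ ℓ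
  comm := Commute.pow_right (k_mul_α 𝕜 ζ ℓ) _
  k_e := k_mul_e 𝕜 ζ ℓ
  k_f := by rw [f_mul_k, smul_smul, inv_mul_cancel₀ (SmallQuantumSL2.zeta_ne_zero ℓ), one_smul]
  b_e := by
    have h1 : α 𝕜 ζ ℓ * e 𝕜 ζ ℓ = ζ⁻¹ ^ 2 • (e 𝕜 ζ ℓ * α 𝕜 ζ ℓ) := by
      rw [e_mul_α, smul_smul, ← mul_pow, inv_mul_cancel₀ (SmallQuantumSL2.zeta_ne_zero ℓ), one_pow, one_smul]
    rw [pow_mul_eq_smul h1, pow_half_of_odd Fact.out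
      (Fact.out : IsPrimitiveRoot ζ ℓ).inv.pow_eq_one]
  b_f := by
    rw [pow_mul_eq_smul (α_mul_f 𝕜 ζ ℓ), pow_half_of_odd Fact.out
      (Fact.out : IsPrimitiveRoot ζ ℓ).pow_eq_one]
  e_f := by rw [pow_right_comm, pow_half_of_odd Fact.out (α_pow 𝕜 ζ ℓ), e_mul_f]

end DoubleExt

/-- The relations of `U_ζ ⊗ 𝒜`, for `E`, `F`, `K` and a central element `Z`. -/
structure IsCentralExtension {𝕜 D : Type*} [Field 𝕜] [Ring D] [Algebra 𝕜 D] (ℓ : ℕ) (ζ : 𝕜)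
    (E F K Z : D) : Prop where
  K_pow : K ^ ℓ = 1
  Z_pow : Z ^ ℓ = 1
  E_pow : E ^ ℓ = 0
  F_pow : F ^ ℓ = 0
  K_E : K * E = ζ ^ 2 • (E * K)
  K_F : K * F = ζ⁻¹ ^ 2 • (F * K)
  E_F : E * F - F * E = (ζ - ζ⁻¹)⁻¹ • (K - K ^ (ℓ - 1))
  Z_E : Commute Z E
  Z_F : Commute Z F
  Z_K : Commute Z K

theorem IsBorelDouble.isCentralExtension {𝕜 D : Type*} [Field 𝕜] [Ring D] [Algebra 𝕜 D] {ℓ : ℕ}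
    {ζ : 𝕜} {e k b f : D} (h : IsBorelDouble ℓ ζ e k b f) :
    IsCentralExtension ℓ ζ ((ζ - ζ⁻¹)⁻¹ • (b ^ (ℓ - 1) * k ^ (ℓ - 1) * e)) (-f) (b ^ (ℓ - 1) * k)
      (b * k) where
  K_pow := h.K_pow
  Z_pow := h.Z_pow
  E_pow := by rw [smul_pow, h.E_pow, smul_zero]
  F_pow := by rw [neg_pow, h.f_pow, mul_zero]
  K_E := by rw [mul_smul_comm, h.K_E, smul_mul_assoc, smul_comm]
  K_F := by rw [mul_neg, h.K_f, neg_mul, smul_neg]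
  E_F := by
    rw [smul_mul_assoc, mul_smul_comm, ← smul_sub, mul_neg, neg_mul, neg_sub_neg,
      ← neg_sub (b ^ (ℓ - 1) * k ^ (ℓ - 1) * e * f), h.E_f, neg_sub]
  Z_E := by
    refine Commute.smul_right (Commute.mul_right ?_ h.commute_Z_e) _
    exact (h.commute_Z_b.pow_right _).mul_right (h.commute_Z_k.pow_right _)
  Z_F := h.commute_Z_f.neg_right
  Z_K := h.commute_Z_K

theorem commute_of_adjoin_eq_top {R A D : Type*} [CommRing R] [Ring A] [Algebra R A] [Ring D]
    [Algebra R D] {s : Set A} (hs : Algebra.adjoin R s = ⊤) (g : A →ₐ[R] D) {x : D}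
    (h : ∀ a ∈ s, Commute (g a) x) (a : A) : Commute (g a) x := by
  have ha : a ∈ Algebra.adjoin R s := hs ▸ Algebra.mem_top
  induction ha using Algebra.adjoin_induction with
  | mem a ha => exact h a ha
  | algebraMap r => rw [AlgHom.commutes]; exact Algebra.commute_algebraMap_left r x
  | add a b _ _ ha hb => rw [map_add]; exact ha.add_left hb
  | mul a b _ _ ha hb => rw [map_mul]; exact ha.mul_left hb

/-! ### The homomorphism from the tensor product to the double -/

namespace IsCentralExtension

open Algebra.TensorProduct Coalgebra

section Hom

variable {𝕜 D : Type*} [Field 𝕜] [Ring D] [Algebra 𝕜 D] {ℓ : ℕ} {ζ : 𝕜} [NeZero ℓ] [Fact (1 < ℓ)]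
  {E F K Z : D} (h : IsCentralExtension ℓ ζ E F K Z)

/-- The homomorphism `U_ζ → D`. -/
noncomputable def homLeft : SmallQuantumSL2 𝕜 ζ ℓ →ₐ[𝕜] D :=
  SmallQuantumSL2.lift 𝕜 ζ ℓ E F K h.K_pow h.E_pow h.F_pow h.K_E h.K_F h.E_F

@[simp] theorem homLeft_E : h.homLeft (SmallQuantumSL2.E 𝕜 ζ ℓ) = E := SmallQuantumSL2.lift_E ..
@[simp] theorem homLeft_F : h.homLeft (SmallQuantumSL2.F 𝕜 ζ ℓ) = F := SmallQuantumSL2.lift_F ..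
@[simp] theorem homLeft_K : h.homLeft (SmallQuantumSL2.K 𝕜 ζ ℓ) = K := SmallQuantumSL2.lift_K ..

/-- The homomorphism `𝒜 → D`. -/
noncomputable def homRight : CyclicAlgebra 𝕜 ℓ →ₐ[𝕜] D := CyclicAlgebra.lift Z h.Z_pow

@[simp] theorem homRight_z : h.homRight (CyclicAlgebra.z 𝕜 ℓ) = Z := CyclicAlgebra.lift_z ..

theorem commute_hom (u : SmallQuantumSL2 𝕜 ζ ℓ) (v : CyclicAlgebra 𝕜 ℓ) :
    Commute (h.homLeft u) (h.homRight v) := by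
  refine (commute_of_adjoin_eq_top CyclicAlgebra.adjoin_z _ ?_ v).symm
  rintro _ rfl
  refine (commute_of_adjoin_eq_top SmallQuantumSL2.adjoin_eq_top _ ?_ u).symm
  rintro _ (rfl | rfl | rfl) <;> simp only [homLeft_E, homLeft_F, homLeft_K, homRight_z]
  exacts [h.Z_E.symm, h.Z_F.symm, h.Z_K.symm]

/-- The homomorphism `U_ζ ⊗ 𝒜 → D`. -/
noncomputable def hom : SmallQuantumSL2 𝕜 ζ ℓ ⊗[𝕜] CyclicAlgebra 𝕜 ℓ →ₐ[𝕜] D :=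
  lift h.homLeft h.homRight h.commute_hom

theorem hom_tmul (u : SmallQuantumSL2 𝕜 ζ ℓ) (v : CyclicAlgebra 𝕜 ℓ) :
    h.hom (u ⊗ₜ v) = h.homLeft u * h.homRight v := lift_tmul ..

@[simp] theorem hom_left (u : SmallQuantumSL2 𝕜 ζ ℓ) : h.hom (u ⊗ₜ 1) = h.homLeft u := by
  rw [hom_tmul, map_one, mul_one]

@[simp] theorem hom_right (v : CyclicAlgebra 𝕜 ℓ) : h.hom (1 ⊗ₜ v) = h.homRight v := by
  rw [hom_tmul, map_one, one_mul]

/-- A multiplicative property of `U_ζ ⊗ 𝒜` may be checked on generators. -/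
theorem induction_generators {p : SmallQuantumSL2 𝕜 ζ ℓ ⊗[𝕜] CyclicAlgebra 𝕜 ℓ → Prop}
    (hE : p (SmallQuantumSL2.E 𝕜 ζ ℓ ⊗ₜ 1)) (hF : p (SmallQuantumSL2.F 𝕜 ζ ℓ ⊗ₜ 1))
    (hK : p (SmallQuantumSL2.K 𝕜 ζ ℓ ⊗ₜ 1)) (hZ : p (1 ⊗ₜ CyclicAlgebra.z 𝕜 ℓ))
    (hc : ∀ c, p (algebraMap 𝕜 _ c)) (ha : ∀ x y, p x → p y → p (x + y))
    (hm : ∀ x y, p x → p y → p (x * y)) (x) : p x := by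
  have hx : x ∈ (⊤ : Subalgebra 𝕜 (SmallQuantumSL2 𝕜 ζ ℓ ⊗[𝕜] CyclicAlgebra 𝕜 ℓ)) := Algebra.mem_top
  rw [← adjoin_union_image_include SmallQuantumSL2.adjoin_eq_top CyclicAlgebra.adjoin_z] at hx
  induction hx using Algebra.adjoin_induction with
  | mem a ha =>
    rcases ha with ⟨_, rfl | rfl | rfl, rfl⟩ | ⟨_, rfl, rfl⟩
    exacts [hE, hF, hK, hZ]
  | algebraMap r => exact hc r
  | add a b _ _ h1 h2 => exact ha a b h1 h2
  | mul a b _ _ h1 h2 => exact hm a b h1 h2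

end Hom

end IsCentralExtension

/-- The coproduct and counit of the quantum double of `B_ζ(sl₂)` in terms of `E`, `F`, `K` and
`Z`. -/
structure IsHopfExtension {𝕜 D : Type*} [Field 𝕜] [Ring D] [HopfAlgebra 𝕜 D] (ℓ : ℕ) (ζ : 𝕜)
    (E F K Z : D) : Prop extends IsCentralExtension ℓ ζ E F K Z where
  odd : Odd ℓ
  isPrimitiveRoot : IsPrimitiveRoot ζ ℓ
  comul_E : Coalgebra.comul (R := 𝕜) E = E ⊗ₜ (Z ^ (ℓ - 1)) + K ⊗ₜ E
  comul_F : Coalgebra.comul (R := 𝕜) F = 1 ⊗ₜ F + F ⊗ₜ (Z * K ^ (ℓ - 1))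
  comul_K : Coalgebra.comul (R := 𝕜) K = K ⊗ₜ K
  comul_Z : Coalgebra.comul (R := 𝕜) Z = Z ⊗ₜ Z
  counit_E : Coalgebra.counit (R := 𝕜) E = 0
  counit_F : Coalgebra.counit (R := 𝕜) F = 0
  counit_K : Coalgebra.counit (R := 𝕜) K = 1
  counit_Z : Coalgebra.counit (R := 𝕜) Z = 1

/-! ### The gauge transformation -/

namespace IsHopfExtension

open Algebra.TensorProduct Coalgebra HopfAlgebra

variable {𝕜 D : Type*} [Field 𝕜] [CharZero 𝕜] [Ring D] [HopfAlgebra 𝕜 D] {ℓ : ℕ} {ζ : 𝕜}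
  {E F K Z : D} (h : IsHopfExtension ℓ ζ E F K Z)

include h

theorem pos : 0 < ℓ := h.odd.pos

theorem isPrimitiveRoot_inv_sq : IsPrimitiveRoot (ζ⁻¹ ^ 2) ℓ :=
  h.isPrimitiveRoot.inv.pow_of_coprime 2 (Nat.coprime_two_left.2 h.odd)

theorem inv_inv_sq : (ζ⁻¹ ^ 2)⁻¹ = ζ ^ 2 := by rw [inv_pow, inv_inv]

theorem left_pow {x : D} (hx : x ^ ℓ = 1) : (x ⊗ₜ[𝕜] (1 : D)) ^ ℓ = 1 := by
  rw [tmul_pow, hx, one_pow, one_def]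

theorem right_pow {x : D} (hx : x ^ ℓ = 1) : ((1 : D) ⊗ₜ[𝕜] x) ^ ℓ = 1 := by
  rw [tmul_pow, hx, one_pow, one_def]

omit [CharZero 𝕜] h in
theorem commute_left_right (x y : D) : Commute (x ⊗ₜ[𝕜] (1 : D)) ((1 : D) ⊗ₜ[𝕜] y) := by
  simp [Commute, SemiconjBy]

theorem isUnit_bichar : IsUnit (bicharacter ℓ ζ⁻¹ K Z) := by
  rw [bicharacter_eq_torusPairing]
  exact isUnit_torusPairing h.pos h.isPrimitiveRoot_inv_sq (h.left_pow h.K_pow)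
    (h.right_pow h.Z_pow) (commute_left_right K Z)

/-- With $K_i,Z_i$ placed in leg $i$, multiplicativity turns both sides of the cocycle identity into
products of the pairings of $(K_1,Z_2)$, $(K_1,Z_3)$ and $(K_2,Z_3)$. The counit conditions reduce
to $T(1,Z)=1=T(K,1)$. -/
theorem isGaugeTransformation :
    IsGaugeTransformation (comul (R := 𝕜)) (counit (R := 𝕜)) (bicharacter ℓ ζ⁻¹ K Z) where
  isUnit := h.isUnit_bichar
  cocycle := by
    have hq := h.isPrimitiveRoot_inv_sq
    rw [assoc_rTensor_comul, lTensor_comul, bicharacter_eq_torusPairing, leg12, leg23]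
    simp only [map_torusPairing]
    have h1 : comulRight 𝕜 D (K ⊗ₜ 1) = K ⊗ₜ (1 ⊗ₜ 1) := by simp [comulRight, one_def]
    have h2 : comulRight 𝕜 D (1 ⊗ₜ Z) = (1 ⊗ₜ (1 ⊗ₜ Z)) * (1 ⊗ₜ (Z ⊗ₜ 1)) := by
      simp [comulRight, h.comul_Z]
    have h3 : comulLeft 𝕜 D (K ⊗ₜ 1) = (K ⊗ₜ (1 ⊗ₜ 1)) * (1 ⊗ₜ (K ⊗ₜ 1)) := by
      simp [comulLeft, h.comul_K]
    have h4 : comulLeft 𝕜 D (1 ⊗ₜ Z) = 1 ⊗ₜ (1 ⊗ₜ Z) := by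
      simp only [comulLeft]; simp [one_def]
    simp only [h1, h2, h3, h4, map_tmul, includeLeft_apply, includeRight_apply,
      AlgHom.coe_id, id]
    have hKp : (K ⊗ₜ[𝕜] ((1 : D) ⊗ₜ[𝕜] (1 : D))) ^ ℓ = 1 := by
      rw [tmul_pow, h.K_pow, ← one_def, one_pow, ← one_def]
    have hZp : ((1 : D) ⊗ₜ[𝕜] ((1 : D) ⊗ₜ[𝕜] Z)) ^ ℓ = 1 := by
      rw [tmul_pow, tmul_pow, h.Z_pow, one_pow, ← one_def, ← one_def]
    rw [← torusPairing_mul' hq hKp (by simp [Commute, SemiconjBy]) (by simp [Commute, SemiconjBy])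
      (by simp [Commute, SemiconjBy]), ← torusPairing_mul hq hZp (by simp [Commute, SemiconjBy])
      (by simp [Commute, SemiconjBy])]
    -- The three pairings commute with one another; the only nontrivial point is the second leg,
    -- where $K$ meets $Z$.
    have hc : Commute (torusPairing ℓ (ζ⁻¹ ^ 2) ((1 : D) ⊗ₜ[𝕜] (K ⊗ₜ[𝕜] (1 : D)))
        ((1 : D) ⊗ₜ[𝕜] ((1 : D) ⊗ₜ[𝕜] Z)))
        (torusPairing ℓ (ζ⁻¹ ^ 2) (K ⊗ₜ[𝕜] ((1 : D) ⊗ₜ[𝕜] (1 : D)))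
          ((1 : D) ⊗ₜ[𝕜] ((1 : D) ⊗ₜ[𝕜] Z))) :=
      commute_torusPairing _ _
        (commute_torusPairing _ _ (by simp [Commute, SemiconjBy])
          (by simp [Commute, SemiconjBy])).symm
        (commute_torusPairing _ _ (by simp [Commute, SemiconjBy])
          (by simp [Commute, SemiconjBy])).symm
    have hc' : Commute (torusPairing ℓ (ζ⁻¹ ^ 2) ((1 : D) ⊗ₜ[𝕜] (K ⊗ₜ[𝕜] (1 : D)))
        ((1 : D) ⊗ₜ[𝕜] ((1 : D) ⊗ₜ[𝕜] Z)))
        (torusPairing ℓ (ζ⁻¹ ^ 2) (K ⊗ₜ[𝕜] ((1 : D) ⊗ₜ[𝕜] (1 : D)))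
          ((1 : D) ⊗ₜ[𝕜] (Z ⊗ₜ[𝕜] (1 : D)))) :=
      commute_torusPairing _ _
        (commute_torusPairing _ _ (by simp [Commute, SemiconjBy])
          (by simp [Commute, SemiconjBy])).symm
        (commute_torusPairing _ _ (by simp [Commute, SemiconjBy, h.Z_K.eq])
          (by simp [Commute, SemiconjBy])).symm
    have hc'' : Commute (torusPairing ℓ (ζ⁻¹ ^ 2) (K ⊗ₜ[𝕜] ((1 : D) ⊗ₜ[𝕜] (1 : D)))
          ((1 : D) ⊗ₜ[𝕜] (Z ⊗ₜ[𝕜] (1 : D))))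
        (torusPairing ℓ (ζ⁻¹ ^ 2) (K ⊗ₜ[𝕜] ((1 : D) ⊗ₜ[𝕜] (1 : D)))
          ((1 : D) ⊗ₜ[𝕜] ((1 : D) ⊗ₜ[𝕜] Z))) :=
      commute_torusPairing _ _
        (commute_torusPairing _ _ (Commute.refl _)
          (by simp [Commute, SemiconjBy])).symm
        (commute_torusPairing _ _ (by simp [Commute, SemiconjBy])
          (by simp [Commute, SemiconjBy])).symm
    exact ((hc.mul_right hc').eq.trans (by rw [hc''.eq])).trans (mul_assoc _ _ _)
  counit_left := by
    have hε : ∀ t : D ⊗[𝕜] D, TensorProduct.lid 𝕜 D ((counit (R := 𝕜)).rTensor D t)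
        = (Algebra.TensorProduct.lid 𝕜 D).toAlgHom.comp
          (Algebra.TensorProduct.map (Bialgebra.counitAlgHom 𝕜 D) (AlgHom.id 𝕜 D)) t := fun t ↦ rfl
    rw [hε, bicharacter_eq_torusPairing, map_torusPairing]
    convert torusPairing_one_left h.pos h.isPrimitiveRoot_inv_sq
    simp [h.counit_K]
  counit_right := by
    have hε : ∀ t : D ⊗[𝕜] D, TensorProduct.rid 𝕜 D ((counit (R := 𝕜)).lTensor D t)
        = (Algebra.TensorProduct.rid 𝕜 𝕜 D).toAlgHom.comp
          (Algebra.TensorProduct.map (AlgHom.id 𝕜 D) (Bialgebra.counitAlgHom 𝕜 D)) t := fun t ↦ rfl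
    rw [hε, bicharacter_eq_torusPairing, map_torusPairing]
    convert torusPairing_one_right h.pos h.isPrimitiveRoot_inv_sq
    simp [h.counit_Z]

/-- At $q=\zeta^{-2}$ the element $E$ has weight $q^{-1}$ under $K$, so crossing adds a $Z$ in the
other leg. -/
theorem bichar_mul_left_E : bicharacter ℓ ζ⁻¹ K Z * (E ⊗ₜ 1) = (E ⊗ₜ Z) * bicharacter ℓ ζ⁻¹ K Z := by
  have h1 : (E ⊗ₜ[𝕜] Z) = (E ⊗ₜ[𝕜] (1 : D)) * ((1 : D) ⊗ₜ[𝕜] Z) := by simp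
  rw [bicharacter_eq_torusPairing, h1]
  refine torusPairing_mul_of_mul_eq_inv h.pos h.isPrimitiveRoot_inv_sq.pow_eq_one
    (h.right_pow h.Z_pow) ?_ (commute_left_right E Z).symm (commute_left_right K Z)
  rw [h.inv_inv_sq, tmul_mul_tmul, tmul_mul_tmul, h.K_E, TensorProduct.smul_tmul']

/-- $F$ has the opposite weight $q$, so crossing removes a $Z$. -/
theorem bichar_mul_left_F : bicharacter ℓ ζ⁻¹ K Z * (F ⊗ₜ Z) = (F ⊗ₜ 1) * bicharacter ℓ ζ⁻¹ K Z := by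
  have h1 : (F ⊗ₜ[𝕜] Z) = (F ⊗ₜ[𝕜] (1 : D)) * ((1 : D) ⊗ₜ[𝕜] Z) := by simp
  rw [bicharacter_eq_torusPairing, h1]
  refine torusPairing_mul_of_mul_eq h.pos h.isPrimitiveRoot_inv_sq.pow_eq_one
    (h.right_pow h.Z_pow) ?_ (commute_left_right F Z).symm
  rw [tmul_mul_tmul, tmul_mul_tmul, h.K_F, TensorProduct.smul_tmul']

theorem commute_bichar {u : D ⊗[𝕜] D} (hK : Commute u (K ⊗ₜ 1)) (hZ : Commute u (1 ⊗ₜ Z)) :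
    Commute (bicharacter ℓ ζ⁻¹ K Z) u := by
  rw [bicharacter_eq_torusPairing]
  exact (commute_torusPairing _ _ hK hZ).symm

end IsHopfExtension

theorem map_productR {𝕜 A B C : Type*} [CommRing 𝕜] [Ring A] [Algebra 𝕜 A] [Ring B] [Algebra 𝕜 B]
    [Ring C] [Algebra 𝕜 C] {g : A ⊗[𝕜] B →ₐ[𝕜] C} {gA : A →ₐ[𝕜] C} {gB : B →ₐ[𝕜] C}
    (hA : ∀ a, g (a ⊗ₜ 1) = gA a) (hB : ∀ b, g (1 ⊗ₜ b) = gB b) (𝓡 : A ⊗[𝕜] A) (𝓢 : B ⊗[𝕜] B) :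
    Algebra.TensorProduct.map g g (productR 𝓡 𝓢)
      = Algebra.TensorProduct.map gA gA 𝓡 * Algebra.TensorProduct.map gB gB 𝓢 := by
  rw [productR, map_mul]
  congr 1
  · induction 𝓡 with
    | zero => simp
    | tmul a b => simp [hA]
    | add a b ha hb => simp only [map_add, ha, hb]
  · induction 𝓢 with
    | zero => simp
    | tmul a b => simp [hB]
    | add a b ha hb => simp only [map_add, ha, hb]

/-! ### The twisted coproduct, antipode and R-matrix -/

namespace IsHopfExtension

open Algebra.TensorProduct Coalgebra HopfAlgebra

variable {𝕜 D : Type*} [Field 𝕜] [CharZero 𝕜] [Ring D] [HopfAlgebra 𝕜 D] {ℓ : ℕ} {ζ : 𝕜}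
  {E F K Z : D} (h : IsHopfExtension ℓ ζ E F K Z)

section Twist

variable [Fact (Odd ℓ)] [Fact (1 < ℓ)] [Fact (IsPrimitiveRoot ζ ℓ)] [NeZero ℓ]

/-- Stated as an intertwining relation, it is additive and multiplicative in $u$, hence a matter of
generators. There the gauge element turns $E\otimes Z^{-1}$ into $E\otimes1$ and $F\otimes ZK^{-1}$
into $F\otimes K^{-1}$; centrality of $Z$ leaves the other terms alone. -/
theorem bichar_mul_comul_hom (u : SmallQuantumSL2 𝕜 ζ ℓ ⊗[𝕜] CyclicAlgebra 𝕜 ℓ) :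
    bicharacter ℓ ζ⁻¹ K Z * comul (R := 𝕜) (h.hom u)
      = Algebra.TensorProduct.map h.hom h.hom (comul (R := 𝕜) u) * bicharacter ℓ ζ⁻¹ K Z := by
  have hZ := pow_mul_pow_sub_one h.pos h.Z_pow
  have hZ' : Commute Z (Z ^ (ℓ - 1)) := Commute.self_pow Z _
  induction u using IsCentralExtension.induction_generators with
  | hE =>
    have h1 : (E ⊗ₜ[𝕜] (Z ^ (ℓ - 1))) = (1 : D) ⊗ₜ[𝕜] (Z ^ (ℓ - 1)) * (E ⊗ₜ[𝕜] (1 : D)) := by simp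
    have h2 : Commute (bicharacter ℓ ζ⁻¹ K Z) ((1 : D) ⊗ₜ[𝕜] (Z ^ (ℓ - 1))) :=
      h.commute_bichar (by simp [Commute, SemiconjBy]) (by simp [Commute, SemiconjBy, hZ'.eq])
    have h3 : Commute (bicharacter ℓ ζ⁻¹ K Z) (K ⊗ₜ[𝕜] E) :=
      h.commute_bichar (by simp [Commute, SemiconjBy]) (by simp [Commute, SemiconjBy, h.Z_E.eq])
    rw [← includeLeft_apply (S := 𝕜), comul_includeLeft, includeLeft_apply, h.hom_left, h.homLeft_E, h.comul_E,
      SmallQuantumSL2.comul_E]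
    simp only [map_add, map_tmul, includeLeft_apply, h.hom_left, h.homLeft_E, h.homLeft_K, map_one]
    rw [mul_add, add_mul, h3.eq, h1, ← mul_assoc, h2.eq, mul_assoc, h.bichar_mul_left_E, ← mul_assoc,
      tmul_mul_tmul, ← hZ'.eq, hZ, one_mul]
  | hF =>
    have h1 : (F ⊗ₜ[𝕜] (Z * K ^ (ℓ - 1))) = (F ⊗ₜ[𝕜] Z) * ((1 : D) ⊗ₜ[𝕜] (K ^ (ℓ - 1))) := by simp
    have h2 : Commute (bicharacter ℓ ζ⁻¹ K Z) ((1 : D) ⊗ₜ[𝕜] (K ^ (ℓ - 1))) :=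
      h.commute_bichar (by simp [Commute, SemiconjBy])
        (by simp [Commute, SemiconjBy, (h.Z_K.pow_right _).eq])
    have h3 : Commute (bicharacter ℓ ζ⁻¹ K Z) ((1 : D) ⊗ₜ[𝕜] F) :=
      h.commute_bichar (by simp [Commute, SemiconjBy]) (by simp [Commute, SemiconjBy, h.Z_F.eq])
    rw [← includeLeft_apply (S := 𝕜), comul_includeLeft, includeLeft_apply, h.hom_left, h.homLeft_F, h.comul_F,
      SmallQuantumSL2.comul_F]
    simp only [map_add, map_tmul, includeLeft_apply, h.hom_left, h.homLeft_F, h.homLeft_K, map_one,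
      map_pow]
    rw [mul_add, add_mul, h3.eq, h1, ← mul_assoc, h.bichar_mul_left_F, mul_assoc, h2.eq, ← mul_assoc,
      tmul_mul_tmul, mul_one, one_mul, add_comm]
  | hK =>
    rw [← includeLeft_apply (S := 𝕜), comul_includeLeft, includeLeft_apply, h.hom_left, h.homLeft_K, h.comul_K,
      SmallQuantumSL2.comul_K]
    simp only [map_tmul, includeLeft_apply, h.hom_left, h.homLeft_K]
    exact (h.commute_bichar (by simp [Commute, SemiconjBy])
      (by simp [Commute, SemiconjBy, h.Z_K.eq])).eq
  | hZ =>
    rw [← includeRight_apply, comul_includeRight, includeRight_apply, h.hom_right, h.homRight_z,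
      h.comul_Z, CyclicAlgebra.comul_z]
    simp only [map_tmul, includeRight_apply, h.hom_right, h.homRight_z]
    exact (h.commute_bichar (by simp [Commute, SemiconjBy, h.Z_K.eq])
      (by simp [Commute, SemiconjBy])).eq
  | hc c =>
    rw [AlgHom.commutes, Bialgebra.comul_algebraMap, Bialgebra.comul_algebraMap, AlgHom.commutes,
      Algebra.commutes]
  | ha x y hx hy => simp only [map_add, mul_add, add_mul, hx, hy]
  | hm x y hx hy =>
    rw [map_mul, Bialgebra.comul_mul, Bialgebra.comul_mul, map_mul, ← mul_assoc, hx, mul_assoc, hy,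
      mul_assoc]

theorem twistComul_hom (u : SmallQuantumSL2 𝕜 ζ ℓ ⊗[𝕜] CyclicAlgebra 𝕜 ℓ) :
    twistComul (comul (R := 𝕜)) (bicharacter ℓ ζ⁻¹ K Z) (h.hom u)
      = Algebra.TensorProduct.map h.hom h.hom (comul (R := 𝕜) u) := by
  change bicharacter ℓ ζ⁻¹ K Z * (comul (R := 𝕜) (h.hom u) * Ring.inverse _) = _
  rw [← mul_assoc, h.bichar_mul_comul_hom, mul_assoc, Ring.mul_inverse_cancel _ h.isUnit_bichar,
    mul_one]

theorem counit_hom (u : SmallQuantumSL2 𝕜 ζ ℓ ⊗[𝕜] CyclicAlgebra 𝕜 ℓ) :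
    counit (R := 𝕜) (h.hom u) = counit (R := 𝕜) u := by
  induction u using IsCentralExtension.induction_generators with
  | hE => simp [h.counit_E]
  | hF => simp [h.counit_F]
  | hK => simp [h.counit_K]
  | hZ => simp [h.counit_Z]
  | hc c => simp
  | ha x y hx hy => simp only [map_add, hx, hy]
  | hm x y hx hy => rw [map_mul, Bialgebra.counit_mul, Bialgebra.counit_mul, hx, hy]

omit [Fact (Odd ℓ)] [Fact (1 < ℓ)] [Fact (IsPrimitiveRoot ζ ℓ)] [NeZero ℓ] in
theorem antipode_of_comul_self {x : D} (hx : x ^ ℓ = 1) (hl : 0 < ℓ)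
    (hΔ : comul (R := 𝕜) x = x ⊗ₜ x) (hε : counit (R := 𝕜) x = 1) :
    antipode 𝕜 x = x ^ (ℓ - 1) := by
  have h1 := mul_antipode_rTensor_comul_apply (R := 𝕜) x
  rw [hΔ, LinearMap.rTensor_tmul, LinearMap.mul'_apply, hε, map_one] at h1
  exact left_inv_eq_right_inv h1 (pow_mul_pow_sub_one hl hx)

section

include h

omit [Fact (Odd ℓ)] [Fact (1 < ℓ)] [Fact (IsPrimitiveRoot ζ ℓ)] [NeZero ℓ]

theorem antipode_K : antipode 𝕜 K = K ^ (ℓ - 1) :=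
  antipode_of_comul_self h.K_pow h.pos h.comul_K h.counit_K

theorem antipode_Z : antipode 𝕜 Z = Z ^ (ℓ - 1) :=
  antipode_of_comul_self h.Z_pow h.pos h.comul_Z h.counit_Z

theorem K_inv_mul_K : K ^ (ℓ - 1) * K = 1 := pow_sub_one_mul h.pos.ne' K ▸ h.K_pow

theorem Z_inv_mul_Z : Z ^ (ℓ - 1) * Z = 1 := pow_sub_one_mul h.pos.ne' Z ▸ h.Z_pow

theorem antipode_pow {x y : D} (hxy : antipode 𝕜 x = y) (n : ℕ) : antipode 𝕜 (x ^ n) = y ^ n := by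
  induction n with
  | zero => rw [pow_zero, pow_zero, antipode_one]
  | succ n ih => rw [pow_succ, antipode_mul_antidistrib, ih, hxy, pow_succ']

theorem antipode_Z_inv : antipode 𝕜 (Z ^ (ℓ - 1)) = Z := by
  rw [h.antipode_pow h.antipode_Z]
  refine left_inv_eq_right_inv (a := Z ^ (ℓ - 1)) ?_ h.Z_inv_mul_Z
  rw [← pow_succ, Nat.sub_add_cancel h.pos, pow_sub_one_pow_eq_one h.Z_pow]

/-- The antipode axiom for $\Delta(E)$ reads $E\,S(Z^{-1})+K\,S(E)=0$ and determines $S(E)$; the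
explicit antipode of the double is not needed. -/
theorem antipode_E : antipode 𝕜 E = -(K ^ (ℓ - 1) * E * Z) := by
  have h1 := mul_antipode_lTensor_comul_apply (R := 𝕜) E
  rw [h.comul_E, map_add, LinearMap.lTensor_tmul, LinearMap.lTensor_tmul, map_add,
    LinearMap.mul'_apply, LinearMap.mul'_apply, h.counit_E, map_zero, h.antipode_Z_inv] at h1
  rw [← one_mul (antipode 𝕜 E), ← h.K_inv_mul_K, mul_assoc, eq_neg_of_add_eq_zero_right h1, mul_neg,
    mul_assoc]

/-- Solved in the same way from $F+S(F)\,ZK^{-1}=0$. -/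
theorem antipode_F : antipode 𝕜 F = -(F * K * Z ^ (ℓ - 1)) := by
  have h1 := mul_antipode_rTensor_comul_apply (R := 𝕜) F
  rw [h.comul_F, map_add, LinearMap.rTensor_tmul, LinearMap.rTensor_tmul, map_add,
    LinearMap.mul'_apply, LinearMap.mul'_apply, h.counit_F, map_zero, antipode_one, one_mul] at h1
  have h2 : Z * K ^ (ℓ - 1) * (K * Z ^ (ℓ - 1)) = 1 := by
    rw [mul_assoc, ← mul_assoc _ K, h.K_inv_mul_K, one_mul, pow_mul_pow_sub_one h.pos h.Z_pow]
  rw [← mul_one (antipode 𝕜 F), ← h2, ← mul_assoc, eq_neg_of_add_eq_zero_right h1, neg_mul,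
    mul_assoc]

/-- $m(\mathrm{id}\otimes S)$ sends $K^i\otimes Z^j$ to $K^iZ^{-j}$, so the twist element is a torus
pairing inside the algebra itself and the same crossing rules apply. -/
theorem twistElement_eq : twistElement (antipode 𝕜) (bicharacter ℓ ζ⁻¹ K Z)
    = torusPairing ℓ (ζ⁻¹ ^ 2) K (Z ^ (ℓ - 1)) := by
  simp only [twistElement, bicharacter, torusPairing, map_smul, map_sum, LinearMap.lTensor_tmul,
    LinearMap.mul'_apply, h.antipode_pow h.antipode_Z, ← pow_mul, mul_assoc]

theorem isUnit_twistElement : IsUnit (twistElement (antipode 𝕜) (bicharacter ℓ ζ⁻¹ K Z)) := by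
  rw [h.twistElement_eq]
  exact isUnit_torusPairing h.pos h.isPrimitiveRoot_inv_sq h.K_pow (pow_sub_one_pow_eq_one h.Z_pow _)
    (h.Z_K.symm.pow_right _)

theorem twistElement_mul_E : twistElement (antipode 𝕜) (bicharacter ℓ ζ⁻¹ K Z) * E
    = E * Z ^ (ℓ - 1) * twistElement (antipode 𝕜) (bicharacter ℓ ζ⁻¹ K Z) := by
  rw [h.twistElement_eq]
  exact torusPairing_mul_of_mul_eq_inv h.pos h.isPrimitiveRoot_inv_sq.pow_eq_one
    (pow_sub_one_pow_eq_one h.Z_pow _) (by rw [h.inv_inv_sq, h.K_E]) (h.Z_E.pow_left _)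
    (h.Z_K.symm.pow_right _)

theorem twistElement_mul_F : twistElement (antipode 𝕜) (bicharacter ℓ ζ⁻¹ K Z) * (F * Z ^ (ℓ - 1))
    = F * twistElement (antipode 𝕜) (bicharacter ℓ ζ⁻¹ K Z) := by
  rw [h.twistElement_eq]
  exact torusPairing_mul_of_mul_eq h.pos h.isPrimitiveRoot_inv_sq.pow_eq_one
    (pow_sub_one_pow_eq_one h.Z_pow _) h.K_F (h.Z_F.pow_left _)

theorem commute_twistElement {u : D} (hK : Commute u K) (hZ : Commute u Z) :
    Commute (twistElement (antipode 𝕜) (bicharacter ℓ ζ⁻¹ K Z)) u := by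
  rw [h.twistElement_eq]
  exact (commute_torusPairing _ _ hK (hZ.pow_right _)).symm

end

/-- The antipodes of the double contain a spare $Z$ in $S(E)$ and $Z^{-1}$ in $S(F)$; crossing the
twist element removes them. Both antipodes reverse products, so the relation again passes from
generators to products. -/
theorem twistElement_mul_antipode_hom (u : SmallQuantumSL2 𝕜 ζ ℓ ⊗[𝕜] CyclicAlgebra 𝕜 ℓ) :
    twistElement (antipode 𝕜) (bicharacter ℓ ζ⁻¹ K Z) * antipode 𝕜 (h.hom u)
      = h.hom (antipode 𝕜 u) * twistElement (antipode 𝕜) (bicharacter ℓ ζ⁻¹ K Z) := by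
  induction u using IsCentralExtension.induction_generators with
  | hE =>
    have hK : Commute _ (K ^ (ℓ - 1)) :=
      h.commute_twistElement ((Commute.refl K).pow_left (ℓ - 1)) (h.Z_K.symm.pow_left _)
    have hZ := h.commute_twistElement h.Z_K (Commute.refl Z)
    have h1 : antipode 𝕜 (SmallQuantumSL2.E 𝕜 ζ ℓ ⊗ₜ[𝕜] (1 : CyclicAlgebra 𝕜 ℓ))
        = antipode 𝕜 (SmallQuantumSL2.E 𝕜 ζ ℓ) ⊗ₜ antipode 𝕜 1 := rfl
    rw [h1, antipode_one, h.hom_left, h.hom_left, h.homLeft_E, SmallQuantumSL2.antipode_E, map_neg,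
      map_mul, map_pow, h.homLeft_E, h.homLeft_K, h.antipode_E, mul_neg, neg_mul, ← mul_assoc,
      ← mul_assoc, hK.eq, mul_assoc _ _ E, h.twistElement_mul_E, mul_assoc, mul_assoc, hZ.eq,
      mul_assoc E, ← mul_assoc (Z ^ (ℓ - 1)), h.Z_inv_mul_Z, one_mul, mul_assoc]
  | hF =>
    have hK : Commute _ K := h.commute_twistElement (Commute.refl K) h.Z_K.symm
    have h1 : antipode 𝕜 (SmallQuantumSL2.F 𝕜 ζ ℓ ⊗ₜ[𝕜] (1 : CyclicAlgebra 𝕜 ℓ))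
        = antipode 𝕜 (SmallQuantumSL2.F 𝕜 ζ ℓ) ⊗ₜ antipode 𝕜 1 := rfl
    rw [h1, antipode_one, h.hom_left, h.hom_left, h.homLeft_F, SmallQuantumSL2.antipode_F, map_neg,
      map_mul, h.homLeft_F, h.homLeft_K, h.antipode_F, mul_neg, neg_mul, mul_assoc F K,
      ← (h.Z_K.pow_left _).eq, ← mul_assoc F, ← mul_assoc, h.twistElement_mul_F, mul_assoc, hK.eq,
      mul_assoc]
  | hK =>
    have hK : Commute _ (K ^ (ℓ - 1)) :=
      h.commute_twistElement ((Commute.refl K).pow_left (ℓ - 1)) (h.Z_K.symm.pow_left _)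
    have h1 : antipode 𝕜 (SmallQuantumSL2.K 𝕜 ζ ℓ ⊗ₜ[𝕜] (1 : CyclicAlgebra 𝕜 ℓ))
        = antipode 𝕜 (SmallQuantumSL2.K 𝕜 ζ ℓ) ⊗ₜ antipode 𝕜 1 := rfl
    rw [h1, antipode_one, h.hom_left, h.hom_left, h.homLeft_K, SmallQuantumSL2.antipode_K, map_pow,
      h.homLeft_K, h.antipode_K, hK.eq]
  | hZ =>
    have hZ : Commute _ (Z ^ (ℓ - 1)) :=
      h.commute_twistElement (h.Z_K.pow_left _) ((Commute.refl Z).pow_left (ℓ - 1))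
    have h1 : antipode 𝕜 ((1 : SmallQuantumSL2 𝕜 ζ ℓ) ⊗ₜ[𝕜] CyclicAlgebra.z 𝕜 ℓ)
        = antipode 𝕜 1 ⊗ₜ antipode 𝕜 (CyclicAlgebra.z 𝕜 ℓ) := rfl
    rw [h1, antipode_one, h.hom_right, h.hom_right, h.homRight_z, CyclicAlgebra.antipode_z, map_pow,
      h.homRight_z, h.antipode_Z, hZ.eq]
  | hc c =>
    simp only [Algebra.algebraMap_eq_smul_one, map_smul, map_one, antipode_one, mul_smul_comm,
      smul_mul_assoc, mul_one, one_mul]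
  | ha x y hx hy => simp only [map_add, mul_add, add_mul, hx, hy]
  | hm x y hx hy =>
    rw [map_mul, antipode_mul_antidistrib, antipode_mul_antidistrib, map_mul, ← mul_assoc, hy,
      mul_assoc, hx, mul_assoc]

theorem twistAntipode_hom (u : SmallQuantumSL2 𝕜 ζ ℓ ⊗[𝕜] CyclicAlgebra 𝕜 ℓ) :
    twistAntipode (antipode 𝕜) (bicharacter ℓ ζ⁻¹ K Z) (h.hom u) = h.hom (antipode 𝕜 u) := by
  change twistElement _ _ * (antipode 𝕜 (h.hom u) * Ring.inverse _) = _
  rw [← mul_assoc, h.twistElement_mul_antipode_hom, mul_assoc,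
    Ring.mul_inverse_cancel _ h.isUnit_twistElement, mul_one]

theorem comm_bichar : TensorProduct.comm 𝕜 D D (bicharacter ℓ ζ⁻¹ K Z)
    = torusPairing ℓ (ζ⁻¹ ^ 2) (Z ⊗ₜ 1) (1 ⊗ₜ K) := by
  have h1 : TensorProduct.comm 𝕜 D D (bicharacter ℓ ζ⁻¹ K Z)
      = (Algebra.TensorProduct.comm 𝕜 D D).toAlgHom (bicharacter ℓ ζ⁻¹ K Z) := rfl
  rw [h1, bicharacter_eq_torusPairing, map_torusPairing,
    torusPairing_symm _ _ (commute_left_right Z K)]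
  rfl

/-- The twist of the R-matrix of the double is the R-matrix of `U_ζ ⊗ 𝒜`. -/
theorem twistR_eq : twistR (qExp ℓ ζ ((Z * E) ⊗ₜ F)
      * torusPairing ℓ (ζ⁻¹ ^ 2) ((K * Z) ⊗ₜ 1) (1 ⊗ₜ (Z * K ^ (ℓ - 1)))) (bicharacter ℓ ζ⁻¹ K Z)
    = Algebra.TensorProduct.map h.hom h.hom
      (productR (SmallQuantumSL2.rMatrix 𝕜 ζ ℓ) (CyclicAlgebra.rMatrix 𝕜 ζ ℓ)) := by
  have hq := h.isPrimitiveRoot_inv_sq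
  have hKi : Commute K (K ^ (ℓ - 1)) := Commute.self_pow K _
  have hZKi : Commute Z (K ^ (ℓ - 1)) := h.Z_K.pow_right _
  have e1 : ((K * Z) ⊗ₜ[𝕜] (1 : D)) = (K ⊗ₜ[𝕜] (1 : D)) * (Z ⊗ₜ[𝕜] (1 : D)) := by simp
  have e2 : ((1 : D) ⊗ₜ[𝕜] (Z * K ^ (ℓ - 1)))
      = ((1 : D) ⊗ₜ[𝕜] Z) * ((1 : D) ⊗ₜ[𝕜] (K ^ (ℓ - 1))) := by simp
  have e3 : ((Z * E) ⊗ₜ[𝕜] F) = (E ⊗ₜ[𝕜] F) * (Z ⊗ₜ[𝕜] (1 : D)) := by simp [h.Z_E.eq]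
  -- the nilpotent factor
  have hs : SemiconjBy (TensorProduct.comm 𝕜 D D (bicharacter ℓ ζ⁻¹ K Z)) ((Z * E) ⊗ₜ F)
      (E ⊗ₜ F) := by
    rw [comm_bichar, torusPairing_symm _ _ (commute_left_right Z K), SemiconjBy, e3]
    -- Taken with $x=1\otimes K$, $y=Z\otimes1$ and $u=E\otimes F$: the weight of $F$ under $K$ is
    -- $\zeta^{-2}=q$.
    refine torusPairing_mul_of_mul_eq h.pos hq.pow_eq_one (h.left_pow h.Z_pow) ?_ ?_
    · simp [h.K_F, TensorProduct.tmul_smul]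
    · simp [Commute, SemiconjBy, h.Z_E.eq]
  -- the torus factor
  have ht : torusPairing ℓ (ζ⁻¹ ^ 2) (Z ⊗ₜ[𝕜] (1 : D)) ((1 : D) ⊗ₜ[𝕜] K)
      * torusPairing ℓ (ζ⁻¹ ^ 2) ((K * Z) ⊗ₜ[𝕜] (1 : D)) ((1 : D) ⊗ₜ[𝕜] (Z * K ^ (ℓ - 1)))
      = torusPairing ℓ (ζ ^ 2) (K ⊗ₜ[𝕜] (1 : D)) ((1 : D) ⊗ₜ[𝕜] K)
        * torusPairing ℓ (ζ⁻¹ ^ 2) (Z ⊗ₜ[𝕜] (1 : D)) ((1 : D) ⊗ₜ[𝕜] Z)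
        * torusPairing ℓ (ζ⁻¹ ^ 2) (K ⊗ₜ[𝕜] (1 : D)) ((1 : D) ⊗ₜ[𝕜] Z) := by
    have hc : ∀ x y x' y' : D, Commute x x' → Commute y y' →
        Commute (torusPairing ℓ (ζ⁻¹ ^ 2) (x ⊗ₜ[𝕜] (1 : D)) ((1 : D) ⊗ₜ[𝕜] y))
          (torusPairing ℓ (ζ⁻¹ ^ 2) (x' ⊗ₜ[𝕜] (1 : D)) ((1 : D) ⊗ₜ[𝕜] y')) := by
      intro x y x' y' hx hy
      refine commute_torusPairing _ _ (commute_torusPairing _ _ ?_ ?_).symm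
        (commute_torusPairing _ _ ?_ ?_).symm <;> simp [Commute, SemiconjBy, hx.eq, hy.eq]
    -- The flipped gauge element cancels the factor on $(Z,K^{-1})$.
    have h1 : torusPairing ℓ (ζ⁻¹ ^ 2) (Z ⊗ₜ[𝕜] (1 : D)) ((1 : D) ⊗ₜ[𝕜] K)
        * torusPairing ℓ (ζ⁻¹ ^ 2) (Z ⊗ₜ[𝕜] (1 : D)) ((1 : D) ⊗ₜ[𝕜] (K ^ (ℓ - 1))) = 1 := by
      rw [torusPairing_mul' hq (h.left_pow h.Z_pow) (commute_left_right _ _)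
        (commute_left_right _ _) (by simp [Commute, SemiconjBy, hKi.eq]), tmul_mul_tmul, one_mul,
        pow_mul_pow_sub_one h.pos h.K_pow, ← one_def, torusPairing_one_right h.pos hq]
    -- Inverting both the root of unity and one argument changes nothing; this produces the
    -- $\zeta^{2ij}$ of $\mathcal R_{U_\zeta}$.
    have h2 : torusPairing ℓ (ζ⁻¹ ^ 2) (K ⊗ₜ[𝕜] (1 : D)) ((1 : D) ⊗ₜ[𝕜] (K ^ (ℓ - 1)))
        = torusPairing ℓ (ζ ^ 2) (K ⊗ₜ[𝕜] (1 : D)) ((1 : D) ⊗ₜ[𝕜] K) := by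
      have e4 : ((1 : D) ⊗ₜ[𝕜] (K ^ (ℓ - 1))) = ((1 : D) ⊗ₜ[𝕜] K) ^ (ℓ - 1) := by simp [tmul_pow]
      rw [torusPairing_symm _ _ (commute_left_right _ _), torusPairing_symm _ (ζ ^ 2)
        (commute_left_right K K), e4, ← torusPairing_inv h.pos (q := ζ ^ 2) _ (h.right_pow h.K_pow),
        inv_pow]
      rw [← pow_mul, mul_comm, pow_mul, h.isPrimitiveRoot.pow_eq_one, one_pow]
    have hZp : ((1 : D) ⊗ₜ[𝕜] (Z * K ^ (ℓ - 1))) ^ ℓ = 1 := by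
      refine h.right_pow ?_
      rw [hZKi.mul_pow, h.Z_pow, one_mul, pow_sub_one_pow_eq_one h.K_pow]
    -- Expansion in both arguments gives four commuting factors. They are arranged so that the one
    -- cancelled by $\mathbf F_{21}$ comes first and the one cancelled by $\mathbf F^{-1}$ comes
    -- last.
    have h3 : torusPairing ℓ (ζ⁻¹ ^ 2) ((K * Z) ⊗ₜ[𝕜] (1 : D)) ((1 : D) ⊗ₜ[𝕜] (Z * K ^ (ℓ - 1)))
        = torusPairing ℓ (ζ⁻¹ ^ 2) (Z ⊗ₜ[𝕜] (1 : D)) ((1 : D) ⊗ₜ[𝕜] (K ^ (ℓ - 1)))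
          * (torusPairing ℓ (ζ⁻¹ ^ 2) (K ⊗ₜ[𝕜] (1 : D)) ((1 : D) ⊗ₜ[𝕜] (K ^ (ℓ - 1)))
          * torusPairing ℓ (ζ⁻¹ ^ 2) (Z ⊗ₜ[𝕜] (1 : D)) ((1 : D) ⊗ₜ[𝕜] Z)
          * torusPairing ℓ (ζ⁻¹ ^ 2) (K ⊗ₜ[𝕜] (1 : D)) ((1 : D) ⊗ₜ[𝕜] Z)) := by
      rw [e1, ← torusPairing_mul hq hZp (commute_left_right _ _)
        (by simp [Commute, SemiconjBy, h.Z_K.eq]), e2,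
        ← torusPairing_mul' hq (h.left_pow h.K_pow) (commute_left_right _ _)
          (commute_left_right _ _) (by simp [Commute, SemiconjBy, hZKi.eq]),
        ← torusPairing_mul' hq (h.left_pow h.Z_pow) (commute_left_right _ _)
          (commute_left_right _ _) (by simp [Commute, SemiconjBy, hZKi.eq])]
      generalize ha : torusPairing ℓ (ζ⁻¹ ^ 2) (K ⊗ₜ[𝕜] (1 : D)) ((1 : D) ⊗ₜ[𝕜] Z) = a
      generalize hb : torusPairing ℓ (ζ⁻¹ ^ 2) (K ⊗ₜ[𝕜] (1 : D)) ((1 : D) ⊗ₜ[𝕜] (K ^ (ℓ - 1))) = b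
      generalize hc' : torusPairing ℓ (ζ⁻¹ ^ 2) (Z ⊗ₜ[𝕜] (1 : D)) ((1 : D) ⊗ₜ[𝕜] Z) = c
      generalize hd : torusPairing ℓ (ζ⁻¹ ^ 2) (Z ⊗ₜ[𝕜] (1 : D)) ((1 : D) ⊗ₜ[𝕜] (K ^ (ℓ - 1))) = d
      have c1 : Commute a b := by rw [← ha, ← hb]; exact hc _ _ _ _ (Commute.refl K) hZKi
      have c2 : Commute a c := by rw [← ha, ← hc']; exact hc _ _ _ _ h.Z_K.symm (Commute.refl Z)
      have c3 : Commute a d := by rw [← ha, ← hd]; exact hc _ _ _ _ h.Z_K.symm hZKi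
      have c4 : Commute b d := by rw [← hb, ← hd]; exact hc _ _ _ _ h.Z_K.symm (Commute.refl _)
      have c5 : Commute c d := by rw [← hc', ← hd]; exact hc _ _ _ _ (Commute.refl Z) hZKi
      have c6 : Commute (a * b * c) d := (c3.mul_left c4).mul_left c5
      have c7 : Commute a (b * c) := c1.mul_right c2
      rw [← mul_assoc, c6.eq, mul_assoc a, c7.eq]
    rw [h3, ← mul_assoc, h1, one_mul, h2]
  have hR : Algebra.TensorProduct.map h.hom h.hom
      (productR (SmallQuantumSL2.rMatrix 𝕜 ζ ℓ) (CyclicAlgebra.rMatrix 𝕜 ζ ℓ))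
      = qExp ℓ ζ (E ⊗ₜ[𝕜] F) * torusPairing ℓ (ζ ^ 2) (K ⊗ₜ[𝕜] (1 : D)) ((1 : D) ⊗ₜ[𝕜] K)
        * torusPairing ℓ (ζ⁻¹ ^ 2) (Z ⊗ₜ[𝕜] (1 : D)) ((1 : D) ⊗ₜ[𝕜] Z) := by
    rw [map_productR h.hom_left h.hom_right, SmallQuantumSL2.rMatrix_eq, CyclicAlgebra.rMatrix,
      bicharacter_eq_torusPairing]
    simp only [map_mul, map_qExp, map_torusPairing, map_tmul, h.homLeft_E, h.homLeft_F, h.homLeft_K,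
      h.homRight_z, map_one]
  rw [twistR, hR, ← mul_assoc, (semiconjBy_qExp hs).eq, mul_assoc (qExp ℓ ζ _), comm_bichar, ht,
    ← bicharacter_eq_torusPairing ℓ ζ⁻¹ K Z, mul_assoc, mul_assoc,
    Ring.mul_inverse_cancel _ h.isUnit_bichar, mul_one, mul_assoc]

end Twist

end IsHopfExtension

/-- The coproduct and counit of the quantum double of `B_ζ(sl₂)` in terms of `e`, `k`, `f` and a
square root `b` of `α`. -/
structure IsBorelDoubleHopf {𝕜 D : Type*} [Field 𝕜] [Ring D] [HopfAlgebra 𝕜 D] (ℓ : ℕ) (ζ : 𝕜)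
    (e k b f : D) : Prop extends IsBorelDouble ℓ ζ e k b f where
  comul_e : Coalgebra.comul (R := 𝕜) e = e ⊗ₜ 1 + (k ^ 2) ⊗ₜ e
  comul_f : Coalgebra.comul (R := 𝕜) f = 1 ⊗ₜ f + f ⊗ₜ (b ^ 2)
  comul_k : Coalgebra.comul (R := 𝕜) k = k ⊗ₜ k
  comul_b : Coalgebra.comul (R := 𝕜) b = b ⊗ₜ b
  counit_e : Coalgebra.counit (R := 𝕜) e = 0
  counit_f : Coalgebra.counit (R := 𝕜) f = 0
  counit_k : Coalgebra.counit (R := 𝕜) k = 1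
  counit_b : Coalgebra.counit (R := 𝕜) b = 1

namespace IsBorelDoubleHopf

open Coalgebra

variable {𝕜 D : Type*} [Field 𝕜] [CharZero 𝕜] [Ring D] [HopfAlgebra 𝕜 D] {ℓ : ℕ} {ζ : 𝕜}
  {e k b f : D} (h : IsBorelDoubleHopf ℓ ζ e k b f)

-- For $E$, the coproduct of $e$ is multiplied by $Z^{-1}\otimes Z^{-1}$, and $Z^{-1}k^2=K$ appears
-- in the first leg; for $F$, the group-like $b^2=\alpha$ is written as $ZK^{-1}$.
include h in
theorem isHopfExtension :
    IsHopfExtension ℓ ζ ((ζ - ζ⁻¹)⁻¹ • (b ^ (ℓ - 1) * k ^ (ℓ - 1) * e)) (-f) (b ^ (ℓ - 1) * k)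
      (b * k) where
  toIsCentralExtension := h.isCentralExtension
  odd := h.odd
  isPrimitiveRoot := h.isPrimitiveRoot
  comul_E := by
    rw [map_smul, Bialgebra.comul_mul, Bialgebra.comul_mul, Bialgebra.comul_pow, Bialgebra.comul_pow,
      h.comul_b, h.comul_k, h.comul_e, h.Z_inv]
    have h1 : k ^ (ℓ - 1) * k ^ 2 = k := by rw [sq, ← mul_assoc, h.k_inv_mul_k, one_mul]
    simp only [Algebra.TensorProduct.tmul_pow, Algebra.TensorProduct.tmul_mul_tmul, mul_add, mul_one,
      mul_assoc, h1, smul_add, TensorProduct.smul_tmul', TensorProduct.tmul_smul]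
  comul_F := by
    rw [map_neg, h.comul_f, h.commute_Z_K.pow_right (ℓ - 1) |>.eq, h.K_inv_mul_Z,
      TensorProduct.tmul_neg, TensorProduct.neg_tmul, neg_add]
  comul_K := by
    rw [Bialgebra.comul_mul, Bialgebra.comul_pow, h.comul_b, h.comul_k,
      Algebra.TensorProduct.tmul_pow, Algebra.TensorProduct.tmul_mul_tmul]
  comul_Z := by
    rw [Bialgebra.comul_mul, h.comul_b, h.comul_k, Algebra.TensorProduct.tmul_mul_tmul]
  counit_E := by rw [map_smul, Bialgebra.counit_mul, h.counit_e, mul_zero, smul_zero]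
  counit_F := by rw [map_neg, h.counit_f, neg_zero]
  counit_K := by
    rw [Bialgebra.counit_mul, Bialgebra.counit_pow, h.counit_b, h.counit_k, one_pow, one_mul]
  counit_Z := by rw [Bialgebra.counit_mul, h.counit_b, h.counit_k, one_mul]

end IsBorelDoubleHopf

/-! ### Coproduct and counit of the double on its generators -/

namespace DrinfeldDouble

open Coalgebra

variable {R H : Type*} [CommRing R] [Ring H] [HopfAlgebra R H] [HasBijectiveAntipode R H]
  [Module.Finite R H] [Module.Free R H]

theorem comul_ofAlg (x : H) : comul (R := R) (ofAlg R H x)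
    = Algebra.TensorProduct.map (ofAlg R H) (ofAlg R H) (comul (R := R) x) := by
  rw [← one_mul (ofAlg R H x), ← map_one (ofDual R H), ofDual_mul_ofAlg, comul_tmul, shuffle_eq,
    Bialgebra.comul_one, map_one, one_mul]

theorem comul_ofDual (p : DualCop R H) : comul (R := R) (ofDual R H p)
    = Algebra.TensorProduct.map (ofDual R H) (ofDual R H) (comul (R := R) p) := by
  rw [← mul_one (ofDual R H p), ← map_one (ofAlg R H), ofDual_mul_ofAlg, comul_tmul, shuffle_eq,
    Bialgebra.comul_one, map_one, mul_one]

theorem counit_ofAlg (x : H) : counit (R := R) (ofAlg R H x) = counit (R := R) x := by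
  rw [← one_mul (ofAlg R H x), ← map_one (ofDual R H), ofDual_mul_ofAlg, counit_tmul,
    DualCop.one_apply, Bialgebra.counit_one, mul_one]

theorem counit_ofDual (p : DualCop R H) : counit (R := R) (ofDual R H p) = p 1 := by
  rw [← mul_one (ofDual R H p), ← map_one (ofAlg R H), ofDual_mul_ofAlg, counit_tmul,
    Bialgebra.counit_one, one_mul]

end DrinfeldDouble

theorem comul_one_tmul {R 𝕜 A : Type*} [CommRing R] [CommRing 𝕜] [Algebra R 𝕜] [Ring A]
    [Bialgebra R A] (u : A) : Coalgebra.comul (R := 𝕜) ((1 : 𝕜) ⊗ₜ[R] u)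
      = baseChangeSq R 𝕜 A (Coalgebra.comul (R := R) u) := by
  have h : ∀ t : A ⊗[R] A, TensorProduct.AlgebraTensorModule.tensorTensorTensorComm R 𝕜 R 𝕜 𝕜 𝕜 A A
      (Coalgebra.comul (R := 𝕜) (1 : 𝕜) ⊗ₜ t) = baseChangeSq R 𝕜 A t := by
    intro t
    induction t with
    | zero => rw [TensorProduct.tmul_zero, map_zero, map_zero]
    | add a b ha hb => rw [TensorProduct.tmul_add, map_add, map_add, ha, hb]
    | tmul a b => rfl
  rw [TensorProduct.comul_tmul]
  exact h _

namespace DoubleExt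

open DrinfeldDouble SmallBorel Coalgebra

variable (𝕜 : Type*) [Field 𝕜] (ζ : 𝕜) (ℓ : ℕ) [Fact (Odd ℓ)] [Fact (IsPrimitiveRoot ζ ℓ)]

theorem baseChangeSq_tmul (u v : DoubleInt ζ ℓ) :
    baseChangeSq (IntAdjoin ζ) 𝕜 (DoubleInt ζ ℓ) (u ⊗ₜ v) = incl 𝕜 ζ ℓ u ⊗ₜ incl 𝕜 ζ ℓ v := rfl

theorem comul_incl (u : DoubleInt ζ ℓ) : comul (R := 𝕜) (incl 𝕜 ζ ℓ u)
    = baseChangeSq (IntAdjoin ζ) 𝕜 (DoubleInt ζ ℓ) (comul (R := IntAdjoin ζ) u) := by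
  exact comul_one_tmul u

theorem counit_incl (u : DoubleInt ζ ℓ) : counit (R := 𝕜) (incl 𝕜 ζ ℓ u)
    = ((counit (R := IntAdjoin ζ) u : IntAdjoin ζ) : 𝕜) := by
  rw [incl_apply, TensorProduct.counit_tmul, CommSemiring.counit_apply, Algebra.smul_def, mul_one]
  rfl

theorem comul_e : comul (R := 𝕜) (e 𝕜 ζ ℓ) = e 𝕜 ζ ℓ ⊗ₜ 1 + (k 𝕜 ζ ℓ ^ 2) ⊗ₜ e 𝕜 ζ ℓ := by
  rw [e_eq, comul_incl, comul_ofAlg, SmallBorel.comul_e, map_add, map_add,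
    Algebra.TensorProduct.map_tmul, Algebra.TensorProduct.map_tmul, baseChangeSq_tmul,
    baseChangeSq_tmul, k_eq, map_one, map_one, map_pow, map_pow]

theorem comul_k : comul (R := 𝕜) (k 𝕜 ζ ℓ) = k 𝕜 ζ ℓ ⊗ₜ k 𝕜 ζ ℓ := by
  rw [k_eq, comul_incl, comul_ofAlg, SmallBorel.comul_k, Algebra.TensorProduct.map_tmul,
    baseChangeSq_tmul]

theorem comul_α : comul (R := 𝕜) (α 𝕜 ζ ℓ) = α 𝕜 ζ ℓ ⊗ₜ α 𝕜 ζ ℓ := by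
  rw [α_eq, comul_incl, comul_ofDual, comul_gradedChar_zero_one, Algebra.TensorProduct.map_tmul,
    baseChangeSq_tmul]

theorem comul_f [Fact (1 < ℓ)] :
    comul (R := 𝕜) (f 𝕜 ζ ℓ) = 1 ⊗ₜ f 𝕜 ζ ℓ + f 𝕜 ζ ℓ ⊗ₜ α 𝕜 ζ ℓ := by
  rw [f_eq, comul_incl, comul_ofDual, comul_gradedChar_one_zero, map_add, map_add,
    Algebra.TensorProduct.map_tmul, Algebra.TensorProduct.map_tmul, baseChangeSq_tmul,
    baseChangeSq_tmul, α_eq, map_one, map_one]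

theorem gradedChar_apply_one {R : Type*} [CommRing R] [IsDomain R] {q : R}
    [Fact (IsPrimitiveRoot q ℓ)] (n s : ℕ) :
    gradedChar R q ℓ n s 1 = if n = 0 then 1 else 0 := by
  have := gradedChar_k_pow (R := R) (ζ := q) (ℓ := ℓ) n s 0
  simpa using this

theorem sq_half : (α 𝕜 ζ ℓ ^ ((ℓ + 1) / 2)) ^ 2 = α 𝕜 ζ ℓ := by
  rw [pow_right_comm, pow_half_of_odd Fact.out (α_pow 𝕜 ζ ℓ)]

theorem isBorelDoubleHopf [Fact (1 < ℓ)] :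
    IsBorelDoubleHopf ℓ ζ (e 𝕜 ζ ℓ) (k 𝕜 ζ ℓ) (α 𝕜 ζ ℓ ^ ((ℓ + 1) / 2)) (f 𝕜 ζ ℓ) where
  toIsBorelDouble := isBorelDouble 𝕜 ζ ℓ
  comul_e := comul_e 𝕜 ζ ℓ
  comul_f := by rw [comul_f, sq_half]
  comul_k := comul_k 𝕜 ζ ℓ
  comul_b := by rw [Bialgebra.comul_pow, comul_α, Algebra.TensorProduct.tmul_pow]
  counit_e := by rw [e_eq, counit_incl, counit_ofAlg, SmallBorel.counit_e]; rfl
  counit_f := by rw [f_eq, counit_incl, counit_ofDual, gradedChar_apply_one]; rfl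
  counit_k := by rw [k_eq, counit_incl, counit_ofAlg, SmallBorel.counit_k]; rfl
  counit_b := by
    rw [Bialgebra.counit_pow, α_eq, counit_incl, counit_ofDual, gradedChar_apply_one, if_pos rfl,
      OneMemClass.coe_one, one_pow]

/-- The definitions use $(\alpha^{-1})^{1/2}$ while the abstract relations use
$(\alpha^{1/2})^{-1}$; the two exponents are exchanged. -/
theorem isHopfExtension [CharZero 𝕜] [Fact (1 < ℓ)] :
    IsHopfExtension ℓ ζ (E 𝕜 ζ ℓ) (F 𝕜 ζ ℓ) (K 𝕜 ζ ℓ) (Z 𝕜 ζ ℓ) := by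
  rw [E, F, K, Z, pow_right_comm]
  exact (isBorelDoubleHopf 𝕜 ζ ℓ).isHopfExtension

theorem gauge_eq : gauge 𝕜 ζ ℓ = bicharacter ℓ ζ⁻¹ (K 𝕜 ζ ℓ) (Z 𝕜 ζ ℓ) := by
  simp only [gauge, P, bicharacter, TensorProduct.tmul_smul, TensorProduct.tmul_sum,
    Finset.smul_sum]

end DoubleExt

/-- The inverse of the structure constants of the powers of `f`. -/
theorem tauCoeff_mul_prod_qBinom {𝕜 : Type*} [Field 𝕜] {ζ : 𝕜} {ℓ : ℕ} (hζ : IsPrimitiveRoot ζ ℓ)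
    (ho : Odd ℓ) (hl : 1 < ℓ) {i : ℕ} (hi : i < ℓ) :
    tauCoeff ζ i * ∏ m ∈ Finset.range i, qBinom (ζ ^ 2) m 1 = (ζ⁻¹ - ζ) ^ i := by
  have hq : IsPrimitiveRoot (ζ ^ 2) ℓ := hζ.pow_of_coprime 2 (Nat.coprime_two_left.2 ho)
  have hne : ∀ m, 0 < m → m < ℓ → (1 - (ζ ^ 2) ^ m) ≠ 0 := fun m h0 hm h ↦
    hq.pow_ne_one_of_pos_of_lt h0.ne' hm (sub_eq_zero.1 h).symm
  have h1 : 1 - ζ ^ 2 ≠ 0 := by simpa using hne 1 one_pos hl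
  have h2 : ∀ m ∈ Finset.range i, qBinom (ζ ^ 2) m 1 * (1 - ζ ^ 2) = 1 - (ζ ^ 2) ^ (m + 1) := by
    intro m hm
    have hm : m < i := Finset.mem_range.1 hm
    have h3 := qBinom_mul (ζ ^ 2) m 1
    rw [Finset.prod_range_succ, Finset.prod_range_zero, one_mul, zero_add, pow_one, mul_right_comm,
      mul_comm] at h3
    have h4 : ∏ s ∈ Finset.range m, (1 - (ζ ^ 2) ^ (s + 1)) ≠ 0 :=
      Finset.prod_ne_zero_iff.2 fun s hs ↦
        hne _ (Nat.succ_pos s) (by have := Finset.mem_range.1 hs; omega)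
    rw [Finset.prod_range_succ] at h3
    exact mul_left_cancel₀ h4 h3
  have h3 := tauCoeff_mul_prod hζ ho hl hi
  rw [← Finset.prod_congr rfl h2, Finset.prod_mul_distrib, Finset.prod_const, Finset.card_range,
    mul_pow, ← mul_assoc] at h3
  exact mul_right_cancel₀ (pow_ne_zero i h1) h3

/-! ### The canonical R-matrix in terms of e, k, α and f -/

namespace DoubleExt

open DrinfeldDouble SmallBorel

variable (𝕜 : Type*) [Field 𝕜] [CharZero 𝕜] (ζ : 𝕜) (ℓ : ℕ) [Fact (Odd ℓ)] [Fact (1 < ℓ)]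
  [Fact (IsPrimitiveRoot ζ ℓ)]

theorem coe_qBinom (i j : ℕ) :
    ((qBinom (zetaInt ζ ^ 2) i j : IntAdjoin ζ) : 𝕜) = qBinom (ζ ^ 2) i j := by
  induction i, j using qBinom.induct with
  | case1 j => simp [qBinom]
  | case2 i => simp [qBinom]
  | case3 i j h1 h2 => simp [qBinom, h1, h2, coe_zetaInt]

/-- Fourier inversion over $\mathbb Z/\ell$: the characters $k^b\mapsto\zeta^{sb}$, summed against
$\zeta^{-js}$, isolate $b=j$. The factor $\ell$ stays on the left because the identity lives over
$\mathbb Z[\zeta]$, where $\zeta^{-1}$ is written as $\zeta^{\ell-1}$. -/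
theorem card_smul_coord [NeZero ℓ] (i j : Fin ℓ) :
    (ℓ : IntAdjoin ζ) • DualCop.of ((basis (IntAdjoin ζ) (zetaInt ζ) ℓ).coord (i, j))
      = ∑ s ∈ Finset.range ℓ, zetaInt ζ ^ ((ℓ - 1) * (j * s))
        • gradedChar (IntAdjoin ζ) (zetaInt ζ) ℓ i s := by
  refine (DualCop.toDual _ _).injective
    ((basis (IntAdjoin ζ) (zetaInt ζ) ℓ).ext fun p ↦ Subtype.coe_injective ?_)
  obtain ⟨a, b⟩ := p
  have hζ : IsPrimitiveRoot ζ ℓ := Fact.out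
  rw [DualCop.smul_apply, DualCop.of_apply, DualCop.sum_apply, Module.Basis.coord_apply,
    Module.Basis.repr_self, basis_apply]
  simp only [DualCop.smul_apply, gradedChar_apply _ _ a.2]
  by_cases h : (a : ℕ) = i
  · have h1 : ∀ s : ℕ, zetaInt ζ ^ ((ℓ - 1) * (↑j * s)) * zetaInt ζ ^ (s * (b : ℕ))
        = (zetaInt ζ ^ ((ℓ - 1) * j + b)) ^ s := fun s ↦ by
      rw [← pow_add, ← pow_mul]; congr 1; ring
    -- Multiplication by $\zeta^{j}$ turns the condition into $\zeta^b=\zeta^j$, and primitivity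
    -- compares exponents below $\ell$.
    have h2 : ζ ^ ((ℓ - 1) * j + b) = 1 ↔ b = j := by
      have hj : ζ ^ ((ℓ - 1) * j) * ζ ^ (j : ℕ) = 1 := by
        rw [← pow_add, ← Nat.succ_mul, Nat.succ_eq_add_one, Nat.sub_add_cancel j.pos, pow_mul,
          hζ.pow_eq_one, one_pow]
      rw [pow_add, ← hj, mul_right_inj' (left_ne_zero_of_mul_eq_one hj)]
      exact ⟨fun h ↦ Fin.ext (hζ.pow_inj b.2 j.2 h), fun h ↦ by rw [h]⟩
    have h3 : (ζ ^ ((ℓ - 1) * j + b)) ^ ℓ = 1 := by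
      rw [← pow_mul, mul_comm, pow_mul, hζ.pow_eq_one, one_pow]
    simp only [if_pos h, h1]
    have h4 := sum_pow_eq_ite _ h3
    push_cast [coe_zetaInt]
    rw [h4]
    simp only [h2, Finsupp.single_apply, Prod.mk.injEq, Fin.ext h, true_and]
    split_ifs <;> simp
  · simp [h, Prod.mk.injEq, Fin.ext_iff]

/-- $f^i\alpha^s$ is this functional times a $q$-factorial, whose inverse is $\tau_i$ up to a power
of $\zeta^{-1}-\zeta$. This is where the coefficients of $\mathcal R_{U_\zeta}$ come from. -/
theorem incl_gradedChar {i : ℕ} (hi : i < ℓ) (s : ℕ) :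
    incl 𝕜 ζ ℓ (ofDual _ _ (gradedChar (IntAdjoin ζ) (zetaInt ζ) ℓ i s))
      = ((ζ⁻¹ - ζ)⁻¹ ^ i * tauCoeff ζ i) • (f 𝕜 ζ ℓ ^ i * α 𝕜 ζ ℓ ^ s) := by
  have hζ : IsPrimitiveRoot ζ ℓ := Fact.out
  have h0 : (ζ⁻¹ - ζ)⁻¹ ^ i * (ζ⁻¹ - ζ) ^ i = 1 := by
    rw [← mul_pow, inv_mul_cancel₀, one_pow]
    rw [← neg_sub, neg_ne_zero]
    exact sub_inv_ne_zero hζ Fact.out Fact.out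
  rw [f_eq, α_eq, ← map_pow, ← map_pow, ← map_pow, ← map_pow, ← map_mul, ← map_mul,
    gradedChar_one_pow, gradedChar_zero_pow, smul_mul_assoc, gradedChar_mul_zero, map_smul, incl_smul,
    smul_smul, zero_add, one_mul]
  have h1 : ((∏ m ∈ Finset.range i, qBinom (zetaInt ζ ^ 2) m 1 : IntAdjoin ζ) : 𝕜)
      = ∏ m ∈ Finset.range i, qBinom (ζ ^ 2) m 1 := by
    push_cast [coe_qBinom]
    rfl
  rw [h1, mul_assoc, tauCoeff_mul_prod_qBinom hζ Fact.out Fact.out hi, h0, one_smul]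

theorem incl_coord [NeZero ℓ] (i j : Fin ℓ) :
    incl 𝕜 ζ ℓ (ofDual _ _ (DualCop.of ((basis (IntAdjoin ζ) (zetaInt ζ) ℓ).coord (i, j))))
      = (ℓ : 𝕜)⁻¹ • ∑ s ∈ Finset.range ℓ, ((ζ⁻¹ - ζ)⁻¹ ^ (i : ℕ) * tauCoeff ζ i)
        • ζ⁻¹ ^ (j * s : ℕ) • (f 𝕜 ζ ℓ ^ (i : ℕ) * α 𝕜 ζ ℓ ^ s) := by
  have h := congrArg (fun u ↦ incl 𝕜 ζ ℓ (ofDual _ _ u)) (card_smul_coord 𝕜 ζ ℓ i j)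
  simp only [map_smul, map_sum] at h
  have hl : (ℓ : 𝕜) ≠ 0 := Nat.cast_ne_zero.2 (NeZero.ne ℓ)
  rw [eq_inv_smul_iff₀ hl]
  refine Eq.trans ?_ (h.trans (Finset.sum_congr rfl fun s _ ↦ ?_))
  · rfl
  · rw [incl_gradedChar 𝕜 ζ ℓ i.2, smul_comm]
    congr 1
    rw [← pow_sub_one_eq_inv i.pos (Fact.out : IsPrimitiveRoot ζ ℓ).pow_eq_one, ← pow_mul]
    exact (algebraMap_smul 𝕜 (zetaInt ζ ^ ((ℓ - 1) * (j * s : ℕ))) _).symm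

theorem rMatrix_eq_sum [NeZero ℓ] : rMatrix 𝕜 ζ ℓ
    = ∑ i : Fin ℓ, ∑ j : Fin ℓ, (e 𝕜 ζ ℓ ^ (i : ℕ) * k 𝕜 ζ ℓ ^ (j : ℕ)) ⊗ₜ[𝕜]
      ((ℓ : 𝕜)⁻¹ • ∑ s ∈ Finset.range ℓ, ((ζ⁻¹ - ζ)⁻¹ ^ (i : ℕ) * tauCoeff ζ i)
        • ζ⁻¹ ^ (j * s : ℕ) • (f 𝕜 ζ ℓ ^ (i : ℕ) * α 𝕜 ζ ℓ ^ s)) := by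
  rw [rMatrix, universalR_eq (IntAdjoin ζ) (BorelInt ζ ℓ) (basis (IntAdjoin ζ) (zetaInt ζ) ℓ), map_sum,
    Fintype.sum_prod_type]
  refine Finset.sum_congr rfl fun i _ ↦ Finset.sum_congr rfl fun j _ ↦ ?_
  rw [baseChangeSq_tmul, incl_coord, basis_apply, map_mul, map_mul, map_pow, map_pow, map_pow,
    map_pow, e_eq, k_eq]

end DoubleExt

section

variable {𝕜 D : Type*} [Field 𝕜] {ℓ : ℕ} {ζ : 𝕜}

/-- The degree $i$ separates from the torus indices $j,s$: the former sums to the exponential, the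
latter to the pairing. The constant $c$ is absorbed into $e$. -/
theorem sum_tmul_eq_qExp_mul [Ring D] [Algebra 𝕜 D] (e k a f : D) (c : 𝕜) :
    ∑ i : Fin ℓ, ∑ j : Fin ℓ, (e ^ (i : ℕ) * k ^ (j : ℕ)) ⊗ₜ[𝕜]
      ((ℓ : 𝕜)⁻¹ • ∑ s ∈ Finset.range ℓ, (c ^ (i : ℕ) * tauCoeff ζ i)
        • ζ⁻¹ ^ (j * s : ℕ) • (f ^ (i : ℕ) * a ^ s))
      = qExp ℓ ζ ((c • e) ⊗ₜ[𝕜] f) * torusPairing ℓ ζ⁻¹ (k ⊗ₜ[𝕜] 1) (1 ⊗ₜ[𝕜] a) := by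
  rw [qExp, torusPairing, Finset.sum_mul, Finset.sum_range]
  refine Finset.sum_congr rfl fun i _ ↦ ?_
  rw [mul_smul_comm, Finset.sum_range, Finset.mul_sum, Finset.smul_sum]
  refine Finset.sum_congr rfl fun j _ ↦ ?_
  rw [TensorProduct.tmul_smul, TensorProduct.tmul_sum, Finset.mul_sum]
  congr 1
  refine Finset.sum_congr rfl fun s _ ↦ ?_
  simp only [Algebra.TensorProduct.tmul_pow, one_pow, Algebra.TensorProduct.tmul_mul_tmul, one_mul,
    mul_one, TensorProduct.tmul_smul, smul_pow, smul_mul_assoc, mul_smul_comm,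
    ← TensorProduct.smul_tmul', smul_smul]
  congr 1
  ring

/-- In the exponent $e=(\zeta-\zeta^{-1})ZE$ and $f=-F$, so the scalars cancel. In the torus part
$(\zeta^{-1},k)$ may be replaced by $(\zeta^{-2},k^2)$, since $2$ is prime to $\ell$; then $k^2=KZ$
and $b^2=ZK^{-1}$. -/
theorem IsBorelDoubleHopf.qExp_mul_torusPairing [CharZero 𝕜] [Ring D] [HopfAlgebra 𝕜 D]
    {e k b f : D} (h : IsBorelDoubleHopf ℓ ζ e k b f) :
    qExp ℓ ζ (((ζ⁻¹ - ζ)⁻¹ • e) ⊗ₜ[𝕜] f) * torusPairing ℓ ζ⁻¹ (k ⊗ₜ[𝕜] 1) (1 ⊗ₜ[𝕜] (b ^ 2))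
      = qExp ℓ ζ ((b * k * ((ζ - ζ⁻¹)⁻¹ • (b ^ (ℓ - 1) * k ^ (ℓ - 1) * e))) ⊗ₜ[𝕜] (-f))
        * torusPairing ℓ (ζ⁻¹ ^ 2) ((b ^ (ℓ - 1) * k * (b * k)) ⊗ₜ[𝕜] 1)
          (1 ⊗ₜ[𝕜] (b * k * (b ^ (ℓ - 1) * k) ^ (ℓ - 1))) := by
  have h1 : ((k ^ 2) ⊗ₜ[𝕜] (1 : D)) = (k ⊗ₜ[𝕜] (1 : D)) ^ 2 := by
    rw [Algebra.TensorProduct.tmul_pow, one_pow]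
  rw [(h.commute_Z_K.pow_right _).eq, h.K_inv_mul_Z, h.K_mul_Z, mul_smul_comm, h.Z_mul_Z_inv_mul,
    h1, torusPairing_pow (Nat.coprime_two_left.2 h.odd) h.pos h.isPrimitiveRoot.inv.pow_eq_one
      (h.isHopfExtension.left_pow h.k_pow), TensorProduct.tmul_neg, ← TensorProduct.neg_tmul,
      ← neg_smul, ← inv_neg, neg_sub]

end

/-! ### Spanning monomials of the small quantum group -/

namespace SmallQuantumSL2

variable {𝕜 : Type*} [Field 𝕜] {ζ : 𝕜} {ℓ : ℕ} [Fact (Odd ℓ)] [Fact (1 < ℓ)]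
  [Fact (IsPrimitiveRoot ζ ℓ)]

variable (𝕜 ζ ℓ) in
/-- The monomials `F ^ a E ^ b K ^ c`. -/
noncomputable def monomial (p : Fin ℓ × Fin ℓ × Fin ℓ) : SmallQuantumSL2 𝕜 ζ ℓ :=
  F 𝕜 ζ ℓ ^ (p.1 : ℕ) * E 𝕜 ζ ℓ ^ (p.2.1 : ℕ) * K 𝕜 ζ ℓ ^ (p.2.2 : ℕ)

theorem monomial_mem_span (a b c : ℕ) : F 𝕜 ζ ℓ ^ a * E 𝕜 ζ ℓ ^ b * K 𝕜 ζ ℓ ^ c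
    ∈ Submodule.span 𝕜 (Set.range (monomial 𝕜 ζ ℓ)) := by
  have hl : 0 < ℓ := (Fact.out : Odd ℓ).pos
  by_cases ha : a < ℓ
  · by_cases hb : b < ℓ
    · rw [← pow_mod_of_pow_eq_one (K_pow (𝕜 := 𝕜) (ζ := ζ) (ℓ := ℓ)) c]
      exact Submodule.subset_span ⟨(⟨a, ha⟩, ⟨b, hb⟩, ⟨c % ℓ, Nat.mod_lt _ hl⟩), rfl⟩
    · rw [pow_eq_zero_of_le (not_lt.1 hb) E_pow, mul_zero, zero_mul]
      exact Submodule.zero_mem _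
  · rw [pow_eq_zero_of_le (not_lt.1 ha) F_pow, zero_mul, zero_mul]
    exact Submodule.zero_mem _

/-- The span contains $1$ and is stable under left multiplication by the generators. Only spanning
is proved; independence will come from the dimension of the double. -/
theorem span_monomial : Submodule.span 𝕜 (Set.range (monomial 𝕜 ζ ℓ)) = ⊤ := by
  refine submodule_eq_top_of_mul_mem adjoin_eq_top _ ?_ ?_
  · simpa using monomial_mem_span (𝕜 := 𝕜) (ζ := ζ) (ℓ := ℓ) 0 0 0
  intro x hx m hm
  induction hm using Submodule.span_induction with
  | zero => rw [mul_zero]; exact Submodule.zero_mem _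
  | add u v _ _ hu hv => rw [mul_add]; exact Submodule.add_mem _ hu hv
  | smul c u _ hu => rw [mul_smul_comm]; exact Submodule.smul_mem _ _ hu
  | mem u hu =>
    obtain ⟨⟨a, b, c⟩, rfl⟩ := hu
    simp only [monomial]
    generalize (a : ℕ) = a; generalize (b : ℕ) = b; generalize (c : ℕ) = c
    have hF : ∀ a b c : ℕ, F 𝕜 ζ ℓ ^ a * K 𝕜 ζ ℓ * (E 𝕜 ζ ℓ ^ b * K 𝕜 ζ ℓ ^ c)
        ∈ Submodule.span 𝕜 (Set.range (monomial 𝕜 ζ ℓ)) := by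
      intro a b c
      rw [mul_assoc, ← mul_assoc (K 𝕜 ζ ℓ), K_mul_E_pow, smul_mul_assoc, mul_smul_comm,
        mul_assoc, ← pow_succ', ← mul_assoc]
      exact Submodule.smul_mem _ _ (monomial_mem_span _ _ _)
    have hF' : ∀ a b c : ℕ, F 𝕜 ζ ℓ ^ a * K 𝕜 ζ ℓ ^ (ℓ - 1) * (E 𝕜 ζ ℓ ^ b * K 𝕜 ζ ℓ ^ c)
        ∈ Submodule.span 𝕜 (Set.range (monomial 𝕜 ζ ℓ)) := by
      intro a b c
      rw [mul_assoc, ← mul_assoc (K 𝕜 ζ ℓ ^ (ℓ - 1)), K_inv_mul_E_pow, smul_mul_assoc, mul_smul_comm,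
        mul_assoc, ← pow_add, ← mul_assoc]
      exact Submodule.smul_mem _ _ (monomial_mem_span _ _ _)
    rcases hx with rfl | rfl | rfl
    · rcases a with _ | a
      · rw [pow_zero, one_mul, ← mul_assoc, ← pow_succ']
        simpa using monomial_mem_span (𝕜 := 𝕜) (ζ := ζ) (ℓ := ℓ) 0 (b + 1) c
      -- $E$ moves past $F^{a+1}$ at the cost of terms with $K^{\pm1}$ between $F^a$ and $E^b$; the
      -- two auxiliary facts `hF` and `hF'` reorder these.
      · have h := E_mul_F_pow (𝕜 := 𝕜) (ζ := ζ) (ℓ := ℓ) a Fact.out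
        rw [mul_assoc, ← mul_assoc, eq_add_of_sub_eq h, add_mul, smul_mul_assoc, smul_mul_assoc,
          mul_sub, mul_smul_comm, sub_mul, smul_mul_assoc, mul_assoc (F 𝕜 ζ ℓ ^ (a + 1)),
          ← mul_assoc (E 𝕜 ζ ℓ), ← pow_succ', ← mul_assoc (F 𝕜 ζ ℓ ^ (a + 1))]
        refine Submodule.add_mem _ (Submodule.smul_mem _ _ (Submodule.smul_mem _ _
          (Submodule.sub_mem _ (Submodule.smul_mem _ _ ?_) ?_))) (monomial_mem_span _ _ _)
        exacts [hF _ _ _, hF' _ _ _]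
    · rw [← mul_assoc, ← mul_assoc, ← pow_succ']
      exact monomial_mem_span _ _ _
    · rw [mul_assoc, ← mul_assoc, K_mul_F_pow, smul_mul_assoc]
      exact Submodule.smul_mem _ _ (hF _ _ _)

end SmallQuantumSL2

/-! ### Bijectivity by counting dimensions -/

namespace IsCentralExtension

variable {𝕜 D : Type*} [Field 𝕜] [Ring D] [Algebra 𝕜 D] {ℓ : ℕ} {ζ : 𝕜} [NeZero ℓ] [Fact (1 < ℓ)]
  {E F K Z : D} (h : IsCentralExtension ℓ ζ E F K Z)

theorem hom_monomial_tmul (a b c d : ℕ) :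
    h.hom ((SmallQuantumSL2.F 𝕜 ζ ℓ ^ a * SmallQuantumSL2.E 𝕜 ζ ℓ ^ b * SmallQuantumSL2.K 𝕜 ζ ℓ ^ c)
      ⊗ₜ (CyclicAlgebra.z 𝕜 ℓ ^ d)) = F ^ a * E ^ b * K ^ c * Z ^ d := by
  rw [hom_tmul]
  simp only [map_mul, map_pow, homLeft_E, homLeft_F, homLeft_K, homRight_z]

theorem span_monomial_tmul [Fact (Odd ℓ)] [Fact (IsPrimitiveRoot ζ ℓ)] :
    Submodule.span 𝕜 (Set.range fun p : Fin ℓ × Fin ℓ × Fin ℓ × Fin ℓ ↦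
      (SmallQuantumSL2.F 𝕜 ζ ℓ ^ (p.1 : ℕ) * SmallQuantumSL2.E 𝕜 ζ ℓ ^ (p.2.1 : ℕ)
        * SmallQuantumSL2.K 𝕜 ζ ℓ ^ (p.2.2.1 : ℕ)) ⊗ₜ[𝕜] (CyclicAlgebra.z 𝕜 ℓ ^ (p.2.2.2 : ℕ)))
      = ⊤ := by
  rw [eq_top_iff]
  rintro w -
  induction w with
  | zero => exact Submodule.zero_mem _
  | add x y hx hy => exact Submodule.add_mem _ hx hy
  | tmul u v =>
    have hu : u ∈ (⊤ : Submodule 𝕜 (SmallQuantumSL2 𝕜 ζ ℓ)) := trivial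
    have hv : v ∈ (⊤ : Submodule 𝕜 (CyclicAlgebra 𝕜 ℓ)) := trivial
    rw [← SmallQuantumSL2.span_monomial] at hu
    rw [← CyclicAlgebra.span_z_pow] at hv
    induction hu using Submodule.span_induction with
    | zero => rw [TensorProduct.zero_tmul]; exact Submodule.zero_mem _
    | add x y _ _ hx hy => rw [TensorProduct.add_tmul]; exact Submodule.add_mem _ hx hy
    | smul c x _ hx => rw [← TensorProduct.smul_tmul']; exact Submodule.smul_mem _ _ hx
    | mem u hu =>
      obtain ⟨⟨a, b, c⟩, rfl⟩ := hu
      induction hv using Submodule.span_induction with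
      | zero => rw [TensorProduct.tmul_zero]; exact Submodule.zero_mem _
      | add x y _ _ hx hy => rw [TensorProduct.tmul_add]; exact Submodule.add_mem _ hx hy
      | smul c x _ hx => rw [TensorProduct.tmul_smul]; exact Submodule.smul_mem _ _ hx
      | mem v hv =>
        obtain ⟨d, rfl⟩ := hv
        exact Submodule.subset_span ⟨(a, b, c, d), rfl⟩

variable [Fact (Odd ℓ)] [Fact (IsPrimitiveRoot ζ ℓ)] (hs : Function.Surjective h.hom)

include hs

/-- If the homomorphism `U_ζ ⊗ 𝒜 → D` is surjective, then the monomials `F ^ a E ^ b K ^ c Z ^ d`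
span `D`. -/
theorem span_eq_top :
    Submodule.span 𝕜 (Set.range fun p : Fin ℓ × Fin ℓ × Fin ℓ × Fin ℓ ↦
      F ^ (p.1 : ℕ) * E ^ (p.2.1 : ℕ) * K ^ (p.2.2.1 : ℕ) * Z ^ (p.2.2.2 : ℕ)) = ⊤ := by
  have h1 := congrArg (Submodule.map h.hom.toLinearMap)
    (span_monomial_tmul (𝕜 := 𝕜) (ζ := ζ) (ℓ := ℓ))
  have h2 : LinearMap.range h.hom.toLinearMap = ⊤ := LinearMap.range_eq_top.2 hs
  rw [Submodule.map_span, ← Set.range_comp, Submodule.map_top, h2] at h1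
  rw [← h1]
  congr 2
  ext p
  exact (h.hom_monomial_tmul _ _ _ _).symm

/-- If moreover `D` has dimension `ℓ ^ 4`, then these monomials are linearly independent. -/
theorem linearIndependent (hd : Module.finrank 𝕜 D = ℓ ^ 4) :
    LinearIndependent 𝕜 fun p : Fin ℓ × Fin ℓ × Fin ℓ × Fin ℓ ↦
      F ^ (p.1 : ℕ) * E ^ (p.2.1 : ℕ) * K ^ (p.2.2.1 : ℕ) * Z ^ (p.2.2.2 : ℕ) := by
  refine linearIndependent_of_top_le_span_of_card_eq_finrank (h.span_eq_top hs).ge ?_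
  rw [hd]
  simp only [Fintype.card_prod, Fintype.card_fin]
  ring

/-- An element of the kernel is a combination of the spanning monomials, and the images of these are
linearly independent, so its coefficients vanish. -/
theorem injective (hd : Module.finrank 𝕜 D = ℓ ^ 4) : Function.Injective h.hom := by
  have hli := h.linearIndependent hs hd
  rw [injective_iff_map_eq_zero]
  intro w hw
  have hw' : w ∈ (⊤ : Submodule 𝕜 (SmallQuantumSL2 𝕜 ζ ℓ ⊗[𝕜] CyclicAlgebra 𝕜 ℓ)) := trivial
  rw [← span_monomial_tmul, Submodule.mem_span_range_iff_exists_fun] at hw'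
  obtain ⟨c, rfl⟩ := hw'
  simp only [map_sum, map_smul, hom_monomial_tmul] at hw
  have hc := Fintype.linearIndependent_iff.1 hli c hw
  simp [hc]

end IsCentralExtension

/-- A subalgebra containing `E`, `F`, `K` and `Z` contains `e`, `k`, `α` and `f`. -/
theorem IsBorelDouble.mem_of_mem {𝕜 D : Type*} [Field 𝕜] [Ring D] [Algebra 𝕜 D] {ℓ : ℕ} {ζ : 𝕜}
    {e k b f : D} (h : IsBorelDouble ℓ ζ e k b f) (hl : 1 < ℓ) {S : Subalgebra 𝕜 D}
    (hE : (ζ - ζ⁻¹)⁻¹ • (b ^ (ℓ - 1) * k ^ (ℓ - 1) * e) ∈ S) (hF : -f ∈ S)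
    (hK : b ^ (ℓ - 1) * k ∈ S) (hZ : b * k ∈ S) : e ∈ S ∧ k ∈ S ∧ b ^ 2 ∈ S ∧ f ∈ S := by
  refine ⟨?_, ?_, ?_, ?_⟩
  · have h0 := sub_inv_ne_zero h.isPrimitiveRoot h.odd hl
    have h5 := S.smul_mem (S.mul_mem hZ hE) (ζ - ζ⁻¹)
    rwa [mul_smul_comm, h.Z_mul_Z_inv_mul, smul_smul, mul_inv_cancel₀ h0, one_smul] at h5
  -- $KZ=k^2$, and for odd $\ell$ its power $(\ell+1)/2$ is $k$.
  · have h5 := S.pow_mem (S.mul_mem hK hZ) ((ℓ + 1) / 2)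
    rwa [h.K_mul_Z, pow_half_of_odd h.odd h.k_pow] at h5
  · have h5 := S.mul_mem (S.pow_mem hK (ℓ - 1)) hZ
    rwa [h.K_inv_mul_Z] at h5
  · simpa using S.neg_mem hF

theorem IsBorelDoubleHopf.twistR_eq {𝕜 D : Type*} [Field 𝕜] [CharZero 𝕜] [Ring D] [HopfAlgebra 𝕜 D]
    {ℓ : ℕ} {ζ : 𝕜} [Fact (Odd ℓ)] [Fact (1 < ℓ)] [Fact (IsPrimitiveRoot ζ ℓ)] [NeZero ℓ]
    {e k b f a E F K Z : D} (h : IsBorelDoubleHopf ℓ ζ e k b f) (ha : a = b ^ 2)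
    (hE : E = (ζ - ζ⁻¹)⁻¹ • (b ^ (ℓ - 1) * k ^ (ℓ - 1) * e)) (hF : F = -f)
    (hK : K = b ^ (ℓ - 1) * k) (hZ : Z = b * k) (hD : IsHopfExtension ℓ ζ E F K Z) :
    twistR (∑ i : Fin ℓ, ∑ j : Fin ℓ, (e ^ (i : ℕ) * k ^ (j : ℕ)) ⊗ₜ[𝕜]
      ((ℓ : 𝕜)⁻¹ • ∑ s ∈ Finset.range ℓ, ((ζ⁻¹ - ζ)⁻¹ ^ (i : ℕ) * tauCoeff ζ i)
        • ζ⁻¹ ^ (j * s : ℕ) • (f ^ (i : ℕ) * a ^ s))) (bicharacter ℓ ζ⁻¹ K Z)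
      = Algebra.TensorProduct.map hD.hom hD.hom
        (productR (SmallQuantumSL2.rMatrix 𝕜 ζ ℓ) (CyclicAlgebra.rMatrix 𝕜 ζ ℓ)) := by
  rw [← hD.twistR_eq, sum_tmul_eq_qExp_mul, ha, h.qExp_mul_torusPairing, hE, hF, hK, hZ]

/-- A quantum double of dimension `ℓ ^ 4` that is generated by `e`, `k`, `α` and `f` is isomorphic to
`U_ζ ⊗ 𝒜`. -/
theorem IsBorelDouble.bijective_hom {𝕜 D : Type*} [Field 𝕜] [Ring D] [Algebra 𝕜 D]
    {ℓ : ℕ} {ζ : 𝕜} [Fact (Odd ℓ)] [Fact (1 < ℓ)] [Fact (IsPrimitiveRoot ζ ℓ)] [NeZero ℓ]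
    {e k b f E F K Z : D} (h : IsBorelDouble ℓ ζ e k b f)
    (hE : E = (ζ - ζ⁻¹)⁻¹ • (b ^ (ℓ - 1) * k ^ (ℓ - 1) * e)) (hF : F = -f)
    (hK : K = b ^ (ℓ - 1) * k) (hZ : Z = b * k) (hD : IsCentralExtension ℓ ζ E F K Z)
    (htop : ∀ S : Subalgebra 𝕜 D, e ∈ S → k ∈ S → b ^ 2 ∈ S → f ∈ S → S = ⊤)
    (hd : Module.finrank 𝕜 D = ℓ ^ 4) : Function.Bijective hD.hom := by
  have hs : Function.Surjective hD.hom := by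
    have h1 := h.mem_of_mem (Fact.out : 1 < ℓ) (S := hD.hom.range)
      (hE ▸ ⟨SmallQuantumSL2.E 𝕜 ζ ℓ ⊗ₜ 1, by simp⟩) (hF ▸ ⟨SmallQuantumSL2.F 𝕜 ζ ℓ ⊗ₜ 1, by simp⟩)
      (hK ▸ ⟨SmallQuantumSL2.K 𝕜 ζ ℓ ⊗ₜ 1, by simp⟩)
      (hZ ▸ ⟨1 ⊗ₜ CyclicAlgebra.z 𝕜 ℓ, by simp⟩)
    exact AlgHom.range_eq_top _ |>.1 (htop _ h1.1 h1.2.1 h1.2.2.1 h1.2.2.2)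
  exact ⟨hD.injective hs hd, hs⟩

theorem TensorProduct.map_symm_map {R A C : Type*} [CommRing R] [Ring A] [Algebra R A] [Ring C]
    [Algebra R C] (g : A ≃ₐ[R] C) (t : A ⊗[R] A) :
    TensorProduct.map g.symm.toLinearMap g.symm.toLinearMap
      (Algebra.TensorProduct.map (g : A →ₐ[R] C) (g : A →ₐ[R] C) t) = t := by
  induction t with
  | zero => simp only [map_zero]
  | add x y hx hy => simp only [map_add, hx, hy]
  | tmul x y =>
    rw [Algebra.TensorProduct.map_tmul, TensorProduct.map_tmul]
    simp

/-! ### Inverting the homomorphism -/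

namespace IsHopfExtension

variable {𝕜 D : Type*} [Field 𝕜] [CharZero 𝕜] [Ring D] [HopfAlgebra 𝕜 D] {ℓ : ℕ} {ζ : 𝕜} [NeZero ℓ]
  [Fact (Odd ℓ)] [Fact (1 < ℓ)] [Fact (IsPrimitiveRoot ζ ℓ)] {E F K Z : D}
  (h : IsHopfExtension ℓ ζ E F K Z) (hb : Function.Bijective h.hom) {𝓡 : D ⊗[𝕜] D}
  (h𝓡 : twistR 𝓡 (bicharacter ℓ ζ⁻¹ K Z) = Algebra.TensorProduct.map h.hom h.hom
    (productR (SmallQuantumSL2.rMatrix 𝕜 ζ ℓ) (CyclicAlgebra.rMatrix 𝕜 ζ ℓ)))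

include hb h𝓡

/-- If `U_ζ ⊗ 𝒜 → D` is bijective and carries the R-matrix of `U_ζ ⊗ 𝒜` to the twisted R-matrix,
then the twist of `D` is a quasi-triangular Hopf algebra. -/
theorem isQuasitriangularHopf_twist :
    IsQuasitriangularHopf (twistComul (Coalgebra.comul (R := 𝕜)) (bicharacter ℓ ζ⁻¹ K Z))
      (Coalgebra.counit (R := 𝕜)) (twistAntipode (HopfAlgebra.antipode 𝕜) (bicharacter ℓ ζ⁻¹ K Z))
      (twistR 𝓡 (bicharacter ℓ ζ⁻¹ K Z)) :=
  IsQuasitriangularHopf.of_algEquiv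
    (IsUniversalR.productR (SmallQuantumSL2.isUniversalR Fact.out)
      (CyclicAlgebra.isUniversalR Fact.out (Fact.out : IsPrimitiveRoot ζ ℓ)))
    (AlgEquiv.ofBijective h.hom hb) h.twistComul_hom h.counit_hom h.twistAntipode_hom h𝓡.symm

/-- Under the same hypotheses, the twist of `D` is isomorphic to `U_ζ ⊗ 𝒜` as a quasi-triangular Hopf
algebra. -/
theorem exists_algEquiv : ∃ ϖ : D ≃ₐ[𝕜] SmallQuantumSL2 𝕜 ζ ℓ ⊗[𝕜] CyclicAlgebra 𝕜 ℓ,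
    (∀ a b c d : ℕ, ϖ (F ^ a * E ^ b * K ^ c * Z ^ d)
      = (SmallQuantumSL2.F 𝕜 ζ ℓ ^ a * SmallQuantumSL2.E 𝕜 ζ ℓ ^ b
          * SmallQuantumSL2.K 𝕜 ζ ℓ ^ c) ⊗ₜ[𝕜] (CyclicAlgebra.z 𝕜 ℓ ^ d)) ∧
    (∀ x, TensorProduct.map ϖ.toLinearMap ϖ.toLinearMap
        (twistComul (Coalgebra.comul (R := 𝕜)) (bicharacter ℓ ζ⁻¹ K Z) x)
      = Coalgebra.comul (R := 𝕜) (ϖ x)) ∧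
    (∀ x, Coalgebra.counit (R := 𝕜) (ϖ x) = Coalgebra.counit (R := 𝕜) x) ∧
    (∀ x, ϖ (twistAntipode (HopfAlgebra.antipode 𝕜) (bicharacter ℓ ζ⁻¹ K Z) x)
      = HopfAlgebra.antipode 𝕜 (ϖ x)) ∧
    TensorProduct.map ϖ.toLinearMap ϖ.toLinearMap (twistR 𝓡 (bicharacter ℓ ζ⁻¹ K Z))
      = productR (SmallQuantumSL2.rMatrix 𝕜 ζ ℓ) (CyclicAlgebra.rMatrix 𝕜 ζ ℓ) := by
  set ψ := AlgEquiv.ofBijective h.hom hb with hψ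
  have hs : ∀ w, ψ.symm (h.hom w) = w := ψ.symm_apply_apply
  have hm : ∀ t, TensorProduct.map ψ.symm.toLinearMap ψ.symm.toLinearMap
    (Algebra.TensorProduct.map h.hom h.hom t) = t := TensorProduct.map_symm_map ψ
  refine ⟨ψ.symm, fun a b c d ↦ ?_, fun x ↦ ?_, fun x ↦ ?_, fun x ↦ ?_, ?_⟩
  · rw [← h.hom_monomial_tmul, hs]
  · obtain ⟨w, rfl⟩ := hb.2 x
    rw [h.twistComul_hom, hm, hs]
  · obtain ⟨w, rfl⟩ := hb.2 x
    rw [h.counit_hom, hs]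
  · obtain ⟨w, rfl⟩ := hb.2 x
    rw [h.twistAntipode_hom, hs, hs]
  · rw [h𝓡, hm]

end IsHopfExtension

/-! ### Generators and dimension of the extended double -/

namespace DoubleExt

open DrinfeldDouble

variable (𝕜 : Type*) [Field 𝕜] [CharZero 𝕜] (ζ : 𝕜) (ℓ : ℕ) [Fact (Odd ℓ)] [Fact (1 < ℓ)]
  [Fact (IsPrimitiveRoot ζ ℓ)]

/-- $B$ is spanned by the $e^ik^j$, and the dual basis is expressed by the $f^i\alpha^s$. The latter
needs denominators such as $\ell$, which is why $S$ is a subalgebra over $𝕜$. -/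
theorem incl_mem [NeZero ℓ] {S : Subalgebra 𝕜 (DoubleExt 𝕜 ζ ℓ)} (he : e 𝕜 ζ ℓ ∈ S)
    (hk : k 𝕜 ζ ℓ ∈ S) (hα : α 𝕜 ζ ℓ ∈ S) (hf : f 𝕜 ζ ℓ ∈ S) (u : DoubleInt ζ ℓ) :
    incl 𝕜 ζ ℓ u ∈ S := by
  have hx : ∀ x, incl 𝕜 ζ ℓ (ofAlg _ _ x) ∈ S := fun x ↦ by
    rw [← (SmallBorel.basis (IntAdjoin ζ) (zetaInt ζ) ℓ).sum_repr x]
    simp only [map_sum, map_smul, SmallBorel.basis_apply]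
    refine S.sum_mem fun p _ ↦ ?_
    rw [map_mul, map_mul, map_pow, map_pow, map_pow, map_pow]
    exact S.smul_mem (S.mul_mem (S.pow_mem he _) (S.pow_mem hk _)) _
  have hp : ∀ p, incl 𝕜 ζ ℓ (ofDual _ _ p) ∈ S := fun p ↦ by
    have h := (SmallBorel.basis (IntAdjoin ζ) (zetaInt ζ) ℓ).sum_dual_apply_smul_coord
      (DualCop.toDual _ _ p)
    have h' : p = ∑ i, p (SmallBorel.basis (IntAdjoin ζ) (zetaInt ζ) ℓ i)
        • DualCop.of ((SmallBorel.basis (IntAdjoin ζ) (zetaInt ζ) ℓ).coord i) := by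
      apply (DualCop.toDual _ _).injective
      conv_lhs => rw [← h]
      simp only [map_sum, map_smul]
      rfl
    rw [h']
    simp only [map_sum, map_smul]
    refine S.sum_mem fun i _ ↦ ?_
    obtain ⟨i, j⟩ := i
    rw [incl_coord]
    exact S.smul_mem (S.smul_mem (S.sum_mem fun s _ ↦ S.smul_mem (S.smul_mem
      (S.mul_mem (S.pow_mem hf _) (S.pow_mem hα _)) _) _) _) _
  induction u using DrinfeldDouble.induction_on with
  | zero => rw [map_zero]; exact S.zero_mem
  | add a b ha hb => rw [map_add]; exact S.add_mem ha hb
  | tmul p x =>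
    rw [← ofDual_mul_ofAlg, map_mul]
    exact S.mul_mem (hp p) (hx x)

/-- `D_e(B)` is generated by `e`, `k`, `α` and `f`. -/
theorem subalgebra_eq_top {S : Subalgebra 𝕜 (DoubleExt 𝕜 ζ ℓ)} (he : e 𝕜 ζ ℓ ∈ S)
    (hk : k 𝕜 ζ ℓ ∈ S) (hα : α 𝕜 ζ ℓ ∈ S) (hf : f 𝕜 ζ ℓ ∈ S) : S = ⊤ := by
  have := SmallBorel.neZero ℓ
  rw [eq_top_iff]
  rintro w -
  induction w using TensorProduct.induction_on with
  | zero => exact S.zero_mem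
  | add x y hx hy => exact S.add_mem hx hy
  | tmul c u =>
    have h : c ⊗ₜ[IntAdjoin ζ] u = c • incl 𝕜 ζ ℓ u := by
      rw [incl_apply, TensorProduct.smul_tmul', smul_eq_mul, mul_one]
    rw [h]
    exact S.smul_mem (incl_mem 𝕜 ζ ℓ he hk hα hf u) c

/-- $B$ and its dual are free of rank $\ell^2$, and extension of scalars preserves the rank of a
free module. -/
theorem finrank_eq : Module.finrank 𝕜 (DoubleExt 𝕜 ζ ℓ) = ℓ ^ 4 := by
  have := SmallBorel.neZero ℓ
  have hB : Module.finrank (IntAdjoin ζ) (BorelInt ζ ℓ) = ℓ ^ 2 := by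
    rw [Module.finrank_eq_card_basis (SmallBorel.basis (IntAdjoin ζ) (zetaInt ζ) ℓ)]
    simp [pow_two]
  have hD : Module.finrank (IntAdjoin ζ) (DualCop (IntAdjoin ζ) (BorelInt ζ ℓ)) = ℓ ^ 2 := by
    rw [(DualCop.toDual (IntAdjoin ζ) (BorelInt ζ ℓ)).finrank_eq, Module.finrank_linearMap_self, hB]
  have : Module.Free (IntAdjoin ζ) (DualCop (IntAdjoin ζ) (BorelInt ζ ℓ)) :=
    .of_equiv (DualCop.toDual (IntAdjoin ζ) (BorelInt ζ ℓ)).symm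
  have h2 : Module.finrank (IntAdjoin ζ) (DoubleInt ζ ℓ) = ℓ ^ 4 := by
    refine (Module.finrank_tensorProduct (R := IntAdjoin ζ)
      (M := DualCop (IntAdjoin ζ) (BorelInt ζ ℓ)) (M' := BorelInt ζ ℓ)).trans ?_
    rw [hD, hB, ← pow_add]
  have : Module.Free (IntAdjoin ζ) (DoubleInt ζ ℓ) :=
    inferInstanceAs (Module.Free (IntAdjoin ζ)
      (DualCop (IntAdjoin ζ) (BorelInt ζ ℓ) ⊗[IntAdjoin ζ] BorelInt ζ ℓ))
  rw [← h2]
  exact Module.finrank_baseChange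

theorem E_eq : E 𝕜 ζ ℓ = (ζ - ζ⁻¹)⁻¹ • ((α 𝕜 ζ ℓ ^ ((ℓ + 1) / 2)) ^ (ℓ - 1)
    * k 𝕜 ζ ℓ ^ (ℓ - 1) * e 𝕜 ζ ℓ) := by
  rw [E, pow_right_comm]

theorem K_eq : K 𝕜 ζ ℓ = (α 𝕜 ζ ℓ ^ ((ℓ + 1) / 2)) ^ (ℓ - 1) * k 𝕜 ζ ℓ := by
  rw [K, pow_right_comm]

theorem bijective_hom [NeZero ℓ] : Function.Bijective (isHopfExtension 𝕜 ζ ℓ).hom :=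
  (isBorelDouble 𝕜 ζ ℓ).bijective_hom (E_eq 𝕜 ζ ℓ) rfl (K_eq 𝕜 ζ ℓ) rfl
    (isHopfExtension 𝕜 ζ ℓ).toIsCentralExtension
    (fun _ he hk hα hf ↦ subalgebra_eq_top 𝕜 ζ ℓ he hk (sq_half 𝕜 ζ ℓ ▸ hα) hf) (finrank_eq 𝕜 ζ ℓ)

theorem twistR_rMatrix [NeZero ℓ] :
    twistR (rMatrix 𝕜 ζ ℓ) (bicharacter ℓ ζ⁻¹ (K 𝕜 ζ ℓ) (Z 𝕜 ζ ℓ))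
      = Algebra.TensorProduct.map (isHopfExtension 𝕜 ζ ℓ).hom (isHopfExtension 𝕜 ζ ℓ).hom
        (productR (SmallQuantumSL2.rMatrix 𝕜 ζ ℓ) (CyclicAlgebra.rMatrix 𝕜 ζ ℓ)) := by
  rw [rMatrix_eq_sum]
  exact (isBorelDoubleHopf 𝕜 ζ ℓ).twistR_eq (sq_half 𝕜 ζ ℓ).symm (E_eq 𝕜 ζ ℓ) rfl (K_eq 𝕜 ζ ℓ) rfl
    (isHopfExtension 𝕜 ζ ℓ)

end DoubleExt

theorem mainTheorem10 (ℓ : ℕ) [Fact (Odd ℓ)] [Fact (1 < ℓ)] (𝕜 : Type*) [Field 𝕜] [CharZero 𝕜]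
    [IsCyclotomicExtension {ℓ} ℚ 𝕜] (ζ : 𝕜) [Fact (IsPrimitiveRoot ζ ℓ)] :
    -- the monomials `F ^ a E ^ b K ^ c Z ^ d` form a basis of `D_e(B)`
    (LinearIndependent 𝕜 (DoubleExt.pbw 𝕜 ζ ℓ) ∧
      Submodule.span 𝕜 (Set.range (DoubleExt.pbw 𝕜 ζ ℓ)) = ⊤) ∧
    -- the gauge element is a gauge transformation
    IsGaugeTransformation (Coalgebra.comul (R := 𝕜)) (Coalgebra.counit (R := 𝕜))
      (DoubleExt.gauge 𝕜 ζ ℓ) ∧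
    -- the twisted double is a quasi-triangular Hopf algebra
    IsQuasitriangularHopf (DoubleExt.gaugeComul 𝕜 ζ ℓ) (Coalgebra.counit (R := 𝕜))
      (DoubleExt.gaugeAntipode 𝕜 ζ ℓ) (DoubleExt.gaugeRMatrix 𝕜 ζ ℓ) ∧
    -- so are `U_ζ`, `𝒜` and `U_ζ ⊗ 𝒜`
    IsUniversalR (SmallQuantumSL2.rMatrix 𝕜 ζ ℓ) ∧
    IsUniversalR (CyclicAlgebra.rMatrix 𝕜 ζ ℓ) ∧
    IsUniversalR (R := 𝕜) (A := SmallQuantumSL2 𝕜 ζ ℓ ⊗[𝕜] CyclicAlgebra 𝕜 ℓ)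
      (productR (SmallQuantumSL2.rMatrix 𝕜 ζ ℓ) (CyclicAlgebra.rMatrix 𝕜 ζ ℓ)) ∧
    -- the isomorphism of quasi-triangular Hopf algebras
    ∃ ϖ : DoubleExt 𝕜 ζ ℓ ≃ₐ[𝕜] SmallQuantumSL2 𝕜 ζ ℓ ⊗[𝕜] CyclicAlgebra 𝕜 ℓ,
      (∀ a b c d : Fin ℓ, ϖ (DoubleExt.pbw 𝕜 ζ ℓ (a, b, c, d))
        = (SmallQuantumSL2.F 𝕜 ζ ℓ ^ (a : ℕ) * SmallQuantumSL2.E 𝕜 ζ ℓ ^ (b : ℕ)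
            * SmallQuantumSL2.K 𝕜 ζ ℓ ^ (c : ℕ)) ⊗ₜ[𝕜] (CyclicAlgebra.z 𝕜 ℓ ^ (d : ℕ))) ∧
      (∀ x, TensorProduct.map ϖ.toLinearMap ϖ.toLinearMap (DoubleExt.gaugeComul 𝕜 ζ ℓ x)
        = Coalgebra.comul (R := 𝕜) (ϖ x)) ∧
      (∀ x, Coalgebra.counit (R := 𝕜) (ϖ x) = Coalgebra.counit (R := 𝕜) x) ∧
      (∀ x, ϖ (DoubleExt.gaugeAntipode 𝕜 ζ ℓ x) = HopfAlgebra.antipode 𝕜 (ϖ x)) ∧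
      TensorProduct.map ϖ.toLinearMap ϖ.toLinearMap (DoubleExt.gaugeRMatrix 𝕜 ζ ℓ)
        = productR (SmallQuantumSL2.rMatrix 𝕜 ζ ℓ) (CyclicAlgebra.rMatrix 𝕜 ζ ℓ) := by
  have := SmallBorel.neZero ℓ
  have h := DoubleExt.isHopfExtension 𝕜 ζ ℓ
  have hb : Function.Bijective h.hom := DoubleExt.bijective_hom 𝕜 ζ ℓ
  have hR := DoubleExt.twistR_rMatrix 𝕜 ζ ℓ
  have hU : IsUniversalR (SmallQuantumSL2.rMatrix 𝕜 ζ ℓ) := SmallQuantumSL2.isUniversalR Fact.out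
  have hA : IsUniversalR (CyclicAlgebra.rMatrix 𝕜 ζ ℓ) :=
    CyclicAlgebra.isUniversalR Fact.out Fact.out
  -- Since the $P_i$ are Fourier sums in $Z$, the gauge element is the bicharacter of $K$ and $Z$ at
  -- $\zeta^{-1}$, the form in which the abstract results are stated.
  rw [DoubleExt.gaugeComul, DoubleExt.gaugeAntipode, DoubleExt.gaugeRMatrix, DoubleExt.gauge_eq]
  obtain ⟨ϖ, h1, h2⟩ := h.exists_algEquiv hb hR
  exact ⟨⟨h.linearIndependent hb.2 (DoubleExt.finrank_eq 𝕜 ζ ℓ), h.span_eq_top hb.2⟩,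
    h.isGaugeTransformation, h.isQuasitriangularHopf_twist hb hR, hU, hA, hU.productR hA,
    ϖ, fun a b c d ↦ h1 a b c d, h2⟩
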